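/- Let $p$ be a prime, $s\ge 1$, $K=\mathbb{Q}(\zeta_{p^s})$, $\zeta_{p^i}=\zeta_{p^s}^{p^{s-i}}$, $\lambda=\zeta_p-1$, $R_i=\mathbb{Z}_{(p)}[\zeta_{p^i}]$, $R=R_s$, and let $\nu$ be the valuation of $K$ above $p$ with $\nu(p)=1$, extended to power series as the infimum over the coefficients. For power series $a_j$ with zero constant term put $E_{n,p}(t)=\exp\big(\sum_{i<n}(\zeta_{p^{n-i}}-1)t^{p^i}/p^i\big)$, $E_{n,p}((a_0,\dots,a_{n-1}))=\prod_{j<n}E_{n-j,p}(a_j)$ and $G_{n,p}(\underline a)=E_{n,p}(p\,\underline a)/E_{n-1,p}(\underline a)$, where $p\,\underline a$ is the multiple as a Witt vector. Let $\wp=\mathrm{id}-\sigma$ on Witt vectors ($\sigma$ the Frobenius) and write, in characteristic $p$, $\wp(y_0,\dots,y_{s-1})=(y_{i-1}-y_{i-1}^p+f_i(y_0,\dots,y_{i-2}))_{1\le i\le s}$. Call polynomials $G_i\in R_i[X_0,\dots,X_{i-2}]$ ($1\le i\le s$) with constant term $1$ admissible if, for the power series $X'_0,\dots,X'_{s-1}$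 in $X_0,\dots,X_{s-1}$ with zero constant term determined by $G_{i,p}((X_0',\dots,X_{i-1}'))=u_{i-1}:=G_i+p\lambda X_{i-1}$, one has $\nu\big(G_{i,p}((X'_0,\dots,X'_{i-2},0))-G_i\big)>\frac p{p-1}$ for all $i$. Given admissible $G_i$, let $L$ be the extension of $K(X_0,\dots,X_{s-1})$ generated by $Z_{s-1}$, where $Z_i^p=Z_{i-1}u_i$ for $0\le i\le s-1$ and $Z_{-1}=1$ (so $Z_{s-1}^{p^s}=\prod_i u_i^{p^i}$); let $\mathcal V_s=\operatorname{Spec}R[X_0,\dots,X_{s-1},u_0^{-1},\dots,u_{s-1}^{-1}]$, and let $\mathcal W_s$ be the spectrum of the integral closure of its coordinate ring in $L$. **Theorem.** Admissible $G_1,\dots,G_s$ exist. Moreover there are polynomials $E_i\in R_i[Y_0,\dots,Y_{i-2}]$, power series $F_i\in R_i[[Y_0,\dots,Y_{i-1}]]$, and polynomials $\overline F_i\in\mathbb F_p[y_0,\dots,y_{i-2}]$, $b_{i-1}\in\mathbb F_p[y_0,\dots,y_{i-2}]$ ($1\le i\le s$, $b_0=0$) such that: 1. If $(Y'_0,\dots,Y'_{s-1})$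 is the Witt vector of power series with zero constant term associated to the change of variables $Z_{i-1}=E_i(Y_0,\dots,Y_{i-2})+\lambda Y_{i-1}$, i.e. $E_i+\lambda Y_{i-1}=E_{i,p}((Y'_0,\dots,Y'_{i-1}))$ for all $i$, then $E_i$ is the truncation of $E_{i,p}((Y'_0,\dots,Y'_{i-2},0))$ to the terms whose coefficients have valuation $<\frac1{p-1}$, and $$Y'_{i-1}=(-1)^{p-1}\frac{\lambda^{p-1}}p\,Y_{i-1}^p+Y_{i-1}+F_i,\qquad F_i\equiv\overline F_i\pmod{\zeta_{p^i}-1}.$$ 2. $\overline F_i=f_i(y_0,y_1+b_1,\dots,y_{i-2}+b_{i-2})+\wp(b_{i-1})$, where $\wp(b)=b-b^p$. 3. For all admissible $G_1,\dots,G_s$, with $L$ and $Z_i$ as above and $Y_i\in L$ defined by $Z_{i-1}=E_i(Y_0,\dots,Y_{i-2})+\lambda Y_{i-1}$: for each $i$, up to multiplication by the constant $\lambda^{p-1}/p$, the minimal polynomial of $Y_{i-1}$ over $K(Y_0,\dots,Y_{i-2},X_{i-1})$ (in particular, for $i=s$, over $\mathbb Q(\zeta_{p^s})(Y_0,\dots,Y_{s-2},X_{s-1})$)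 is $$\frac{\lambda^{p-1}}p\,T^p+T+H_i(T)-Z_{i-2}X_{i-1},$$ where $H_i$ is a polynomial in $T$ of degree $<p$ with coefficients in $D_i=R_i\big[Y_0,\dots,Y_{i-2},\tfrac1{Z_0},\dots,\tfrac1{Z_{i-2}}\big]$ and $H_i\equiv\overline F_i(Y_0,\dots,Y_{i-2})\pmod{(\zeta_{p^i}-1)D_i[T]}$. In particular $X_{i-1}\in R_i\big[Y_0,\dots,Y_{i-1},\tfrac1{Z_0},\dots,\tfrac1{Z_{i-2}}\big]$. 4. In the situation of 3, the special fiber (modulo $\zeta_{p^s}-1$) of $\mathcal V_s$ is $\operatorname{Spec}\mathbb F_p[x_0,\dots,x_{s-1}]$, with $x_i$ the reduction of $X_i$, and the special fiber of $\mathcal W_s\to\mathcal V_s$ is the Artin–Schreier–Witt cover $$\wp(y_0,y_1+b_1,\dots,y_{s-1}+b_{s-1})=(x_0,\dots,x_{s-1}),$$ i.e. the coordinate ring of the special fiber of $\mathcal W_s$ is $\mathbb F_p[x_0,\dots,x_{s-1},y_0,\dots,y_{s-1}]$ modulo these $s$ equations, with $y_i$ the reduction of $Y_i$. In particular the two covers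 are birational. -/

import Mathlib

open scoped BigOperators

universe u v

noncomputable section

namespace KASW

/-! ### The base: roots of unity, the rings `ℤ_(p)[ζ_{p^i}]`, the valuation -/

section Base

variable {K : Type*} [Field K]

/-- The compatible primitive `p^i`-th root of unity `ζ_{p^i} = ζ^{p^{s-i}}` (for `i ≤ s`), where
`ζ` is a primitive `p^s`-th root of unity. -/
def zetaLevel (p s : ℕ) (ζ : K) (i : ℕ) : K := ζ ^ p ^ (s - i)

/-- `λ = ζ_p - 1`. -/
def lam (p s : ℕ) (ζ : K) : K := zetaLevel p s ζ 1 - 1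

/-- The ring `ℤ_(p)[ζ_{p^i}]`, as a subring of `K`. -/
def levelRing (p s : ℕ) (ζ : K) (i : ℕ) : Subring K :=
  Subring.closure
    ({x : K | ∃ a b : ℤ, ¬ (p : ℤ) ∣ b ∧ x = (a : K) / (b : K)} ∪ {zetaLevel p s ζ i})

/-- The valuation `ν` of `K = ℚ(ζ_{p^s})` above `p`, normalised by `ν(p) = 1`. As `p` is totally
ramified in `K`, it is given by `ν(x) = v_p(N_{K/ℚ}(x)) / [K : ℚ]`. -/
def nu (p : ℕ) [NumberField K] (x : K) : WithTop ℚ :=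
  open scoped Classical in
  if x = 0 then ⊤
  else (((padicValRat p (Algebra.norm ℚ x) : ℚ) / (Module.finrank ℚ K : ℚ) : ℚ) : WithTop ℚ)

end Base

/-! ### Finite tuples as sequences -/

section Tuples

variable {A : Type*} [Zero A]

/-- `(a_0, …, a_{s-1})` extended by zeros. -/
def extendZero {s : ℕ} (a : Fin s → A) (j : ℕ) : A := if h : j < s then a ⟨j, h⟩ else 0

/-- `(a_0, …, a_{i-1}, 0, 0, …)`. -/
def cut (i : ℕ) (a : ℕ → A) (j : ℕ) : A := if j < i then a j else 0

end Tuples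

/-! ### The deformed Artin-Hasse exponentials -/

section Series

variable {K : Type*} [Field K] [CharZero K] {σ : Type*}

/-- `E_{n,p}(t) = exp (∑_{i < n} (ζ_{p^{n-i}} - 1) t^{p^i} / p^i)`, evaluated at a power
series `t` with zero constant term. -/
def artinHasse (p s : ℕ) (ζ : K) (n : ℕ) (t : MvPowerSeries σ K) : MvPowerSeries σ K :=
  (PowerSeries.exp K).subst
    (∑ i ∈ Finset.range n,
      MvPowerSeries.C ((zetaLevel p s ζ (n - i) - 1) / (p : K) ^ i) * t ^ p ^ i)

/-- `E_{n,p}((a_0, …, a_{n-1})) = ∏_{j < n} E_{n-j,p}(a_j)`. -/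
def EWitt (p s : ℕ) (ζ : K) (n : ℕ) (a : ℕ → MvPowerSeries σ K) : MvPowerSeries σ K :=
  ∏ j ∈ Finset.range n, artinHasse p s ζ (n - j) (a j)

/-- `G_{n,p}(a) = E_{n,p}(p a) / E_{n-1,p}(a)` for `a = (a_0, …, a_{n-1})`, where `p a` is the
multiple in the ring of Witt vectors. -/
def GWitt (p s : ℕ) [Fact p.Prime] (ζ : K) (n : ℕ) (a : ℕ → MvPowerSeries σ K) :
    MvPowerSeries σ K :=
  EWitt p s ζ n (fun j => (p • WittVector.mk p a).coeff j) * (EWitt p s ζ (n - 1) a)⁻¹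

end Series

/-! ### The Kummer side and the change of variables

Indices are shifted by one: for `i : Fin s`, the entries `G i`, `E i`, `F i`, … are what is
usually written `G_{i+1}`, `E_{i+1}`, `F_{i+1}`, …, while `X i`, `Y i` are `X_i`, `Y_i`. -/

section Data

variable {K : Type*} [Field K] [NumberField K]

/-- `G_1, …, G_s` are admissible approximations of the series
`G_{i+1,p}((X_0', …, X_{i-1}', 0))`, where `(X_0', …, X_{s-1}')` is the Witt vector attached to
`u_i = G_{i+1}(X_0, …, X_{i-1}) + p λ X_i`. -/
structure IsKummerDatum (p s : ℕ) [Fact p.Prime] (ζ : K)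
    (G : Fin s → MvPolynomial (Fin s) K) (X' : Fin s → MvPowerSeries (Fin s) K) : Prop where
  coeff_mem : ∀ (i : Fin s) (n : Fin s →₀ ℕ), (G i).coeff n ∈ levelRing p s ζ (i + 1)
  vars_lt : ∀ i, ∀ j ∈ (G i).vars, j < i
  constantCoeff_eq : ∀ i, MvPolynomial.constantCoeff (G i) = 1
  witt_constantCoeff : ∀ i, MvPowerSeries.constantCoeff (X' i) = 0
  witt_eq : ∀ i : Fin s, GWitt p s ζ (i + 1) (extendZero X') =
    (G i : MvPowerSeries (Fin s) K) +
      MvPowerSeries.C ((p : K) * lam p s ζ) * MvPowerSeries.X i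
  approx : ∀ (i : Fin s) (n : Fin s →₀ ℕ),
    (((p : ℚ) / ((p : ℚ) - 1) : ℚ) : WithTop ℚ) <
      nu p (MvPowerSeries.coeff n
        (GWitt p s ζ (i + 1) (cut i (extendZero X')) - (G i : MvPowerSeries (Fin s) K)))

/-- `(Y_0', …, Y_{s-1}')` is the Witt vector attached to the change of variables
`Z_i = E_{i+1}(Y_0, …, Y_{i-1}) + λ Y_i`, that is `Z_i = E_{i+1,p}((Y_0', …, Y_i'))`. -/
structure IsAssociatedWitt (p s : ℕ) (ζ : K)
    (E : Fin s → MvPolynomial (Fin s) K) (Y' : Fin s → MvPowerSeries (Fin s) K) : Prop where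
  witt_constantCoeff : ∀ i, MvPowerSeries.constantCoeff (Y' i) = 0
  witt_eq : ∀ i : Fin s, (E i : MvPowerSeries (Fin s) K) +
      MvPowerSeries.C (lam p s ζ) * MvPowerSeries.X i = EWitt p s ζ (i + 1) (extendZero Y')

open scoped Classical in
/-- The polynomial `E` is the truncation of the power series `f` to the terms whose coefficients
have valuation strictly smaller than `1 / (p - 1)`. -/
def IsTruncation (p s : ℕ) (E : MvPolynomial (Fin s) K) (f : MvPowerSeries (Fin s) K) : Prop :=
  ∀ n : Fin s →₀ ℕ, E.coeff n =
    if nu p (MvPowerSeries.coeff n f) < ((1 / ((p : ℚ) - 1) : ℚ) : WithTop ℚ)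
    then MvPowerSeries.coeff n f else 0

end Data

/-! ### The cover `𝒲_s → 𝒱_s` -/

section Cover

variable {K : Type*} [Field K] {L : Type*} [Field L] [Algebra K L]

/-- `u_i = G_{i+1}(X_0, …, X_{i-1}) + p λ X_i` in `L`. -/
def unitElt (p s : ℕ) (ζ : K) (G : Fin s → MvPolynomial (Fin s) K) (x : Fin s → L)
    (i : Fin s) : L :=
  MvPolynomial.aeval x (G i) + algebraMap K L ((p : K) * lam p s ζ) * x i

/-- `L` is the extension of the rational function field `K(X_0, …, X_{s-1})` generated by
`Z_{s-1}`, where `Z_{s-1}^{p^s} = ∏ u_i^{p^i}`, in the form of the tower of Kummer equations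
`Z_i^p = Z_{i-1} u_i`, `Z_{-1} = 1`. Here `Z 0` is `Z_{-1}` and `Z i.succ` is `Z_i`, so that
`Z i.castSucc` is `Z_{i-1}`. -/
structure IsKummerTower (p s : ℕ) (ζ : K) (G : Fin s → MvPolynomial (Fin s) K)
    (x : Fin s → L) (Z : Fin (s + 1) → L) : Prop where
  algebraicIndependent : AlgebraicIndependent K x
  zero_eq : Z 0 = 1
  pow_eq : ∀ i : Fin s, Z i.succ ^ p = Z i.castSucc * unitElt p s ζ G x i
  adjoin_eq_top : IntermediateField.adjoin K (Set.range x ∪ {Z (Fin.last s)}) = ⊤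

/-- `ℤ_(p)[ζ_{p^{i+1}}][Y_0, …, Y_{m-1}, 1/Z_0, …, 1/Z_{i-1}]` inside `L`. -/
def fracRing (p s : ℕ) (ζ : K) (Y : Fin s → L) (Z : Fin (s + 1) → L) (i m : ℕ) : Subring L :=
  Subring.closure
    (algebraMap K L '' (levelRing p s ζ (i + 1)) ∪ {t | ∃ j : Fin s, (j : ℕ) < m ∧ t = Y j} ∪
      {t | ∃ j : Fin s, (j : ℕ) < i ∧ t = (Z j.succ)⁻¹})

/-- The coordinate ring `R[X_0, …, X_{s-1}, 1/u_0, …, 1/u_{s-1}]` of `𝒱_s`,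
`R = ℤ_(p)[ζ_{p^s}]`. -/
def ringV (p s : ℕ) (ζ : K) (G : Fin s → MvPolynomial (Fin s) K) (x : Fin s → L) : Subring L :=
  Subring.closure
    (algebraMap K L '' (levelRing p s ζ s) ∪ Set.range x ∪
      Set.range (fun i => (unitElt p s ζ G x i)⁻¹))

/-- The coordinate ring of `𝒲_s`: the integral closure of that of `𝒱_s` in `L`. -/
def ringW (p s : ℕ) (ζ : K) (G : Fin s → MvPolynomial (Fin s) K) (x : Fin s → L) : Subring L :=
  (integralClosure (ringV p s ζ G x) L).toSubring

/-- The principal ideal of the subring `S` generated by `c` (used for `c ∈ S`). -/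
def idealOf (S : Subring L) (c : L) : Ideal S := Ideal.span {w : S | (w : L) = c}

end Cover

/-! ### Artin-Schreier-Witt theory -/

section ASW

/-- The `i`-th component of `℘(y_0, …, y_{s-1}) = y - σ(y)`, a difference of Witt vectors, with
`σ` the Frobenius. -/
def wp (p s : ℕ) [Fact p.Prime] {A : Type*} [CommRing A] (a : Fin s → A) (i : Fin s) : A :=
  (WittVector.mk p (extendZero a) - WittVector.frobenius (WittVector.mk p (extendZero a))).coeff i

/-- The polynomial `f_{i+1}(y_0, …, y_{i-1})` over `𝔽_p` for which the `i`-th component of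
`℘(y_0, …, y_{s-1})` is `y_i - y_i^p + f_{i+1}(y_0, …, y_{i-1})`. -/
def aswPoly (p s : ℕ) [Fact p.Prime] (i : Fin s) : MvPolynomial (Fin s) (ZMod p) :=
  wp p s (fun j => (MvPolynomial.X j : MvPolynomial (Fin s) (ZMod p))) i -
    (MvPolynomial.X i - MvPolynomial.X i ^ p)

/-- The coordinate ring `𝔽_p[x, y] / (℘(y_0 + b_0, …, y_{s-1} + b_{s-1}) - (x_0, …, x_{s-1}))`
of the Artin-Schreier-Witt cover of affine space; the variables `Sum.inl` are the `x_i` and the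
variables `Sum.inr` are the `y_i`. -/
abbrev aswCover (p s : ℕ) [Fact p.Prime] (b : Fin s → MvPolynomial (Fin s) (ZMod p)) : Type :=
  MvPolynomial (Fin s ⊕ Fin s) (ZMod p) ⧸
    Ideal.span (Set.range fun i : Fin s =>
      wp p s (fun j => MvPolynomial.X (Sum.inr j) + MvPolynomial.rename Sum.inr (b j)) i -
        MvPolynomial.X (Sum.inl i))

end ASW

end KASW

end

set_option linter.unusedSectionVars false

noncomputable section

namespace KASW

/-! ### Arithmetic of the rings ℤ_(p)[ζ_{p^i}] inside K. -/

section LevelRing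

variable {p s : ℕ} [hp : Fact p.Prime] {K : Type*} [Field K] [CharZero K] {ζ : K}

/-! Let E be the Artin-Hasse exponential, so that log E(T) = ∑ T^{p^i}/p^i. Then E_{n,p}(t) =
E(ζ_{p^n} t)/E(t), the sum stopping because ζ_{p^n}^{p^i} = 1 for i ≥ n (`artinHasse_eq_subst`).
Dwork's criterion makes E integral at p, hence E_{n,p} ≡ 1 modulo ζ_{p^n} - 1. Written with ghost
components, E_{n,p} turns addition of Witt vectors into multiplication (`EWitt_eq_exp`,
`EWitt_add`), so E_{n,p}(a)^p = E_{n-1,p}(a) G_{n,p}(a) (`GWitt_mul_EWitt`). This is the Kummer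
tower Z_i^p = Z_{i-1} u_i: with Z given by Y' and u by X', the tower says that X' and Y' are the
same Witt vector in two coordinate systems.

In E_{n,p} and G_{n,p} the last Witt component enters only through exp(λ ·) and exp(pλ ·)
(`EWitt_succ_cut`, `GWitt_succ_cut`). So the components can be found one at a time with the series
log(1 + cT)/c. For c = pλ it is T modulo λ; for c = λ it is T - T^p (`ellS_lam_eq`), because
λ^{p-1}/p ≡ -1. That is where Artin-Schreier equations come from.

Truncations have to be polynomials, so the series must be restricted: almost all coefficients
divisible by any given power of ζ - 1. E_{n,p} is not restricted in general (E_{1,p} is exp(λT)),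
but E_{n,p}(T)/E_{n,p}(T^p) and E_{n,p}(T)^p/E_{n-1,p}(T) are. For the universal parameter c = 1 +
X, the coefficients of their logarithms are, up to a factor, consecutive differences of the
convergent sequence ((1+X)^{p^i} - 1)/p^i (`expQuotFrob_mem_nullSub`, `expQuotPow_mem_nullSub`);
then X is specialised to an element of the maximal ideal. As G_{n,p} is a product of such series,
admissible G exist (`exists_kummerStep`).

For Y' the induction (`exists_aswStep`) runs as follows. Suppose Y'_0, …, Y'_{i-1} reduce to the
first components of ℘(y + b). Lift y + b to c, with c^{(p)} its vector of p-th powers, and write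
(Y'_0, …, Y'_{i-1}, 0) + c^{(p)} = ρ + c. Then ρ reduces to 0 below i, and at i to minus the part of
℘_i not involving y_i. So E of the cut vector is E(c)/E(c^{(p)}) times E(ρ), which is restricted up
to the factor exp(λ ρ_i) ≡ 1 modulo λ. Its truncation E_i is therefore a polynomial, and solving for
Y'_i gives ℘_i(y + b), where b_i is minus the reduction of the truncation error divided by λ.

For the minimal polynomials, the tower expresses X_i as a power series ξ_i in the Y_j, and
uniqueness of Witt components gives X'(ξ) = Y' (`ASWDatum.subst_xi_eq`). Dividing (E_i + λT)^p -
Z_{i-1}u_i by pλ gives the equation. Only its constant term needs work, and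
`ASWDatum.exists_constant_term` finds it to be the reduction of F_i modulo ζ_{p^i} - 1. `fracPair`
carries this from power series to L. The equation is irreducible because Z_{i-1}u_i has degree one
in X_i over a field over which X_i is transcendental.

Finally the Y_j are algebraically independent and generate L. The ring R[Y, 1/Z] is a localization
of a polynomial ring over a discrete valuation ring, hence integrally closed, hence the coordinate
ring of 𝒲_s (`ringW_eq_locRing`). Modulo ζ - 1 all Z_i and u_i become 1, and the equations become x
= ℘(y + b). -/

theorem ratio_mem_levelRing (i : ℕ) (a b : ℤ) (hb : ¬ (p : ℤ) ∣ b) :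
    (a : K) / (b : K) ∈ levelRing p s ζ i :=
  Subring.subset_closure (Or.inl ⟨a, b, hb, rfl⟩)

theorem zeta_mem_levelRing (i : ℕ) : zetaLevel p s ζ i ∈ levelRing p s ζ i :=
  Subring.subset_closure (Or.inr rfl)

theorem zetaLevel_pow {i j : ℕ} (hji : j ≤ i) (his : i ≤ s) :
    zetaLevel p s ζ i ^ p ^ j = zetaLevel p s ζ (i - j) := by
  unfold zetaLevel
  rw [← pow_mul, ← pow_add]
  congr 2
  omega

theorem zetaLevel_mem {i j : ℕ} (hji : j ≤ i) (his : i ≤ s) :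
    zetaLevel p s ζ j ∈ levelRing p s ζ i := by
  have h := zetaLevel_pow (p := p) (ζ := ζ) (Nat.sub_le i j) his
  rw [Nat.sub_sub_self hji] at h
  rw [← h]
  exact pow_mem (zeta_mem_levelRing i) _

theorem levelRing_mono {i j : ℕ} (hij : i ≤ j) (hj : j ≤ s) :
    levelRing p s ζ i ≤ levelRing p s ζ j := by
  refine Subring.closure_le.2 ?_
  rintro x (⟨a, b, hb, rfl⟩ | rfl)
  · exact ratio_mem_levelRing j a b hb
  · exact zetaLevel_mem hij hj

theorem pi_mem (i : ℕ) : zetaLevel p s ζ i - 1 ∈ levelRing p s ζ i :=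
  sub_mem (zeta_mem_levelRing i) (one_mem _)

theorem pi_mem_of_le {i j : ℕ} (hji : j ≤ i) (his : i ≤ s) :
    zetaLevel p s ζ j - 1 ∈ levelRing p s ζ i :=
  sub_mem (zetaLevel_mem hji his) (one_mem _)

theorem lam_mem {i : ℕ} (hi : 1 ≤ i) (his : i ≤ s) : lam p s ζ ∈ levelRing p s ζ i :=
  pi_mem_of_le hi his

theorem zetaLevel_self : zetaLevel p s ζ s = ζ := by simp [zetaLevel]

theorem zetaLevel_prim (hζ : IsPrimitiveRoot ζ (p ^ s)) {i : ℕ} (his : i ≤ s) :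
    IsPrimitiveRoot (zetaLevel p s ζ i) (p ^ i) := by
  refine hζ.pow (pow_pos hp.out.pos _) ?_
  rw [← pow_add]
  congr 1
  omega

theorem zetaLevel_zero (hζ : IsPrimitiveRoot ζ (p ^ s)) : zetaLevel p s ζ 0 = 1 := by
  simp [zetaLevel, hζ.pow_eq_one]

theorem pi_ne_zero (hζ : IsPrimitiveRoot ζ (p ^ s)) {i : ℕ} (hi : 1 ≤ i) (his : i ≤ s) :
    zetaLevel p s ζ i - 1 ≠ 0 := by
  refine sub_ne_zero.2 ((zetaLevel_prim hζ his).ne_one ?_)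
  exact Nat.one_lt_pow (by omega) hp.out.one_lt

theorem natCast_ne (hp : Fact p.Prime) : (p : K) ≠ 0 := Nat.cast_ne_zero.2 hp.out.ne_zero

theorem int_ne {b : ℤ} (hb : ¬ (p : ℤ) ∣ b) : (b : K) ≠ 0 :=
  Int.cast_ne_zero.2 (by rintro rfl; exact hb (dvd_zero _))

theorem not_dvd_mul {a b : ℤ} (ha : ¬ (p : ℤ) ∣ a) (hb : ¬ (p : ℤ) ∣ b) : ¬ (p : ℤ) ∣ a * b :=
  fun h => ((Nat.prime_iff_prime_int.1 hp.out).dvd_or_dvd h).elim ha hb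

theorem not_dvd_one : ¬ (p : ℤ) ∣ 1 := by
  intro h
  have := Int.eq_one_of_dvd_one (by positivity) h
  exact hp.out.one_lt.ne' (by exact_mod_cast this)

/-- Norms and monic equations need algebraic integers. One denominator prime to p suffices, since
such denominators are closed under products. -/
theorem levelRing_integral (hζ : IsPrimitiveRoot ζ (p ^ s)) {i : ℕ} (his : i ≤ s) {x : K}
    (hx : x ∈ levelRing p s ζ i) : ∃ b : ℤ, ¬ (p : ℤ) ∣ b ∧ IsIntegral ℤ ((b : K) * x) := by
  unfold levelRing at hx
  induction hx using Subring.closure_induction with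
  | mem x hx =>
    rcases hx with ⟨a, b, hb, rfl⟩ | rfl
    · refine ⟨b, hb, ?_⟩
      rw [mul_div_cancel₀ _ (int_ne hb)]
      exact isIntegral_algebraMap (R := ℤ) (x := a)
    · refine ⟨1, not_dvd_one, ?_⟩
      rw [Int.cast_one, one_mul]
      exact (zetaLevel_prim hζ his).isIntegral (pow_pos hp.out.pos _)
  | zero => exact ⟨1, not_dvd_one, by simpa using isIntegral_zero⟩
  | one => exact ⟨1, not_dvd_one, by simpa using isIntegral_one⟩
  | add x y _ _ hx hy =>
    obtain ⟨b, hb, h⟩ := hx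
    obtain ⟨c, hc, h'⟩ := hy
    refine ⟨b * c, not_dvd_mul hb hc, ?_⟩
    have : ((b * c : ℤ) : K) * (x + y) = (c : K) * (b * x) + (b : K) * (c * y) := by
      push_cast; ring
    rw [this]
    exact ((isIntegral_algebraMap (R := ℤ) (x := c)).mul h).add
      ((isIntegral_algebraMap (R := ℤ) (x := b)).mul h')
  | neg x _ hx =>
    obtain ⟨b, hb, h⟩ := hx
    exact ⟨b, hb, by simpa using h.neg⟩
  | mul x y _ _ hx hy =>
    obtain ⟨b, hb, h⟩ := hx
    obtain ⟨c, hc, h'⟩ := hy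
    refine ⟨b * c, not_dvd_mul hb hc, ?_⟩
    have : ((b * c : ℤ) : K) * (x * y) = (b * x) * (c * y) := by push_cast; ring
    rw [this]
    exact h.mul h'

theorem int_inv_mem (i : ℕ) {b : ℤ} (hb : ¬ (p : ℤ) ∣ b) : (b : K)⁻¹ ∈ levelRing p s ζ i := by
  simpa using ratio_mem_levelRing (K := K) (s := s) (ζ := ζ) i 1 b hb

/-- An integer prime to `p` stays invertible after adding a multiple of `p`. -/
theorem unit_of_add_p_mul (hζ : IsPrimitiveRoot ζ (p ^ s)) {i : ℕ} (his : i ≤ s) {w : K}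
    (hw : w ∈ levelRing p s ζ i) {m : ℤ} (hm : ¬ (p : ℤ) ∣ m) :
    (m : K) + p * w ≠ 0 ∧ ((m : K) + p * w)⁻¹ ∈ levelRing p s ζ i := by
  obtain ⟨b, hb, hint⟩ := levelRing_integral hζ his hw
  set R := levelRing p s ζ i
  let a : R := ⟨(b : K) * w, mul_mem (intCast_mem R b) hw⟩
  obtain ⟨q, hq, hqa⟩ := hint
  -- Q is monic with root -p(bw). Hence b(m + pw) = mb + p(bw) divides the integer Q(mb), and modulo
  -- p only the leading term of Q survives, so Q(mb) ≡ (mb)^deg is prime to p.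
  let Q := (q.scaleRoots (-(p : ℤ)))
  have hroot : Polynomial.aeval (algebraMap ℤ R (-(p : ℤ)) * a) Q = 0 := by
    refine Polynomial.scaleRoots_aeval_eq_zero ?_
    apply Subtype.val_injective
    have : R.subtype (Polynomial.aeval a q) = Polynomial.eval₂ (algebraMap ℤ K) (R.subtype a) q := by
      rw [Polynomial.aeval_def, Polynomial.hom_eval₂]
      congr 1
    exact this.trans hqa
  have hdvd := Polynomial.sub_dvd_eval_sub (algebraMap ℤ R (m * b)) (algebraMap ℤ R (-(p : ℤ)) * a)
    (Q.map (algebraMap ℤ R))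
  rw [Polynomial.eval_map_algebraMap, Polynomial.eval_map_algebraMap, hroot, sub_zero,
    Polynomial.aeval_algebraMap_apply] at hdvd
  obtain ⟨r, hr⟩ := hdvd
  set N : ℤ := Polynomial.aeval (m * b) Q with hN
  have hNp : ¬ (p : ℤ) ∣ N := by
    rw [← ZMod.intCast_zmod_eq_zero_iff_dvd N p]
    have h1 : ((N : ℤ) : ZMod p) = (Q.map (Int.castRingHom (ZMod p))).eval ((m * b : ℤ) : ZMod p) := by
      rw [hN, Polynomial.coe_aeval_eq_eval, Polynomial.eval_intCast_map]
      simp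
    have h2 : Q.map (Int.castRingHom (ZMod p)) = Polynomial.X ^ q.natDegree := by
      rw [Polynomial.map_scaleRoots _ _ _ (by rw [hq.leadingCoeff]; simp)]
      simp [Polynomial.scaleRoots_zero, hq.map, hq.natDegree_map]
    rw [h1, h2, Polynomial.eval_pow, Polynomial.eval_X]
    refine pow_ne_zero _ ?_
    rw [Ne, ZMod.intCast_zmod_eq_zero_iff_dvd]
    exact not_dvd_mul hm hb
  have hK : (N : K) = ((b : K) * ((m : K) + p * w)) * (r : K) := by
    have := congrArg (fun z : R => (z : K)) hr
    simp only [eq_intCast, Subring.coe_intCast, Subring.coe_mul, AddSubgroupClass.coe_sub, a] at this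
    rw [this]; push_cast; ring
  have hN0 : (N : K) ≠ 0 := int_ne hNp
  have h0 : (m : K) + p * w ≠ 0 := by
    intro h; rw [h] at hK; simp at hK; exact hN0 (by exact_mod_cast hK)
  refine ⟨h0, ?_⟩
  have : ((m : K) + p * w)⁻¹ = (N : K)⁻¹ * b * r := by
    have hr0 : (r : K) ≠ 0 := by intro h; rw [h, mul_zero] at hK; exact hN0 hK
    have hb0 : (b : K) ≠ 0 := int_ne hb
    rw [hK]; field_simp
  rw [this]
  exact mul_mem (mul_mem (int_inv_mem i hNp) (intCast_mem R b)) r.2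

/-- Expand (λ + 1)^p = 1. Besides λ^p and pλ every remaining term is divisible by pλ²; divide by pλ.
This congruence λ^{p-1}/p ≡ -1 turns the Kummer equation into T - T^p on the special fibre. -/
theorem lam_pow (hζ : IsPrimitiveRoot ζ (p ^ s)) (hs : 1 ≤ s) :
    ∃ r ∈ levelRing p s ζ 1, lam p s ζ ^ (p - 1) / (p : K) = -1 + lam p s ζ * r := by
  have hl : lam p s ζ ∈ levelRing p s ζ 1 := lam_mem le_rfl hs
  have hl0 : lam p s ζ ≠ 0 := pi_ne_zero hζ le_rfl hs
  have h1 : (lam p s ζ + 1) ^ p = 1 := by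
    have := (zetaLevel_prim hζ hs).pow_eq_one
    simpa [lam] using this
  have h2 : (1 : ℕ) < p := hp.out.one_lt
  have hpow : p - 1 + 1 = p := Nat.sub_add_cancel h2.le
  rw [add_pow_prime_eq' hp.out] at h1
  set c : ℕ → K := fun k => ((p.choose k / p : ℕ) : K)
  have hmem : 1 ∈ Finset.Ioo 0 p := Finset.mem_Ioo.2 ⟨one_pos, h2⟩
  rw [← Finset.add_sum_erase _ _ hmem] at h1
  have h3 : ∑ k ∈ (Finset.Ioo 0 p).erase 1, lam p s ζ ^ k * 1 ^ (p - k) * c k =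
      lam p s ζ * (lam p s ζ * ∑ k ∈ (Finset.Ioo 0 p).erase 1, lam p s ζ ^ (k - 2) * c k) := by
    rw [Finset.mul_sum, Finset.mul_sum]
    refine Finset.sum_congr rfl fun k hk => ?_
    have hk2 : k = k - 2 + 1 + 1 := by
      simp only [Finset.mem_erase, Finset.mem_Ioo] at hk
      omega
    conv_lhs => rw [hk2, pow_succ, pow_succ, ← hk2]
    rw [one_pow]; ring
  refine ⟨-∑ k ∈ (Finset.Ioo 0 p).erase 1, lam p s ζ ^ (k - 2) * c k,
    neg_mem (sum_mem fun k _ => mul_mem (pow_mem hl _) (natCast_mem _ _)), ?_⟩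
  change _ + _ + (p : K) * (_ + ∑ k ∈ (Finset.Ioo 0 p).erase 1,
    lam p s ζ ^ k * 1 ^ (p - k) * c k) = 1 at h1
  rw [h3] at h1
  set S := ∑ k ∈ (Finset.Ioo 0 p).erase 1, lam p s ζ ^ (k - 2) * c k
  have hp0 : (p : K) ≠ 0 := natCast_ne hp
  have h4 : ((p.choose 1 / p : ℕ) : K) = 1 := by
    rw [Nat.choose_one_right, Nat.div_self hp.out.pos, Nat.cast_one]
  rw [h4] at h1
  rw [div_eq_iff hp0]
  apply mul_left_cancel₀ hl0
  rw [mul_comm, ← pow_succ, hpow]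
  simp only [one_pow, pow_one, mul_one] at h1
  linear_combination h1

/-- Frobenius modulo p applied to (1 + π)^{p^i} = 1, for π = ζ_{p^i} - 1. Together with `p_dvd_pi`
it shows that p and π have the same radical. -/
theorem pi_pow_dvd (hζ : IsPrimitiveRoot ζ (p ^ s)) {i : ℕ} (his : i ≤ s) :
    ∃ r ∈ levelRing p s ζ i, (zetaLevel p s ζ i - 1) ^ p ^ i = p * r := by
  let z : levelRing p s ζ i := ⟨_, pi_mem i⟩
  obtain ⟨r, hr⟩ := exists_add_pow_prime_pow_eq hp.out z 1 i
  have hz : (z + 1) ^ p ^ i = 1 := by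
    apply Subtype.val_injective
    simpa [z] using (zetaLevel_prim hζ his).pow_eq_one
  rw [hz] at hr
  refine ⟨((-(z * r) : levelRing p s ζ i) : K), Subtype.property _, ?_⟩
  have h2 := congrArg (fun z : levelRing p s ζ i => (z : K)) hr
  simp only [Subring.coe_one, Subring.coe_add, Subring.coe_mul, Subring.coe_pow,
    Subring.coe_natCast, one_pow, mul_one, z] at h2 ⊢
  push_cast
  linear_combination -h2

theorem pi_dvd_pi {i j : ℕ} (hji : j ≤ i) (his : i ≤ s) :
    ∃ r ∈ levelRing p s ζ i, zetaLevel p s ζ j - 1 = (zetaLevel p s ζ i - 1) * r := by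
  have h := zetaLevel_pow (p := p) (ζ := ζ) (Nat.sub_le i j) his
  rw [Nat.sub_sub_self hji] at h
  let z : levelRing p s ζ i := ⟨_, zeta_mem_levelRing i⟩
  obtain ⟨r, hr⟩ := sub_dvd_pow_sub_pow z 1 (p ^ (i - j))
  refine ⟨r, r.2, ?_⟩
  have h2 := congrArg (fun z : levelRing p s ζ i => (z : K)) hr
  simp only [z, one_pow] at h2
  push_cast at h2
  rw [← h, h2]

theorem p_dvd_pi (hζ : IsPrimitiveRoot ζ (p ^ s)) {i : ℕ} (hi : 1 ≤ i) (his : i ≤ s) :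
    ∃ r ∈ levelRing p s ζ i, (p : K) = (zetaLevel p s ζ i - 1) * r := by
  obtain ⟨r, hr, h⟩ := lam_pow hζ (hi.trans his)
  obtain ⟨r', hr', h'⟩ := pi_dvd_pi (p := p) (ζ := ζ) hi his
  have hr := levelRing_mono hi his hr
  have h2 := hp.out.two_le
  have hpow : p - 1 = p - 2 + 1 := by omega
  refine ⟨r' * (p * r - lam p s ζ ^ (p - 2)),
    mul_mem hr' (sub_mem (mul_mem (natCast_mem _ _) hr) (pow_mem (lam_mem hi his) _)), ?_⟩
  rw [← mul_assoc, ← h']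
  change _ = lam p s ζ * _
  rw [div_eq_iff (natCast_ne hp), hpow, pow_succ] at h
  linear_combination h

/-- It is enough to treat generators: ζ_{p^i} ≡ 1, and a/b ≡ au when ub ≡ 1 modulo p. So the residue
ring is a quotient of ℤ. -/
theorem levelRing_residue (hζ : IsPrimitiveRoot ζ (p ^ s)) {i : ℕ} (hi : 1 ≤ i) (his : i ≤ s)
    {x : K} (hx : x ∈ levelRing p s ζ i) :
    ∃ n : ℤ, ∃ r ∈ levelRing p s ζ i, x = n + (zetaLevel p s ζ i - 1) * r := by
  have hx' := hx
  unfold levelRing at hx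
  induction hx using Subring.closure_induction with
  | mem x hx =>
    rcases hx with ⟨a, b, hb, rfl⟩ | rfl
    · have hco : IsCoprime b (p : ℤ) :=
        (((Nat.prime_iff_prime_int.1 hp.out).coprime_iff_not_dvd).2 hb).symm
      obtain ⟨u, w, huw⟩ := hco
      obtain ⟨r, hr, h⟩ := p_dvd_pi hζ hi his
      refine ⟨a * u, r * w * (a / b), mul_mem (mul_mem hr (intCast_mem _ _)) hx', ?_⟩
      have hb0 : (b : K) ≠ 0 := int_ne hb
      have huw' : (u : K) * b + w * p = 1 := by exact_mod_cast huw
      rw [show (zetaLevel p s ζ i - 1) * (r * w * ((a : K) / b)) =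
        ((zetaLevel p s ζ i - 1) * r) * w * (a / b) by ring, ← h]
      field_simp
      push_cast
      linear_combination -(a : K) * huw'
    · exact ⟨1, 1, one_mem _, by push_cast; ring⟩
  | zero => exact ⟨0, 0, zero_mem _, by simp⟩
  | one => exact ⟨1, 0, zero_mem _, by simp⟩
  | add x y h1 h2 hx hy =>
    obtain ⟨n, r, hr, h⟩ := hx h1
    obtain ⟨m, t, ht, h'⟩ := hy h2
    refine ⟨n + m, r + t, add_mem hr ht, ?_⟩
    rw [h, h']; push_cast; ring
  | neg x h1 hx =>
    obtain ⟨n, r, hr, h⟩ := hx h1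
    refine ⟨-n, -r, neg_mem hr, ?_⟩
    rw [h]; push_cast; ring
  | mul x y h1 h2 hx hy =>
    obtain ⟨n, r, hr, h⟩ := hx h1
    obtain ⟨m, t, ht, h'⟩ := hy h2
    refine ⟨n * m, r * y + n * t, add_mem (mul_mem hr h2) (mul_mem (intCast_mem _ _) ht), ?_⟩
    rw [h]; push_cast
    linear_combination (n : K) * h'

/-- Locality of the ring. The p^i-th power of n + πr is an integer prime to p plus a multiple of p,
so `unit_of_add_p_mul` applies to it, and a divisor of a unit is a unit. -/
theorem unit_of_residue (hζ : IsPrimitiveRoot ζ (p ^ s)) {i : ℕ} (his : i ≤ s)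
    {r : K} (hr : r ∈ levelRing p s ζ i) {n : ℤ} (hn : ¬ (p : ℤ) ∣ n) :
    (n : K) + (zetaLevel p s ζ i - 1) * r ≠ 0 ∧
      ((n : K) + (zetaLevel p s ζ i - 1) * r)⁻¹ ∈ levelRing p s ζ i := by
  set x := (n : K) + (zetaLevel p s ζ i - 1) * r with hx
  have hxm : x ∈ levelRing p s ζ i := add_mem (intCast_mem _ _) (mul_mem (pi_mem i) hr)
  obtain ⟨t, ht, h⟩ := pi_pow_dvd hζ his
  let z : levelRing p s ζ i := ⟨_, mul_mem (pi_mem i) hr⟩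
  obtain ⟨w, hw⟩ := exists_add_pow_prime_pow_eq hp.out (n : levelRing p s ζ i) z i
  have hw := congrArg (fun z : levelRing p s ζ i => (z : K)) hw
  simp only [z] at hw
  push_cast at hw
  rw [mul_pow, h, ← hx] at hw
  have hx2 : x ^ p ^ i = ((n ^ p ^ i : ℤ) : K) + p * (t * r ^ p ^ i +
      n * ((zetaLevel p s ζ i - 1) * r) * w) := by rw [hw]; push_cast; ring
  have hn' : ¬ (p : ℤ) ∣ n ^ p ^ i := fun h' =>
    hn ((Nat.prime_iff_prime_int.1 hp.out).dvd_of_dvd_pow h')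
  obtain ⟨h0, hinv⟩ := unit_of_add_p_mul hζ his (w := t * r ^ p ^ i +
      n * ((zetaLevel p s ζ i - 1) * r) * w) (add_mem (mul_mem ht (pow_mem hr _))
        (mul_mem (mul_mem (intCast_mem _ _) (mul_mem (pi_mem i) hr)) w.2)) hn'
  rw [← hx2] at h0 hinv
  have hpos : 0 < p ^ i := pow_pos hp.out.pos _
  have hx0 : x ≠ 0 := fun h => h0 (by rw [h, zero_pow hpos.ne'])
  refine ⟨hx0, ?_⟩
  have : x⁻¹ = x ^ (p ^ i - 1) * (x ^ p ^ i)⁻¹ := by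
    rw [eq_mul_inv_iff_mul_eq₀ h0, ← Nat.sub_add_cancel hpos, Nat.add_sub_cancel, pow_succ]
    field_simp
  rw [this]
  exact mul_mem (pow_mem hxm _) hinv

end LevelRing

/-! ### The norm valuation, and the factorization of elements into a unit and a power of ζ_{p^i} -
1. -/

section Valuation

variable {p s : ℕ} [hp : Fact p.Prime] {K : Type*} [Field K] [NumberField K] {ζ : K}

/-- The (unnormalised) valuation `v_p(N(x))`. -/
def normVal (p : ℕ) (x : K) : ℤ := padicValRat p (Algebra.norm ℚ x)

theorem norm_ne_zero {x : K} (hx : x ≠ 0) : Algebra.norm ℚ x ≠ 0 :=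
  Algebra.norm_ne_zero_iff.2 hx

theorem normVal_mul {x y : K} (hx : x ≠ 0) (hy : y ≠ 0) :
    normVal p (x * y) = normVal p x + normVal p y := by
  rw [normVal, map_mul, padicValRat.mul (norm_ne_zero hx) (norm_ne_zero hy)]; rfl

theorem normVal_inv (x : K) : normVal p x⁻¹ = - normVal p x := by
  by_cases hx : x = 0
  · simp [hx, normVal]
  have h := normVal_mul (p := p) hx (inv_ne_zero hx)
  rw [mul_inv_cancel₀ hx] at h
  have h1 : normVal p (1 : K) = 0 := by simp [normVal]
  linarith

theorem normVal_pow {x : K} (_hx : x ≠ 0) (n : ℕ) : normVal p (x ^ n) = n * normVal p x := by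
  rw [normVal, map_pow, padicValRat.pow]; rfl

theorem normVal_int (b : ℤ) :
    normVal p (b : K) = Module.finrank ℚ K * padicValRat p b := by
  by_cases hb : b = 0
  · simp [hb, normVal]
  have : Algebra.norm ℚ (b : K) = (b : ℚ) ^ Module.finrank ℚ K := by
    rw [← Algebra.norm_algebraMap (S := K) (b : ℚ)]; simp
  rw [normVal, this, padicValRat.pow]

/-- Norms of algebraic integers are integers, and the cleared denominator is prime to p. -/
theorem normVal_nonneg (hζ : IsPrimitiveRoot ζ (p ^ s)) {i : ℕ} (his : i ≤ s) {x : K}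
    (hx : x ∈ levelRing p s ζ i) : 0 ≤ normVal p x := by
  by_cases h0 : x = 0
  · simp [h0, normVal]
  obtain ⟨b, hb, h⟩ := levelRing_integral hζ his hx
  have h1 : 0 ≤ normVal p ((b : K) * x) := by
    have := Algebra.isIntegral_norm ℚ h
    obtain ⟨n, hn⟩ := IsIntegrallyClosed.isIntegral_iff.1 this
    rw [normVal, ← hn]
    simp
  rw [normVal_mul (int_ne hb) h0, normVal_int] at h1
  have : padicValRat p (b : ℚ) = 0 := by
    rw [padicValRat.of_int, padicValInt.eq_zero_of_not_dvd hb]; rfl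
  rwa [this, mul_zero, zero_add] at h1

theorem normVal_p : normVal p (p : K) = Module.finrank ℚ K := by
  have := normVal_int (p := p) (K := K) (p : ℤ)
  simp only [Int.cast_natCast] at this
  rw [this, padicValRat.self hp.out.one_lt, mul_one]

theorem normVal_pi_pos (hζ : IsPrimitiveRoot ζ (p ^ s)) {i : ℕ} (hi : 1 ≤ i) (his : i ≤ s) :
    0 < normVal p (zetaLevel p s ζ i - 1) := by
  obtain ⟨r, hr, h⟩ := pi_pow_dvd hζ his
  have h0 := pi_ne_zero hζ hi his
  have hr0 : r ≠ 0 := by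
    rintro rfl
    rw [mul_zero] at h
    exact pow_ne_zero _ h0 h
  have h1 := congrArg (normVal p) h
  rw [normVal_pow h0, normVal_mul (natCast_ne hp) hr0, normVal_p] at h1
  have h2 := normVal_nonneg hζ his hr
  have h3 : (0 : ℤ) < Module.finrank ℚ K := by exact_mod_cast Module.finrank_pos
  by_contra hc
  have h4 := normVal_nonneg hζ his (pi_mem (p := p) (s := s) (ζ := ζ) i)
  have h5 : normVal p (zetaLevel p s ζ i - 1) = 0 := le_antisymm (not_lt.1 hc) h4
  rw [h5] at h1
  linarith

/-- An element with nonzero residue is a unit; otherwise divide by ζ_{p^i} - 1 and repeat. The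
process stops because `normVal` decreases. So each level is a discrete valuation ring, even when
ζ_{p^i} does not generate K. -/
theorem levelRing_factor (hζ : IsPrimitiveRoot ζ (p ^ s)) {i : ℕ} (hi : 1 ≤ i) (his : i ≤ s)
    {x : K} (hx : x ∈ levelRing p s ζ i) (h0 : x ≠ 0) :
    ∃ (k : ℕ) (u : K), u ∈ levelRing p s ζ i ∧ u⁻¹ ∈ levelRing p s ζ i ∧ u ≠ 0 ∧
      x = u * (zetaLevel p s ζ i - 1) ^ k := by
  obtain ⟨N, hN⟩ : ∃ N : ℕ, normVal p x < N := ⟨(normVal p x).toNat + 1, by omega⟩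
  induction N generalizing x with
  | zero => exact absurd (normVal_nonneg hζ his hx) (by simpa using hN)
  | succ N ih =>
    obtain ⟨n, r, hr, h⟩ := levelRing_residue hζ hi his hx
    by_cases hn : (p : ℤ) ∣ n
    · obtain ⟨m, rfl⟩ := hn
      obtain ⟨t, ht, hpt⟩ := p_dvd_pi hζ hi his
      have hxy : x = (zetaLevel p s ζ i - 1) * (t * m + r) := by
        rw [h]; push_cast; rw [hpt]; ring
      have hy0 : t * m + r ≠ 0 := by intro h; rw [h, mul_zero] at hxy; exact h0 hxy
      have hv := congrArg (normVal p) hxy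
      rw [normVal_mul (pi_ne_zero hζ hi his) hy0] at hv
      have := normVal_pi_pos hζ hi his
      obtain ⟨k, u, hu, hu', hu0, hk⟩ := ih (add_mem (mul_mem ht (intCast_mem _ m)) hr) hy0
        (by push_cast at hN; linarith)
      exact ⟨k + 1, u, hu, hu', hu0, by rw [hxy, hk]; ring⟩
    · have := unit_of_residue hζ his hr hn
      rw [← h] at this
      exact ⟨0, x, hx, this.2, this.1, by simp⟩

theorem normVal_unit (hζ : IsPrimitiveRoot ζ (p ^ s)) {i : ℕ} (his : i ≤ s) {u : K}
    (hu : u ∈ levelRing p s ζ i) (hu' : u⁻¹ ∈ levelRing p s ζ i) : normVal p u = 0 := by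
  have h1 := normVal_nonneg hζ his hu
  have h2 := normVal_nonneg hζ his hu'
  rw [normVal_inv] at h2
  linarith

/-- A quotient of elements of `ℤ_(p)[ζ_{p^i}]` that is integral at `p` lies in that ring. -/
theorem levelRing_div (hζ : IsPrimitiveRoot ζ (p ^ s)) {i : ℕ} (hi : 1 ≤ i) (his : i ≤ s)
    {a b : K} (ha : a ∈ levelRing p s ζ i) (hb : b ∈ levelRing p s ζ i)
    (h : 0 ≤ normVal p (a / b)) : a / b ∈ levelRing p s ζ i := by
  by_cases ha0 : a = 0
  · simp [ha0]
  by_cases hb0 : b = 0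
  · simp [hb0]
  obtain ⟨k, u, hu, hu', hu0, rfl⟩ := levelRing_factor hζ hi his ha ha0
  obtain ⟨l, w, hw, hw', hw0, rfl⟩ := levelRing_factor hζ hi his hb hb0
  have hpi := pi_ne_zero hζ hi his
  have hpos := normVal_pi_pos hζ hi his
  have hkl : l ≤ k := by
    rw [div_eq_mul_inv, normVal_mul ha0 (inv_ne_zero hb0), normVal_inv,
      normVal_mul hu0 (pow_ne_zero _ hpi), normVal_mul hw0 (pow_ne_zero _ hpi),
      normVal_pow hpi, normVal_pow hpi, normVal_unit hζ his hu hu',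
      normVal_unit hζ his hw hw'] at h
    have h' : (l : ℤ) * normVal p (zetaLevel p s ζ i - 1) ≤
      k * normVal p (zetaLevel p s ζ i - 1) := by linarith
    exact_mod_cast le_of_mul_le_mul_right h' hpos
  have : u * (zetaLevel p s ζ i - 1) ^ k / (w * (zetaLevel p s ζ i - 1) ^ l) =
      u * w⁻¹ * (zetaLevel p s ζ i - 1) ^ (k - l) := by
    rw [← Nat.sub_add_cancel hkl, Nat.add_sub_cancel, pow_add]
    field_simp
  rw [this]
  exact mul_mem (mul_mem hu hw') (pow_mem (pi_mem i) _)

end Valuation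

/-! ### Descent of congruences between levels, the bounds on `nu` as divisibility, and the residue
field. -/

section Residue

variable {p s : ℕ} [hp : Fact p.Prime] {K : Type*} [Field K] [NumberField K] {ζ : K}

theorem pi_dvd_of_normVal_pos (hζ : IsPrimitiveRoot ζ (p ^ s)) {i : ℕ} (hi : 1 ≤ i) (his : i ≤ s)
    {x : K} (hx : x ∈ levelRing p s ζ i) (h : 0 < normVal p x) :
    ∃ r ∈ levelRing p s ζ i, x = (zetaLevel p s ζ i - 1) * r := by
  have h0 : x ≠ 0 := by rintro rfl; simp [normVal] at h
  obtain ⟨k, u, hu, hu', hu0, rfl⟩ := levelRing_factor hζ hi his hx h0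
  rcases k with _ | k
  · rw [pow_zero, mul_one, normVal_unit hζ his hu hu'] at h
    exact absurd h (lt_irrefl _)
  · exact ⟨u * (zetaLevel p s ζ i - 1) ^ k, mul_mem hu (pow_mem (pi_mem i) _), by ring⟩

theorem normVal_pos_of_pi_dvd (hζ : IsPrimitiveRoot ζ (p ^ s)) {i : ℕ} (hi : 1 ≤ i) (his : i ≤ s)
    {r : K} (hr : r ∈ levelRing p s ζ i) (h : r ≠ 0) :
    0 < normVal p ((zetaLevel p s ζ i - 1) * r) := by
  rw [normVal_mul (pi_ne_zero hζ hi his) h]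
  have := normVal_pi_pos hζ hi his
  have := normVal_nonneg hζ his hr
  linarith

/-- Divisibility by the uniformizer means positive `normVal` at every level. This lets reductions be
computed once at level s while the congruences are asserted modulo ζ_{p^i} - 1. -/
theorem pi_dvd_descend (hζ : IsPrimitiveRoot ζ (p ^ s)) {i j : ℕ} (hi : 1 ≤ i) (hij : i ≤ j)
    (hj : j ≤ s) {x r : K} (hx : x ∈ levelRing p s ζ i) (hr : r ∈ levelRing p s ζ j)
    (h : x = (zetaLevel p s ζ j - 1) * r) :
    ∃ t ∈ levelRing p s ζ i, x = (zetaLevel p s ζ i - 1) * t := by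
  by_cases hr0 : r = 0
  · exact ⟨0, zero_mem _, by rw [h, hr0, mul_zero, mul_zero]⟩
  · refine pi_dvd_of_normVal_pos hζ hi (hij.trans hj) hx ?_
    rw [h]
    exact normVal_pos_of_pi_dvd hζ (hi.trans hij) hj hr hr0

theorem not_pi_dvd_one (hζ : IsPrimitiveRoot ζ (p ^ s)) {i : ℕ} (hi : 1 ≤ i) (his : i ≤ s)
    {r : K} (hr : r ∈ levelRing p s ζ i) : (1 : K) ≠ (zetaLevel p s ζ i - 1) * r := by
  intro h
  have hr0 : r ≠ 0 := by rintro rfl; simp at h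
  have := normVal_pos_of_pi_dvd hζ hi his hr hr0
  rw [← h] at this
  simp [normVal] at this

/-- By `lam_pow`, λ^{p-1}/p is a unit. In the normalisation of `nu` this says ν(λ) = 1/(p - 1). -/
theorem normVal_lam (hζ : IsPrimitiveRoot ζ (p ^ s)) (hs : 1 ≤ s) :
    ((p : ℤ) - 1) * normVal p (lam p s ζ) = Module.finrank ℚ K := by
  obtain ⟨r, hr, h⟩ := lam_pow hζ hs
  have h0 : lam p s ζ ≠ 0 := pi_ne_zero hζ le_rfl hs
  obtain ⟨hu0, hu⟩ := unit_of_residue hζ hs hr (n := -1) (by simpa using not_dvd_one)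
  have h1 : normVal p (lam p s ζ ^ (p - 1) / (p : K)) = 0 := by
    refine normVal_unit hζ hs (i := 1) ?_ ?_
    · rw [h]; exact add_mem (neg_mem (one_mem _)) (mul_mem (pi_mem 1) hr)
    · rw [h]; simpa [lam] using hu
  rw [div_eq_mul_inv, normVal_mul (pow_ne_zero _ h0) (inv_ne_zero (natCast_ne hp)),
    normVal_inv, normVal_p, normVal_pow h0, Nat.cast_sub hp.out.one_lt.le] at h1
  push_cast at h1
  linarith

theorem lam_pow_unit (hζ : IsPrimitiveRoot ζ (p ^ s)) {i : ℕ} (hi : 1 ≤ i) (his : i ≤ s) :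
    lam p s ζ ^ (p - 1) / (p : K) ∈ levelRing p s ζ i ∧
    (lam p s ζ ^ (p - 1) / (p : K))⁻¹ ∈ levelRing p s ζ i := by
  obtain ⟨r, hr, h⟩ := lam_pow hζ (hi.trans his)
  obtain ⟨hu0, hu⟩ := unit_of_residue hζ (hi.trans his) hr (n := -1) (by simpa using not_dvd_one)
  refine ⟨levelRing_mono hi his ?_, levelRing_mono hi his ?_⟩
  · rw [h]; exact add_mem (neg_mem (one_mem _)) (mul_mem (pi_mem 1) hr)
  · rw [h]; simpa [lam] using hu

variable (p s) in
theorem exists_int_mul_mem [IsCyclotomicExtension {p ^ s} ℚ K] (hζ : IsPrimitiveRoot ζ (p ^ s))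
    (x : K) : ∃ m : ℤ, m ≠ 0 ∧ (m : K) * x ∈ levelRing p s ζ s := by
  have hne : NeZero (p ^ s) := ⟨pow_ne_zero _ hp.out.ne_zero⟩
  have hx : x ∈ Algebra.adjoin ℚ ({ζ} : Set K) := by
    rw [IsCyclotomicExtension.adjoin_primitive_root_eq_top hζ]; trivial
  induction hx using Algebra.adjoin_induction with
  | mem x hx =>
    rw [Set.mem_singleton_iff.1 hx]
    refine ⟨1, one_ne_zero, ?_⟩
    have := zeta_mem_levelRing (p := p) (s := s) (ζ := ζ) s
    rw [zetaLevel_self] at this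
    simpa using this
  | algebraMap q =>
    refine ⟨q.den, by exact_mod_cast q.den_nz, ?_⟩
    have : ((q.den : ℤ) : K) * algebraMap ℚ K q = (q.num : K) := by
      have h : (q.den : ℚ) * q = q.num := by rw [mul_comm]; exact Rat.mul_den_eq_num q
      have h2 := congrArg (algebraMap ℚ K) h
      rw [map_mul, map_natCast, map_intCast] at h2
      rw [Int.cast_natCast]
      exact h2
    rw [this]
    exact intCast_mem _ _
  | add x y _ _ hx hy =>
    obtain ⟨m, hm, h⟩ := hx
    obtain ⟨n, hn, h'⟩ := hy
    refine ⟨m * n, mul_ne_zero hm hn, ?_⟩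
    have : ((m * n : ℤ) : K) * (x + y) = n * (m * x) + m * (n * y) := by push_cast; ring
    rw [this]
    exact add_mem (mul_mem (intCast_mem _ _) h) (mul_mem (intCast_mem _ _) h')
  | mul x y _ _ hx hy =>
    obtain ⟨m, hm, h⟩ := hx
    obtain ⟨n, hn, h'⟩ := hy
    refine ⟨m * n, mul_ne_zero hm hn, ?_⟩
    have : ((m * n : ℤ) : K) * (x * y) = (m * x) * (n * y) := by push_cast; ring
    rw [this]
    exact mul_mem h h'

/-- At the top level K is the fraction field, so the discrete valuation ring is the whole valuation
ring. -/
theorem mem_levelRing_iff [IsCyclotomicExtension {p ^ s} ℚ K] (hζ : IsPrimitiveRoot ζ (p ^ s))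
    (hs : 1 ≤ s) (x : K) : x ∈ levelRing p s ζ s ↔ 0 ≤ normVal p x := by
  refine ⟨normVal_nonneg hζ le_rfl, fun h => ?_⟩
  obtain ⟨m, hm, hx⟩ := exists_int_mul_mem p s hζ x
  have hm' : (m : K) ≠ 0 := Int.cast_ne_zero.2 hm
  have : x = (m * x) / m := by field_simp
  rw [this] at h ⊢
  exact levelRing_div hζ hs le_rfl hx (intCast_mem _ _) h

theorem nu_of_ne {x : K} (hx : x ≠ 0) :
    nu p x = (((normVal p x : ℚ) / (Module.finrank ℚ K : ℚ) : ℚ) : WithTop ℚ) := by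
  rw [nu, if_neg hx]; rfl

theorem nu_lt_iff [IsCyclotomicExtension {p ^ s} ℚ K] (hζ : IsPrimitiveRoot ζ (p ^ s))
    (hs : 1 ≤ s) (x : K) :
    nu p x < ((1 / ((p : ℚ) - 1) : ℚ) : WithTop ℚ) ↔ x / lam p s ζ ∉ levelRing p s ζ s := by
  by_cases hx : x = 0
  · simp [hx, nu]
  have hl : lam p s ζ ≠ 0 := pi_ne_zero hζ le_rfl hs
  rw [nu_of_ne hx, WithTop.coe_lt_coe, mem_levelRing_iff hζ hs, div_eq_mul_inv x,
    normVal_mul hx (inv_ne_zero hl), normVal_inv, not_le]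
  have h1 := normVal_lam hζ hs
  have hd : (0 : ℚ) < Module.finrank ℚ K := by exact_mod_cast Module.finrank_pos
  have hp1 : (0 : ℚ) < (p : ℚ) - 1 := by
    have : (1 : ℚ) < p := by exact_mod_cast hp.out.one_lt
    linarith
  have h1' : ((p : ℚ) - 1) * normVal p (lam p s ζ) = Module.finrank ℚ K := by exact_mod_cast h1
  rw [div_lt_div_iff₀ hd hp1, one_mul, ← h1', mul_comm, mul_lt_mul_iff_right₀ hp1, Int.cast_lt]
  omega

/-- Since ν(pλ) = p/(p - 1), the strict inequality means divisibility by pλ with one further factor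
ζ - 1. From here on admissibility is a divisibility statement. -/
theorem lt_nu_iff [IsCyclotomicExtension {p ^ s} ℚ K] (hζ : IsPrimitiveRoot ζ (p ^ s))
    (hs : 1 ≤ s) (x : K) :
    (((p : ℚ) / ((p : ℚ) - 1) : ℚ) : WithTop ℚ) < nu p x ↔
      ∃ r ∈ levelRing p s ζ s, x = (p * lam p s ζ) * ((ζ - 1) * r) := by
  have hz : ζ - 1 ≠ 0 := by
    have := pi_ne_zero hζ hs le_rfl
    rwa [zetaLevel_self] at this
  have hl : lam p s ζ ≠ 0 := pi_ne_zero hζ le_rfl hs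
  have hpl : (p : K) * lam p s ζ ≠ 0 := mul_ne_zero (natCast_ne hp) hl
  by_cases hx : x = 0
  · subst hx
    simp only [nu, if_true, WithTop.coe_lt_top, true_iff]
    exact ⟨0, zero_mem _, by simp⟩
  have h1 := normVal_lam hζ hs
  have hd : (0 : ℚ) < Module.finrank ℚ K := by exact_mod_cast Module.finrank_pos
  have hp1 : (0 : ℚ) < (p : ℚ) - 1 := by
    have : (1 : ℚ) < p := by exact_mod_cast hp.out.one_lt
    linarith
  have h1' : ((p : ℚ) - 1) * normVal p (lam p s ζ) = Module.finrank ℚ K := by exact_mod_cast h1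
  have key : (((p : ℚ) / ((p : ℚ) - 1) : ℚ) : WithTop ℚ) < nu p x ↔
      0 < normVal p (x / (p * lam p s ζ)) := by
    rw [nu_of_ne hx, WithTop.coe_lt_coe, div_eq_mul_inv x,
      normVal_mul hx (inv_ne_zero hpl), normVal_inv, normVal_mul (natCast_ne hp) hl, normVal_p,
      div_lt_div_iff₀ hp1 hd, ← h1]
    have : (p : ℚ) * Module.finrank ℚ K = (Module.finrank ℚ K + normVal p (lam p s ζ)) *
      ((p : ℚ) - 1) := by linear_combination -h1'
    rw [this, mul_lt_mul_iff_left₀ hp1, h1]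
    constructor
    · intro h
      have : (Module.finrank ℚ K + normVal p (lam p s ζ) : ℤ) < normVal p x := by exact_mod_cast h
      linarith
    · intro h
      have : (Module.finrank ℚ K + normVal p (lam p s ζ) : ℤ) < normVal p x := by linarith
      exact_mod_cast this
  rw [key]
  constructor
  · intro h
    obtain ⟨r, hr, h'⟩ := pi_dvd_of_normVal_pos hζ hs le_rfl
      ((mem_levelRing_iff hζ hs _).2 h.le) h
    rw [zetaLevel_self] at h'
    exact ⟨r, hr, by rw [← h', mul_div_cancel₀ _ hpl]⟩
  · rintro ⟨r, hr, h⟩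
    have hr0 : r ≠ 0 := by rintro rfl; simp at h; exact hx h
    have := normVal_pos_of_pi_dvd hζ hs le_rfl hr hr0
    rw [zetaLevel_self] at this
    rwa [h, mul_div_cancel_left₀ _ hpl]

/-- ℤ maps onto the residue ring by `levelRing_residue`; the kernel contains the maximal ideal (p)
and not 1. -/
theorem exists_residue (hζ : IsPrimitiveRoot ζ (p ^ s)) (hs : 1 ≤ s) :
    ∃ res : levelRing p s ζ s →+* ZMod p, ∀ x : levelRing p s ζ s,
      res x = 0 ↔ ∃ r ∈ levelRing p s ζ s, (x : K) = (ζ - 1) * r := by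
  set R := levelRing p s ζ s
  have hpi : ζ - 1 ∈ R := by
    have := pi_mem (p := p) (s := s) (ζ := ζ) s
    rwa [zetaLevel_self] at this
  set I : Ideal R := Ideal.span {⟨ζ - 1, hpi⟩} with hI
  have hmem : ∀ x : R, x ∈ I ↔ ∃ r ∈ R, (x : K) = (ζ - 1) * r := by
    intro x
    rw [hI, Ideal.mem_span_singleton']
    constructor
    · rintro ⟨r, rfl⟩; exact ⟨r, r.2, by push_cast; ring⟩
    · rintro ⟨r, hr, h⟩; exact ⟨⟨r, hr⟩, Subtype.ext (by push_cast; rw [h]; ring)⟩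
  let f : ℤ →+* R ⧸ I := Int.castRingHom _
  have hsurj : Function.Surjective f := by
    intro x
    obtain ⟨x, rfl⟩ := Ideal.Quotient.mk_surjective x
    obtain ⟨n, r, hr, h⟩ := levelRing_residue hζ hs le_rfl x.2
    rw [zetaLevel_self] at h
    refine ⟨n, ?_⟩
    have : (f n) = Ideal.Quotient.mk I (n : R) := by simp [f]
    rw [this, eq_comm, Ideal.Quotient.eq, hmem]
    exact ⟨r, hr, by push_cast; rw [h]; ring⟩
  have hker : RingHom.ker f = Ideal.span {(p : ℤ)} := by
    have hmax : (Ideal.span {(p : ℤ)}).IsMaximal :=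
      PrincipalIdealRing.isMaximal_of_irreducible (Nat.prime_iff_prime_int.1 hp.out).irreducible
    refine (hmax.eq_of_le ?_ ?_).symm
    · rw [Ne, Ideal.eq_top_iff_one, RingHom.mem_ker, map_one]
      intro h
      have : (Ideal.Quotient.mk I 1) = 0 := by rw [map_one]; exact h
      rw [Ideal.Quotient.eq_zero_iff_mem, hmem] at this
      obtain ⟨r, hr, h⟩ := this
      have h2 := not_pi_dvd_one hζ hs le_rfl hr
      rw [zetaLevel_self] at h2
      exact h2 (by simpa using h)
    · rw [Ideal.span_le, Set.singleton_subset_iff, SetLike.mem_coe, RingHom.mem_ker]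
      have : (f p) = Ideal.Quotient.mk I (p : R) := by simp [f]
      rw [this, Ideal.Quotient.eq_zero_iff_mem, hmem]
      obtain ⟨r, hr, h⟩ := p_dvd_pi hζ hs le_rfl
      rw [zetaLevel_self] at h
      exact ⟨r, hr, by push_cast; exact h⟩
  let e : R ⧸ I ≃+* ZMod p := (RingHom.quotientKerEquivOfSurjective hsurj).symm.trans
    ((Ideal.quotEquivOfEq hker).trans (Int.quotientSpanNatEquivZMod p))
  refine ⟨e.toRingHom.comp (Ideal.Quotient.mk I), fun x => ?_⟩
  rw [← hmem, ← Ideal.Quotient.eq_zero_iff_mem]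
  exact map_eq_zero_iff e e.injective

end Residue

/-! ### Formal exponential and logarithm. -/

section ExpLog

open PowerSeries

variable {τ : Type*} {R : Type*} [CommRing R] [Algebra ℚ R]

/-- The identity is checked on coefficients for two free variables, where it is the binomial formula
for factorials, and then specialised. -/
theorem exp_subst_add {a b : MvPowerSeries τ R} (ha : HasSubst a) (hb : HasSubst b) :
    (exp R).subst (a + b) = (exp R).subst a * (exp R).subst b := by
  have key : (exp R).subst (MvPowerSeries.X (0 : Fin 2) + MvPowerSeries.X 1 :
      MvPowerSeries (Fin 2) R) = (exp R).subst (MvPowerSeries.X (0 : Fin 2) :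
      MvPowerSeries (Fin 2) R) * (exp R).subst (MvPowerSeries.X (1 : Fin 2) :
      MvPowerSeries (Fin 2) R) := by
    ext e
    rw [coeff_subst_X_zero_add_X_one, coeff_subst_X_zero_subst_mul_X_one]
    simp only [coeff_exp]
    rw [← map_natCast (algebraMap ℚ R), ← map_mul, ← map_mul]
    congr 1
    have h := Nat.add_choose_mul_factorial_mul_factorial (e 0) (e 1)
    rw [← Nat.choose_symm_add] at h
    have h' : (((e 0 + e 1).choose (e 0) : ℕ) : ℚ) * (e 0).factorial * (e 1).factorial =
      (e 0 + e 1).factorial := by exact_mod_cast h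
    have h0 : ((e 0).factorial : ℚ) ≠ 0 := by positivity
    have h1 : ((e 1).factorial : ℚ) ≠ 0 := by positivity
    have h2 : ((e 0 + e 1).factorial : ℚ) ≠ 0 := by positivity
    field_simp
    linear_combination h'
  have hab : MvPowerSeries.HasSubst (![a, b] : Fin 2 → MvPowerSeries τ R) := by
    refine ⟨fun i => ?_, fun d => Set.toFinite _⟩
    fin_cases i
    · exact ha
    · exact hb
  have hX : ∀ i : Fin 2, HasSubst (MvPowerSeries.X i : MvPowerSeries (Fin 2) R) :=
    fun i => HasSubst.X i
  have h := congrArg (MvPowerSeries.subst ![a, b]) key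
  rw [MvPowerSeries.subst_mul hab] at h
  simp only [PowerSeries.subst] at h ⊢
  rw [MvPowerSeries.subst_comp_subst_apply (((hX 0).add (hX 1)).const) hab,
    MvPowerSeries.subst_comp_subst_apply (hX 0).const hab,
    MvPowerSeries.subst_comp_subst_apply (hX 1).const hab] at h
  simpa [MvPowerSeries.subst_add hab, MvPowerSeries.subst_X hab] using h

theorem exp_subst_zero : (exp R).subst (0 : MvPowerSeries τ R) = 1 := by
  rw [subst_zero_eq_C_constantCoeff]
  simp

theorem exp_subst_neg {a : MvPowerSeries τ R} (ha : HasSubst a) :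
    (exp R).subst a * (exp R).subst (-a) = 1 := by
  have hn : HasSubst (-a) := by
    have := ha.smul' (-1 : R)
    rwa [neg_one_smul] at this
  rw [← exp_subst_add ha hn, add_neg_cancel, exp_subst_zero]

theorem exp_subst_nsmul {a : MvPowerSeries τ R} (ha : HasSubst a) (n : ℕ) :
    (exp R).subst (n • a) = (exp R).subst a ^ n := by
  induction n with
  | zero => rw [zero_smul, pow_zero, exp_subst_zero]
  | succ n ih =>
    have : HasSubst (n • a) := by
      have := ha.smul' (n : R)
      rwa [Nat.cast_smul_eq_nsmul] at this
    rw [succ_nsmul, exp_subst_add this ha, ih, pow_succ]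

theorem HasSubst.sum {ι : Type*} (s : Finset ι) {a : ι → MvPowerSeries τ R}
    (ha : ∀ i ∈ s, HasSubst (a i)) : HasSubst (∑ i ∈ s, a i) := by
  classical
  induction s using Finset.induction_on with
  | empty => rw [Finset.sum_empty]; exact HasSubst.zero
  | insert i s hi ih =>
    rw [Finset.sum_insert hi]
    exact (ha i (Finset.mem_insert_self i s)).add (ih fun j hj => ha j (Finset.mem_insert_of_mem hj))

theorem exp_subst_sum {ι : Type*} (s : Finset ι) {a : ι → MvPowerSeries τ R}
    (ha : ∀ i ∈ s, HasSubst (a i)) :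
    (exp R).subst (∑ i ∈ s, a i) = ∏ i ∈ s, (exp R).subst (a i) := by
  classical
  induction s using Finset.induction_on with
  | empty => rw [Finset.sum_empty, Finset.prod_empty, exp_subst_zero]
  | insert i s hi ih =>
    rw [Finset.sum_insert hi, Finset.prod_insert hi,
      exp_subst_add (ha i (Finset.mem_insert_self i s))
        (HasSubst.sum s fun j hj => ha j (Finset.mem_insert_of_mem hj)),
      ih fun j hj => ha j (Finset.mem_insert_of_mem hj)]

theorem constantCoeff_exp_subst {a : MvPowerSeries τ R} (ha : MvPowerSeries.constantCoeff a = 0) :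
    MvPowerSeries.constantCoeff ((exp R).subst a) = 1 := by
  rw [constantCoeff_subst (HasSubst.of_constantCoeff_zero ha), finsum_eq_single _ 0]
  · simp
  · intro n hn
    rw [map_pow, ha, zero_pow hn, smul_zero]

variable {K : Type*} [Field K] [CharZero K]

/-- Both sides have derivative 1 and no constant term. -/
theorem log_subst_exp : (log K).subst (exp K - 1) = X := by
  have hs : HasSubst (exp K - 1) := HasSubst.exp_sub_one
  refine derivative.ext ?_ ?_
  · rw [derivative_subst hs, deriv_log, map_sub, derivative_exp, derivative_one, sub_zero,
      derivative_X]
    have h1 : (mk fun n => algebraMap ℚ K ((-1 : ℚ) ^ n)) * (1 + X) = 1 := by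
      ext n
      rcases n with _ | n
      · simp [mul_add]
      · simp [mul_add, coeff_succ_mul_X, pow_succ, coeff_one]
    have h2 := congrArg (subst (exp K - 1 : PowerSeries K)) h1
    rw [subst_mul hs, subst_add hs, subst_X hs] at h2
    have h3 : subst (exp K - 1 : PowerSeries K) (1 : PowerSeries K) = 1 := by
      rw [← coe_substAlgHom hs, map_one]
    rw [h3] at h2
    have h4 : (1 + (exp K - 1) : PowerSeries K) = exp K := add_sub_cancel _ _
    rwa [h4] at h2
  · rw [constantCoeff_X]
    exact constantCoeff_subst_eq_zero (by
      rw [map_sub, map_one, ← constantCoeff_eq, constantCoeff_exp, sub_self]) _ constantCoeff_log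

/-- A left inverse of exp - 1 under composition coincides with its right inverse. -/
theorem exp_subst_log : (exp K).subst (log K) = 1 + X := by
  have hs : HasSubst (exp K - 1) := HasSubst.exp_sub_one
  have h0 : constantCoeff (exp K - 1) = 0 := by simp
  have h1 : IsUnit (coeff 1 (exp K - 1)) := by simp [coeff_exp, coeff_one]
  set Q := (exp K - 1).substInvOfIsUnit h1
  have hQ : HasSubst Q := HasSubst.substInvOfIsUnit _ h1
  have hr : (exp K - 1).subst Q = X := subst_substInvOfIsUnit_right _ h0 h1
  have h2 : log K = Q := by
    have h3 := congrArg (subst Q) (log_subst_exp (K := K))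
    rw [subst_comp_subst_apply hs hQ, subst_X hQ] at h3
    have h4 : subst Q (exp K - 1 : PowerSeries K) = (X : PowerSeries K) := hr
    rw [h4] at h3
    rwa [X_subst] at h3
  rw [← h2] at hr
  have h5 : subst (log K) (1 : PowerSeries K) = (1 : PowerSeries K) := by
    rw [← coe_substAlgHom HasSubst.log, map_one]
  have h6 : subst (log K) (exp K) = subst (log K) (exp K - 1) + (1 : PowerSeries K) := by
    have h7 := subst_sub (R := K) (HasSubst.log (A := K)) (exp K) (1 : PowerSeries K)
    rw [h5] at h7
    rw [h7, sub_add_cancel]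
  rw [h6, hr, add_comm]

theorem exp_subst_injective {a b : MvPowerSeries τ K} (ha : HasSubst a) (hb : HasSubst b)
    (h : (exp K).subst a = (exp K).subst b) : a = b := by
  have key : ∀ {c : MvPowerSeries τ K}, HasSubst c →
      (log K).subst ((exp K).subst c - 1) = c := by
    intro c hc
    have h1 := congrArg (subst c) (log_subst_exp (K := K))
    rw [subst_comp_subst_apply HasSubst.exp_sub_one hc, subst_X hc, subst_sub hc] at h1
    have h2 : subst c (1 : PowerSeries K) = 1 := by
      rw [← coe_substAlgHom hc, map_one]
    rwa [h2] at h1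
  rw [← key ha, h, key hb]

/-- The power series `log (1 + c T) / c`. -/
def ellS (c : K) : PowerSeries K :=
  mk fun k => if k = 0 then 0 else (-1) ^ (k + 1) * c ^ (k - 1) / k

theorem smul_ellS (c : K) : c • ellS c = rescale c (log K) := by
  ext k
  rcases k with _ | k
  · simp [ellS, coeff_rescale]
  · simp [ellS, coeff_rescale, coeff_log]
    ring

theorem constantCoeff_ellS (c : K) : constantCoeff (ellS c) = 0 := by
  rw [← coeff_zero_eq_constantCoeff_apply, ellS, coeff_mk, if_pos rfl]

theorem smul_subst_ellS (c : K) {t : MvPowerSeries τ K} (ht : HasSubst t) :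
    MvPowerSeries.C c * (ellS c).subst t = (log K).subst (c • t) := by
  rw [← MvPowerSeries.smul_eq_C_mul, ← subst_smul ht, smul_ellS, rescale_eq_subst]
  have h := subst_comp_subst_apply (R := K) (HasSubst.smul_X' (R := K) c) ht (log K)
  rw [h]
  congr 1
  rw [subst_smul ht, subst_X ht]

theorem exp_subst_log_subst {u : MvPowerSeries τ K} (hu : HasSubst u) :
    (exp K).subst ((log K).subst u) = 1 + u := by
  have h := subst_comp_subst_apply (R := K) (HasSubst.log (A := K)) hu (exp K)
  rw [← h, exp_subst_log, subst_add hu, subst_X hu]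
  congr 1
  rw [← coe_substAlgHom hu, map_one]

/-- The solution y of exp(c y) = 1 + c t. It serves to solve for the last Witt component, with c =
pλ on the X side and c = λ on the Y side. -/
theorem exp_subst_ellS (c : K) {t : MvPowerSeries τ K} (ht : HasSubst t) :
    (exp K).subst (MvPowerSeries.C c * (ellS c).subst t) = 1 + MvPowerSeries.C c * t := by
  rw [smul_subst_ellS c ht, exp_subst_log_subst (ht.smul' c), MvPowerSeries.smul_eq_C_mul]

end ExpLog

/-! ### Power series with integral coefficients, and restricted power series. -/

section CoeffSubrings

variable {K : Type*} [Field K] {s : ℕ}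

/-- The additive subgroup `c · R`. -/
def mulSub (R : Subring K) (c : K) : AddSubgroup K :=
  R.toAddSubgroup.map (AddMonoidHom.mulLeft c)

theorem mem_mulSub {R : Subring K} {c x : K} : x ∈ mulSub R c ↔ ∃ r ∈ R, x = c * r := by
  simp only [mulSub, AddSubgroup.mem_map, AddMonoidHom.coe_mulLeft]
  exact ⟨fun ⟨r, hr, h⟩ => ⟨r, hr, h.symm⟩, fun ⟨r, hr, h⟩ => ⟨r, hr, h.symm⟩⟩

theorem mul_mem_mulSub {R : Subring K} {c x y : K} (hx : x ∈ mulSub R c) (hy : y ∈ R) :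
    x * y ∈ mulSub R c := by
  obtain ⟨r, hr, rfl⟩ := mem_mulSub.1 hx
  exact mem_mulSub.2 ⟨r * y, mul_mem hr hy, by ring⟩

theorem mul_mem_mulSub' {R : Subring K} {c x y : K} (hx : x ∈ R) (hy : y ∈ mulSub R c) :
    x * y ∈ mulSub R c := by
  rw [mul_comm]; exact mul_mem_mulSub hy hx

theorem mulSub_le {R : Subring K} {c : K} (hc : c ∈ R) {x : K} (hx : x ∈ mulSub R c) : x ∈ R := by
  obtain ⟨r, hr, rfl⟩ := mem_mulSub.1 hx
  exact mul_mem hc hr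

theorem mulSub_mono {R : Subring K} {c d : K} (hd : d ∈ R) {x : K} (hx : x ∈ mulSub R (c * d)) :
    x ∈ mulSub R c := by
  obtain ⟨r, hr, rfl⟩ := mem_mulSub.1 hx
  exact mem_mulSub.2 ⟨d * r, mul_mem hd hr, by ring⟩

theorem mulSub_pow_mono {R : Subring K} {c : K} (hc : c ∈ R) {m n : ℕ} (h : m ≤ n) {x : K}
    (hx : x ∈ mulSub R (c ^ n)) : x ∈ mulSub R (c ^ m) := by
  rw [← Nat.sub_add_cancel h, pow_add, mul_comm] at hx
  exact mulSub_mono (pow_mem hc _) hx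

/-- Power series with coefficients in `R` which only involve the variables of index `< i`. -/
def coeffSub (R : Subring K) (s i : ℕ) : Subring (MvPowerSeries (Fin s) K) where
  carrier := {f | ∀ n, MvPowerSeries.coeff n f ∈ R ∧
    (MvPowerSeries.coeff n f ≠ 0 → ∀ j ∈ n.support, (j : ℕ) < i)}
  zero_mem' := fun n => by simp
  one_mem' := fun n => by
    classical
    rw [MvPowerSeries.coeff_one]
    split_ifs with h
    · subst h; simp [one_mem]
    · simp
  add_mem' := fun {f g} hf hg n => by
    refine ⟨by rw [map_add]; exact add_mem (hf n).1 (hg n).1, fun h => ?_⟩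
    rw [map_add] at h
    by_cases h0 : MvPowerSeries.coeff n f = 0
    · rw [h0, zero_add] at h; exact (hg n).2 h
    · exact (hf n).2 h0
  neg_mem' := fun {f} hf n => by
    rw [map_neg]
    exact ⟨neg_mem (hf n).1, fun h => (hf n).2 (neg_ne_zero.1 h)⟩
  mul_mem' := fun {f g} hf hg n => by
    classical
    rw [MvPowerSeries.coeff_mul]
    refine ⟨sum_mem fun x _ => mul_mem (hf _).1 (hg _).1, fun h j hj => ?_⟩
    obtain ⟨⟨a, b⟩, hab, h0⟩ := Finset.exists_ne_zero_of_sum_ne_zero h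
    rw [Finset.HasAntidiagonal.mem_antidiagonal] at hab
    simp only at hab
    rw [← hab] at hj
    rcases Finset.mem_union.1 (Finsupp.support_add hj) with h1 | h1
    · exact (hf a).2 (left_ne_zero_of_mul h0) j h1
    · exact (hg b).2 (right_ne_zero_of_mul h0) j h1

theorem mem_coeffSub {R : Subring K} {i : ℕ} {f : MvPowerSeries (Fin s) K} :
    f ∈ coeffSub R s i ↔ ∀ n, MvPowerSeries.coeff n f ∈ R ∧
    (MvPowerSeries.coeff n f ≠ 0 → ∀ j ∈ n.support, (j : ℕ) < i) := Iff.rfl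

theorem coeffSub_mono {R R' : Subring K} (h : R ≤ R') {i i' : ℕ} (hi : i ≤ i')
    {f : MvPowerSeries (Fin s) K} (hf : f ∈ coeffSub R s i) : f ∈ coeffSub R' s i' :=
  fun n => ⟨h (hf n).1, fun h0 j hj => ((hf n).2 h0 j hj).trans_le hi⟩

theorem C_mem_coeffSub {R : Subring K} {c : K} (hc : c ∈ R) (i : ℕ) :
    MvPowerSeries.C c ∈ coeffSub R s i := fun n => by
  classical
  rw [MvPowerSeries.coeff_C]
  split_ifs with h
  · subst h; simp [hc]
  · simp

theorem X_mem_coeffSub (R : Subring K) {i : ℕ} {j : Fin s} (h : (j : ℕ) < i) :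
    (MvPowerSeries.X j : MvPowerSeries (Fin s) K) ∈ coeffSub R s i := fun n => by
  classical
  rw [MvPowerSeries.coeff_X]
  split_ifs with h0
  · subst h0
    refine ⟨one_mem _, fun _ k hk => ?_⟩
    rw [Finsupp.mem_support_single] at hk
    rw [hk.1]; exact h
  · simp

theorem coeffSub_div {R : Subring K} {i : ℕ} {c : K} {f : MvPowerSeries (Fin s) K}
    (hc : c ≠ 0) (hf : f ∈ coeffSub R s i) {R' : Subring K}
    (h : ∀ n, MvPowerSeries.coeff n f ∈ mulSub R' c) :
    ∃ g ∈ coeffSub R' s i, f = MvPowerSeries.C c * g := by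
  refine ⟨MvPowerSeries.C c⁻¹ * f, fun n => ?_, ?_⟩
  · rw [MvPowerSeries.coeff_C_mul]
    obtain ⟨r, hr, h0⟩ := mem_mulSub.1 (h n)
    refine ⟨by rw [h0, inv_mul_cancel_left₀ hc]; exact hr, fun h1 => (hf n).2 ?_⟩
    exact right_ne_zero_of_mul h1
  · rw [← mul_assoc, ← map_mul, mul_inv_cancel₀ hc, map_one, one_mul]

theorem subst_mem_coeffSub {R : Subring K} {i : ℕ} {f : PowerSeries K}
    (hf : ∀ k, PowerSeries.coeff k f ∈ R) {t : MvPowerSeries (Fin s) K}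
    (ht : t ∈ coeffSub R s i) (h0 : MvPowerSeries.constantCoeff t = 0) :
    f.subst t ∈ coeffSub R s i := fun n => by
  rw [PowerSeries.coeff_subst (PowerSeries.HasSubst.of_constantCoeff_zero h0)]
  refine ⟨?_, fun h => ?_⟩
  · refine finsum_induction (· ∈ R) (zero_mem _) (fun _ _ => add_mem) fun k => ?_
    rw [smul_eq_mul]
    exact mul_mem (hf k) ((pow_mem ht k) n).1
  · obtain ⟨k, hk⟩ := not_forall.1 (mt finsum_eq_zero_of_forall_eq_zero h)
    rw [smul_eq_mul] at hk
    exact ((pow_mem ht k) n).2 (right_ne_zero_of_mul hk)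

/-- Power series with coefficients in `R`, almost all of which are divisible by any given power
of `ϖ`. -/
def resSub (R : Subring K) (ϖ : K) (s : ℕ) : Subring (MvPowerSeries (Fin s) K) where
  carrier := {f | (∀ n, MvPowerSeries.coeff n f ∈ R) ∧
    ∀ N : ℕ, {n | MvPowerSeries.coeff n f ∉ mulSub R (ϖ ^ N)}.Finite}
  zero_mem' := ⟨fun n => by simp, fun N => by simp [zero_mem]⟩
  one_mem' := by
    classical
    refine ⟨fun n => ?_, fun N => (Set.finite_singleton 0).subset fun n hn => ?_⟩
    · rw [MvPowerSeries.coeff_one]; split_ifs <;> simp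
    · by_contra h
      refine hn ?_
      rw [MvPowerSeries.coeff_one, if_neg (by simpa using h)]
      exact zero_mem _
  add_mem' := fun {f g} hf hg => by
    refine ⟨fun n => add_mem (hf.1 n) (hg.1 n), fun N =>
      ((hf.2 N).union (hg.2 N)).subset fun n hn => ?_⟩
    by_contra h
    simp only [Set.mem_union, Set.mem_ofPred_eq, not_or, not_not] at h
    exact hn (add_mem h.1 h.2)
  neg_mem' := fun {f} hf => by
    refine ⟨fun n => neg_mem (hf.1 n), fun N => (hf.2 N).subset fun n hn h => hn ?_⟩
    rw [map_neg]
    exact neg_mem h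
  mul_mem' := fun {f g} hf hg => by
    classical
    refine ⟨fun n => ?_, fun N =>
      (Set.Finite.image2 (· + ·) (hf.2 N) (hg.2 N)).subset fun n hn => ?_⟩
    · rw [MvPowerSeries.coeff_mul]
      exact sum_mem fun x _ => mul_mem (hf.1 _) (hg.1 _)
    · by_contra h
      refine hn ?_
      rw [MvPowerSeries.coeff_mul]
      refine sum_mem fun x hx => ?_
      rw [Finset.HasAntidiagonal.mem_antidiagonal] at hx
      by_cases h1 : MvPowerSeries.coeff x.1 f ∈ mulSub R (ϖ ^ N)
      · exact mul_mem_mulSub h1 (hg.1 _)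
      · by_cases h2 : MvPowerSeries.coeff x.2 g ∈ mulSub R (ϖ ^ N)
        · exact mul_mem_mulSub' (hf.1 _) h2
        · exact absurd ⟨x.1, h1, x.2, h2, hx⟩ h

theorem finite_mem_resSub {R : Subring K} {ϖ : K} {f : MvPowerSeries (Fin s) K}
    (hf : ∀ n, MvPowerSeries.coeff n f ∈ R) (h : {n | MvPowerSeries.coeff n f ≠ 0}.Finite) :
    f ∈ resSub R ϖ s :=
  ⟨hf, fun _ => h.subset fun n hn h0 => hn (by rw [h0]; exact zero_mem _)⟩

theorem C_mem_resSub {R : Subring K} {c : K} (hc : c ∈ R) (ϖ : K) :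
    MvPowerSeries.C c ∈ resSub R ϖ s :=
  finite_mem_resSub (fun n => (C_mem_coeffSub hc 0 n).1) <| (Set.finite_singleton 0).subset
    fun n hn => by
      classical
      by_contra h
      rw [Set.mem_ofPred_eq, MvPowerSeries.coeff_C, if_neg (by simpa using h)] at hn
      exact hn rfl

theorem mvPolynomial_mem_resSub {R : Subring K} {ϖ : K} {f : MvPolynomial (Fin s) K}
    (hf : ∀ n, f.coeff n ∈ R) : (f : MvPowerSeries (Fin s) K) ∈ resSub R ϖ s :=
  finite_mem_resSub (fun n => by rw [MvPolynomial.coeff_coe]; exact hf n) <|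
    f.support.finite_toSet.subset fun n hn => by
      rw [Set.mem_ofPred_eq, MvPolynomial.coeff_coe] at hn
      exact MvPolynomial.mem_support_iff.2 hn

theorem X_mem_resSub (R : Subring K) (ϖ : K) (j : Fin s) :
    (MvPowerSeries.X j : MvPowerSeries (Fin s) K) ∈ resSub R ϖ s := by
  rw [← MvPolynomial.coe_X]
  refine mvPolynomial_mem_resSub fun n => ?_
  classical
  rw [MvPolynomial.coeff_X]
  split_ifs <;> simp

/-- A quotient of a restricted power series by a constant is restricted when it is integral. -/
theorem resSub_of_C_mul {R : Subring K} {ϖ c : K} (hc : c ≠ 0) {m : ℕ}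
    (hm : ϖ ^ m ∈ mulSub R c) {f g : MvPowerSeries (Fin s) K} (hf : f ∈ resSub R ϖ s)
    (hg : ∀ n, MvPowerSeries.coeff n g ∈ R) (h : f = MvPowerSeries.C c * g) :
    g ∈ resSub R ϖ s := by
  refine ⟨hg, fun N => (hf.2 (m + N)).subset fun n hn h0 => hn ?_⟩
  obtain ⟨r, hr, h1⟩ := mem_mulSub.1 h0
  obtain ⟨t, ht, h2⟩ := mem_mulSub.1 hm
  rw [h, MvPowerSeries.coeff_C_mul, pow_add, h2] at h1
  refine mem_mulSub.2 ⟨t * r, mul_mem ht hr, mul_left_cancel₀ hc ?_⟩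
  rw [h1]; ring

/-- The coefficients of the one-variable power series `f` tend to zero. -/
def TendsZero (R : Subring K) (ϖ : K) (f : PowerSeries K) : Prop :=
  ∀ N : ℕ, ∃ M, ∀ k ≥ M, PowerSeries.coeff k f ∈ mulSub R (ϖ ^ N)

/-- For a given N, f is a polynomial plus ϖ^N times an integral series. The polynomial keeps t
restricted, and the rest contributes only multiples of ϖ^N. -/
theorem subst_mem_resSub {R : Subring K} {ϖ : K} (hϖ : ϖ ≠ 0) {f : PowerSeries K}
    (hf : ∀ k, PowerSeries.coeff k f ∈ R) (hf' : TendsZero R ϖ f)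
    {t : MvPowerSeries (Fin s) K} (ht : t ∈ resSub R ϖ s)
    (h0 : MvPowerSeries.constantCoeff t = 0) : f.subst t ∈ resSub R ϖ s := by
  have hs : PowerSeries.HasSubst t := PowerSeries.HasSubst.of_constantCoeff_zero h0
  have ht' : t ∈ coeffSub R s s := fun n => ⟨ht.1 n, fun _ j _ => j.2⟩
  refine ⟨fun n => (subst_mem_coeffSub hf ht' h0 n).1, fun N => ?_⟩
  obtain ⟨M, hM⟩ := hf' N
  set P : Polynomial K := PowerSeries.trunc M f
  have hP : ((P : PowerSeries K)).subst t ∈ resSub R ϖ s := by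
    rw [PowerSeries.subst_coe hs, Polynomial.aeval_eq_sum_range]
    refine sum_mem fun k _ => ?_
    rw [MvPowerSeries.smul_eq_C_mul]
    refine mul_mem (C_mem_resSub ?_ ϖ) (pow_mem ht k)
    rw [PowerSeries.coeff_trunc]
    split_ifs
    · exact hf k
    · exact zero_mem _
  have hϖN : ϖ ^ N ≠ 0 := pow_ne_zero _ hϖ
  set g : PowerSeries K := (ϖ ^ N)⁻¹ • (f - P)
  have hg : ∀ k, PowerSeries.coeff k g ∈ R := by
    intro k
    rw [PowerSeries.coeff_smul, map_sub, Polynomial.coeff_coe, PowerSeries.coeff_trunc]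
    split_ifs with h
    · simp
    · obtain ⟨r, hr, h1⟩ := mem_mulSub.1 (hM k (not_lt.1 h))
      rw [sub_zero, h1, smul_eq_mul, inv_mul_cancel_left₀ hϖN]
      exact hr
  have hfg : f = P + (ϖ ^ N) • g := by
    simp only [g]
    rw [smul_inv_smul₀ hϖN]; ring
  refine (hP.2 N).subset fun n hn h => hn ?_
  rw [hfg, PowerSeries.subst_add hs, PowerSeries.subst_smul hs, map_add,
    MvPowerSeries.coeff_smul]
  exact add_mem h (mem_mulSub.2 ⟨_, (subst_mem_coeffSub hg ht' h0 n).1, rfl⟩)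

end CoeffSubrings

/-! ### Reduction of restricted power series to polynomials. -/

section Reduction

variable {K : Type*} [Field K] {s : ℕ} {R : Subring K} {ϖ : K} {k : Type*} [CommRing k]

theorem reduction_finite (res : R →+* k)
    (hres : ∀ x : R, (x : K) ∈ mulSub R ϖ → res x = 0)
    (f : resSub R ϖ s) : {n | res ⟨MvPowerSeries.coeff n f.1, f.2.1 n⟩ ≠ 0}.Finite :=
  (f.2.2 1).subset fun n hn h => hn (hres _ (by rwa [pow_one] at h))

/-- The reduction of a restricted power series is a polynomial. -/
def reductionFun (res : R →+* k) (hres : ∀ x : R, (x : K) ∈ mulSub R ϖ → res x = 0)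
    (f : resSub R ϖ s) : MvPolynomial (Fin s) k :=
  ∑ n ∈ (reduction_finite res hres f).toFinset,
    MvPolynomial.monomial n (res ⟨MvPowerSeries.coeff n f.1, f.2.1 n⟩)

theorem coeff_reductionFun (res : R →+* k) (hres : ∀ x : R, (x : K) ∈ mulSub R ϖ → res x = 0)
    (f : resSub R ϖ s) (n : Fin s →₀ ℕ) :
    (reductionFun res hres f).coeff n = res ⟨MvPowerSeries.coeff n f.1, f.2.1 n⟩ := by
  classical
  rw [reductionFun, MvPolynomial.coeff_sum]
  simp only [MvPolynomial.coeff_monomial]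
  rw [Finset.sum_ite_eq']
  split_ifs with h
  · rfl
  · exact (by simpa using h : _ = (0 : k)).symm

/-- Reduction of restricted power series as a ring homomorphism. -/
def reduction (res : R →+* k) (hres : ∀ x : R, (x : K) ∈ mulSub R ϖ → res x = 0) :
    resSub R ϖ s →+* MvPolynomial (Fin s) k where
  toFun := reductionFun res hres
  map_one' := by
    classical
    ext n
    rw [coeff_reductionFun, MvPolynomial.coeff_one]
    split_ifs with h
    · rw [← map_one res]; congr 1; apply Subtype.ext; simp [MvPowerSeries.coeff_one, h]
    · rw [← map_zero res]; congr 1; apply Subtype.ext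
      simp [MvPowerSeries.coeff_one, Ne.symm h]
  map_zero' := by
    ext n
    rw [coeff_reductionFun, MvPolynomial.coeff_zero, ← map_zero res]; rfl
  map_add' f g := by
    ext n
    rw [coeff_reductionFun, MvPolynomial.coeff_add, coeff_reductionFun, coeff_reductionFun,
      ← map_add]; rfl
  map_mul' f g := by
    classical
    ext n
    rw [coeff_reductionFun, MvPolynomial.coeff_mul]
    simp only [coeff_reductionFun, ← map_mul]
    rw [← map_sum]
    congr 1
    apply Subtype.ext
    rw [AddSubmonoidClass.coe_finsetSum]
    exact MvPowerSeries.coeff_mul n f.1 g.1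

theorem coeff_reduction (res : R →+* k) (hres : ∀ x : R, (x : K) ∈ mulSub R ϖ → res x = 0)
    (f : resSub R ϖ s) (n : Fin s →₀ ℕ) :
    (reduction res hres f).coeff n = res ⟨MvPowerSeries.coeff n f.1, f.2.1 n⟩ :=
  coeff_reductionFun res hres f n

end Reduction

/-! ### Dwork's integrality criterion over ℚ_p. -/

section Dwork

open PowerSeries

variable {p : ℕ} [hp : Fact p.Prime]

theorem norm_sum_le_of_forall {ι : Type*} (t : Finset ι) (f : ι → ℚ_[p]) {c : ℝ} (hc : 0 ≤ c)
    (h : ∀ i ∈ t, ‖f i‖ ≤ c) : ‖∑ i ∈ t, f i‖ ≤ c := by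
  classical
  induction t using Finset.induction_on with
  | empty => simpa using hc
  | insert a t ha ih =>
    rw [Finset.sum_insert ha]
    exact (Padic.nonarchimedean _ _).trans
      (max_le (h a (Finset.mem_insert_self a t)) (ih fun i hi => h i (Finset.mem_insert_of_mem hi)))

/-- Over 𝔽_p the p-th power of a polynomial is its value at T^p. -/
theorem norm_coeff_pow_sub_expand (Q : Polynomial ℤ_[p]) (n : ℕ) :
    ‖(((Q ^ p - Polynomial.expand ℤ_[p] p Q).coeff n : ℤ_[p]) : ℚ_[p])‖ ≤ (p : ℝ)⁻¹ := by
  have h1 : (Q ^ p - Polynomial.expand ℤ_[p] p Q).map PadicInt.toZMod = 0 := by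
    rw [Polynomial.map_sub, Polynomial.map_pow, Polynomial.map_expand, ZMod.expand_card, sub_self]
  have h2 : PadicInt.toZMod ((Q ^ p - Polynomial.expand ℤ_[p] p Q).coeff n) = 0 := by
    rw [← Polynomial.coeff_map, h1, Polynomial.coeff_zero]
  rw [← RingHom.mem_ker, PadicInt.ker_toZMod, PadicInt.maximalIdeal_eq_span_p,
    Ideal.mem_span_singleton] at h2
  obtain ⟨r, hr⟩ := h2
  rw [hr, PadicInt.coe_mul, norm_mul]
  have h3 : ‖(r : ℚ_[p])‖ ≤ 1 := r.2
  have h4 : ‖((p : ℤ_[p]) : ℚ_[p])‖ = (p : ℝ)⁻¹ := by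
    rw [PadicInt.coe_natCast, Padic.norm_p]
  rw [h4]
  exact mul_le_of_le_one_right (by positivity) h3

theorem inv_p_le_one : (p : ℝ)⁻¹ ≤ 1 :=
  inv_le_one_of_one_le₀ (by exact_mod_cast hp.out.one_lt.le)

/-- Dwork's integrality criterion. -/
theorem norm_coeff_le_one_of_dwork {f w : PowerSeries ℚ_[p]} (hf : constantCoeff f = 1)
    (hw : ∀ n, ‖coeff n (w - 1)‖ ≤ (p : ℝ)⁻¹)
    (h : f ^ p = expand p hp.out.ne_zero f * w) (n : ℕ) : ‖coeff n f‖ ≤ 1 := by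
  induction n using Nat.strong_induction_on with
  | _ n ih =>
  rcases Nat.eq_zero_or_pos n with rfl | hn
  · rw [coeff_zero_eq_constantCoeff_apply, hf, norm_one]
  have hpinv : (0 : ℝ) ≤ (p : ℝ)⁻¹ := by positivity
  have hlift : ∀ k, ∃ z : ℤ_[p], k < n → (z : ℚ_[p]) = coeff k f := fun k => by
    by_cases hk : k < n
    · exact ⟨⟨coeff k f, ih k hk⟩, fun _ => rfl⟩
    · exact ⟨0, fun h => absurd h hk⟩
  choose a ha using hlift
  -- By induction the truncation of f below degree n is integral, so Q^p ≡ Q(T^p) modulo p is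
  -- available for it.
  set Q : Polynomial ℤ_[p] := ∑ k ∈ Finset.range n, Polynomial.monomial k (a k) with hQdef
  have hQ : ((Q.map (algebraMap ℤ_[p] ℚ_[p]) : Polynomial ℚ_[p]) : PowerSeries ℚ_[p]) =
      ((trunc n f : Polynomial ℚ_[p]) : PowerSeries ℚ_[p]) := by
    congr 1
    ext m
    rw [Polynomial.coeff_map, coeff_trunc, hQdef, Polynomial.finsetSum_coeff]
    simp only [Polynomial.coeff_monomial, Finset.sum_ite_eq', Finset.mem_range]
    split_ifs with h1
    · exact ha m h1
    · simp
  set P : PowerSeries ℚ_[p] := ((trunc n f : Polynomial ℚ_[p]) : PowerSeries ℚ_[p]) with hP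
  obtain ⟨g, hg⟩ : (X : PowerSeries ℚ_[p]) ^ n ∣ f - P := by
    rw [X_pow_dvd_iff]
    intro m hm
    rw [map_sub, hP, Polynomial.coeff_coe, coeff_trunc, if_pos hm, sub_self]
  have hfP : f = P + X ^ n * g := by rw [← hg]; ring
  have hP0 : constantCoeff P = 1 := by
    rw [← coeff_zero_eq_constantCoeff_apply, hP, Polynomial.coeff_coe, coeff_trunc, if_pos hn,
      coeff_zero_eq_constantCoeff_apply, hf]
  have hfn : coeff n f = constantCoeff g := by
    have : coeff n P = 0 := by
      rw [hP, Polynomial.coeff_coe, coeff_trunc, if_neg (lt_irrefl _)]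
    have h2 := congrArg (coeff n) hfP
    rw [map_add, this, zero_add, coeff_X_pow_mul', if_pos le_rfl, Nat.sub_self] at h2
    simpa using h2
  -- The unknown coefficient enters the n-th coefficient of f^p linearly with factor p, because P
  -- has constant term 1. Everything else is known modulo p, so p times the coefficient is divisible
  -- by p.
  have e1 : coeff n (f ^ p) = coeff n (P ^ p) + p * coeff n f := by
    obtain ⟨k, hk⟩ := Polynomial.powAddExpansion P (X ^ n * g) p
    conv_lhs => rw [hfP, hk]
    rw [map_add, map_add, hfn]
    have h1 : coeff n (k * (X ^ n * g) ^ 2) = 0 := by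
      have : k * (X ^ n * g) ^ 2 = X ^ (2 * n) * (k * g ^ 2) := by ring
      rw [this, coeff_X_pow_mul', if_neg (by omega)]
    have h2 : coeff n ((p : PowerSeries ℚ_[p]) * P ^ (p - 1) * (X ^ n * g)) =
        p * constantCoeff g := by
      have : (p : PowerSeries ℚ_[p]) * P ^ (p - 1) * (X ^ n * g) =
        X ^ n * ((p : PowerSeries ℚ_[p]) * P ^ (p - 1) * g) := by ring
      rw [this, coeff_X_pow_mul', if_pos le_rfl, Nat.sub_self, coeff_zero_eq_constantCoeff_apply]
      simp [hP0]
    rw [h1, h2, add_zero]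
  have hE : ∀ i ≤ n, ‖coeff i (expand p hp.out.ne_zero f)‖ ≤ 1 := by
    intro i hi
    rw [coeff_expand]
    split_ifs with h
    · exact ih _ ((Nat.div_le_div_right hi).trans_lt (Nat.div_lt_self hn hp.out.one_lt))
    · simp
  have e2 : ‖coeff n (expand p hp.out.ne_zero f * w) - coeff n (expand p hp.out.ne_zero f)‖
      ≤ (p : ℝ)⁻¹ := by
    have : expand p hp.out.ne_zero f * w = expand p hp.out.ne_zero f +
      expand p hp.out.ne_zero f * (w - 1) := by ring
    rw [this, map_add, add_sub_cancel_left, coeff_mul]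
    refine norm_sum_le_of_forall _ _ hpinv fun x hx => ?_
    rw [norm_mul]
    rw [Finset.HasAntidiagonal.mem_antidiagonal] at hx
    calc _ ≤ 1 * (p : ℝ)⁻¹ := mul_le_mul (hE _ (by omega)) (hw _) (norm_nonneg _) zero_le_one
      _ = _ := one_mul _
  have e3 : coeff n (expand p hp.out.ne_zero f) =
      (((Polynomial.expand ℤ_[p] p Q).coeff n : ℤ_[p]) : ℚ_[p]) := by
    have h1 : ∀ m, ((Q.coeff m : ℤ_[p]) : ℚ_[p]) = coeff m P := by
      intro m
      rw [← hQ, Polynomial.coeff_coe, Polynomial.coeff_map]; rfl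
    rw [coeff_expand, Polynomial.coeff_expand hp.out.pos]
    split_ifs with h
    · rw [h1, hP, Polynomial.coeff_coe, coeff_trunc, if_pos (Nat.div_lt_self hn hp.out.one_lt)]
    · simp
  have e4 : coeff n (P ^ p) = (((Q ^ p).coeff n : ℤ_[p]) : ℚ_[p]) := by
    rw [← hQ, ← Polynomial.coe_pow, Polynomial.coeff_coe, ← Polynomial.map_pow,
      Polynomial.coeff_map]; rfl
  have e5 := norm_coeff_pow_sub_expand Q n
  rw [Polynomial.coeff_sub, PadicInt.coe_sub, ← e3, ← e4] at e5
  rw [h] at e1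
  have e6 : (p : ℚ_[p]) * coeff n f = (coeff n (expand p hp.out.ne_zero f * w) -
      coeff n (expand p hp.out.ne_zero f)) +
      -(coeff n (P ^ p) - coeff n (expand p hp.out.ne_zero f)) := by rw [e1]; ring
  have e7 : ‖(p : ℚ_[p]) * coeff n f‖ ≤ (p : ℝ)⁻¹ := by
    rw [e6]
    refine (Padic.nonarchimedean _ _).trans (max_le e2 ?_)
    rwa [norm_neg]
  rw [norm_mul, Padic.norm_p] at e7
  have : (0 : ℝ) < (p : ℝ)⁻¹ := inv_pos.2 (by exact_mod_cast hp.out.pos)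
  nlinarith [norm_nonneg (coeff n f)]

/-- Legendre's bound v_p(n!) < n; it gives exp(pT) ≡ 1 modulo p, the hypothesis on w in Dwork's
criterion. -/
theorem norm_pow_div_factorial (n : ℕ) (hn : n ≠ 0) :
    ‖(p : ℚ_[p]) ^ n * ((n.factorial : ℚ_[p]))⁻¹‖ ≤ (p : ℝ)⁻¹ := by
  have hlt : padicValNat p n.factorial < n := by
    refine lt_of_le_of_lt ?_ (sub_one_mul_padicValNat_factorial_lt_of_ne_zero p hn)
    exact Nat.le_mul_of_pos_left _ (Nat.sub_pos_of_lt hp.out.one_lt)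
  obtain ⟨c, hc⟩ : p ^ padicValNat p n.factorial ∣ n.factorial := pow_padicValNat_dvd
  rw [norm_mul, norm_inv, norm_pow, Padic.norm_p,
    Padic.norm_eq_zpow_neg_valuation (by exact_mod_cast n.factorial_ne_zero),
    Padic.valuation_natCast]
  have hp0 : (p : ℝ) ≠ 0 := by exact_mod_cast hp.out.ne_zero
  rw [← zpow_neg, neg_neg, zpow_natCast, inv_pow]
  generalize padicValNat p n.factorial = v at *
  obtain ⟨m, rfl⟩ := Nat.exists_eq_add_of_lt hlt
  rw [show v + m + 1 = (m + 1) + v by ring, pow_add _ (m + 1) v, mul_inv,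
    inv_mul_cancel_right₀ (pow_ne_zero _ hp0), ← inv_pow]
  exact pow_le_of_le_one (by positivity) inv_p_le_one (by omega)

end Dwork

/-! ### The Artin-Hasse exponential and its integrality. -/

section ArtinHasseSeries

open PowerSeries

variable {p : ℕ} [hp : Fact p.Prime] {R : Type*} [CommRing R] [Algebra ℚ R]

open scoped Classical in
/-- The power series `∑ i, a_{p^i} T^{p^i} / p^i`. -/
def primePowSeries (p : ℕ) (a : ℕ → R) : PowerSeries R :=
  PowerSeries.mk fun n => if ∃ i, n = p ^ i then algebraMap ℚ R (1 / (n : ℚ)) * a n else 0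

theorem coeff_primePowSeries_pow (a : ℕ → R) (i : ℕ) :
    coeff (p ^ i) (primePowSeries p a) = algebraMap ℚ R (1 / (p : ℚ) ^ i) * a (p ^ i) := by
  rw [primePowSeries, coeff_mk, if_pos ⟨i, rfl⟩]
  push_cast; rfl

theorem coeff_primePowSeries_of_ne (a : ℕ → R) {n : ℕ} (h : ∀ i, n ≠ p ^ i) :
    coeff n (primePowSeries p a) = 0 := by
  rw [primePowSeries, coeff_mk, if_neg (by simpa using h)]

theorem constantCoeff_primePowSeries (a : ℕ → R) :
    constantCoeff (primePowSeries p a) = 0 := by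
  rw [← coeff_zero_eq_constantCoeff_apply, coeff_primePowSeries_of_ne]
  exact fun i => (pow_pos hp.out.pos i).ne

theorem hasSubst_primePowSeries (a : ℕ → R) : HasSubst (primePowSeries p a) :=
  HasSubst.of_constantCoeff_zero' (constantCoeff_primePowSeries a)

theorem ext_primePow {f g : PowerSeries R} (h : ∀ i, coeff (p ^ i) f = coeff (p ^ i) g)
    (hf : ∀ n, (∀ i, n ≠ p ^ i) → coeff n f = 0) (hg : ∀ n, (∀ i, n ≠ p ^ i) → coeff n g = 0) :
    f = g := by
  ext n
  by_cases hn : ∃ i, n = p ^ i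
  · obtain ⟨i, rfl⟩ := hn; exact h i
  · rw [not_exists] at hn
    rw [hf n hn, hg n hn]

theorem coeff_expand_primePowSeries_succ (a : ℕ → R) (i : ℕ) :
    coeff (p ^ (i + 1)) (expand p hp.out.ne_zero (primePowSeries p a)) =
      algebraMap ℚ R (1 / (p : ℚ) ^ i) * a (p ^ i) := by
  rw [pow_succ', coeff_expand_mul, coeff_primePowSeries_pow]

theorem coeff_expand_primePowSeries_one (a : ℕ → R) :
    coeff (p ^ 0) (expand p hp.out.ne_zero (primePowSeries p a)) = 0 := by
  rw [coeff_expand_of_not_dvd]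
  rw [pow_zero]; exact hp.out.one_lt.not_ge ∘ Nat.le_of_dvd one_pos

theorem coeff_expand_primePowSeries_of_ne (a : ℕ → R) {n : ℕ} (h : ∀ i, n ≠ p ^ i) :
    coeff n (expand p hp.out.ne_zero (primePowSeries p a)) = 0 := by
  rw [coeff_expand]
  split_ifs with hd
  · refine coeff_primePowSeries_of_ne a fun i hi => h (i + 1) ?_
    rw [pow_succ', ← hi, Nat.mul_div_cancel' hd]
  · rfl

theorem coeff_X_of_ne_primePow {n : ℕ} (h : ∀ i, n ≠ p ^ i) :
    coeff n (X : PowerSeries R) = 0 := by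
  rw [coeff_X, if_neg (by simpa using h 0)]

theorem coeff_X_primePow_succ (i : ℕ) : coeff (p ^ (i + 1)) (X : PowerSeries R) = 0 := by
  rw [coeff_X, if_neg (Nat.one_lt_pow i.succ_ne_zero hp.out.one_lt).ne']

theorem rescale_exp_subst (c : R) {f : PowerSeries R} (hf : HasSubst f) :
    rescale c ((exp R).subst f) = (exp R).subst (rescale c f) := by
  rw [rescale_eq_subst, rescale_eq_subst]
  exact subst_comp_subst_apply (R := R) hf (HasSubst.smul_X' (R := R) c) (exp R)

theorem expand_exp_subst {f : PowerSeries R} (hf : HasSubst f) :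
    expand p hp.out.ne_zero ((exp R).subst f) = (exp R).subst (expand p hp.out.ne_zero f) := by
  exact expand_subst p hp.out.ne_zero hf _

theorem map_exp_subst {S : Type*} [CommRing S] [Algebra ℚ S] (h : R →+* S) {f : PowerSeries R}
    (hf : HasSubst f) : map h ((exp R).subst f) = (exp S).subst (map h f) := by
  have := map_subst hf (h := h) (exp R)
  rw [map_exp] at this
  exact this

variable (p R) in
/-- The Artin-Hasse exponential. -/
def artinHasseExp : PowerSeries R := (exp R).subst (primePowSeries p fun _ => (1 : R))

theorem constantCoeff_exp_subst' {f : PowerSeries R} (hf : constantCoeff f = 0) :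
    constantCoeff ((exp R).subst f) = 1 := constantCoeff_exp_subst hf

theorem constantCoeff_artinHasseExp : constantCoeff (artinHasseExp p R) = 1 :=
  constantCoeff_exp_subst' (constantCoeff_primePowSeries _)

theorem hasSubst_expand {f : PowerSeries R} (hf : constantCoeff f = 0) :
    HasSubst (expand p hp.out.ne_zero f) :=
  HasSubst.of_constantCoeff_zero' (by rw [constantCoeff_expand, hf])

/-- On logarithms: p ∑ T^{p^i}/p^i = ∑ (T^p)^{p^i}/p^i + pT. This is Dwork's relation with w =
exp(pT). -/
theorem artinHasseExp_pow : artinHasseExp p R ^ p =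
    expand p hp.out.ne_zero (artinHasseExp p R) * (exp R).subst ((p : R) • (X : PowerSeries R)) := by
  have hs := hasSubst_primePowSeries (p := p) fun _ => (1 : R)
  have h1 : HasSubst ((p : R) • (X : PowerSeries R)) := HasSubst.smul_X' _
  rw [artinHasseExp, expand_exp_subst hs]
  have h2 := exp_subst_nsmul hs p
  have h3 := exp_subst_add (hasSubst_expand (p := p)
    (constantCoeff_primePowSeries (p := p) fun _ => (1 : R))) h1
  refine h2.symm.trans (Eq.trans ?_ h3)
  congr 1
  refine ext_primePow (p := p) (fun i => ?_) (fun n hn => ?_) fun n hn => ?_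
  · rw [map_nsmul]
    erw [map_add]
    rcases i with _ | i
    · rw [coeff_expand_primePowSeries_one, coeff_primePowSeries_pow]
      simp
    · rw [coeff_expand_primePowSeries_succ, coeff_primePowSeries_pow]
      erw [coeff_smul]
      rw [coeff_X_primePow_succ]
      have : (p : ℚ) ≠ 0 := by exact_mod_cast hp.out.ne_zero
      rw [mul_one, mul_one, smul_zero, add_zero, nsmul_eq_mul,
        ← map_natCast (algebraMap ℚ R), ← map_mul]
      congr 1
      rw [pow_succ]
      field_simp
  · rw [map_nsmul]; rw [coeff_primePowSeries_of_ne _ hn, smul_zero]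
  · erw [map_add, coeff_smul]
    rw [coeff_expand_primePowSeries_of_ne _ hn, coeff_X_of_ne_primePow hn, smul_zero, add_zero]

theorem norm_coeff_artinHasseExp (n : ℕ) : ‖coeff n (artinHasseExp p ℚ_[p])‖ ≤ 1 := by
  refine norm_coeff_le_one_of_dwork constantCoeff_artinHasseExp (fun n => ?_)
    artinHasseExp_pow n
  rw [map_sub, ← rescale_eq_subst, coeff_rescale, coeff_exp, coeff_one]
  rcases eq_or_ne n 0 with rfl | hn
  · simp
  · rw [if_neg hn, sub_zero]
    have := norm_pow_div_factorial (p := p) n hn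
    simpa using this

/-- The rational numbers that are integral at `p`. -/
def locSub (p : ℕ) [Fact p.Prime] : Subring ℚ := (PadicInt.subring p).comap (Rat.castHom ℚ_[p])

theorem mem_locSub {q : ℚ} : q ∈ locSub p ↔ ‖(q : ℚ_[p])‖ ≤ 1 := Iff.rfl

theorem coeff_artinHasseExp_mem (n : ℕ) : coeff n (artinHasseExp p ℚ) ∈ locSub p := by
  rw [mem_locSub]
  have h : map (Rat.castHom ℚ_[p]) (artinHasseExp p ℚ) = artinHasseExp p ℚ_[p] := by
    rw [artinHasseExp, artinHasseExp, map_exp_subst _ (hasSubst_primePowSeries _)]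
    congr 1
    ext n
    rw [coeff_map]
    simp only [primePowSeries, coeff_mk]
    split_ifs <;> simp
  have := norm_coeff_artinHasseExp (p := p) n
  rw [← h, coeff_map] at this
  exact this

end ArtinHasseSeries

/-! ### Power series over a subring, and those congruent to 1. -/

section SeriesOver

open PowerSeries

variable {R : Type*} [CommRing R]

/-- Power series with coefficients in the subring `S`. -/
def seriesOver (S : Subring R) : Subring (PowerSeries R) := (PowerSeries.map S.subtype).range

theorem mem_seriesOver {S : Subring R} {f : PowerSeries R} :
    f ∈ seriesOver S ↔ ∀ n, coeff n f ∈ S := by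
  constructor
  · rintro ⟨g, rfl⟩ n
    rw [coeff_map]; exact (coeff n g).2
  · intro h
    exact ⟨PowerSeries.mk fun n => ⟨coeff n f, h n⟩, by ext n; simp⟩

theorem C_mem_seriesOver {S : Subring R} {c : R} (hc : c ∈ S) : C c ∈ seriesOver S :=
  ⟨C ⟨c, hc⟩, by simp⟩

theorem exists_inv_mem_seriesOver {S : Subring R} {f : PowerSeries R} (hf : f ∈ seriesOver S)
    (h0 : constantCoeff f = 1) : ∃ g ∈ seriesOver S, f * g = 1 := by
  obtain ⟨F, rfl⟩ := hf
  have h1 : constantCoeff F = 1 := by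
    rw [← coeff_zero_eq_constantCoeff_apply, coeff_map, coeff_zero_eq_constantCoeff_apply] at h0
    exact Subtype.ext h0
  have hu : IsUnit F := isUnit_iff_constantCoeff.2 (by rw [h1]; exact isUnit_one)
  obtain ⟨G, hG⟩ := hu.exists_right_inv
  exact ⟨_, ⟨G, rfl⟩, by rw [← map_mul, hG, map_one]⟩

theorem expand_mem_seriesOver {p : ℕ} (hp : p ≠ 0) {S : Subring R} {f : PowerSeries R}
    (hf : f ∈ seriesOver S) : expand p hp f ∈ seriesOver S := by
  obtain ⟨F, rfl⟩ := hf
  exact ⟨expand p hp F, map_expand p hp _ F⟩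

/-- The power series `1 + c g` with `g` over the subring `S`. -/
def oneAddMul (S : Subring R) (c : R) : Set (PowerSeries R) :=
  {f | ∃ g ∈ seriesOver S, f = 1 + C c * g}

theorem mul_mem_oneAddMul {S : Subring R} {c : R} (hc : c ∈ S) {f g : PowerSeries R}
    (hf : f ∈ oneAddMul S c) (hg : g ∈ oneAddMul S c) : f * g ∈ oneAddMul S c := by
  obtain ⟨f, hf, rfl⟩ := hf
  obtain ⟨g, hg, rfl⟩ := hg
  exact ⟨f + g + C c * (f * g), add_mem (add_mem hf hg)
    (mul_mem (C_mem_seriesOver hc) (mul_mem hf hg)), by ring⟩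

theorem pow_mem_oneAddMul {S : Subring R} {c : R} (hc : c ∈ S) {f : PowerSeries R}
    (hf : f ∈ oneAddMul S c) (n : ℕ) : f ^ n ∈ oneAddMul S c := by
  induction n with
  | zero => exact ⟨0, zero_mem _, by simp⟩
  | succ n ih => rw [pow_succ]; exact mul_mem_oneAddMul hc ih hf

theorem mem_seriesOver_of_oneAddMul {S : Subring R} {c : R} (hc : c ∈ S) {f : PowerSeries R}
    (hf : f ∈ oneAddMul S c) : f ∈ seriesOver S := by
  obtain ⟨f, hf, rfl⟩ := hf
  exact add_mem (one_mem _) (mul_mem (C_mem_seriesOver hc) hf)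

theorem oneAddMul_mono {S : Subring R} {c d : R} (hd : d ∈ S) {f : PowerSeries R}
    (hf : f ∈ oneAddMul S (c * d)) : f ∈ oneAddMul S c := by
  obtain ⟨f, hf, rfl⟩ := hf
  exact ⟨C d * f, mul_mem (C_mem_seriesOver hd) hf, by rw [map_mul]; ring⟩

theorem inv_mem_oneAddMul {S : Subring R} {c : R} (hc : c ∈ S) {f g : PowerSeries R}
    (hf : f ∈ oneAddMul S c) (h0 : constantCoeff f = 1) (hfg : f * g = 1) :
    g ∈ oneAddMul S c := by
  obtain ⟨g', hg', h1⟩ := exists_inv_mem_seriesOver (mem_seriesOver_of_oneAddMul hc hf) h0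
  have : g = g' := by
    calc g = g * (f * g') := by rw [h1, mul_one]
      _ = (f * g) * g' := by ring
      _ = g' := by rw [hfg, one_mul]
  subst this
  obtain ⟨f, hf, rfl⟩ := hf
  refine ⟨-(f * g), neg_mem (mul_mem hf hg'), ?_⟩
  linear_combination hfg

theorem expand_mem_oneAddMul {p : ℕ} (hp : p ≠ 0) {S : Subring R} {c : R} {f : PowerSeries R}
    (hf : f ∈ oneAddMul S c) : expand p hp f ∈ oneAddMul S c := by
  obtain ⟨f, hf, rfl⟩ := hf
  exact ⟨expand p hp f, expand_mem_seriesOver hp hf, by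
    rw [map_add, map_one, map_mul, expand_C]⟩

end SeriesOver

/-! ### Integrality of E(cT)/E(T) and of the two series derived from it. -/

section ExpQuot

open PowerSeries

variable {p : ℕ} [hp : Fact p.Prime] {R : Type*} [CommRing R] [Algebra ℚ R]

variable (p) in
/-- The power series `∑ i, (c^{p^i} - 1) T^{p^i} / p^i`. -/
def powSubLog (c : R) : PowerSeries R := primePowSeries p fun n => c ^ n - 1

theorem constantCoeff_powSubLog (c : R) : constantCoeff (powSubLog p c) = 0 :=
  constantCoeff_primePowSeries _

theorem hasSubst_powSubLog (c : R) : HasSubst (powSubLog p c) := hasSubst_primePowSeries _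

variable (p) in
/-- The quotient `E(cT) / E(T)`, for the Artin-Hasse exponential `E`. -/
def expQuot (c : R) : PowerSeries R := (exp R).subst (powSubLog p c)

variable (p) in
/-- The quotient of `E(cT) / E(T)` by its value at `T ^ p`. -/
def expQuotFrob (c : R) : PowerSeries R :=
  (exp R).subst (powSubLog p c - expand p hp.out.ne_zero (powSubLog p c))

variable (p) in
/-- The quotient of `(E(cT) / E(T)) ^ p` by `E(c^p T) / E(T)`. -/
def expQuotPow (c : R) : PowerSeries R :=
  (exp R).subst (p • powSubLog p c - powSubLog p (c ^ p))

theorem constantCoeff_expQuot (c : R) : constantCoeff (expQuot p c) = 1 :=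
  constantCoeff_exp_subst' (constantCoeff_powSubLog _)

theorem expQuot_mul_artinHasseExp (c : R) :
    artinHasseExp p R * expQuot p c = rescale c (artinHasseExp p R) := by
  have hs := hasSubst_primePowSeries (p := p) fun _ => (1 : R)
  rw [artinHasseExp, rescale_exp_subst c hs]
  refine (exp_subst_add hs (hasSubst_powSubLog c)).symm.trans ?_
  congr 1
  ext n
  erw [map_add]
  simp only [primePowSeries, powSubLog, coeff_mk, coeff_rescale]
  split_ifs <;> ring

theorem expQuot_eq_mul_expand (c : R) :
    expQuot p c = expQuotFrob p c * expand p hp.out.ne_zero (expQuot p c) := by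
  have h0 := constantCoeff_powSubLog (p := p) c
  have h1 : constantCoeff (expand p hp.out.ne_zero (powSubLog p c)) = 0 := by
    rw [constantCoeff_expand, h0]
  rw [expQuot, expand_exp_subst (hasSubst_powSubLog c), expQuotFrob]
  refine Eq.trans ?_ (exp_subst_add (HasSubst.of_constantCoeff_zero' ?_)
    (HasSubst.of_constantCoeff_zero' h1))
  · congr 1
    exact (sub_add_cancel _ _).symm
  · rw [map_sub, h0, h1, sub_zero]

theorem expQuot_pow (c : R) : expQuot p c ^ p = expQuotPow p c * expQuot p (c ^ p) := by
  rw [expQuot, expQuot, expQuotPow]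
  refine (exp_subst_nsmul (hasSubst_powSubLog c) p).symm.trans (Eq.trans ?_
    (exp_subst_add (HasSubst.of_constantCoeff_zero' ?_) (hasSubst_powSubLog (c ^ p))))
  · congr 1
    exact (sub_add_cancel _ _).symm
  · rw [map_sub, map_nsmul, constantCoeff_powSubLog, constantCoeff_powSubLog, smul_zero, sub_zero]

theorem expQuot_one : expQuot p (1 : R) = 1 := by
  have : powSubLog p (1 : R) = 0 := by
    ext n
    simp [powSubLog, primePowSeries]
  rw [expQuot, this]
  exact exp_subst_zero

theorem coeff_artinHasseExp (n : ℕ) : coeff n (artinHasseExp p R) =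
    algebraMap ℚ R (coeff n (artinHasseExp p ℚ)) := by
  rw [← coeff_map, artinHasseExp, artinHasseExp, map_exp_subst _ (hasSubst_primePowSeries _)]
  congr 2
  ext n
  rw [coeff_map]
  simp only [primePowSeries, coeff_mk]
  split_ifs <;> simp

variable {S : Subring R} (hS : ∀ q ∈ locSub p, algebraMap ℚ R q ∈ S)

include hS

theorem artinHasseExp_mem_seriesOver : artinHasseExp p R ∈ seriesOver S :=
  mem_seriesOver.2 fun n => by
    rw [coeff_artinHasseExp]; exact hS _ (coeff_artinHasseExp_mem n)

/-- The n-th coefficient of E(cT) - E(T) is a multiple of c^n - 1, hence of c - 1, and E is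
invertible over S. -/
theorem expQuot_mem_oneAddMul {c : R} (hc : c ∈ S) : expQuot p c ∈ oneAddMul S (c - 1) := by
  have hA := artinHasseExp_mem_seriesOver hS
  obtain ⟨A', hA', h1⟩ := exists_inv_mem_seriesOver hA constantCoeff_artinHasseExp
  obtain ⟨D, hD, h2⟩ : ∃ D ∈ seriesOver S, rescale c (artinHasseExp p R) =
      artinHasseExp p R + C (c - 1) * D := by
    refine ⟨PowerSeries.mk fun n => coeff n (artinHasseExp p R) * ∑ i ∈ Finset.range n, c ^ i,
      mem_seriesOver.2 fun n => ?_, ?_⟩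
    · rw [coeff_mk]
      exact mul_mem (mem_seriesOver.1 hA n) (sum_mem fun i _ => pow_mem hc i)
    · ext n
      rw [coeff_rescale, map_add, coeff_C_mul, coeff_mk]
      linear_combination (-coeff n (artinHasseExp p R)) * mul_geom_sum c n
  refine ⟨D * A', mul_mem hD hA', ?_⟩
  have h3 := expQuot_mul_artinHasseExp (p := p) c
  rw [h2] at h3
  linear_combination A' * h3 + (1 - expQuot p c) * h1

theorem expQuotFrob_mem_oneAddMul {c : R} (hc : c ∈ S) :
    expQuotFrob p c ∈ oneAddMul S (c - 1) := by
  have hc1 : c - 1 ∈ S := sub_mem hc (one_mem _)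
  have h := expQuot_mem_oneAddMul hS hc
  obtain ⟨V, hV, h1⟩ := exists_inv_mem_seriesOver
    (mem_seriesOver_of_oneAddMul hc1 h) (constantCoeff_expQuot c)
  have h2 := inv_mem_oneAddMul hc1 h (constantCoeff_expQuot c) h1
  have : expQuotFrob p c = expQuot p c * expand p hp.out.ne_zero V := by
    have h3 := expQuot_eq_mul_expand (p := p) c
    have h4 := congrArg (expand p hp.out.ne_zero) h1
    rw [map_mul, map_one] at h4
    linear_combination (-expand p hp.out.ne_zero V) * h3 - expQuotFrob p c * h4
  rw [this]
  exact mul_mem_oneAddMul hc1 h (expand_mem_oneAddMul _ h2)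

/-- Numerator and denominator are both ≡ 1 modulo c - 1, as c - 1 divides c^p - 1. -/
theorem expQuotPow_mem_oneAddMul {c : R} (hc : c ∈ S) :
    expQuotPow p c ∈ oneAddMul S (c - 1) := by
  have hc1 : c - 1 ∈ S := sub_mem hc (one_mem _)
  have h := expQuot_mem_oneAddMul hS hc
  have h' := expQuot_mem_oneAddMul hS (pow_mem hc p)
  rw [← mul_geom_sum] at h'
  replace h' := oneAddMul_mono (sum_mem fun i _ => pow_mem hc i) h'
  obtain ⟨V, hV, h1⟩ := exists_inv_mem_seriesOver
    (mem_seriesOver_of_oneAddMul hc1 h') (constantCoeff_expQuot _)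
  have h2 := inv_mem_oneAddMul hc1 h' (constantCoeff_expQuot _) h1
  have : expQuotPow p c = expQuot p c ^ p * V := by
    have h3 := expQuot_pow (p := p) c
    linear_combination (-V) * h3 - expQuotPow p c * h1
  rw [this]
  exact mul_mem_oneAddMul hc1 (pow_mem_oneAddMul hc1 h p) h2

end ExpQuot

/-! ### Change of the coefficient ring, for specialising the universal parameter. -/

section ExpQuotMap

open PowerSeries

variable {p : ℕ} [hp : Fact p.Prime] {R S : Type*} [CommRing R] [Algebra ℚ R] [CommRing S]
  [Algebra ℚ S] (h : R →+* S)

theorem map_powSubLog (c : R) : map h (powSubLog p c) = powSubLog p (h c) := by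
  ext n
  rw [coeff_map]
  simp only [primePowSeries, powSubLog, coeff_mk]
  split_ifs
  · rw [map_mul, map_sub, map_pow, map_one]
    congr 1
    exact RingHom.congr_fun (Subsingleton.elim (h.comp (algebraMap ℚ R)) (algebraMap ℚ S)) _
  · simp

theorem map_expQuotFrob (c : R) : map h (expQuotFrob p c) = expQuotFrob p (h c) := by
  rw [expQuotFrob, expQuotFrob, map_exp_subst, map_sub, map_expand, map_powSubLog]
  refine HasSubst.of_constantCoeff_zero' ?_
  rw [map_sub, constantCoeff_expand, sub_self]

theorem map_expQuotPow (c : R) : map h (expQuotPow p c) = expQuotPow p (h c) := by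
  rw [expQuotPow, expQuotPow, map_exp_subst, map_sub, map_nsmul, map_powSubLog, map_powSubLog,
    map_pow]
  refine HasSubst.of_constantCoeff_zero' ?_
  rw [map_sub, map_nsmul, constantCoeff_powSubLog, constantCoeff_powSubLog, smul_zero, sub_zero]

end ExpQuotMap

/-! ### p-adic decay of the coefficients at the universal parameter c = 1 + X. -/

section NullCoefficients

open PowerSeries Filter Topology

variable {p : ℕ} [hp : Fact p.Prime]

/-- The coefficients of `X ^ k` of a power series over `ℚ[X]`, as a power series over `ℚ_[p]`. -/
def polyCoeff (p : ℕ) [Fact p.Prime] (k : ℕ) (H : PowerSeries (Polynomial ℚ)) :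
    PowerSeries ℚ_[p] :=
  PowerSeries.mk fun n => (((coeff n H).coeff k : ℚ) : ℚ_[p])

theorem polyCoeff_mul (k : ℕ) (F G : PowerSeries (Polynomial ℚ)) : polyCoeff p k (F * G) =
    ∑ x ∈ Finset.HasAntidiagonal.antidiagonal k, polyCoeff p x.1 F * polyCoeff p x.2 G := by
  ext n
  simp only [polyCoeff, coeff_mk, coeff_mul, Polynomial.finsetSum_coeff, Polynomial.coeff_mul,
    map_sum, Rat.cast_sum, Rat.cast_mul]
  exact Finset.sum_comm

theorem isRestricted_sum {ι : Type*} (t : Finset ι) (f : ι → PowerSeries ℚ_[p])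
    (h : ∀ i ∈ t, IsRestricted 1 (f i)) : IsRestricted 1 (∑ i ∈ t, f i) :=
  sum_mem (S := IsRestricted.addSubgroup (R := ℚ_[p]) 1) h

variable (p) in
/-- Power series over `ℚ[X]` such that for all `k` the coefficients of `X ^ k` tend to zero
`p`-adically. -/
def nullSub : Subring (PowerSeries (Polynomial ℚ)) where
  carrier := {H | ∀ k, IsRestricted 1 (polyCoeff p k H)}
  zero_mem' := fun k => by
    have : polyCoeff p k 0 = 0 := by ext n; simp [polyCoeff]
    rw [this]; exact isRestricted_zero 1
  one_mem' := fun k => by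
    have : polyCoeff p k 1 = C (if k = 0 then 1 else 0) := by
      ext n
      rw [polyCoeff, coeff_mk, coeff_one, coeff_C]
      split_ifs with h1 h2 <;> simp [Polynomial.coeff_one, *]
    rw [this]; exact isRestricted_C 1 _
  add_mem' := fun {f g} hf hg k => by
    have : polyCoeff p k (f + g) = polyCoeff p k f + polyCoeff p k g := by
      ext n; simp [polyCoeff]
    rw [this]; exact isRestricted.add 1 (hf k) (hg k)
  neg_mem' := fun {f} hf k => by
    have : polyCoeff p k (-f) = -polyCoeff p k f := by ext n; simp [polyCoeff]
    rw [this]; exact isRestricted.neg 1 (hf k)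
  mul_mem' := fun {f g} hf hg k => by
    rw [polyCoeff_mul]
    exact isRestricted_sum _ _ fun x _ => isRestricted.mul 1 (hf _) (hg _)

theorem smul_mem_nullSub (c : ℚ) {f : PowerSeries (Polynomial ℚ)} (hf : f ∈ nullSub p) :
    C (Polynomial.C c) * f ∈ nullSub p := fun k => by
  have : polyCoeff p k (C (Polynomial.C c) * f) = C (c : ℚ_[p]) * polyCoeff p k f := by
    ext n; simp [polyCoeff]
  rw [this]; exact isRestricted.mul 1 (isRestricted_C 1 _) (hf k)

theorem mem_nullSub_of_bound {f : PowerSeries (Polynomial ℚ)}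
    (h : ∀ k, ∃ B : ℝ, ∀ n ≠ 0, ‖(((coeff n f).coeff k : ℚ) : ℚ_[p])‖ ≤ B * (1 / (n : ℝ))) :
    f ∈ nullSub p := fun k => by
  obtain ⟨B, hB⟩ := h k
  rw [isRestricted_iff']
  simp only [one_pow, mul_one]
  refine squeeze_zero' (Eventually.of_forall fun n => norm_nonneg _)
    (g := fun n : ℕ => B * (1 / (n : ℝ))) ?_ ?_
  · filter_upwards [eventually_ne_atTop 0] with n hn
    rw [polyCoeff, coeff_mk]; exact hB n hn
  · have := (tendsto_one_div_atTop_nhds_zero_nat (𝕜 := ℝ)).const_mul B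
    rwa [mul_zero] at this

/-- L is divisible by the coefficient variable X, so L^d does not meet X^k when d > k. The
exponential is thus a finite sum for each k, and the denominators d! stay bounded. -/
theorem coeff_exp_subst_eq {L : PowerSeries (Polynomial ℚ)} (h0 : constantCoeff L = 0)
    (hL : ∀ n, Polynomial.X ∣ coeff n L) (n k : ℕ) :
    (coeff n ((exp (Polynomial ℚ)).subst L)).coeff k =
    (coeff n (∑ d ∈ Finset.range (k + 1), C (Polynomial.C (1 / (d.factorial : ℚ))) * L ^ d)).coeff
      k := by
  have hs : HasSubst L := HasSubst.of_constantCoeff_zero' h0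
  rw [coeff_subst' hs]
  have hfin : (Function.support fun d =>
      coeff d (exp (Polynomial ℚ)) • coeff n (L ^ d)).Finite := coeff_subst_finite' hs _ n
  have hX : ∀ d, k < d → (coeff n (L ^ d)).coeff k = 0 := by
    intro d hd
    choose g hg using hL
    have h1 : L = C Polynomial.X * PowerSeries.mk g := by
      ext1 m; rw [coeff_C_mul, coeff_mk, hg]
    rw [h1, mul_pow, ← map_pow, coeff_C_mul, Polynomial.coeff_X_pow_mul', if_neg (by omega)]
  have h1 := AddMonoidHom.map_finsum (Polynomial.lcoeff ℚ k).toAddMonoidHom hfin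
  rw [show ∀ q : Polynomial ℚ, q.coeff k = (Polynomial.lcoeff ℚ k).toAddMonoidHom q from
    fun q => rfl, h1, map_sum, ← Polynomial.lcoeff_apply, map_sum]
  have hco : ∀ d, coeff d (exp (Polynomial ℚ)) • coeff n (L ^ d) =
      coeff n (C (Polynomial.C (1 / (d.factorial : ℚ))) * L ^ d) := by
    intro d
    rw [coeff_exp, coeff_C_mul, smul_eq_mul]; rfl
  rw [finsum_eq_sum_of_support_subset]
  · exact Finset.sum_congr rfl fun d _ => by rw [hco]; rfl
  · intro d hd
    by_contra h
    refine hd ?_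
    simp only [Finset.coe_range, Set.mem_Iio, not_lt] at h
    change (coeff d (exp (Polynomial ℚ)) • coeff n (L ^ d)).coeff k = 0
    rw [hco, coeff_C_mul, Polynomial.coeff_C_mul, hX d (by omega), mul_zero]

theorem exp_subst_mem_nullSub {L : PowerSeries (Polynomial ℚ)} (h0 : constantCoeff L = 0)
    (hL : ∀ n, Polynomial.X ∣ coeff n L) (h : L ∈ nullSub p) :
    (exp (Polynomial ℚ)).subst L ∈ nullSub p := fun k => by
  have h1 : ∑ d ∈ Finset.range (k + 1), C (Polynomial.C (1 / (d.factorial : ℚ))) * L ^ d ∈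
      nullSub p := sum_mem fun d _ => smul_mem_nullSub _ (pow_mem h d)
  have : polyCoeff p k ((exp (Polynomial ℚ)).subst L) = polyCoeff p k
    (∑ d ∈ Finset.range (k + 1), C (Polynomial.C (1 / (d.factorial : ℚ))) * L ^ d) := by
    ext n
    rw [polyCoeff, polyCoeff, coeff_mk, coeff_mk, coeff_exp_subst_eq h0 hL]
  rw [this]
  exact h1 k

/-- The division by n disappears: up to a factor depending only on k, the coefficients of ((1+X)^n -
1)/n are integer polynomials in n, hence p-adically continuous in n. -/
theorem choose_div (n k : ℕ) (hn : n ≠ 0) : (1 / (n : ℚ)) * (n.choose (k + 1) : ℚ) =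
    (1 / ((k + 1).factorial : ℚ)) * (((descPochhammer ℤ k).eval ((n : ℤ) - 1) : ℤ) : ℚ) := by
  obtain ⟨m, rfl⟩ := Nat.exists_eq_succ_of_ne_zero hn
  have h1 : (((m + 1).descFactorial (k + 1) : ℕ) : ℚ) = (m + 1) * (m.descFactorial k : ℚ) := by
    rw [Nat.succ_descFactorial_succ]; push_cast; ring
  rw [Nat.descFactorial_eq_factorial_mul_choose] at h1
  have h2 : (descPochhammer ℤ k).eval (((m + 1 : ℕ) : ℤ) - 1) = (m.descFactorial k : ℤ) := by
    push_cast
    rw [add_sub_cancel_right, descPochhammer_eval_eq_descFactorial]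
  rw [Nat.succ_eq_add_one, h2]
  have h3 : (((k + 1).factorial : ℕ) : ℚ) ≠ 0 := by exact_mod_cast (k + 1).factorial_ne_zero
  have h4 : ((m : ℚ) + 1) ≠ 0 := by positivity
  push_cast at h1 ⊢
  field_simp
  push_cast at *
  linear_combination h1

theorem coeff_inv_mul_one_add_X_pow (n k : ℕ) (hn : n ≠ 0) :
    (algebraMap ℚ (Polynomial ℚ) (1 / (n : ℚ)) * ((1 + Polynomial.X) ^ n - 1)).coeff k =
    if k = 0 then 0 else
      (1 / (k.factorial : ℚ)) * (((descPochhammer ℤ (k - 1)).eval ((n : ℤ) - 1) : ℤ) : ℚ) := by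
  rw [Polynomial.algebraMap_eq, Polynomial.coeff_C_mul, Polynomial.coeff_sub,
    Polynomial.coeff_one_add_X_pow, Polynomial.coeff_one]
  rcases k with _ | k
  · simp
  · rw [if_neg k.succ_ne_zero, if_neg k.succ_ne_zero, sub_zero, choose_div n k hn,
      Nat.add_sub_cancel]

/-- p^{i+1} - 1 ≡ p^i - 1 modulo p^i, and integer polynomials preserve congruences. The factor p on
the right allows for the difference between p^i and p^{i+1}. -/
theorem norm_descPochhammer_sub (k i : ℕ) :
    ‖((((descPochhammer ℤ k).eval (((p ^ (i + 1) : ℕ) : ℤ) - 1) : ℤ) : ℚ_[p]) -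
      (((descPochhammer ℤ k).eval (((p ^ i : ℕ) : ℤ) - 1) : ℤ) : ℚ_[p]))‖ ≤
      p * (1 / ((p ^ (i + 1) : ℕ) : ℝ)) := by
  have h := Polynomial.sub_dvd_eval_sub (((p ^ (i + 1) : ℕ) : ℤ) - 1) (((p ^ i : ℕ) : ℤ) - 1)
    (descPochhammer ℤ k)
  have h2 : ((p ^ i : ℕ) : ℤ) ∣ (((p ^ (i + 1) : ℕ) : ℤ) - 1) - (((p ^ i : ℕ) : ℤ) - 1) := by
    push_cast
    exact ⟨p - 1, by ring⟩
  rw [← Int.cast_sub]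
  have h3 := h2.trans h
  have h4 := (Padic.norm_int_le_pow_iff_dvd (p := p) _ i).2 (by exact_mod_cast h3)
  refine h4.trans (le_of_eq ?_)
  have hp0 : (p : ℝ) ≠ 0 := by exact_mod_cast hp.out.ne_zero
  rw [zpow_neg, zpow_natCast]
  push_cast
  rw [pow_succ]
  field_simp

theorem coeff_powSubLog_one_add_X (i k : ℕ) :
    (coeff (p ^ i) (powSubLog p (1 + Polynomial.X : Polynomial ℚ))).coeff k =
    if k = 0 then 0 else (1 / (k.factorial : ℚ)) *
      (((descPochhammer ℤ (k - 1)).eval (((p ^ i : ℕ) : ℤ) - 1) : ℤ) : ℚ) := by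
  rw [← coeff_inv_mul_one_add_X_pow _ _ (pow_ne_zero i hp.out.ne_zero), powSubLog,
    coeff_primePowSeries_pow]
  push_cast; rfl

/-- ((1+X)^{p^i} - 1)/p^i tends to log(1 + X) and not to 0. Subtracting the value at T^p leaves
differences of consecutive terms, which do tend to 0. -/
theorem norm_coeff_powSubLog_sub_le (i k : ℕ) :
    ‖(((coeff (p ^ (i + 1)) (powSubLog p (1 + Polynomial.X : Polynomial ℚ) -
      expand p hp.out.ne_zero (powSubLog p (1 + Polynomial.X : Polynomial ℚ)))).coeff k : ℚ) :
        ℚ_[p])‖ ≤ ‖((1 / (k.factorial : ℚ) : ℚ) : ℚ_[p])‖ * p * (1 / ((p ^ (i + 1) : ℕ) : ℝ)) := by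
  rw [map_sub, pow_succ' p i, coeff_expand_mul, ← pow_succ' p i, Polynomial.coeff_sub,
    coeff_powSubLog_one_add_X, coeff_powSubLog_one_add_X]
  rcases eq_or_ne k 0 with rfl | hk
  · simp only [if_true, sub_zero, Rat.cast_zero, norm_zero]
    positivity
  · rw [if_neg hk, if_neg hk, ← mul_sub, Rat.cast_mul, norm_mul, mul_assoc]
    refine mul_le_mul_of_nonneg_left ?_ (norm_nonneg _)
    have := norm_descPochhammer_sub (p := p) (k - 1) i
    simpa only [Rat.cast_sub, Rat.cast_intCast] using this

theorem X_dvd_coeff_powSubLog (n m : ℕ) :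
    Polynomial.X ∣ coeff n (powSubLog p ((1 + Polynomial.X : Polynomial ℚ) ^ m)) := by
  rw [powSubLog, primePowSeries, coeff_mk]
  split_ifs
  · refine Dvd.dvd.mul_left ?_ _
    rw [← pow_mul]
    have := sub_dvd_pow_sub_pow (1 + Polynomial.X : Polynomial ℚ) 1 (m * n)
    rwa [add_sub_cancel_left, one_pow] at this
  · exact dvd_zero _

theorem expQuotFrob_mem_nullSub :
    expQuotFrob p (1 + Polynomial.X : Polynomial ℚ) ∈ nullSub p := by
  refine exp_subst_mem_nullSub ?_ (fun n => ?_) (mem_nullSub_of_bound fun k => ?_)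
  · rw [map_sub, constantCoeff_expand, sub_self]
  · have h := fun n => X_dvd_coeff_powSubLog (p := p) n 1
    simp only [pow_one] at h
    rw [map_sub, coeff_expand]
    split_ifs
    · exact dvd_sub (h _) (h _)
    · rw [sub_zero]; exact h _
  · set L := powSubLog p (1 + Polynomial.X : Polynomial ℚ) -
      expand p hp.out.ne_zero (powSubLog p (1 + Polynomial.X : Polynomial ℚ)) with hL
    -- The first summand covers degree 1 = p^0, where there is no preceding term to subtract.
    refine ⟨‖(((coeff 1 L).coeff k : ℚ) : ℚ_[p])‖ +
      ‖((1 / (k.factorial : ℚ) : ℚ) : ℚ_[p])‖ * p, fun n hn => ?_⟩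
    by_cases h : ∃ i, n = p ^ i
    · obtain ⟨i, rfl⟩ := h
      rw [add_mul]
      rcases i with _ | i
      · rw [pow_zero, Nat.cast_one, div_one, mul_one]
        exact le_add_of_nonneg_right (by positivity)
      · exact (norm_coeff_powSubLog_sub_le i k).trans (le_add_of_nonneg_left (by positivity))
    · rw [not_exists] at h
      rw [hL, map_sub, powSubLog, coeff_primePowSeries_of_ne _ h,
        coeff_expand_primePowSeries_of_ne _ h]
      simp only [sub_zero, Polynomial.coeff_zero, Rat.cast_zero, norm_zero]
      positivity

theorem expQuotPow_mem_nullSub :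
    expQuotPow p (1 + Polynomial.X : Polynomial ℚ) ∈ nullSub p := by
  refine exp_subst_mem_nullSub ?_ (fun n => ?_) (mem_nullSub_of_bound fun k => ?_)
  · rw [map_sub, map_nsmul, constantCoeff_powSubLog, constantCoeff_powSubLog, smul_zero, sub_zero]
  · have h := X_dvd_coeff_powSubLog (p := p) n 1
    rw [pow_one] at h
    rw [map_sub, map_nsmul]
    exact dvd_sub (dvd_nsmul_of_dvd _ h) (X_dvd_coeff_powSubLog n p)
  · refine ⟨‖((1 / (k.factorial : ℚ) : ℚ) : ℚ_[p])‖ * p, fun n hn => ?_⟩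
    by_cases h : ∃ i, n = p ^ i
    · obtain ⟨i, rfl⟩ := h
      -- Up to the factor -p this is the same difference of consecutive terms, moved from degree
      -- p^{i+1} to degree p^i.
      have key : coeff (p ^ i) (p • powSubLog p (1 + Polynomial.X : Polynomial ℚ) -
          powSubLog p ((1 + Polynomial.X : Polynomial ℚ) ^ p)) = - (p : Polynomial ℚ) *
          coeff (p ^ (i + 1)) (powSubLog p (1 + Polynomial.X : Polynomial ℚ) -
          expand p hp.out.ne_zero (powSubLog p (1 + Polynomial.X : Polynomial ℚ))) := by
        rw [map_sub, map_sub, map_nsmul, pow_succ' p i, coeff_expand_mul, ← pow_succ' p i,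
          powSubLog, powSubLog, coeff_primePowSeries_pow, coeff_primePowSeries_pow,
          coeff_primePowSeries_pow, ← pow_mul, ← pow_succ' p i, nsmul_eq_mul]
        have : (p : Polynomial ℚ) * algebraMap ℚ (Polynomial ℚ) (1 / (p : ℚ) ^ (i + 1)) =
            algebraMap ℚ (Polynomial ℚ) (1 / (p : ℚ) ^ i) := by
          rw [← map_natCast (algebraMap ℚ (Polynomial ℚ)), ← map_mul]
          congr 1
          have : (p : ℚ) ≠ 0 := by exact_mod_cast hp.out.ne_zero
          rw [pow_succ]
          field_simp
        linear_combination ((1 + Polynomial.X : Polynomial ℚ) ^ p ^ (i + 1) - 1) * this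
      rw [key, neg_mul, Polynomial.coeff_neg, Rat.cast_neg, norm_neg,
        ← map_natCast (Polynomial.C), Polynomial.coeff_C_mul, Rat.cast_mul, norm_mul,
        Rat.cast_natCast, Padic.norm_p]
      have h1 := norm_coeff_powSubLog_sub_le (p := p) i k
      have hp1 := hp.out.one_lt
      refine (mul_le_of_le_one_left (norm_nonneg _) inv_p_le_one).trans (h1.trans ?_)
      refine mul_le_mul_of_nonneg_left ?_ (by positivity)
      refine one_div_le_one_div_of_le (by exact_mod_cast pow_pos hp.out.pos i) ?_
      exact_mod_cast Nat.pow_le_pow_right hp.out.pos i.le_succ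
    · rw [not_exists] at h
      rw [map_sub, map_nsmul, powSubLog, powSubLog, coeff_primePowSeries_of_ne _ h,
        coeff_primePowSeries_of_ne _ h]
      simp only [smul_zero, sub_zero, Polynomial.coeff_zero, Rat.cast_zero, norm_zero]
      positivity

end NullCoefficients

/-! ### Specialisation of the universal series at roots of unity. -/

section Specialisation

open PowerSeries Filter Topology

variable {p s : ℕ} [hp : Fact p.Prime] {K : Type*} [Field K] [CharZero K] {ζ : K}

theorem not_dvd_den_of_mem_locSub {q : ℚ} (hq : q ∈ locSub p) : ¬ p ∣ q.den := by
  rw [mem_locSub, Padic.norm_rat_le_one_iff_padicValuation_le_one,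
    Rat.padicValuation_le_one_iff] at hq
  exact hq

theorem algebraMap_mem_levelRing (i : ℕ) {q : ℚ} (hq : q ∈ locSub p) :
    algebraMap ℚ K q ∈ levelRing p s ζ i := by
  have h := ratio_mem_levelRing (p := p) (s := s) (ζ := ζ) i q.num (q.den : ℤ) (by
    rw [Int.natCast_dvd_natCast]; exact not_dvd_den_of_mem_locSub hq)
  have h2 : algebraMap ℚ K q = (q.num : K) / ((q.den : ℤ) : K) := by
    rw [eq_ratCast, Int.cast_natCast]
    exact Rat.cast_def q
  rw [h2]; exact h

theorem inv_pow_mul_mem_locSub {q : ℚ} {N : ℕ} (hq : ‖(q : ℚ_[p])‖ ≤ ((p : ℝ)⁻¹) ^ N) :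
    q / (p : ℚ) ^ N ∈ locSub p := by
  rw [mem_locSub]
  push_cast
  rw [norm_div, norm_pow, Padic.norm_p]
  exact div_le_one_of_le₀ hq (by positivity)

variable (p) in
/-- The polynomials whose coefficients are integral at `p`. -/
def locPoly : Subring (Polynomial ℚ) := (Polynomial.mapRingHom (locSub p).subtype).range

theorem coeff_mem_of_mem_locPoly {f : Polynomial ℚ} (hf : f ∈ locPoly p) (n : ℕ) :
    f.coeff n ∈ locSub p := by
  obtain ⟨g, rfl⟩ := hf
  rw [Polynomial.coe_mapRingHom, Polynomial.coeff_map]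
  exact (g.coeff n).2

theorem algebraMap_mem_locPoly {q : ℚ} (hq : q ∈ locSub p) :
    algebraMap ℚ (Polynomial ℚ) q ∈ locPoly p := ⟨Polynomial.C ⟨q, hq⟩, by simp⟩

theorem one_add_X_mem_locPoly : (1 + Polynomial.X : Polynomial ℚ) ∈ locPoly p :=
  ⟨1 + Polynomial.X, by simp⟩

/-- Modulo ϖ^N the powers π^k with k ≥ N vanish. For each of the finitely many k < N, the
coefficients of X^k are eventually divisible by p^N. -/
theorem tendsZero_map_aeval {R : Subring K} {ϖ π : K}
    (hR : ∀ q ∈ locSub p, algebraMap ℚ K q ∈ R) (hπ : π ∈ mulSub R ϖ)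
    (hpϖ : (p : K) ∈ mulSub R ϖ) (hϖ : ϖ ∈ R) {H : PowerSeries (Polynomial ℚ)}
    (hH : H ∈ seriesOver (locPoly p)) (hH' : H ∈ nullSub p) :
    TendsZero R ϖ (PowerSeries.map (Polynomial.aeval π).toRingHom H) := by
  intro N
  have hpow : ∀ {x : K} (_ : x ∈ mulSub R ϖ) (k : ℕ), x ^ k ∈ mulSub R (ϖ ^ k) := by
    intro x hx k
    obtain ⟨r, hr, rfl⟩ := mem_mulSub.1 hx
    exact mem_mulSub.2 ⟨r ^ k, pow_mem hr k, mul_pow _ _ _⟩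
  have hev : ∀ k, ∃ M, ∀ n ≥ M, ‖(((coeff n H).coeff k : ℚ) : ℚ_[p])‖ ≤ ((p : ℝ)⁻¹) ^ N := by
    intro k
    have h := hH' k
    rw [isRestricted_iff'] at h
    simp only [one_pow, mul_one, polyCoeff, coeff_mk] at h
    have hpos : (0 : ℝ) < ((p : ℝ)⁻¹) ^ N :=
      pow_pos (inv_pos.2 (by exact_mod_cast hp.out.pos)) N
    obtain ⟨M, hM⟩ := eventually_atTop.1 (h.eventually_lt_const hpos)
    exact ⟨M, fun n hn => (hM n hn).le⟩
  choose M hM using hev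
  refine ⟨∑ k ∈ Finset.range N, M k, fun n hn => ?_⟩
  rw [coeff_map]
  change Polynomial.aeval π (coeff n H) ∈ _
  rw [Polynomial.aeval_eq_sum_range]
  refine sum_mem fun k _ => ?_
  have hc := coeff_mem_of_mem_locPoly (mem_seriesOver.1 hH n) k
  rw [Algebra.smul_def]
  have hπR : π ∈ R := mulSub_le hϖ hπ
  by_cases hk : k < N
  · have h1 : M k ≤ n := (Finset.single_le_sum (f := M) (fun _ _ => Nat.zero_le _)
      (Finset.mem_range.2 hk)).trans hn
    refine mul_mem_mulSub ?_ (pow_mem hπR k)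
    have h2 := inv_pow_mul_mem_locSub (hM k n h1)
    have h3 : algebraMap ℚ K ((coeff n H).coeff k) =
        (p : K) ^ N * algebraMap ℚ K ((coeff n H).coeff k / (p : ℚ) ^ N) := by
      have : (p : K) ≠ 0 := by exact_mod_cast hp.out.ne_zero
      rw [map_div₀, map_pow, map_natCast]
      field_simp
    rw [h3]
    exact mul_mem_mulSub (hpow hpϖ N) (hR _ h2)
  · exact mul_mem_mulSub' (hR _ hc) (mulSub_pow_mono hϖ (not_lt.1 hk) (hpow hπ k))

theorem pi_mem_mulSub {i : ℕ} (his : i ≤ s) :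
    zetaLevel p s ζ i - 1 ∈ mulSub (levelRing p s ζ s) (ζ - 1) := by
  obtain ⟨r, hr, h⟩ := pi_dvd_pi (p := p) (ζ := ζ) his le_rfl
  rw [zetaLevel_self] at h
  exact mem_mulSub.2 ⟨r, hr, h⟩

theorem p_mem_mulSub (hs : 1 ≤ s) (hζ : IsPrimitiveRoot ζ (p ^ s)) :
    (p : K) ∈ mulSub (levelRing p s ζ s) (ζ - 1) := by
  obtain ⟨r, hr, h⟩ := p_dvd_pi hζ hs le_rfl
  rw [zetaLevel_self] at h
  exact mem_mulSub.2 ⟨r, hr, h⟩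

theorem pi_self_mem : ζ - 1 ∈ levelRing p s ζ s := by
  have := pi_mem (p := p) (s := s) (ζ := ζ) s
  rwa [zetaLevel_self] at this

theorem expQuotFrob_tendsZero (hs : 1 ≤ s) (hζ : IsPrimitiveRoot ζ (p ^ s)) {n : ℕ} (hn : n ≤ s) :
    TendsZero (levelRing p s ζ s) (ζ - 1) (expQuotFrob p (zetaLevel p s ζ n)) := by
  have h := tendsZero_map_aeval (p := p) (fun q hq => algebraMap_mem_levelRing s hq)
    (pi_mem_mulSub hn) (p_mem_mulSub hs hζ) pi_self_mem
    (mem_seriesOver_of_oneAddMul (sub_mem one_add_X_mem_locPoly (one_mem _))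
      (expQuotFrob_mem_oneAddMul (fun q hq => algebraMap_mem_locPoly hq) one_add_X_mem_locPoly))
    expQuotFrob_mem_nullSub
  rw [map_expQuotFrob] at h
  simpa using h

theorem expQuotPow_tendsZero (hs : 1 ≤ s) (hζ : IsPrimitiveRoot ζ (p ^ s)) {n : ℕ} (hn : n ≤ s) :
    TendsZero (levelRing p s ζ s) (ζ - 1) (expQuotPow p (zetaLevel p s ζ n)) := by
  have h := tendsZero_map_aeval (p := p) (fun q hq => algebraMap_mem_levelRing s hq)
    (pi_mem_mulSub hn) (p_mem_mulSub hs hζ) pi_self_mem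
    (mem_seriesOver_of_oneAddMul (sub_mem one_add_X_mem_locPoly (one_mem _))
      (expQuotPow_mem_oneAddMul (fun q hq => algebraMap_mem_locPoly hq) one_add_X_mem_locPoly))
    expQuotPow_mem_nullSub
  rw [map_expQuotPow] at h
  simpa using h

/-- ζ_{p^n}^{p^i} = ζ_{p^{n-i}}, which is 1 from i = n on, so the infinite series `powSubLog` is the
finite sum defining E_{n,p}. -/
theorem artinHasse_eq_subst (hζ : IsPrimitiveRoot ζ (p ^ s)) {n : ℕ} (hn : n ≤ s) {σ : Type*}
    {t : MvPowerSeries σ K} (ht : MvPowerSeries.constantCoeff t = 0) :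
    artinHasse p s ζ n t = (expQuot p (zetaLevel p s ζ n)).subst t := by
  have hs : HasSubst t := HasSubst.of_constantCoeff_zero ht
  have h1 : powSubLog p (zetaLevel p s ζ n) = ∑ i ∈ Finset.range n,
      C ((zetaLevel p s ζ (n - i) - 1) / (p : K) ^ i) * (X : PowerSeries K) ^ p ^ i := by
    have hc : ∀ m, coeff m (∑ i ∈ Finset.range n,
        C ((zetaLevel p s ζ (n - i) - 1) / (p : K) ^ i) * (X : PowerSeries K) ^ p ^ i) =
        ∑ i ∈ Finset.range n, if m = p ^ i then (zetaLevel p s ζ (n - i) - 1) / (p : K) ^ i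
          else 0 := by
      intro m
      rw [map_sum]
      refine Finset.sum_congr rfl fun i _ => ?_
      rw [coeff_C_mul, coeff_X_pow]
      split_ifs <;> simp
    refine ext_primePow (p := p) (fun i => ?_) (fun m hm => coeff_primePowSeries_of_ne _ hm)
      fun m hm => ?_
    · rw [hc, powSubLog, coeff_primePowSeries_pow]
      simp only [(Nat.pow_right_injective hp.out.two_le).eq_iff]
      rw [Finset.sum_ite_eq]
      split_ifs with h
      · rw [zetaLevel_pow (Finset.mem_range.1 h).le hn]
        simp [div_eq_inv_mul]
      · have : zetaLevel p s ζ n ^ p ^ i = 1 := by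
          have h2 : n ≤ i := by simpa using h
          rw [← Nat.sub_add_cancel h2, add_comm, pow_add, pow_mul, zetaLevel_pow le_rfl hn,
            Nat.sub_self, zetaLevel_zero hζ, one_pow]
        rw [this, sub_self, mul_zero]
    · rw [hc]
      exact Finset.sum_eq_zero fun i _ => if_neg (hm i)
  have h2 : (powSubLog p (zetaLevel p s ζ n)).subst t = ∑ i ∈ Finset.range n,
      MvPowerSeries.C ((zetaLevel p s ζ (n - i) - 1) / (p : K) ^ i) * t ^ p ^ i := by
    rw [h1, ← coe_substAlgHom hs, map_sum]
    refine Finset.sum_congr rfl fun i _ => ?_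
    rw [map_mul, map_pow, coe_substAlgHom hs, subst_X hs, subst_C]
  rw [artinHasse, ← h2, expQuot]
  exact (subst_comp_subst_apply (R := K) (hasSubst_powSubLog _) hs (exp K)).symm

end Specialisation

/-! ### The series log(1 + cT)/c and (exp(cT) - 1)/c for c = λ and c = pλ. -/

section LogSeries

open PowerSeries

variable {p s : ℕ} [hp : Fact p.Prime]

/-- As p is a unit times λ^{p-1}, the order of λ in λ^{k-1}/k is k - 1 - (p - 1)v_p(k). It is
positive for all k except 1 and p. -/
theorem sub_one_mul_val_lt {k : ℕ} (hk : 2 ≤ k) (hkp : k ≠ p) :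
    (p - 1) * padicValNat p k + 1 ≤ k - 1 := by
  obtain ⟨q, hq⟩ : ∃ q, p = q + 2 := ⟨p - 2, by have := hp.out.two_le; omega⟩
  have hd : p ^ padicValNat p k ∣ k := pow_padicValNat_dvd
  have hle := Nat.le_of_dvd (by omega) hd
  generalize padicValNat p k = v at *
  rcases v with _ | _ | v
  · omega
  · obtain ⟨m, hm⟩ := hd
    rw [zero_add, pow_one] at *
    have hm2 : 2 ≤ m := by
      rcases m with _ | _ | m
      · omega
      · omega
      · omega
    have := Nat.mul_le_mul_left p hm2
    omega
  · have key : ∀ v, (p - 1) * (v + 3) + 1 ≤ p ^ (v + 2) := by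
      intro v
      subst hq
      have h1 : q + 2 - 1 = q + 1 := by omega
      rw [h1]
      induction v with
      | zero => norm_num; nlinarith
      | succ v ih =>
        have h2 : (q + 2) ^ (v + 1 + 2) = (q + 2) ^ (v + 2) * (q + 2) := by rw [← pow_succ]
        rw [h2]
        nlinarith [Nat.zero_le (q * v), Nat.zero_le (q * q * v)]
    have h1 : (p - 1) * (v + 3) + 1 ≤ p ^ (v + 1 + 1) := key v
    have h2 : (p - 1) * (v + 3) = (p - 1) * (v + 1 + 1) + (p - 1) := by ring
    omega

/-- v_p(k) is logarithmic in k, so the same order tends to infinity. This makes log(1 + λT)/λ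
restricted. -/
theorem exists_forall_sub_one_mul_val_le (N : ℕ) :
    ∃ M, ∀ k ≥ M, (p - 1) * padicValNat p k + N ≤ k - 1 := by
  refine ⟨8 * p ^ 2 + 2 * N + 2, fun k hk => ?_⟩
  have hk0 : k ≠ 0 := by omega
  have hle := Nat.le_of_dvd (by omega) (pow_padicValNat_dvd (p := p) (n := k))
  have h2 : 2 ^ padicValNat p k ≤ k := (Nat.pow_le_pow_left hp.out.two_le _).trans hle
  generalize padicValNat p k = v at *
  have h3 : ∀ v : ℕ, v * v ≤ 2 * 2 ^ v := by
    intro v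
    induction v with
    | zero => simp
    | succ v ih =>
      rcases Nat.lt_or_ge v 3 with h | h
      · interval_cases v <;> norm_num
      · rw [pow_succ]; nlinarith
  have h4 := h3 v
  have h5 : (p - 1) * v ≤ p * v := Nat.mul_le_mul_right _ (Nat.sub_le _ _)
  have h6 : 2 * (p * v) ≤ k := by
    by_contra h
    push Not at h
    have : (p * v) * (p * v) ≤ 2 * p ^ 2 * k := by nlinarith [sq_nonneg (p : ℤ)]
    nlinarith
  omega

variable {K : Type*} [Field K] [CharZero K] {ζ : K}

theorem lam_pow_div_mem (hs : 1 ≤ s) (hζ : IsPrimitiveRoot ζ (p ^ s)) (k : ℕ) (hk : k ≠ 0) {e : ℕ}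
    (he : (p - 1) * padicValNat p k + e ≤ k - 1) :
    lam p s ζ ^ (k - 1) / (k : K) ∈ mulSub (levelRing p s ζ 1) (lam p s ζ ^ e) := by
  obtain ⟨r, hr, h⟩ := lam_pow hζ hs
  have hl : lam p s ζ ∈ levelRing p s ζ 1 := lam_mem le_rfl hs
  set w := lam p s ζ ^ (p - 1) / (p : K) with hw
  have hwm : w ∈ levelRing p s ζ 1 := by
    rw [h]; exact add_mem (neg_mem (one_mem _)) (mul_mem hl hr)
  obtain ⟨m, hm⟩ := pow_padicValNat_dvd (p := p) (n := k)
  have hpm : ¬ p ∣ m := fun hd => by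
    refine pow_succ_padicValNat_not_dvd (p := p) hk ?_
    rw [pow_succ]
    conv_rhs => rw [hm]
    exact mul_dvd_mul_left _ hd
  obtain ⟨f, hf⟩ := Nat.exists_eq_add_of_le he
  have hp0 : (p : K) ≠ 0 := by exact_mod_cast hp.out.ne_zero
  have hm0 : (m : K) ≠ 0 := by
    refine Nat.cast_ne_zero.2 fun h0 => hpm (by rw [h0]; exact dvd_zero _)
  have hinv : (m : K)⁻¹ ∈ levelRing p s ζ 1 := by
    have := ratio_mem_levelRing (p := p) (s := s) (ζ := ζ) 1 1 m (by exact_mod_cast hpm)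
    simpa using this
  refine mem_mulSub.2 ⟨lam p s ζ ^ f * w ^ padicValNat p k * (m : K)⁻¹,
    mul_mem (mul_mem (pow_mem hl _) (pow_mem hwm _)) hinv, ?_⟩
  have hkm : (k : K) = (p : K) ^ padicValNat p k * m := by exact_mod_cast hm
  rw [hkm, hf, hw, div_pow, ← pow_mul, pow_add, pow_add]
  field_simp

theorem ellS_lam_tendsZero (hs : 1 ≤ s) (hζ : IsPrimitiveRoot ζ (p ^ s)) :
    TendsZero (levelRing p s ζ s) (ζ - 1) (ellS (lam p s ζ)) := by
  intro N
  obtain ⟨M, hM⟩ := exists_forall_sub_one_mul_val_le (p := p) N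
  refine ⟨M + 1, fun k hk => ?_⟩
  rw [ellS, coeff_mk, if_neg (by omega)]
  have h := lam_pow_div_mem hs hζ k (by omega) (hM k (by omega))
  obtain ⟨r, hr, h⟩ := mem_mulSub.1 h
  obtain ⟨t, ht, h'⟩ := mem_mulSub.1 (pi_mem_mulSub (p := p) (ζ := ζ) hs)
  have hr' := levelRing_mono (p := p) (ζ := ζ) hs le_rfl hr
  rw [mul_div_assoc, h]
  refine mem_mulSub.2 ⟨(-1) ^ (k + 1) * (t ^ N * r),
    mul_mem (pow_mem (neg_mem (one_mem _)) _) (mul_mem (pow_mem ht _) hr'), ?_⟩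
  rw [lam, h', mul_pow]; ring

/-- Only the terms of degree 1 and p survive modulo λ, and the latter has coefficient
(-1)^{p+1}λ^{p-1}/p ≡ -1. The Artin-Schreier operator appears here. -/
theorem ellS_lam_eq (hs : 1 ≤ s) (hζ : IsPrimitiveRoot ζ (p ^ s)) :
    ∃ D ∈ seriesOver (levelRing p s ζ 1), ellS (lam p s ζ) = X - X ^ p + C (lam p s ζ) * D := by
  have hl0 : lam p s ζ ≠ 0 := pi_ne_zero hζ le_rfl hs
  have hp1 := hp.out.one_lt
  suffices h : ∀ k, coeff k (ellS (lam p s ζ) - (X - X ^ p)) ∈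
      mulSub (levelRing p s ζ 1) (lam p s ζ) by
    choose r hr h using fun k => mem_mulSub.1 (h k)
    refine ⟨PowerSeries.mk r, mem_seriesOver.2 fun n => by rw [coeff_mk]; exact hr n, ?_⟩
    rw [← sub_eq_iff_eq_add']
    ext k
    rw [h, coeff_C_mul, coeff_mk]
  intro k
  rw [map_sub, map_sub, ellS, coeff_mk, coeff_X, coeff_X_pow]
  by_cases h0 : k = 0
  · subst h0
    rw [if_pos rfl, if_neg zero_ne_one, if_neg hp.out.ne_zero.symm]
    simp [zero_mem]
  by_cases h1 : k = 1
  · subst h1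
    rw [if_neg one_ne_zero, if_pos rfl, if_neg hp1.ne]
    simp [zero_mem]
  rw [if_neg h0, if_neg h1]
  by_cases h2 : k = p
  · subst h2
    rw [if_pos rfl]
    obtain ⟨r, hr, h⟩ := lam_pow hζ hs
    rw [mul_div_assoc, h]
    -- For p = 2 the sign (-1)^{p+1} is -1, which is harmless since λ = -2 and 1 ≡ -1.
    rcases hp.out.eq_two_or_odd' with h2 | h2
    · subst h2
      have hl : lam 2 s ζ = -2 := by
        have := (zetaLevel_prim (p := 2) hζ hs)
        rw [pow_one] at this
        rw [lam, IsPrimitiveRoot.eq_neg_one_of_two_right this]; norm_num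
      refine mem_mulSub.2 ⟨-1 - r, sub_mem (neg_mem (one_mem _)) hr, ?_⟩
      rw [hl]; ring
    · refine mem_mulSub.2 ⟨r, hr, ?_⟩
      rw [h2.add_one.neg_one_pow]; ring
  · rw [if_neg h2, sub_zero, sub_zero, mul_div_assoc]
    have h := lam_pow_div_mem hs hζ k h0 (sub_one_mul_val_lt (p := p) (k := k) (by omega) h2)
    rw [pow_one] at h
    exact mul_mem_mulSub' (pow_mem (neg_mem (one_mem _)) _) h

theorem p_pow_div_mem (i k : ℕ) {m : ℕ} (hm : m ≠ 0)
    (h : padicValNat p m ≤ k - 1) : (p : K) ^ (k - 1) / (m : K) ∈ levelRing p s ζ i := by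
  obtain ⟨c, hc⟩ := pow_padicValNat_dvd (p := p) (n := m)
  have hpm : ¬ p ∣ c := fun hd => by
    refine pow_succ_padicValNat_not_dvd (p := p) hm ?_
    rw [pow_succ]
    conv_rhs => rw [hc]
    exact mul_dvd_mul_left _ hd
  have hp0 : (p : K) ≠ 0 := by exact_mod_cast hp.out.ne_zero
  have hc0 : (c : K) ≠ 0 := by
    refine Nat.cast_ne_zero.2 fun h0 => hpm (by rw [h0]; exact dvd_zero _)
  obtain ⟨f, hf⟩ := Nat.exists_eq_add_of_le h
  have := ratio_mem_levelRing (p := p) (s := s) (ζ := ζ) i ((p : ℤ) ^ f) c (by exact_mod_cast hpm)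
  have hkm : (m : K) = (p : K) ^ padicValNat p m * c := by exact_mod_cast hc
  convert this using 1
  rw [hkm, hf, pow_add]
  push_cast
  field_simp

theorem padicValNat_le_pred {k : ℕ} (hk : k ≠ 0) : padicValNat p k ≤ k - 1 := by
  have hle := Nat.le_of_dvd (by omega) (pow_padicValNat_dvd (p := p) (n := k))
  have := (Nat.lt_pow_self hp.out.one_lt (n := padicValNat p k)).trans_le hle
  omega

theorem padicValNat_factorial_le_pred {k : ℕ} (hk : k ≠ 0) : padicValNat p k.factorial ≤ k - 1 := by
  have h1 := sub_one_mul_padicValNat_factorial_lt_of_ne_zero p hk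
  have h2 := Nat.le_mul_of_pos_left (padicValNat p k.factorial) (Nat.sub_pos_of_lt hp.out.one_lt)
  omega

theorem ellS_p_lam_coeff (k : ℕ) :
    coeff k (ellS ((p : K) * lam p s ζ)) ∈ mulSub (levelRing p s ζ 1) (lam p s ζ ^ (k - 1)) := by
  rw [ellS, coeff_mk]
  split_ifs with h0
  · exact zero_mem _
  · have h := p_pow_div_mem (p := p) (s := s) (K := K) (ζ := ζ) 1 k h0 (padicValNat_le_pred h0)
    refine mem_mulSub.2 ⟨(-1) ^ (k + 1) * ((p : K) ^ (k - 1) / (k : K)),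
      mul_mem (pow_mem (neg_mem (one_mem _)) _) h, ?_⟩
    rw [mul_pow]; ring

theorem tendsZero_of_lam_pow (hs : 1 ≤ s) {f : PowerSeries K}
    (hf : ∀ k, coeff k f ∈ mulSub (levelRing p s ζ 1) (lam p s ζ ^ (k - 1))) :
    TendsZero (levelRing p s ζ s) (ζ - 1) f := by
  intro N
  refine ⟨N + 1, fun k hk => ?_⟩
  obtain ⟨r, hr, h⟩ := mem_mulSub.1 (hf k)
  obtain ⟨t, ht, h'⟩ := mem_mulSub.1 (pi_mem_mulSub (p := p) (ζ := ζ) hs)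
  have hr' := levelRing_mono (p := p) (ζ := ζ) hs le_rfl hr
  refine mulSub_pow_mono pi_self_mem (show N ≤ k - 1 by omega) (mem_mulSub.2
    ⟨t ^ (k - 1) * r, mul_mem (pow_mem ht _) hr', ?_⟩)
  rw [h, lam, h', mul_pow]; ring

theorem exists_eq_X_add_lam_mul (hs : 1 ≤ s) {f : PowerSeries K} (h0 : coeff 0 f = 0)
    (h1 : coeff 1 f = 1)
    (hf : ∀ k, coeff k f ∈ mulSub (levelRing p s ζ 1) (lam p s ζ ^ (k - 1))) :
    ∃ D ∈ seriesOver (levelRing p s ζ 1), f = X + C (lam p s ζ) * D := by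
  have hl : lam p s ζ ∈ levelRing p s ζ 1 := lam_mem le_rfl hs
  choose r hr h using fun k => mem_mulSub.1 (hf k)
  refine ⟨PowerSeries.mk fun k => if k ≤ 1 then 0 else lam p s ζ ^ (k - 2) * r k,
    mem_seriesOver.2 fun n => ?_, ?_⟩
  · rw [coeff_mk]
    split_ifs
    · exact zero_mem _
    · exact mul_mem (pow_mem hl _) (hr n)
  · ext k
    rw [map_add, coeff_C_mul, coeff_mk, coeff_X]
    rcases k with _ | _ | k
    · rw [h0]; simp
    · rw [zero_add, h1]; simp
    · rw [if_neg (by omega), if_neg (by omega), h, zero_add, show k + 1 + 1 - 2 = k by omega,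
        show k + 1 + 1 - 1 = k + 1 by omega]
      ring

/-- Now p^{k-1}/k is already integral and λ^{k-1} is left over, so no term of degree p survives. -/
theorem ellS_p_lam_eq (hs : 1 ≤ s) : ∃ D ∈ seriesOver (levelRing p s ζ 1),
    ellS ((p : K) * lam p s ζ) = X + C (lam p s ζ) * D :=
  exists_eq_X_add_lam_mul hs (by simp [ellS]) (by simp [ellS]) ellS_p_lam_coeff

/-- The power series `(exp (c T) - 1) / c`. -/
def expSubOneDiv (c : K) : PowerSeries K :=
  PowerSeries.mk fun k => if k = 0 then 0 else c ^ (k - 1) / (k.factorial : K)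

theorem exp_subst_C_mul (c : K) {τ : Type*} {t : MvPowerSeries τ K} (ht : HasSubst t) :
    (exp K).subst (MvPowerSeries.C c * t) = 1 + MvPowerSeries.C c * (expSubOneDiv c).subst t := by
  have h1 : rescale c (exp K) = 1 + C c * expSubOneDiv c := by
    ext k
    rw [coeff_rescale, map_add, coeff_C_mul, expSubOneDiv, coeff_mk, coeff_one, coeff_exp]
    rcases k with _ | k
    · simp
    · simp only [Nat.add_eq_zero_iff, one_ne_zero, and_false, if_false, zero_add,
        Nat.add_sub_cancel]
      rw [map_div₀, map_one, map_natCast, pow_succ]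
      ring
  have h2 := subst_comp_subst_apply (R := K) (HasSubst.smul_X' (R := K) c) ht (exp K)
  have h3 : (c • (X : PowerSeries K)).subst t = MvPowerSeries.C c * t := by
    rw [subst_smul ht, subst_X ht, MvPowerSeries.smul_eq_C_mul]
  rw [← h3, ← h2, ← rescale_eq_subst, h1, ← coe_substAlgHom ht, map_add, map_mul, map_one,
    coe_substAlgHom, subst_C]

theorem expSubOneDiv_p_lam_coeff (k : ℕ) : coeff k (expSubOneDiv ((p : K) * lam p s ζ))
    ∈ mulSub (levelRing p s ζ 1) (lam p s ζ ^ (k - 1)) := by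
  rw [expSubOneDiv, coeff_mk]
  split_ifs with h0
  · exact zero_mem _
  · have h := p_pow_div_mem (p := p) (s := s) (K := K) (ζ := ζ) 1 k k.factorial_ne_zero
      (padicValNat_factorial_le_pred h0)
    refine mem_mulSub.2 ⟨_, h, ?_⟩
    rw [mul_pow]; ring

theorem expSubOneDiv_p_lam_eq (hs : 1 ≤ s) : ∃ D ∈ seriesOver (levelRing p s ζ 1),
    expSubOneDiv ((p : K) * lam p s ζ) = X + C (lam p s ζ) * D :=
  exists_eq_X_add_lam_mul hs (by simp [expSubOneDiv]) (by simp [expSubOneDiv])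
    expSubOneDiv_p_lam_coeff

end LogSeries

/-! ### Witt vectors: leading differences and the components of ℘. -/

section WittFacts

variable {p : ℕ} [hp : Fact p.Prime] {A B : Type*} [CommRing A] [CommRing B]

theorem truncate_eq_iff {n : ℕ} {x y : WittVector p A} :
    WittVector.truncate n x = WittVector.truncate n y ↔ ∀ i < n, x.coeff i = y.coeff i := by
  constructor
  · intro h i hi
    have := congrArg (fun z => z.coeff ⟨i, hi⟩) h
    simpa only [WittVector.coeff_truncate] using this
  · intro h
    refine TruncatedWittVector.ext fun i => ?_
    rw [WittVector.coeff_truncate, WittVector.coeff_truncate]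
    exact h i i.2

theorem sub_coeff_eq_zero {n : ℕ} {x y : WittVector p A} (h : ∀ i < n, x.coeff i = y.coeff i)
    {i : ℕ} (hi : i < n) : (x - y).coeff i = 0 := by
  have h1 : WittVector.truncate n (x - y) = WittVector.truncate n (0 : WittVector p A) := by
    rw [map_sub, truncate_eq_iff.2 h, sub_self, map_zero]
  rw [truncate_eq_iff.1 h1 i hi, WittVector.zero_coeff]

/-- The difference of two vectors agreeing below n is V^n of a difference, and the zeroth component
is additive. -/
theorem sub_coeff_of_agree {n : ℕ} {x y : WittVector p A}
    (h : ∀ i < n, x.coeff i = y.coeff i) : (x - y).coeff n = x.coeff n - y.coeff n := by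
  have key : ∀ z : WittVector p A, ∃ w : WittVector p A, w.coeff 0 = z.coeff n ∧
      z = WittVector.init n z + (WittVector.verschiebung)^[n] w := by
    intro z
    have hz : ∀ i < n, (WittVector.tail n z).coeff i = 0 := by
      intro i hi
      simp [WittVector.tail, WittVector.select, WittVector.coeff_mk, hi]
    refine ⟨(WittVector.tail n z).shift n, ?_, ?_⟩
    · rw [WittVector.shift_coeff]
      simp [WittVector.tail, WittVector.select, WittVector.coeff_mk]
    · rw [← WittVector.eq_iterate_verschiebung hz, WittVector.init_add_tail]
  have hinit : WittVector.init n x = WittVector.init n y := by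
    ext i
    simp only [WittVector.init, WittVector.select, WittVector.coeff_mk]
    split_ifs with hi
    · exact h i hi
    · rfl
  obtain ⟨w, hw, hx⟩ := key x
  obtain ⟨v, hv, hy⟩ := key y
  have : x - y = (WittVector.verschiebung)^[n] (w - v) := by
    rw [iterate_map_sub]
    calc x - y = (WittVector.init n x + (WittVector.verschiebung)^[n] w) -
          (WittVector.init n y + (WittVector.verschiebung)^[n] v) := by rw [← hx, ← hy]
      _ = _ := by rw [hinit, add_sub_add_left_eq_sub]
  rw [this]
  have h2 := WittVector.iterate_verschiebung_coeff (w - v) n 0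
  rw [zero_add] at h2
  rw [h2, ← hw, ← hv]
  exact map_sub (WittVector.constantCoeff (p := p) (R := A)) w v

theorem map_mk (φ : A →+* B) (c : ℕ → A) :
    WittVector.map φ (WittVector.mk p c) = WittVector.mk p fun j => φ (c j) := by
  ext i; rw [WittVector.map_coeff, WittVector.coeff_mk, WittVector.coeff_mk]

/-- Witt vectors with coefficients in a subring. -/
def wittOver (p : ℕ) [Fact p.Prime] (S : Subring A) : Subring (WittVector p A) :=
  (WittVector.map S.subtype).range

theorem mem_wittOver {S : Subring A} {x : WittVector p A} :
    x ∈ wittOver p S ↔ ∀ i, x.coeff i ∈ S := by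
  constructor
  · rintro ⟨y, rfl⟩ i
    rw [WittVector.map_coeff]; exact (y.coeff i).2
  · intro h
    exact ⟨WittVector.mk p fun i => ⟨x.coeff i, h i⟩, by
      ext i; rw [WittVector.map_coeff, WittVector.coeff_mk]; rfl⟩

theorem cut_apply_lt {M : Type*} [Zero M] {i j : ℕ} (a : ℕ → M) (h : j < i) : cut i a j = a j :=
  if_pos h

theorem cut_apply_ge {M : Type*} [Zero M] {i j : ℕ} (a : ℕ → M) (h : i ≤ j) : cut i a j = 0 :=
  if_neg (not_lt.2 h)

theorem cut_congr {M : Type*} [Zero M] {i : ℕ} {a a' : ℕ → M} (h : ∀ j < i, a j = a' j) :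
    cut i a = cut i a' := by
  funext j
  unfold cut
  split_ifs with hj
  · exact h j hj
  · rfl

/-- The components of `℘` for sequences. -/
def wpSeq (p : ℕ) [Fact p.Prime] (c : ℕ → A) (i : ℕ) : A :=
  (WittVector.mk p c - WittVector.frobenius (WittVector.mk p c)).coeff i

theorem wp_eq_wpSeq {s : ℕ} (a : Fin s → A) (i : Fin s) :
    wp p s a i = wpSeq p (extendZero a) i := rfl

variable [CharP A p] [CharP B p]

theorem map_frobenius_of_charP (φ : A →+* B) (x : WittVector p A) :
    WittVector.map φ (WittVector.frobenius x) = WittVector.frobenius (WittVector.map φ x) := by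
  ext i
  rw [WittVector.map_coeff, WittVector.coeff_frobenius_charP, WittVector.coeff_frobenius_charP,
    WittVector.map_coeff, map_pow]

theorem map_wpSeq (φ : A →+* B) (c : ℕ → A) (i : ℕ) :
    φ (wpSeq p c i) = wpSeq p (fun j => φ (c j)) i := by
  rw [wpSeq, wpSeq, ← WittVector.map_coeff φ, map_sub, map_frobenius_of_charP, map_mk]

theorem map_wp {s : ℕ} (φ : A →+* B) (c : Fin s → A) (i : Fin s) :
    φ (wp p s c i) = wp p s (fun j => φ (c j)) i := by
  rw [wp_eq_wpSeq, map_wpSeq, wp_eq_wpSeq]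
  congr 1
  funext j
  unfold extendZero
  split_ifs
  · rfl
  · exact map_zero φ

theorem wpSeq_congr {c c' : ℕ → A} {i : ℕ} (h : ∀ j ≤ i, c j = c' j) :
    wpSeq p c i = wpSeq p c' i := by
  have h1 : ∀ j < i + 1, (WittVector.mk p c).coeff j = (WittVector.mk p c').coeff j :=
    fun j hj => by rw [WittVector.coeff_mk, WittVector.coeff_mk]; exact h j (Nat.lt_succ_iff.1 hj)
  have h2 : WittVector.truncate (i + 1) (WittVector.mk p c - WittVector.frobenius
      (WittVector.mk p c)) = WittVector.truncate (i + 1) (WittVector.mk p c' -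
        WittVector.frobenius (WittVector.mk p c')) := by
    rw [map_sub, map_sub, truncate_eq_iff.2 h1]
    congr 1
    rw [truncate_eq_iff]
    intro j hj
    rw [WittVector.coeff_frobenius_charP, WittVector.coeff_frobenius_charP, h1 j hj]
  exact truncate_eq_iff.1 h2 i i.lt_succ_self

/-- With x the vector and y its cut, ℘x - ℘y = (x - y) - (Fx - Fy), where each difference has its
first possible nonzero component at i. There Witt subtraction is ordinary subtraction. -/
theorem wpSeq_eq_cut (c : ℕ → A) (i : ℕ) :
    wpSeq p c i = wpSeq p (cut i c) i + (c i - c i ^ p) := by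
  set x := WittVector.mk p c
  set y := WittVector.mk p (cut i c)
  have h1 : ∀ j < i, x.coeff j = y.coeff j := fun j hj => by
    rw [WittVector.coeff_mk, WittVector.coeff_mk, cut_apply_lt c hj]
  have h2 : ∀ j < i, (WittVector.frobenius x).coeff j = (WittVector.frobenius y).coeff j :=
    fun j hj => by
      rw [WittVector.coeff_frobenius_charP, WittVector.coeff_frobenius_charP, h1 j hj]
  have h3 : ∀ j < i, (x - WittVector.frobenius x).coeff j = (y - WittVector.frobenius y).coeff j := by
    rw [← truncate_eq_iff, map_sub, map_sub, truncate_eq_iff.2 h1, truncate_eq_iff.2 h2]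
  have h4 := sub_coeff_of_agree h3
  have h5 : ∀ j < i, (x - y).coeff j = (WittVector.frobenius x - WittVector.frobenius y).coeff j :=
    fun j hj => by rw [sub_coeff_eq_zero h1 hj, sub_coeff_eq_zero h2 hj]
  have h6 := sub_coeff_of_agree h5
  rw [sub_coeff_of_agree h1, sub_coeff_of_agree h2, WittVector.coeff_frobenius_charP,
    WittVector.coeff_frobenius_charP] at h6
  have h7 : x.coeff i = c i := by rw [WittVector.coeff_mk]
  have h8 : y.coeff i = 0 := by rw [WittVector.coeff_mk, cut_apply_ge c le_rfl]
  rw [h7, h8, zero_pow hp.out.ne_zero, sub_zero, sub_zero] at h6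
  have h9 : x - WittVector.frobenius x - (y - WittVector.frobenius y) =
    x - y - (WittVector.frobenius x - WittVector.frobenius y) := by abel
  rw [h9, h6] at h4
  change (x - WittVector.frobenius x).coeff i = (y - WittVector.frobenius y).coeff i + _
  rw [h4]; ring

theorem wpSeq_mem {S : Subring A} {c : ℕ → A} {i : ℕ} (h : ∀ j ≤ i, c j ∈ S) :
    wpSeq p c i ∈ S := by
  rw [wpSeq_congr (c' := cut (i + 1) c) fun j hj => (cut_apply_lt c (Nat.lt_succ_of_le hj)).symm]
  have hx : WittVector.mk p (cut (i + 1) c) ∈ wittOver p S := mem_wittOver.2 fun j => by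
    rw [WittVector.coeff_mk, cut]
    split_ifs with hj
    · exact h j (Nat.lt_succ_iff.1 hj)
    · exact zero_mem _
  have hF : WittVector.frobenius (WittVector.mk p (cut (i + 1) c)) ∈ wittOver p S :=
    mem_wittOver.2 fun j => by
      rw [WittVector.coeff_frobenius_charP]
      exact pow_mem (mem_wittOver.1 hx j) p
  exact mem_wittOver.1 (sub_mem hx hF) i

end WittFacts

/-! ### E_{n,p} and G_{n,p} on Witt vectors. -/

section WittExp

variable {p s : ℕ} [hp : Fact p.Prime] {K : Type*} [Field K] [CharZero K] {ζ : K} {σ : Type*}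

open PowerSeries

theorem ghostComponent_eq (a : ℕ → MvPowerSeries σ K) (m : ℕ) :
    WittVector.ghostComponent m (WittVector.mk p a) =
      ∑ j ∈ Finset.range (m + 1), (p : MvPowerSeries σ K) ^ j * a j ^ p ^ (m - j) := by
  rw [WittVector.ghostComponent_apply, aeval_wittPolynomial]
  rfl

theorem constantCoeff_ghostComponent {x : WittVector p (MvPowerSeries σ K)}
    (hx : ∀ j, MvPowerSeries.constantCoeff (x.coeff j) = 0) (m : ℕ) :
    MvPowerSeries.constantCoeff (WittVector.ghostComponent m x) = 0 := by
  have h : x = WittVector.mk p x.coeff := by ext; rw [WittVector.coeff_mk]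
  rw [h, ghostComponent_eq, map_sum]
  refine Finset.sum_eq_zero fun j _ => ?_
  rw [map_mul, map_pow, map_pow, hx, zero_pow (pow_ne_zero _ hp.out.ne_zero), mul_zero]

/-- In ∑_j ∑_i (ζ_{p^{n-j-i}} - 1) a_j^{p^i}/p^i the terms with i + j = m add up to a multiple of
the m-th ghost component. Ghost components are additive, so E_{n,p} is multiplicative. -/
theorem EWitt_eq_exp (n : ℕ) {x : WittVector p (MvPowerSeries σ K)}
    (hx : ∀ j, MvPowerSeries.constantCoeff (x.coeff j) = 0) :
    EWitt p s ζ n x.coeff = (exp K).subst (∑ m ∈ Finset.range n,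
      MvPowerSeries.C ((zetaLevel p s ζ (n - m) - 1) / (p : K) ^ m) *
        WittVector.ghostComponent m x) := by
  have hc : ∀ (c : K) (j i : ℕ), HasSubst (MvPowerSeries.C c * x.coeff j ^ p ^ i) := fun c j i =>
    HasSubst.of_constantCoeff_zero (by
      rw [map_mul, map_pow, hx, zero_pow (pow_ne_zero _ hp.out.ne_zero), mul_zero])
  simp only [EWitt, artinHasse]
  rw [← exp_subst_sum _ fun j _ => HasSubst.sum _ fun i _ => hc _ _ _]
  congr 1
  have h : x = WittVector.mk p x.coeff := by ext; rw [WittVector.coeff_mk]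
  have hp0 : (p : K) ≠ 0 := by exact_mod_cast hp.out.ne_zero
  have h2 : ∀ m ∈ Finset.range n, MvPowerSeries.C ((zetaLevel p s ζ (n - m) - 1) / (p : K) ^ m) *
        WittVector.ghostComponent m x = ∑ j ∈ Finset.range (m + 1),
        MvPowerSeries.C ((zetaLevel p s ζ (n - m) - 1) / (p : K) ^ (m - j)) *
          x.coeff j ^ p ^ (m - j) := by
    intro m _
    conv_lhs => rw [h, ghostComponent_eq, Finset.mul_sum]
    refine Finset.sum_congr rfl fun j hj => ?_
    have hjm : j ≤ m := Nat.lt_succ_iff.1 (Finset.mem_range.1 hj)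
    rw [← mul_assoc, ← map_natCast (MvPowerSeries.C (R := K) (σ := σ)),
      ← map_pow, ← map_mul]
    congr 2
    rw [show (p : K) ^ m = (p : K) ^ (m - j) * (p : K) ^ j by
      rw [← pow_add, Nat.sub_add_cancel hjm]]
    field_simp
  rw [Finset.sum_congr rfl h2, Finset.sum_sigma', Finset.sum_sigma']
  refine Finset.sum_bij' (fun z _ => ⟨z.1 + z.2, z.1⟩) (fun z _ => ⟨z.2, z.1 - z.2⟩) ?_ ?_ ?_ ?_ ?_
  · rintro ⟨j, i⟩ h; simp at h ⊢; omega
  · rintro ⟨m, j⟩ h; simp at h ⊢; omega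
  · rintro ⟨j, i⟩ h; simp
  · rintro ⟨m, j⟩ h; simp at h ⊢; omega
  · rintro ⟨j, i⟩ h
    simp only [Nat.add_sub_cancel_left, Nat.sub_sub]

theorem hasSubst_ghost_sum (n : ℕ) {x : WittVector p (MvPowerSeries σ K)}
    (hx : ∀ j, MvPowerSeries.constantCoeff (x.coeff j) = 0) (c : ℕ → K) :
    HasSubst (∑ m ∈ Finset.range n, MvPowerSeries.C (c m) * WittVector.ghostComponent m x) :=
  HasSubst.sum _ fun m _ => HasSubst.of_constantCoeff_zero (by
    rw [map_mul, constantCoeff_ghostComponent hx, mul_zero])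

theorem constantCoeff_add_coeff {x y : WittVector p (MvPowerSeries σ K)}
    (hx : ∀ j, MvPowerSeries.constantCoeff (x.coeff j) = 0)
    (hy : ∀ j, MvPowerSeries.constantCoeff (y.coeff j) = 0) (j : ℕ) :
    MvPowerSeries.constantCoeff ((x + y).coeff j) = 0 := by
  have hx' : WittVector.map (MvPowerSeries.constantCoeff (σ := σ) (R := K)) x = 0 := by
    ext i; rw [WittVector.map_coeff, hx, WittVector.zero_coeff]
  have hy' : WittVector.map (MvPowerSeries.constantCoeff (σ := σ) (R := K)) y = 0 := by
    ext i; rw [WittVector.map_coeff, hy, WittVector.zero_coeff]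
  rw [← WittVector.map_coeff, map_add, hx', hy', add_zero, WittVector.zero_coeff]

theorem constantCoeff_neg_coeff {x : WittVector p (MvPowerSeries σ K)}
    (hx : ∀ j, MvPowerSeries.constantCoeff (x.coeff j) = 0) (j : ℕ) :
    MvPowerSeries.constantCoeff ((-x).coeff j) = 0 := by
  have hx' : WittVector.map (MvPowerSeries.constantCoeff (σ := σ) (R := K)) x = 0 := by
    ext i; rw [WittVector.map_coeff, hx, WittVector.zero_coeff]
  rw [← WittVector.map_coeff, map_neg, hx', neg_zero, WittVector.zero_coeff]

theorem EWitt_add (n : ℕ) {x y : WittVector p (MvPowerSeries σ K)}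
    (hx : ∀ j, MvPowerSeries.constantCoeff (x.coeff j) = 0)
    (hy : ∀ j, MvPowerSeries.constantCoeff (y.coeff j) = 0) :
    EWitt p s ζ n (x + y).coeff = EWitt p s ζ n x.coeff * EWitt p s ζ n y.coeff := by
  rw [EWitt_eq_exp n hx, EWitt_eq_exp n hy, EWitt_eq_exp n (constantCoeff_add_coeff hx hy),
    ← exp_subst_add (hasSubst_ghost_sum n hx _) (hasSubst_ghost_sum n hy _)]
  congr 1
  rw [← Finset.sum_add_distrib]
  exact Finset.sum_congr rfl fun m _ => by rw [map_add, mul_add]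

theorem constantCoeff_artinHasse (n : ℕ) {t : MvPowerSeries σ K}
    (ht : MvPowerSeries.constantCoeff t = 0) :
    MvPowerSeries.constantCoeff (artinHasse p s ζ n t) = 1 := by
  refine constantCoeff_exp_subst ?_
  rw [map_sum]
  refine Finset.sum_eq_zero fun i _ => ?_
  rw [map_mul, map_pow, ht, zero_pow (pow_ne_zero _ hp.out.ne_zero), mul_zero]

theorem constantCoeff_EWitt (n : ℕ) {a : ℕ → MvPowerSeries σ K}
    (ha : ∀ j, MvPowerSeries.constantCoeff (a j) = 0) :
    MvPowerSeries.constantCoeff (EWitt p s ζ n a) = 1 := by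
  rw [EWitt, map_prod]
  exact Finset.prod_eq_one fun j _ => constantCoeff_artinHasse _ (ha j)

theorem EWitt_nsmul (n : ℕ) {x : WittVector p (MvPowerSeries σ K)}
    (hx : ∀ j, MvPowerSeries.constantCoeff (x.coeff j) = 0) (k : ℕ) :
    (∀ j, MvPowerSeries.constantCoeff ((k • x).coeff j) = 0) ∧
    EWitt p s ζ n (k • x).coeff = EWitt p s ζ n x.coeff ^ k := by
  induction k with
  | zero =>
    have h0 : ∀ j, MvPowerSeries.constantCoeff (R := K) (σ := σ)
        ((0 : WittVector p (MvPowerSeries σ K)).coeff j) = 0 := fun j => by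
      rw [WittVector.zero_coeff, map_zero]
    rw [zero_smul, pow_zero]
    refine ⟨h0, ?_⟩
    have h1 := EWitt_add (p := p) (s := s) (ζ := ζ) n h0 h0
    rw [add_zero] at h1
    have h2 : EWitt p s ζ n (0 : WittVector p (MvPowerSeries σ K)).coeff ≠ 0 := fun h => by
      have := constantCoeff_EWitt (p := p) (s := s) (ζ := ζ) n h0
      rw [h, map_zero] at this
      exact zero_ne_one this
    exact mul_left_cancel₀ h2 (by rw [← h1, mul_one])
  | succ k ih =>
    rw [succ_nsmul]
    exact ⟨constantCoeff_add_coeff ih.1 hx, by rw [EWitt_add n ih.1 hx, ih.2, pow_succ]⟩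

/-- The last component contributes only E_{1,p} = exp(λ ·), so it can be solved for once the earlier
ones are known. -/
theorem EWitt_succ_cut (n : ℕ) (a : ℕ → MvPowerSeries σ K) :
    EWitt p s ζ (n + 1) a = EWitt p s ζ (n + 1) (cut n a) * artinHasse p s ζ 1 (a n) := by
  have h0 : artinHasse p s ζ 1 (0 : MvPowerSeries σ K) = 1 := by
    rw [artinHasse, Finset.sum_eq_zero, exp_subst_zero]
    intro i _
    rw [zero_pow (pow_ne_zero _ hp.out.ne_zero), mul_zero]
  rw [EWitt, EWitt, Finset.prod_range_succ, Finset.prod_range_succ, cut_apply_ge a le_rfl,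
    Nat.add_sub_cancel_left, h0, mul_one]
  congr 1
  exact Finset.prod_congr rfl fun j hj => by rw [cut_apply_lt a (Finset.mem_range.1 hj)]

theorem artinHasse_one (t : MvPowerSeries σ K) :
    artinHasse p s ζ 1 t = (exp K).subst (MvPowerSeries.C (lam p s ζ) * t) := by
  rw [artinHasse, Finset.sum_range_one, pow_zero, pow_zero, pow_one, div_one, Nat.sub_zero, lam]

theorem EWitt_congr {n : ℕ} {a a' : ℕ → MvPowerSeries σ K} (h : ∀ j < n, a j = a' j) :
    EWitt p s ζ n a = EWitt p s ζ n a' :=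
  Finset.prod_congr rfl fun j hj => by rw [h j (Finset.mem_range.1 hj)]

/-- E_{n,p}(p a) = E_{n,p}(a)^p by multiplicativity. This is the Kummer relation Z_{n-1}^p = Z_{n-2}
u_{n-1} at the level of Witt vectors. -/
theorem GWitt_mul_EWitt (n : ℕ) {a : ℕ → MvPowerSeries σ K}
    (ha : ∀ j, MvPowerSeries.constantCoeff (a j) = 0) :
    GWitt p s ζ n a * EWitt p s ζ (n - 1) a = EWitt p s ζ n a ^ p := by
  have h1 := constantCoeff_EWitt (p := p) (s := s) (ζ := ζ) (n - 1) ha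
  have h2 := (EWitt_nsmul (p := p) (s := s) (ζ := ζ) n (x := WittVector.mk p a)
    (fun j => by rw [WittVector.coeff_mk]; exact ha j) p).2
  rw [WittVector.coeff_mk] at h2
  rw [GWitt, mul_assoc, MvPowerSeries.inv_mul_cancel _ (by rw [h1]; exact one_ne_zero), mul_one]
  exact h2

/-- Each factor is E_{m,p}(T)^p/E_{m-1,p}(T) at one component, because ζ_{p^m}^p = ζ_{p^{m-1}}.
These quotients are restricted, although E_{m,p} need not be. -/
theorem GWitt_eq_prod (hζ : IsPrimitiveRoot ζ (p ^ s)) {n : ℕ} (hn : n ≤ s)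
    {a : ℕ → MvPowerSeries σ K} (ha : ∀ j, MvPowerSeries.constantCoeff (a j) = 0) :
    GWitt p s ζ n a = ∏ j ∈ Finset.range n,
      (expQuotPow p (zetaLevel p s ζ (n - j))).subst (a j) := by
  have hs := fun j => HasSubst.of_constantCoeff_zero (ha j)
  have h1 := constantCoeff_EWitt (p := p) (s := s) (ζ := ζ) (n - 1) ha
  have h0 : EWitt p s ζ (n - 1) a ≠ 0 := fun h => by
    rw [h, map_zero] at h1; exact zero_ne_one h1
  refine mul_right_cancel₀ h0 ?_
  rw [GWitt_mul_EWitt n ha]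
  rcases n with _ | n
  · simp [EWitt]
  -- A trivial factor at ζ_{p^0} = 1 is added so that both products run over the same range.
  have h2 : EWitt p s ζ (n + 1 - 1) a = ∏ j ∈ Finset.range (n + 1),
      (expQuot p (zetaLevel p s ζ (n - j))).subst (a j) := by
    rw [Finset.prod_range_succ, Nat.sub_self, zetaLevel_zero hζ, expQuot_one,
      ← coe_substAlgHom (hs n), map_one, mul_one, Nat.add_sub_cancel, EWitt]
    exact Finset.prod_congr rfl fun j _ => artinHasse_eq_subst hζ (by omega) (ha j)
  rw [h2, EWitt, ← Finset.prod_pow, ← Finset.prod_mul_distrib]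
  refine Finset.prod_congr rfl fun j hj => ?_
  have hj' := Finset.mem_range.1 hj
  rw [artinHasse_eq_subst hζ (by omega) (ha j), ← subst_pow (hs j), expQuot_pow, subst_mul (hs j)]
  have h3 := zetaLevel_pow (p := p) (s := s) (ζ := ζ) (i := n + 1 - j) (j := 1) (by omega) (by omega)
  rw [pow_one] at h3
  rw [h3, show n + 1 - j - 1 = n - j by omega]

theorem expQuotPow_one_subst (hs : 1 ≤ s) (hζ : IsPrimitiveRoot ζ (p ^ s))
    {t : MvPowerSeries σ K} (ht : MvPowerSeries.constantCoeff t = 0) :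
    (expQuotPow p (zetaLevel p s ζ 1)).subst t =
      (exp K).subst (MvPowerSeries.C ((p : K) * lam p s ζ) * t) := by
  have hst := HasSubst.of_constantCoeff_zero ht
  have h3 := zetaLevel_pow (p := p) (s := s) (ζ := ζ) (i := 1) (j := 1) le_rfl hs
  rw [pow_one, Nat.sub_self, zetaLevel_zero hζ] at h3
  have h1 : expQuotPow p (zetaLevel p s ζ 1) = expQuot p (zetaLevel p s ζ 1) ^ p := by
    rw [expQuot_pow, h3, expQuot_one, mul_one]
  rw [h1, subst_pow hst, ← artinHasse_eq_subst hζ hs ht, artinHasse_one, ← exp_subst_nsmul]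
  · congr 1
    rw [nsmul_eq_mul, map_mul, map_natCast, mul_assoc]
  · exact HasSubst.of_constantCoeff_zero (by rw [map_mul, ht, mul_zero])

theorem GWitt_succ_cut (hζ : IsPrimitiveRoot ζ (p ^ s)) {n : ℕ} (hn : n + 1 ≤ s)
    {a : ℕ → MvPowerSeries σ K} (ha : ∀ j, MvPowerSeries.constantCoeff (a j) = 0) :
    GWitt p s ζ (n + 1) a = GWitt p s ζ (n + 1) (cut n a) *
      (exp K).subst (MvPowerSeries.C ((p : K) * lam p s ζ) * a n) := by
  have hc : ∀ j, MvPowerSeries.constantCoeff (cut n a j) = 0 := fun j => by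
    unfold cut; split_ifs
    · exact ha j
    · exact map_zero _
  rw [GWitt_eq_prod hζ hn ha, GWitt_eq_prod hζ hn hc, Finset.prod_range_succ,
    Finset.prod_range_succ, Nat.add_sub_cancel_left, expQuotPow_one_subst (by omega) hζ (ha n),
    expQuotPow_one_subst (by omega) hζ (hc n), cut_apply_ge a le_rfl, mul_zero, exp_subst_zero,
    mul_one]
  congr 1
  exact Finset.prod_congr rfl fun j hj => by rw [cut_apply_lt a (Finset.mem_range.1 hj)]

theorem GWitt_congr (hζ : IsPrimitiveRoot ζ (p ^ s)) {n : ℕ} (hn : n ≤ s)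
    {a a' : ℕ → MvPowerSeries σ K} (ha : ∀ j, MvPowerSeries.constantCoeff (a j) = 0)
    (ha' : ∀ j, MvPowerSeries.constantCoeff (a' j) = 0) (h : ∀ j < n, a j = a' j) :
    GWitt p s ζ n a = GWitt p s ζ n a' := by
  rw [GWitt_eq_prod hζ hn ha, GWitt_eq_prod hζ hn ha']
  exact Finset.prod_congr rfl fun j hj => by rw [h j (Finset.mem_range.1 hj)]

end WittExp

/-! ### Restricted series with coefficients in a given level: substitution, inverses, truncation. -/

section GoodSeries

variable {p s : ℕ} [hp : Fact p.Prime] {K : Type*} [Field K] [NumberField K] {ζ : K}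

variable (p s ζ) in
/-- Restricted power series in the variables of index `< m` with coefficients in
`ℤ_(p)[ζ_{p^n}]`. -/
def goodSub (n m : ℕ) : Subring (MvPowerSeries (Fin s) K) :=
  coeffSub (levelRing p s ζ n) s m ⊓ resSub (levelRing p s ζ s) (ζ - 1) s

theorem goodSub_mono {n n' m m' : ℕ} (hn : n ≤ n') (hn' : n' ≤ s) (hm : m ≤ m')
    {f : MvPowerSeries (Fin s) K} (hf : f ∈ goodSub p s ζ n m) : f ∈ goodSub p s ζ n' m' :=
  ⟨coeffSub_mono (levelRing_mono hn hn') hm hf.1, hf.2⟩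

theorem X_mem_goodSub (n : ℕ) {m : ℕ} {j : Fin s} (h : (j : ℕ) < m) :
    (MvPowerSeries.X j : MvPowerSeries (Fin s) K) ∈ goodSub p s ζ n m :=
  ⟨X_mem_coeffSub _ h, X_mem_resSub _ _ j⟩

theorem mvPolynomial_mem_goodSub {n m : ℕ} (hn : n ≤ s) {f : MvPolynomial (Fin s) K}
    (hf : ∀ k, f.coeff k ∈ levelRing p s ζ n) (hv : ∀ j ∈ f.vars, (j : ℕ) < m) :
    (f : MvPowerSeries (Fin s) K) ∈ goodSub p s ζ n m := by
  refine ⟨fun k => ?_, mvPolynomial_mem_resSub fun k => levelRing_mono hn le_rfl (hf k)⟩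
  rw [MvPolynomial.coeff_coe]
  exact ⟨hf k, fun h j hj => hv j ((MvPolynomial.mem_vars_iff_mem_support j).2
    ⟨k, MvPolynomial.mem_support_iff.2 h, hj⟩)⟩

theorem subst_mem_goodSub (hs : 1 ≤ s) (hζ : IsPrimitiveRoot ζ (p ^ s)) {n m : ℕ} (hn : n ≤ s)
    {f : PowerSeries K} (hf : f ∈ seriesOver (levelRing p s ζ n))
    (hf' : TendsZero (levelRing p s ζ s) (ζ - 1) f) {t : MvPowerSeries (Fin s) K}
    (ht : t ∈ goodSub p s ζ n m) (h0 : MvPowerSeries.constantCoeff t = 0) :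
    f.subst t ∈ goodSub p s ζ n m := by
  have hϖ : ζ - 1 ≠ 0 := by
    have := pi_ne_zero hζ hs le_rfl
    rwa [zetaLevel_self] at this
  exact ⟨subst_mem_coeffSub (mem_seriesOver.1 hf) ht.1 h0, subst_mem_resSub hϖ
    (fun k => levelRing_mono hn le_rfl (mem_seriesOver.1 hf k)) hf' ht.2 h0⟩

/-- The power series `1 + c g` with `g` over `S` in the variables of index `< m`. -/
def mvOneAddMul (S : Subring K) (s : ℕ) (c : K) (m : ℕ) : Set (MvPowerSeries (Fin s) K) :=
  {f | ∃ g ∈ coeffSub S s m, f = 1 + MvPowerSeries.C c * g}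

theorem mul_mem_mvOneAddMul {S : Subring K} {c : K} (hc : c ∈ S) {m : ℕ}
    {f g : MvPowerSeries (Fin s) K} (hf : f ∈ mvOneAddMul S s c m) (hg : g ∈ mvOneAddMul S s c m) :
    f * g ∈ mvOneAddMul S s c m := by
  obtain ⟨f, hf, rfl⟩ := hf
  obtain ⟨g, hg, rfl⟩ := hg
  exact ⟨f + g + MvPowerSeries.C c * (f * g), add_mem (add_mem hf hg)
    (mul_mem (C_mem_coeffSub hc m) (mul_mem hf hg)), by ring⟩

theorem one_mem_mvOneAddMul (S : Subring K) (c : K) (m : ℕ) :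
    (1 : MvPowerSeries (Fin s) K) ∈ mvOneAddMul S s c m := ⟨0, zero_mem _, by simp⟩

theorem prod_mem_mvOneAddMul {S : Subring K} {c : K} (hc : c ∈ S) {m : ℕ} {ι : Type*}
    (I : Finset ι) {f : ι → MvPowerSeries (Fin s) K} (hf : ∀ i ∈ I, f i ∈ mvOneAddMul S s c m) :
    ∏ i ∈ I, f i ∈ mvOneAddMul S s c m :=
  Finset.prod_induction _ (· ∈ mvOneAddMul S s c m) (fun _ _ => mul_mem_mvOneAddMul hc)
    (one_mem_mvOneAddMul S c m) hf

theorem subst_mem_mvOneAddMul {S : Subring K} {c : K} {m : ℕ} {f : PowerSeries K}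
    (hf : f ∈ oneAddMul S c) {t : MvPowerSeries (Fin s) K} (ht : t ∈ coeffSub S s m)
    (h0 : MvPowerSeries.constantCoeff t = 0) : f.subst t ∈ mvOneAddMul S s c m := by
  obtain ⟨g, hg, rfl⟩ := hf
  have hs := PowerSeries.HasSubst.of_constantCoeff_zero h0
  refine ⟨g.subst t, subst_mem_coeffSub (mem_seriesOver.1 hg) ht h0, ?_⟩
  rw [← PowerSeries.coe_substAlgHom hs, map_add, map_mul, map_one, PowerSeries.coe_substAlgHom hs,
    PowerSeries.subst_C]

theorem geom_subst (c : K) {t : MvPowerSeries (Fin s) K} (ht : PowerSeries.HasSubst t) :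
    (1 + MvPowerSeries.C c * t) * (PowerSeries.mk fun k => (-c) ^ k).subst t = 1 := by
  have h1 : (1 + PowerSeries.C c * PowerSeries.X) * (PowerSeries.mk fun k => (-c) ^ k) =
      (1 : PowerSeries K) := by
    ext k
    rw [add_mul, one_mul, mul_assoc, map_add, PowerSeries.coeff_C_mul, PowerSeries.coeff_mk]
    rcases k with _ | k
    · simp
    · rw [PowerSeries.coeff_succ_X_mul, PowerSeries.coeff_mk, PowerSeries.coeff_one,
        if_neg k.succ_ne_zero, pow_succ]
      ring
  have h2 := congrArg (PowerSeries.subst t) h1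
  rw [PowerSeries.subst_mul ht] at h2
  rw [← PowerSeries.coe_substAlgHom ht] at h2
  rw [map_add, map_mul, map_one, PowerSeries.coe_substAlgHom ht, PowerSeries.subst_X ht,
    PowerSeries.subst_C] at h2
  exact h2

theorem levelRing_of_mul (hζ : IsPrimitiveRoot ζ (p ^ s)) {n : ℕ} (hn : 1 ≤ n) (hns : n ≤ s)
    {a c r : K} (ha : a ∈ levelRing p s ζ n) (hc : c ∈ levelRing p s ζ n) (hc0 : c ≠ 0)
    (hr : r ∈ levelRing p s ζ s) (h : a = c * r) : r ∈ levelRing p s ζ n := by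
  have h1 : r = a / c := by rw [h, mul_div_cancel_left₀ _ hc0]
  rw [h1]
  refine levelRing_div hζ hn hns ha hc ?_
  rw [← h1]
  exact normVal_nonneg hζ le_rfl hr

theorem pi_pow_mem_mulSub_pi (hζ : IsPrimitiveRoot ζ (p ^ s)) {n : ℕ} (hn : 1 ≤ n) (hns : n ≤ s) :
    ∃ M, (ζ - 1) ^ M ∈ mulSub (levelRing p s ζ s) (zetaLevel p s ζ n - 1) := by
  obtain ⟨r, hr, h⟩ := pi_pow_dvd (p := p) hζ (le_refl s)
  obtain ⟨t, ht, h'⟩ := p_dvd_pi hζ hn hns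
  rw [zetaLevel_self] at h
  refine ⟨p ^ s, mem_mulSub.2 ⟨t * r, mul_mem (levelRing_mono hns le_rfl ht) hr, ?_⟩⟩
  rw [h, h', mul_assoc]

/-- Write f = 1 + πq. The geometric series in πq has coefficients (-π)^k in q, which tend to zero,
so the inverse stays restricted. -/
theorem exists_inv_mem_goodSub (hζ : IsPrimitiveRoot ζ (p ^ s)) {n m : ℕ} (hn : 1 ≤ n)
    (hns : n ≤ s) {f : MvPowerSeries (Fin s) K} (hf : f ∈ goodSub p s ζ n m)
    (hf1 : f ∈ mvOneAddMul (levelRing p s ζ n) s (zetaLevel p s ζ n - 1) m)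
    (h0 : MvPowerSeries.constantCoeff f = 1) : ∃ g ∈ goodSub p s ζ n m, f * g = 1 := by
  obtain ⟨q, hq, rfl⟩ := hf1
  have hπ0 := pi_ne_zero hζ hn hns
  have hq0 : MvPowerSeries.constantCoeff q = 0 := by
    rw [map_add, map_one, map_mul, MvPowerSeries.constantCoeff_C, add_eq_left] at h0
    exact (mul_eq_zero.1 h0).resolve_left hπ0
  obtain ⟨M, hM⟩ := pi_pow_mem_mulSub_pi hζ hn hns
  have hq1 : q ∈ resSub (levelRing p s ζ s) (ζ - 1) s := by
    refine resSub_of_C_mul hπ0 hM (f := MvPowerSeries.C (zetaLevel p s ζ n - 1) * q) ?_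
      (fun k => levelRing_mono hns le_rfl (hq k).1) rfl
    have := sub_mem hf.2 (one_mem (resSub (levelRing p s ζ s) (ζ - 1) s))
    rwa [add_sub_cancel_left] at this
  refine ⟨_, subst_mem_goodSub (hn.trans hns) hζ hns
    (f := PowerSeries.mk fun k => (-(zetaLevel p s ζ n - 1)) ^ k) ?_ ?_ ⟨hq, hq1⟩ hq0,
    geom_subst _ (PowerSeries.HasSubst.of_constantCoeff_zero hq0)⟩
  · refine mem_seriesOver.2 fun k => ?_
    rw [PowerSeries.coeff_mk]
    exact pow_mem (neg_mem (pi_mem n)) k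
  · intro N
    refine ⟨N, fun k hk => ?_⟩
    rw [PowerSeries.coeff_mk]
    obtain ⟨r, hr, h⟩ := mem_mulSub.1 (pi_mem_mulSub (p := p) (ζ := ζ) hns)
    refine mulSub_pow_mono pi_self_mem hk (mem_mulSub.2 ⟨(-r) ^ k, pow_mem (neg_mem hr) k, ?_⟩)
    rw [h, ← mul_pow]; congr 1; ring

theorem exists_mvPolynomial_of_finite {f : MvPowerSeries (Fin s) K}
    (hf : {n | MvPowerSeries.coeff n f ≠ 0}.Finite) :
    ∃ P : MvPolynomial (Fin s) K, ∀ n, P.coeff n = MvPowerSeries.coeff n f := by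
  classical
  refine ⟨∑ n ∈ hf.toFinset, MvPolynomial.monomial n (MvPowerSeries.coeff n f), fun n => ?_⟩
  rw [MvPolynomial.coeff_sum]
  simp only [MvPolynomial.coeff_monomial]
  rw [Finset.sum_ite_eq']
  split_ifs with h
  · rfl
  · simpa [eq_comm] using h

-- The truncated series f need not be restricted; it is enough that it agrees modulo J with a
-- restricted Q. Then almost all coefficients of f lie in J and the truncation is a polynomial. Used
-- for J generated by pλ(ζ - 1) and by λ.
open scoped Classical in
theorem exists_truncation (hζ : IsPrimitiveRoot ζ (p ^ s)) {n m : ℕ} (hn : 1 ≤ n) (hns : n ≤ s)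
    {c : K} (hc0 : c ≠ 0) (hc : c ∈ levelRing p s ζ n) (J : AddSubgroup K)
    (hJ : ∀ x ∈ J, x ∈ mulSub (levelRing p s ζ s) c) {M : ℕ}
    (hM : ∀ x ∈ mulSub (levelRing p s ζ s) ((ζ - 1) ^ M), x ∈ J)
    {f Q : MvPowerSeries (Fin s) K} (hf : f ∈ coeffSub (levelRing p s ζ n) s m)
    (hQ : Q ∈ goodSub p s ζ n m) (hfQ : ∀ k, MvPowerSeries.coeff k (Q - f) ∈ J) :
    ∃ E : MvPolynomial (Fin s) K, (∀ k, E.coeff k = if MvPowerSeries.coeff k f ∈ J then 0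
        else MvPowerSeries.coeff k f) ∧
      (∀ k, E.coeff k ∈ levelRing p s ζ n) ∧ (∀ j ∈ E.vars, (j : ℕ) < m) ∧
      ∃ D ∈ goodSub p s ζ n m, Q = (E : MvPowerSeries (Fin s) K) + MvPowerSeries.C c * D ∧
        ∀ k, c * MvPowerSeries.coeff k D ∈ J := by
  set e : MvPowerSeries (Fin s) K := fun k => if MvPowerSeries.coeff k f ∈ J then 0
    else MvPowerSeries.coeff k f with he
  have hce : ∀ k, MvPowerSeries.coeff k e = if MvPowerSeries.coeff k f ∈ J then 0
    else MvPowerSeries.coeff k f := fun k => rfl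
  have hfin : {k | MvPowerSeries.coeff k e ≠ 0}.Finite := by
    refine (hQ.2.2 M).subset fun k hk h => hk ?_
    rw [hce, if_pos]
    have := sub_mem (hM _ h) (hfQ k)
    rwa [map_sub, sub_sub_cancel] at this
  obtain ⟨E, hE⟩ := exists_mvPolynomial_of_finite hfin
  have hEc : ∀ k, E.coeff k ∈ levelRing p s ζ n := fun k => by
    rw [hE, hce]; split_ifs
    · exact zero_mem _
    · exact (hf k).1
  have hEv : ∀ j ∈ E.vars, (j : ℕ) < m := by
    intro j hj
    obtain ⟨k, hk, hjk⟩ := (MvPolynomial.mem_vars_iff_mem_support j).1 hj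
    rw [MvPolynomial.mem_support_iff, hE, hce] at hk
    split_ifs at hk with h
    · exact absurd rfl hk
    · exact (hf k).2 hk j hjk
  have hEg := mvPolynomial_mem_goodSub hns hEc hEv
  have hQE := sub_mem hQ hEg
  have hQEJ : ∀ k, MvPowerSeries.coeff k (Q - (E : MvPowerSeries (Fin s) K)) ∈ J := by
    intro k
    have h1 : MvPowerSeries.coeff k (Q - (E : MvPowerSeries (Fin s) K)) = MvPowerSeries.coeff k (Q - f) +
        (MvPowerSeries.coeff k f - MvPowerSeries.coeff k e) := by
      rw [map_sub, map_sub, MvPolynomial.coeff_coe, hE]; ring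
    rw [h1]
    refine add_mem (hfQ k) ?_
    rw [hce]
    split_ifs with h
    · rwa [sub_zero]
    · rw [sub_self]; exact zero_mem _
  have hdiv : ∀ k, MvPowerSeries.coeff k (Q - (E : MvPowerSeries (Fin s) K)) ∈ mulSub (levelRing p s ζ n) c := by
    intro k
    obtain ⟨r, hr, h⟩ := mem_mulSub.1 (hJ _ (hQEJ k))
    exact mem_mulSub.2 ⟨r, levelRing_of_mul hζ hn hns (hQE.1 k).1 hc hc0 hr h, h⟩
  obtain ⟨D, hD, hQD⟩ := coeffSub_div hc0 hQE.1 hdiv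
  have hMc : (ζ - 1) ^ M ∈ mulSub (levelRing p s ζ s) c :=
    hJ _ (hM _ (mem_mulSub.2 ⟨1, one_mem _, (mul_one _).symm⟩))
  refine ⟨E, fun k => by rw [hE, hce], hEc, hEv, D, ⟨hD, resSub_of_C_mul hc0 hMc hQE.2
    (fun k => levelRing_mono hns le_rfl (hD k).1) hQD⟩, by rw [← hQD]; ring, fun k => ?_⟩
  rw [← MvPowerSeries.coeff_C_mul, ← hQD]
  exact hQEJ k

theorem locSub_le_levelRing (i : ℕ) : ∀ q ∈ locSub p, algebraMap ℚ K q ∈ levelRing p s ζ i :=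
  fun _ hq => algebraMap_mem_levelRing i hq

theorem oneAddMul_level {n n' : ℕ} (hn : n ≤ n') (hn' : n' ≤ s) {f : PowerSeries K}
    (hf : f ∈ oneAddMul (levelRing p s ζ n) (zetaLevel p s ζ n - 1)) :
    f ∈ oneAddMul (levelRing p s ζ n') (zetaLevel p s ζ n' - 1) := by
  obtain ⟨g, hg, rfl⟩ := hf
  obtain ⟨r, hr, h⟩ := pi_dvd_pi (p := p) (ζ := ζ) hn hn'
  refine oneAddMul_mono hr ⟨g, mem_seriesOver.2 fun k =>
    levelRing_mono hn hn' (mem_seriesOver.1 hg k), ?_⟩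
  rw [h]

theorem expQuotPow_subst_mem (hs : 1 ≤ s) (hζ : IsPrimitiveRoot ζ (p ^ s)) {n n' m : ℕ}
    (hn : n ≤ n') (hn' : n' ≤ s) {t : MvPowerSeries (Fin s) K} (ht : t ∈ goodSub p s ζ n' m)
    (h0 : MvPowerSeries.constantCoeff t = 0) :
    (expQuotPow p (zetaLevel p s ζ n)).subst t ∈ goodSub p s ζ n' m ∧
    (expQuotPow p (zetaLevel p s ζ n)).subst t ∈
      mvOneAddMul (levelRing p s ζ n') s (zetaLevel p s ζ n' - 1) m := by
  have h1 := oneAddMul_level (ζ := ζ) hn hn'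
    (expQuotPow_mem_oneAddMul (p := p) (R := K) (locSub_le_levelRing n) (zeta_mem_levelRing n))
  exact ⟨subst_mem_goodSub hs hζ hn' (mem_seriesOver_of_oneAddMul (pi_mem n') h1)
    (expQuotPow_tendsZero hs hζ (hn.trans hn')) ht h0, subst_mem_mvOneAddMul h1 ht.1 h0⟩

theorem expQuotFrob_subst_mem (hs : 1 ≤ s) (hζ : IsPrimitiveRoot ζ (p ^ s)) {n n' m : ℕ}
    (hn : n ≤ n') (hn' : n' ≤ s) {t : MvPowerSeries (Fin s) K} (ht : t ∈ goodSub p s ζ n' m)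
    (h0 : MvPowerSeries.constantCoeff t = 0) :
    (expQuotFrob p (zetaLevel p s ζ n)).subst t ∈ goodSub p s ζ n' m ∧
    (expQuotFrob p (zetaLevel p s ζ n)).subst t ∈
      mvOneAddMul (levelRing p s ζ n') s (zetaLevel p s ζ n' - 1) m := by
  have h1 := oneAddMul_level (ζ := ζ) hn hn'
    (expQuotFrob_mem_oneAddMul (p := p) (R := K) (locSub_le_levelRing n) (zeta_mem_levelRing n))
  exact ⟨subst_mem_goodSub hs hζ hn' (mem_seriesOver_of_oneAddMul (pi_mem n') h1)
    (expQuotFrob_tendsZero hs hζ (hn.trans hn')) ht h0, subst_mem_mvOneAddMul h1 ht.1 h0⟩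

theorem expQuot_subst_mem {n n' m : ℕ} (hn : n ≤ n') (hn' : n' ≤ s)
    {t : MvPowerSeries (Fin s) K} (ht : t ∈ coeffSub (levelRing p s ζ n') s m)
    (h0 : MvPowerSeries.constantCoeff t = 0) :
    (expQuot p (zetaLevel p s ζ n)).subst t ∈
      mvOneAddMul (levelRing p s ζ n') s (zetaLevel p s ζ n' - 1) m :=
  subst_mem_mvOneAddMul (oneAddMul_level (ζ := ζ) hn hn'
    (expQuot_mem_oneAddMul (p := p) (R := K) (locSub_le_levelRing n) (zeta_mem_levelRing n))) ht h0

end GoodSeries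

/-! ### Construction of admissible G_1, …, G_s. -/

section KummerData

theorem constantCoeff_subst_of_zero {τ K : Type*} [Field K] (f : PowerSeries K)
    {t : MvPowerSeries τ K} (ht : MvPowerSeries.constantCoeff t = 0) :
    MvPowerSeries.constantCoeff (f.subst t) = PowerSeries.constantCoeff f := by
  rw [PowerSeries.constantCoeff_subst (PowerSeries.HasSubst.of_constantCoeff_zero ht),
    finsum_eq_single _ 0]
  · simp
  · intro n hn
    rw [map_pow, ht, zero_pow hn, smul_zero]

theorem constantCoeff_expQuotPow {p : ℕ} [hp : Fact p.Prime] {R : Type*} [CommRing R] [Algebra ℚ R]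
    (c : R) : PowerSeries.constantCoeff (expQuotPow p c) = 1 :=
  constantCoeff_exp_subst' (by
    rw [map_sub, map_nsmul, constantCoeff_powSubLog, constantCoeff_powSubLog, smul_zero, sub_zero])

theorem constantCoeff_expQuotFrob {p : ℕ} [hp : Fact p.Prime] {R : Type*} [CommRing R]
    [Algebra ℚ R] (c : R) : PowerSeries.constantCoeff (expQuotFrob p c) = 1 :=
  constantCoeff_exp_subst' (by rw [map_sub, PowerSeries.constantCoeff_expand, sub_self])

variable {p s : ℕ} [hp : Fact p.Prime] {K : Type*} [Field K] [NumberField K] {ζ : K}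

theorem constantCoeff_cut {a : ℕ → MvPowerSeries (Fin s) K} {i : ℕ}
    (h : ∀ j < i, MvPowerSeries.constantCoeff (a j) = 0) (j : ℕ) :
    MvPowerSeries.constantCoeff (cut i a j) = 0 := by
  unfold cut
  split_ifs with hj
  · exact h j hj
  · exact map_zero _

theorem cut_mem_goodSub {a : ℕ → MvPowerSeries (Fin s) K} {i n m : ℕ}
    (h : ∀ j < i, a j ∈ goodSub p s ζ n m) (j : ℕ) : cut i a j ∈ goodSub p s ζ n m := by
  unfold cut
  split_ifs with hj
  · exact h j hj
  · exact zero_mem _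

theorem cut_succ_update {M : Type*} [Zero M] (a : ℕ → M) (i : ℕ) (y : M) :
    cut i (cut (i + 1) (Function.update a i y)) = cut i a := by
  funext j
  unfold cut
  split_ifs with h1 h2
  · exact Function.update_of_ne h1.ne _ _
  · omega
  · rfl

theorem cut_succ_update_self {M : Type*} [Zero M] (a : ℕ → M) (i : ℕ) (y : M) :
    cut (i + 1) (Function.update a i y) i = y := by
  rw [cut_apply_lt _ i.lt_succ_self, Function.update_self]

theorem cut_update {M : Type*} [Zero M] (a : ℕ → M) {i k : ℕ} (h : k ≤ i) (y : M) :
    cut k (Function.update a i y) = cut k a :=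
  cut_congr fun j hj => Function.update_of_ne (by omega) _ _

variable (p s ζ) in
/-- The conditions on the `i`-th entry of an admissible datum with integral restricted Witt
vector. -/
structure KummerStep (a : ℕ → MvPowerSeries (Fin s) K) (G : MvPolynomial (Fin s) K) (i : Fin s) :
    Prop where
  mem : a i ∈ goodSub p s ζ (i + 1) (i + 1)
  constantCoeff_eq : MvPowerSeries.constantCoeff (a i) = 0
  coeff_mem : ∀ n, G.coeff n ∈ levelRing p s ζ (i + 1)
  vars_lt : ∀ j ∈ G.vars, (j : ℕ) < i
  constantCoeff_G : MvPolynomial.constantCoeff G = 1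
  witt_eq : GWitt p s ζ (i + 1) (cut (i + 1) a) = (G : MvPowerSeries (Fin s) K) +
      MvPowerSeries.C ((p : K) * lam p s ζ) * MvPowerSeries.X i
  approx : ∀ n, MvPowerSeries.coeff n
    (GWitt p s ζ (i + 1) (cut i a) - (G : MvPowerSeries (Fin s) K)) ∈
      mulSub (levelRing p s ζ s) ((p : K) * lam p s ζ * (ζ - 1))

theorem KummerStep.update {a : ℕ → MvPowerSeries (Fin s) K} {G : MvPolynomial (Fin s) K} {i : Fin s}
    (h : KummerStep p s ζ a G i) {k : ℕ} (hk : (i : ℕ) < k) (y : MvPowerSeries (Fin s) K) :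
    KummerStep p s ζ (Function.update a k y) G i := by
  have h1 : Function.update a k y i = a i := Function.update_of_ne hk.ne _ _
  exact ⟨by rw [h1]; exact h.mem, by rw [h1]; exact h.constantCoeff_eq, h.coeff_mem, h.vars_lt,
    h.constantCoeff_G, by rw [cut_update a hk]; exact h.witt_eq,
    by rw [cut_update a hk.le]; exact h.approx⟩

theorem GWitt_cut_mem (hζ : IsPrimitiveRoot ζ (p ^ s)) {i : ℕ} (hi : i + 1 ≤ s)
    {a : ℕ → MvPowerSeries (Fin s) K} (ha : ∀ j < i, a j ∈ goodSub p s ζ (j + 1) (j + 1))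
    (ha0 : ∀ j < i, MvPowerSeries.constantCoeff (a j) = 0) :
    GWitt p s ζ (i + 1) (cut i a) ∈ goodSub p s ζ (i + 1) i ∧
    GWitt p s ζ (i + 1) (cut i a) ∈
      mvOneAddMul (levelRing p s ζ (i + 1)) s (zetaLevel p s ζ (i + 1) - 1) i ∧
    MvPowerSeries.constantCoeff (GWitt p s ζ (i + 1) (cut i a)) = 1 := by
  have h0 := constantCoeff_cut ha0
  have hm := cut_mem_goodSub (p := p) (ζ := ζ) (n := i + 1) (m := i) fun j hj =>
    goodSub_mono (by omega) hi hj (ha j hj)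
  rw [GWitt_eq_prod hζ hi h0]
  have hs := fun j => expQuotPow_subst_mem (by omega) hζ (n := i + 1 - j) (n' := i + 1)
    (Nat.sub_le _ _) hi (hm j) (h0 j)
  refine ⟨prod_mem fun j _ => (hs j).1, prod_mem_mvOneAddMul (pi_mem _) _ fun j _ => (hs j).2, ?_⟩
  rw [map_prod]
  exact Finset.prod_eq_one fun j _ => by
    rw [constantCoeff_subst_of_zero _ (h0 j), constantCoeff_expQuotPow]

theorem pi_ne_zero_self (hs : 1 ≤ s) (hζ : IsPrimitiveRoot ζ (p ^ s)) : ζ - 1 ≠ 0 := by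
  have := pi_ne_zero hζ hs le_rfl
  rwa [zetaLevel_self] at this

theorem pi_pow_mem_mulSub_p (hζ : IsPrimitiveRoot ζ (p ^ s)) :
    (ζ - 1) ^ p ^ s ∈ mulSub (levelRing p s ζ s) (p : K) := by
  obtain ⟨r, hr, h⟩ := pi_pow_dvd (p := p) hζ (le_refl s)
  rw [zetaLevel_self] at h
  exact mem_mulSub.2 ⟨r, hr, h⟩

theorem pi_pow_mem_mulSub_lam (hs : 1 ≤ s) (hζ : IsPrimitiveRoot ζ (p ^ s)) :
    (ζ - 1) ^ p ^ s ∈ mulSub (levelRing p s ζ s) (lam p s ζ) := by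
  obtain ⟨r, hr, h⟩ := mem_mulSub.1 (pi_pow_mem_mulSub_p hζ)
  obtain ⟨t, ht, h'⟩ := p_dvd_pi hζ le_rfl hs
  exact mem_mulSub.2 ⟨t * r, mul_mem (levelRing_mono hs le_rfl ht) hr, by
    rw [h, h', lam, mul_assoc]⟩

theorem p_mul_lam_ne_zero (hs : 1 ≤ s) (hζ : IsPrimitiveRoot ζ (p ^ s)) :
    (p : K) * lam p s ζ ≠ 0 :=
  mul_ne_zero (by exact_mod_cast hp.out.ne_zero) (pi_ne_zero hζ le_rfl hs)

theorem p_mul_lam_mem {n : ℕ} (hn : 1 ≤ n) (hns : n ≤ s) :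
    (p : K) * lam p s ζ ∈ levelRing p s ζ n :=
  mul_mem (natCast_mem _ p) (lam_mem hn hns)

theorem one_notMem_mulSub (hs : 1 ≤ s) (hζ : IsPrimitiveRoot ζ (p ^ s)) :
    (1 : K) ∉ mulSub (levelRing p s ζ s) (ζ - 1) := fun h => by
  obtain ⟨r, hr, h⟩ := mem_mulSub.1 h
  rw [← zetaLevel_self (p := p) (s := s) (ζ := ζ)] at h
  exact not_pi_dvd_one hζ hs le_rfl hr h

theorem constantCoeff_coe_mvPolynomial (G : MvPolynomial (Fin s) K) :
    MvPowerSeries.constantCoeff (G : MvPowerSeries (Fin s) K) = MvPolynomial.constantCoeff G := by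
  rw [← MvPowerSeries.coeff_zero_eq_constantCoeff_apply, MvPolynomial.coeff_coe,
    MvPolynomial.constantCoeff_eq]

theorem coeff_zero_eq (f : MvPowerSeries (Fin s) K) :
    MvPowerSeries.coeff 0 f = MvPowerSeries.constantCoeff f :=
  MvPowerSeries.coeff_zero_eq_constantCoeff_apply f

/-- With g = G_{i+1,p}(X'_0, …, X'_{i-1}, 0), truncate g = G + pλD, where D is divisible by ζ - 1.
The condition g exp(pλy) = G + pλX_i reads exp(pλy) = 1 + pλ(X_i - D)/g and is solved by `ellS` at
pλ. -/
theorem exists_kummerStep (hζ : IsPrimitiveRoot ζ (p ^ s)) (i : Fin s)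
    {a : ℕ → MvPowerSeries (Fin s) K} (ha : ∀ j < (i : ℕ), a j ∈ goodSub p s ζ (j + 1) (j + 1))
    (ha0 : ∀ j < (i : ℕ), MvPowerSeries.constantCoeff (a j) = 0) :
    ∃ y G, KummerStep p s ζ (Function.update a i y) G i := by
  have hi : (i : ℕ) + 1 ≤ s := i.2
  have hs : 1 ≤ s := by omega
  set c : K := (p : K) * lam p s ζ
  have hc0 : c ≠ 0 := p_mul_lam_ne_zero hs hζ
  obtain ⟨hg, hg1, hg0⟩ := GWitt_cut_mem hζ hi ha ha0
  set g := GWitt p s ζ (i + 1) (cut i a)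
  have hcs : c ∈ levelRing p s ζ s := p_mul_lam_mem hs le_rfl
  obtain ⟨G, hGc, hGm, hGv, D, hD, hgD, hDJ⟩ := exists_truncation hζ (n := i + 1) (m := i)
    -- The exponent 2p^s + 1 suffices since (ζ - 1)^{p^s} is divisible by p and by λ, and one more
    -- factor ζ - 1 is needed.
    (by omega) hi hc0 (p_mul_lam_mem (by omega) hi) (mulSub (levelRing p s ζ s) (c * (ζ - 1)))
    (fun x hx => mulSub_mono pi_self_mem hx) (M := p ^ s + p ^ s + 1) (fun x hx => by
      obtain ⟨r, hr, rfl⟩ := mem_mulSub.1 hx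
      obtain ⟨t, ht, h⟩ := mem_mulSub.1 (pi_pow_mem_mulSub_p hζ)
      obtain ⟨t', ht', h'⟩ := mem_mulSub.1 (pi_pow_mem_mulSub_lam hs hζ)
      refine mem_mulSub.2 ⟨t * t' * r, mul_mem (mul_mem ht ht') hr, ?_⟩
      rw [pow_succ, pow_add]
      nth_rewrite 1 [h]
      rw [h']; ring) (f := g) (Q := g) hg.1 hg
      (fun k => by rw [sub_self, map_zero]; exact zero_mem _)
  have hG0 : MvPolynomial.constantCoeff G = 1 := by
    rw [MvPolynomial.constantCoeff_eq, hGc, coeff_zero_eq, hg0, if_neg]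
    intro h
    refine one_notMem_mulSub hs hζ ?_
    rw [mul_comm] at h
    exact mulSub_mono hcs h
  have hD0 : MvPowerSeries.constantCoeff D = 0 := by
    have h := congrArg MvPowerSeries.constantCoeff hgD
    rw [map_add, constantCoeff_coe_mvPolynomial, hG0, hg0, left_eq_add, map_mul,
      MvPowerSeries.constantCoeff_C] at h
    exact (mul_eq_zero.1 h).resolve_left hc0
  obtain ⟨g', hg', hgg'⟩ := exists_inv_mem_goodSub hζ (by omega) hi hg hg1 hg0
  have hD' : D ∈ goodSub p s ζ (i + 1) (i + 1) := goodSub_mono le_rfl hi (Nat.le_succ _) hD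
  set t := (MvPowerSeries.X i - D) * g'
  have ht : t ∈ goodSub p s ζ (i + 1) (i + 1) := mul_mem
    (sub_mem (X_mem_goodSub _ (Nat.lt_succ_self _)) hD') (goodSub_mono le_rfl hi (Nat.le_succ _) hg')
  have ht0 : MvPowerSeries.constantCoeff t = 0 := by
    rw [map_mul, map_sub, hD0, MvPowerSeries.constantCoeff_X, sub_zero, zero_mul]
  have hell : ellS c ∈ seriesOver (levelRing p s ζ (i + 1)) := mem_seriesOver.2 fun k =>
    levelRing_mono (by omega) hi (mulSub_le (pow_mem (lam_mem le_rfl hs) _) (ellS_p_lam_coeff k))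
  have hy := subst_mem_goodSub hs hζ hi hell (tendsZero_of_lam_pow hs ellS_p_lam_coeff) ht ht0
  have hst := PowerSeries.HasSubst.of_constantCoeff_zero ht0
  have hy0 : MvPowerSeries.constantCoeff ((ellS c).subst t) = 0 := by
    rw [constantCoeff_subst_of_zero _ ht0, constantCoeff_ellS]
  refine ⟨(ellS c).subst t, G, by rwa [Function.update_self], by rwa [Function.update_self],
    hGm, hGv, hG0, ?_, fun n => ?_⟩
  · have h0 : ∀ j, MvPowerSeries.constantCoeff
        (cut (i + 1) (Function.update a i ((ellS c).subst t)) j) = 0 :=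
      constantCoeff_cut fun j hj => by
        rcases Nat.lt_succ_iff_lt_or_eq.1 hj with h | rfl
        · rw [Function.update_of_ne h.ne]; exact ha0 j h
        · rw [Function.update_self]; exact hy0
    rw [GWitt_succ_cut hζ hi h0, cut_succ_update, cut_succ_update_self, exp_subst_ellS c hst]
    change g * (1 + MvPowerSeries.C c * ((MvPowerSeries.X i - D) * g')) = _
    linear_combination (MvPowerSeries.C c * (MvPowerSeries.X i - D)) * hgg' + hgD
  · rw [cut_update a le_rfl]
    change MvPowerSeries.coeff n (g - _) ∈ _
    rw [hgD, add_sub_cancel_left, MvPowerSeries.coeff_C_mul]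
    exact hDJ n

theorem exists_kummerSteps (hζ : IsPrimitiveRoot ζ (p ^ s)) (m : ℕ) (hm : m ≤ s) :
    ∃ (a : ℕ → MvPowerSeries (Fin s) K) (G : ℕ → MvPolynomial (Fin s) K),
      ∀ i : Fin s, (i : ℕ) < m → KummerStep p s ζ a (G i) i := by
  induction m with
  | zero => exact ⟨0, 0, fun i hi => absurd hi (Nat.not_lt_zero _)⟩
  | succ m ih =>
    obtain ⟨a, G, h⟩ := ih (by omega)
    obtain ⟨y, g, hy⟩ := exists_kummerStep hζ ⟨m, hm⟩ (a := a)
      (fun j hj => (h ⟨j, by simp at hj; omega⟩ hj).mem)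
      (fun j hj => (h ⟨j, by simp at hj; omega⟩ hj).constantCoeff_eq)
    refine ⟨Function.update a m y, Function.update G m g, fun i hi => ?_⟩
    rcases Nat.lt_succ_iff_lt_or_eq.1 hi with h1 | h1
    · rw [Function.update_of_ne h1.ne]
      exact (h i h1).update h1 y
    · obtain rfl : i = ⟨m, hm⟩ := Fin.ext h1
      rw [Function.update_self]
      exact hy

theorem extendZero_apply (a : ℕ → MvPowerSeries (Fin s) K) {j : ℕ} (hj : j < s) :
    extendZero (fun i : Fin s => a i) j = a j := dif_pos hj

theorem cut_extendZero (a : ℕ → MvPowerSeries (Fin s) K) {j : ℕ} (hj : j ≤ s) :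
    cut j (extendZero (fun i : Fin s => a i)) = cut j a :=
  cut_congr fun _ hk => extendZero_apply a (hk.trans_le hj)

theorem constantCoeff_extendZero {a : Fin s → MvPowerSeries (Fin s) K}
    (h : ∀ i, MvPowerSeries.constantCoeff (a i) = 0) (j : ℕ) :
    MvPowerSeries.constantCoeff (extendZero a j) = 0 := by
  unfold extendZero
  split_ifs
  · exact h _
  · exact map_zero _

theorem exists_isKummerDatum [IsCyclotomicExtension {p ^ s} ℚ K] (hs : 1 ≤ s)
    (hζ : IsPrimitiveRoot ζ (p ^ s)) :
    ∃ (G : Fin s → MvPolynomial (Fin s) K) (X' : Fin s → MvPowerSeries (Fin s) K),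
      IsKummerDatum p s ζ G X' := by
  obtain ⟨a, G, h⟩ := exists_kummerSteps (K := K) hζ s le_rfl
  have h0 : ∀ i : Fin s, MvPowerSeries.constantCoeff (a i) = 0 := fun i =>
    (h i i.2).constantCoeff_eq
  have h1 := constantCoeff_extendZero (a := fun i : Fin s => a i) h0
  refine ⟨fun i => G i, fun i => a i, fun i => (h i i.2).coeff_mem, fun i => (h i i.2).vars_lt,
    fun i => (h i i.2).constantCoeff_G, h0, fun i => ?_, fun i n => ?_⟩
  · rw [← (h i i.2).witt_eq, ← cut_extendZero a i.2]
    exact GWitt_congr hζ i.2 h1 (constantCoeff_cut fun j _ => h1 j)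
      fun j hj => (cut_apply_lt _ hj).symm
  · rw [cut_extendZero a i.2.le, lt_nu_iff hζ hs]
    obtain ⟨r, hr, h2⟩ := mem_mulSub.1 ((h i i.2).approx n)
    exact ⟨r, hr, by rw [h2]; ring⟩

end KummerData

/-! ### Reduction modulo ζ - 1 to polynomials over 𝔽_p, and lifting back. -/

section ReductionMap

variable {p s : ℕ} [hp : Fact p.Prime] {K : Type*} [Field K] [NumberField K] {ζ : K}

/-- Polynomials over `𝔽_p` in the variables of index `< m`. -/
def varSub (p s m : ℕ) : Subring (MvPolynomial (Fin s) (ZMod p)) :=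
  (MvPolynomial.supported (ZMod p) {j : Fin s | (j : ℕ) < m}).toSubring

theorem mem_varSub {m : ℕ} {q : MvPolynomial (Fin s) (ZMod p)} :
    q ∈ varSub p s m ↔ ∀ j ∈ q.vars, (j : ℕ) < m := by
  rw [varSub, Subalgebra.mem_toSubring, MvPolynomial.mem_supported]
  rfl

theorem varSub_mono {m m' : ℕ} (h : m ≤ m') : varSub p s m ≤ varSub p s m' := fun _ hq =>
  mem_varSub.2 fun j hj => (mem_varSub.1 hq j hj).trans_le h

theorem X_mem_varSub {m : ℕ} {j : Fin s} (h : (j : ℕ) < m) :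
    (MvPolynomial.X j : MvPolynomial (Fin s) (ZMod p)) ∈ varSub p s m := by
  refine mem_varSub.2 fun k hk => ?_
  have : Nontrivial (ZMod p) := ZMod.nontrivial_iff.2 hp.out.ne_one
  rw [MvPolynomial.vars_X, Finset.mem_singleton] at hk
  rw [hk]; exact h

variable {res : levelRing p s ζ s →+* ZMod p}
  (hres : ∀ x : levelRing p s ζ s, res x = 0 ↔ ∃ r ∈ levelRing p s ζ s, (x : K) = (ζ - 1) * r)

/-- The reduction of restricted power series modulo `ζ_{p^s} - 1`. -/
def redMap : resSub (levelRing p s ζ s) (ζ - 1) s →+* MvPolynomial (Fin s) (ZMod p) :=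
  reduction res fun x hx => (hres x).2 (mem_mulSub.1 hx)

theorem redMap_eq_zero_iff (f : resSub (levelRing p s ζ s) (ζ - 1) s) : redMap hres f = 0 ↔
    ∀ n, MvPowerSeries.coeff n f.1 ∈ mulSub (levelRing p s ζ s) (ζ - 1) := by
  rw [MvPolynomial.ext_iff]
  refine forall_congr' fun n => ?_
  rw [redMap, coeff_reduction, MvPolynomial.coeff_zero, hres, mem_mulSub]

theorem redMap_eq_iff (f g : resSub (levelRing p s ζ s) (ζ - 1) s) :
    redMap hres f = redMap hres g ↔
    ∀ n, MvPowerSeries.coeff n (f.1 - g.1) ∈ mulSub (levelRing p s ζ s) (ζ - 1) := by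
  rw [← sub_eq_zero, ← map_sub, redMap_eq_zero_iff]
  rfl

theorem redMap_X (j : Fin s) : redMap hres ⟨MvPowerSeries.X j, X_mem_resSub _ _ j⟩ =
    MvPolynomial.X j := by
  classical
  ext n
  rw [redMap, coeff_reduction, MvPolynomial.coeff_X]
  have : (⟨MvPowerSeries.coeff n (MvPowerSeries.X j), (X_mem_resSub _ (ζ - 1) j).1 n⟩ :
      levelRing p s ζ s) = if n = Finsupp.single j 1 then 1 else 0 := by
    apply Subtype.ext
    change MvPowerSeries.coeff n (MvPowerSeries.X j) = _
    rw [MvPowerSeries.coeff_X]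
    split_ifs <;> rfl
  rw [this]
  split_ifs with h1 h2 h2
  · exact map_one res
  · exact absurd h1.symm h2
  · exact absurd h2.symm h1
  · exact map_zero res

theorem redMap_mem_varSub {S : Subring K} {m : ℕ} (f : resSub (levelRing p s ζ s) (ζ - 1) s)
    (hf : f.1 ∈ coeffSub S s m) : redMap hres f ∈ varSub p s m := by
  refine mem_varSub.2 fun j hj => ?_
  obtain ⟨n, hn, hjn⟩ := (MvPolynomial.mem_vars_iff_mem_support j).1 hj
  rw [MvPolynomial.mem_support_iff, redMap, coeff_reduction] at hn
  refine (hf n).2 (fun h => hn ?_) j hjn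
  rw [show (⟨MvPowerSeries.coeff n f.1, f.2.1 n⟩ : levelRing p s ζ s) = 0 from Subtype.ext h,
    map_zero]

theorem constantCoeff_redMap (f : resSub (levelRing p s ζ s) (ζ - 1) s)
    (hf : MvPowerSeries.constantCoeff f.1 = 0) :
    MvPolynomial.constantCoeff (redMap hres f) = 0 := by
  rw [MvPolynomial.constantCoeff_eq, redMap, coeff_reduction]
  rw [show (⟨MvPowerSeries.coeff 0 f.1, f.2.1 0⟩ : levelRing p s ζ s) = 0 from
    Subtype.ext ((coeff_zero_eq f.1).trans hf), map_zero]

theorem exists_int_lift (q : MvPolynomial (Fin s) (ZMod p)) :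
    ∃ P : MvPolynomial (Fin s) ℤ, (∀ n, ((P.coeff n : ℤ) : ZMod p) = q.coeff n) ∧
      ∀ n, q.coeff n = 0 → P.coeff n = 0 := by
  classical
  have hc : ∀ n, (∑ n ∈ q.support, MvPolynomial.monomial n ((q.coeff n).val : ℤ)).coeff n =
      if q.coeff n = 0 then 0 else ((q.coeff n).val : ℤ) := by
    intro n
    rw [MvPolynomial.coeff_sum]
    simp only [MvPolynomial.coeff_monomial]
    rw [Finset.sum_ite_eq']
    simp only [MvPolynomial.mem_support_iff]
    split_ifs <;> simp_all
  refine ⟨_, fun n => ?_, fun n h => by rw [hc, if_pos h]⟩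
  have : NeZero p := ⟨hp.out.ne_zero⟩
  rw [hc]
  split_ifs with h
  · rw [h, Int.cast_zero]
  · rw [Int.cast_natCast, ZMod.natCast_zmod_val]

theorem redMap_int (P : MvPolynomial (Fin s) ℤ) {q : MvPolynomial (Fin s) (ZMod p)}
    (hP : ∀ n, ((P.coeff n : ℤ) : ZMod p) = q.coeff n)
    (h : ((MvPolynomial.map (Int.castRingHom K) P : MvPolynomial (Fin s) K) :
      MvPowerSeries (Fin s) K) ∈ resSub (levelRing p s ζ s) (ζ - 1) s) :
    redMap hres ⟨_, h⟩ = q := by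
  ext n
  rw [redMap, coeff_reduction, ← hP]
  have : (⟨MvPowerSeries.coeff n ((MvPolynomial.map (Int.castRingHom K) P : MvPolynomial (Fin s) K) :
      MvPowerSeries (Fin s) K), h.1 n⟩ : levelRing p s ζ s) = ((P.coeff n : ℤ) : levelRing p s ζ s) := by
    apply Subtype.ext
    change MvPowerSeries.coeff n (MvPolynomial.map (Int.castRingHom K) P : MvPolynomial (Fin s) K).toMvPowerSeries = _
    rw [MvPolynomial.coeff_coe, MvPolynomial.coeff_map]
    simp
  rw [this, map_intCast]

theorem exists_goodSub_lift {n m : ℕ} (hn : n ≤ s) {q : MvPolynomial (Fin s) (ZMod p)}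
    (hq : q ∈ varSub p s m) (hq0 : MvPolynomial.constantCoeff q = 0) :
    ∃ c, ∃ hc : c ∈ goodSub p s ζ n m, MvPowerSeries.constantCoeff c = 0 ∧
      redMap hres ⟨c, hc.2⟩ = q := by
  obtain ⟨P, hP, hP0⟩ := exists_int_lift q
  have hc : ((MvPolynomial.map (Int.castRingHom K) P : MvPolynomial (Fin s) K) :
      MvPowerSeries (Fin s) K) ∈ goodSub p s ζ n m := by
    refine mvPolynomial_mem_goodSub hn (fun k => ?_) fun j hj => ?_
    · rw [MvPolynomial.coeff_map]; exact intCast_mem _ _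
    · obtain ⟨k, hk, hjk⟩ := (MvPolynomial.mem_vars_iff_mem_support j).1 hj
      rw [MvPolynomial.mem_support_iff, MvPolynomial.coeff_map] at hk
      refine mem_varSub.1 hq j ((MvPolynomial.mem_vars_iff_mem_support j).2 ⟨k, ?_, hjk⟩)
      rw [MvPolynomial.mem_support_iff]
      intro h
      rw [hP0 k h, map_zero] at hk
      exact hk rfl
  refine ⟨_, hc, ?_, redMap_int hres P hP hc.2⟩
  rw [constantCoeff_coe_mvPolynomial, MvPolynomial.constantCoeff_eq, MvPolynomial.coeff_map,
    hP0 0 (by rwa [MvPolynomial.constantCoeff_eq] at hq0), map_zero]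

theorem expand_subst_eq (f : PowerSeries K) {t : MvPowerSeries (Fin s) K}
    (ht : MvPowerSeries.constantCoeff t = 0) :
    (PowerSeries.expand p hp.out.ne_zero f).subst t = f.subst (t ^ p) := by
  have hst := PowerSeries.HasSubst.of_constantCoeff_zero ht
  rw [PowerSeries.expand_apply, PowerSeries.subst_comp_subst_apply (R := K)
    (PowerSeries.HasSubst.X_pow hp.out.ne_zero) hst]
  congr 1
  rw [PowerSeries.subst_pow hst, PowerSeries.subst_X hst]

theorem exists_eq_C_mul (hζ : IsPrimitiveRoot ζ (p ^ s)) {n m : ℕ} (hn : 1 ≤ n)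
    (hns : n ≤ s) {t : MvPowerSeries (Fin s) K} (ht : t ∈ goodSub p s ζ n m)
    (h : redMap hres ⟨t, ht.2⟩ = 0) :
    ∃ t' ∈ goodSub p s ζ n m, t = MvPowerSeries.C (zetaLevel p s ζ n - 1) * t' := by
  have hπ0 := pi_ne_zero hζ hn hns
  rw [redMap_eq_zero_iff] at h
  obtain ⟨t', ht', h1⟩ := coeffSub_div (R' := levelRing p s ζ n) hπ0 ht.1 fun k => by
    obtain ⟨r, hr, h2⟩ := mem_mulSub.1 (h k)
    change MvPowerSeries.coeff k t = _ at h2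
    rw [← zetaLevel_self (p := p) (s := s) (ζ := ζ)] at h2
    exact mem_mulSub.2 (pi_dvd_descend hζ hn hns le_rfl (ht.1 k).1 hr h2)
  obtain ⟨M, hM⟩ := pi_pow_mem_mulSub_pi hζ hn hns
  exact ⟨t', ⟨ht', resSub_of_C_mul hπ0 hM ht.2
    (fun k => levelRing_mono hns le_rfl (ht' k).1) h1⟩, h1⟩

/-- If t reduces to zero then t = πt', and f(πt') has coefficients π^k f_k tending to zero. No decay
of f is needed; this is how E_{n,p} itself may be evaluated at ρ. -/
theorem subst_mem_goodSub_of_red (hζ : IsPrimitiveRoot ζ (p ^ s)) {n m : ℕ} (hn : 1 ≤ n)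
    (hns : n ≤ s) {f : PowerSeries K} (hf : f ∈ seriesOver (levelRing p s ζ n))
    {t : MvPowerSeries (Fin s) K} (ht : t ∈ goodSub p s ζ n m)
    (h0 : MvPowerSeries.constantCoeff t = 0) (h : redMap hres ⟨t, ht.2⟩ = 0) :
    f.subst t ∈ goodSub p s ζ n m := by
  obtain ⟨t', ht', rfl⟩ := exists_eq_C_mul hres hζ hn hns ht h
  set π := zetaLevel p s ζ n - 1
  have h1 : MvPowerSeries.constantCoeff t' = 0 := by
    rw [map_mul, MvPowerSeries.constantCoeff_C] at h0
    exact (mul_eq_zero.1 h0).resolve_left (pi_ne_zero hζ hn hns)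
  have hst := PowerSeries.HasSubst.of_constantCoeff_zero h1
  have h2 : f.subst (MvPowerSeries.C π * t') = (PowerSeries.rescale π f).subst t' := by
    rw [PowerSeries.rescale_eq_subst, PowerSeries.subst_comp_subst_apply (R := K)
      (PowerSeries.HasSubst.smul_X' (R := K) π) hst, PowerSeries.subst_smul hst,
      PowerSeries.subst_X hst, MvPowerSeries.smul_eq_C_mul]
  rw [h2]
  refine subst_mem_goodSub (hn.trans hns) hζ hns (mem_seriesOver.2 fun k => ?_) ?_ ht' h1
  · rw [PowerSeries.coeff_rescale]
    exact mul_mem (pow_mem (pi_mem n) k) (mem_seriesOver.1 hf k)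
  · intro N
    refine ⟨N, fun k hk => ?_⟩
    rw [PowerSeries.coeff_rescale]
    obtain ⟨r, hr, h⟩ := mem_mulSub.1 (pi_mem_mulSub (p := p) (ζ := ζ) hns)
    refine mulSub_pow_mono pi_self_mem hk (mem_mulSub.2 ⟨r ^ k * PowerSeries.coeff k f,
      mul_mem (pow_mem hr k) (levelRing_mono hns le_rfl (mem_seriesOver.1 hf k)), ?_⟩)
    rw [show π = (ζ - 1) * r from h, mul_pow]; ring

theorem redMap_ellS (hs : 1 ≤ s) (hζ : IsPrimitiveRoot ζ (p ^ s))
    (t : resSub (levelRing p s ζ s) (ζ - 1) s) (h0 : MvPowerSeries.constantCoeff t.1 = 0)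
    (h : (ellS (lam p s ζ)).subst t.1 ∈ resSub (levelRing p s ζ s) (ζ - 1) s) :
    redMap hres ⟨_, h⟩ = redMap hres t - redMap hres t ^ p := by
  rw [← map_pow, ← map_sub, redMap_eq_iff]
  obtain ⟨D, hD, h1⟩ := ellS_lam_eq hs hζ
  have hst := PowerSeries.HasSubst.of_constantCoeff_zero h0
  have h2 : (ellS (lam p s ζ)).subst t.1 - (t.1 - t.1 ^ p) =
      MvPowerSeries.C (lam p s ζ) * D.subst t.1 := by
    rw [h1, ← PowerSeries.coe_substAlgHom hst, map_add, map_sub, map_pow, map_mul,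
      PowerSeries.coe_substAlgHom hst, PowerSeries.subst_X hst, PowerSeries.subst_C]
    ring
  intro n
  change MvPowerSeries.coeff n ((ellS (lam p s ζ)).subst t.1 - (t.1 - t.1 ^ p)) ∈ _
  rw [h2, MvPowerSeries.coeff_C_mul]
  have ht' : t.1 ∈ coeffSub (levelRing p s ζ s) s s := fun n => ⟨t.2.1 n, fun _ j _ => j.2⟩
  exact mul_mem_mulSub (pi_mem_mulSub hs) (subst_mem_coeffSub
    (fun k => levelRing_mono hs le_rfl (mem_seriesOver.1 hD k)) ht' h0 n).1

end ReductionMap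

/-! ### The conditions on Y', and comparison of the cut vector with ℘ of a lift. -/

section ArtinSchreierStep

variable {p s : ℕ} [hp : Fact p.Prime] {K : Type*} [Field K] [NumberField K] {ζ : K}

/-- The sequence `X_j + b_j`. -/
def shiftVar (p s : ℕ) (b : ℕ → MvPolynomial (Fin s) (ZMod p)) (j : ℕ) :
    MvPolynomial (Fin s) (ZMod p) :=
  if h : j < s then MvPolynomial.X ⟨j, h⟩ + b j else 0

theorem shiftVar_of_lt (b : ℕ → MvPolynomial (Fin s) (ZMod p)) (j : Fin s) :
    shiftVar p s b j = MvPolynomial.X j + b j := dif_pos j.2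

variable {res : levelRing p s ζ s →+* ZMod p}
  (hres : ∀ x : levelRing p s ζ s, res x = 0 ↔ ∃ r ∈ levelRing p s ζ s, (x : K) = (ζ - 1) * r)

open scoped Classical in
/-- The conditions on the `i`-th entries of the Witt vector `Y'` (here `a`), of the polynomials
`b` and of the polynomial `E`. -/
structure ASWStep (a : ℕ → MvPowerSeries (Fin s) K) (b : ℕ → MvPolynomial (Fin s) (ZMod p))
    (E : MvPolynomial (Fin s) K) (i : Fin s) : Prop where
  mem : a i ∈ goodSub p s ζ (i + 1) (i + 1)
  constantCoeff_eq : MvPowerSeries.constantCoeff (a i) = 0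
  coeff_mem : ∀ n, E.coeff n ∈ levelRing p s ζ (i + 1)
  vars_lt : ∀ j ∈ E.vars, (j : ℕ) < i
  constantCoeff_E : MvPolynomial.constantCoeff E = 1
  sub_one_mem : ∀ n, MvPowerSeries.coeff n ((E : MvPowerSeries (Fin s) K) - 1) ∈
    mulSub (levelRing p s ζ (i + 1)) (zetaLevel p s ζ (i + 1) - 1)
  witt_eq : (E : MvPowerSeries (Fin s) K) + MvPowerSeries.C (lam p s ζ) * MvPowerSeries.X i =
    EWitt p s ζ (i + 1) a
  trunc : ∀ n, E.coeff n =
    if MvPowerSeries.coeff n (EWitt p s ζ (i + 1) (cut i a)) ∈ mulSub (levelRing p s ζ s) (lam p s ζ)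
    then 0 else MvPowerSeries.coeff n (EWitt p s ζ (i + 1) (cut i a))
  b_mem : b i ∈ varSub p s i
  b_constantCoeff : MvPolynomial.constantCoeff (b i) = 0
  red_eq : redMap hres ⟨a i, mem.2⟩ = wpSeq p (shiftVar p s b) i

theorem ASWStep.update {a : ℕ → MvPowerSeries (Fin s) K} {b : ℕ → MvPolynomial (Fin s) (ZMod p)}
    {E : MvPolynomial (Fin s) K} {i : Fin s} (h : ASWStep hres a b E i) {k : ℕ} (hk : (i : ℕ) < k)
    (y : MvPowerSeries (Fin s) K) (c : MvPolynomial (Fin s) (ZMod p)) :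
    ASWStep hres (Function.update a k y) (Function.update b k c) E i := by
  have h1 : Function.update a k y i = a i := Function.update_of_ne hk.ne _ _
  have h2 : Function.update b k c i = b i := Function.update_of_ne hk.ne _ _
  have h3 : ∀ j < (i : ℕ) + 1, Function.update a k y j = a j := fun j hj =>
    Function.update_of_ne (by omega) _ _
  refine ⟨by rw [h1]; exact h.mem, by rw [h1]; exact h.constantCoeff_eq, h.coeff_mem, h.vars_lt,
    h.constantCoeff_E, h.sub_one_mem, by rw [EWitt_congr h3]; exact h.witt_eq,
    by rw [cut_update a hk.le]; exact h.trunc, by rw [h2]; exact h.b_mem,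
    by rw [h2]; exact h.b_constantCoeff, ?_⟩
  have h4 : wpSeq p (shiftVar p s (Function.update b k c)) i = wpSeq p (shiftVar p s b) i :=
    wpSeq_congr fun j hj => by
      unfold shiftVar
      rw [Function.update_of_ne (show j ≠ k by omega)]
  rw [h4, ← h.red_eq]
  congr 2

/-- The product by which `EWitt` of a vector differs from `EWitt` of its vector of `p`-th powers. -/
theorem EWitt_eq_prod_mul (hζ : IsPrimitiveRoot ζ (p ^ s)) {n : ℕ} (hn : n ≤ s)
    {c : ℕ → MvPowerSeries (Fin s) K} (hc : ∀ j, MvPowerSeries.constantCoeff (c j) = 0) :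
    EWitt p s ζ n c = (∏ j ∈ Finset.range n, (expQuotFrob p (zetaLevel p s ζ (n - j))).subst (c j)) *
      EWitt p s ζ n (fun j => c j ^ p) := by
  rw [EWitt, EWitt, ← Finset.prod_mul_distrib]
  refine Finset.prod_congr rfl fun j _ => ?_
  have h0 : MvPowerSeries.constantCoeff (c j ^ p) = 0 := by
    rw [map_pow, hc, zero_pow hp.out.ne_zero]
  rw [artinHasse_eq_subst hζ (by omega) (hc j), artinHasse_eq_subst hζ (by omega) h0,
    ← expand_subst_eq _ (hc j),
    ← PowerSeries.subst_mul (PowerSeries.HasSubst.of_constantCoeff_zero (hc j)),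
    ← expQuot_eq_mul_expand]

theorem add_eq_sub_sub_add {A : Type*} [AddCommGroup A] (x y z : A) :
    x + z = x - (y - z) + y := by abel

/-- Comparison of the Witt vector `a` cut at `i` with `℘` of a lift. -/
theorem exists_witt_remainder {i : ℕ} (hi : i + 1 ≤ s) {a : ℕ → MvPowerSeries (Fin s) K}
    (ha : ∀ j < i, a j ∈ goodSub p s ζ (i + 1) i)
    (ha0 : ∀ j < i, MvPowerSeries.constantCoeff (a j) = 0)
    {q : ℕ → MvPolynomial (Fin s) (ZMod p)} (hq : ∀ j < i, q j ∈ varSub p s i)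
    (hq0 : ∀ j < i, MvPolynomial.constantCoeff (q j) = 0)
    (hred : ∀ j, ∀ hj : j < i, redMap hres ⟨a j, (ha j hj).2⟩ = wpSeq p q j) :
    ∃ (c : ℕ → MvPowerSeries (Fin s) K) (ρ : WittVector p (MvPowerSeries (Fin s) K)),
      (∀ j, c j ∈ goodSub p s ζ (i + 1) i ∧ MvPowerSeries.constantCoeff (c j) = 0) ∧
      (∀ j, MvPowerSeries.constantCoeff (ρ.coeff j) = 0) ∧
      WittVector.mk p (cut i a) + WittVector.mk p (fun j => c j ^ p) = ρ + WittVector.mk p c ∧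
      ∃ hρ : ∀ j, ρ.coeff j ∈ goodSub p s ζ (i + 1) i,
        (∀ j < i, redMap hres ⟨ρ.coeff j, (hρ j).2⟩ = 0) ∧
        redMap hres ⟨ρ.coeff i, (hρ i).2⟩ = -wpSeq p (cut i q) i := by
  classical
  have hlift : ∀ j, ∃ c, ∃ hc : c ∈ goodSub p s ζ (i + 1) i, MvPowerSeries.constantCoeff c = 0 ∧
      redMap hres ⟨c, hc.2⟩ = cut i q j := by
    intro j
    unfold cut
    split_ifs with hj
    · exact exists_goodSub_lift hres hi (hq j hj) (hq0 j hj)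
    · exact exists_goodSub_lift hres hi (zero_mem _) (map_zero _)
  choose c hc hc0 hcr using hlift
  let S := goodSub p s ζ (i + 1) i
  have hca : ∀ j, cut i a j ∈ S := fun j => cut_mem_goodSub ha j
  let y : WittVector p S := WittVector.mk p fun j => ⟨cut i a j, hca j⟩
  let C : WittVector p S := WittVector.mk p fun j => ⟨c j, hc j⟩
  let C' : WittVector p S := WittVector.mk p fun j => ⟨c j ^ p, pow_mem (hc j) p⟩
  let ι := WittVector.map (p := p) S.subtype
  let r : S →+* MvPolynomial (Fin s) (ZMod p) := (redMap hres).comp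
    (Subring.inclusion (show S ≤ resSub (levelRing p s ζ s) (ζ - 1) s from inf_le_right))
  -- In characteristic zero the vector C' of p-th powers is not the Witt Frobenius of C, but it
  -- reduces to it. So C - C' reduces to ℘ of the cut of q, and ρ measures the deviation of a from
  -- it.
  let ρ : WittVector p S := y - (C - C')
  have hy : ι y = WittVector.mk p (cut i a) := map_mk _ _
  have hC : ι C = WittVector.mk p c := map_mk _ _
  have hC' : ι C' = WittVector.mk p (fun j => c j ^ p) := map_mk _ _
  have hρ : ∀ j, (ι ρ).coeff j ∈ S := fun j => by
    rw [WittVector.map_coeff]; exact (ρ.coeff j).2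
  have hrρ : ∀ j, redMap hres ⟨(ι ρ).coeff j, (hρ j).2⟩ = (WittVector.map r ρ).coeff j := by
    intro j
    refine Eq.trans ?_ (WittVector.map_coeff r ρ j).symm
    change _ = redMap hres _
    congr 1
  have hrC : WittVector.map r C = WittVector.mk p (cut i q) := by
    rw [map_mk]; congr 1; funext j; exact hcr j
  have hrC' : WittVector.map r C' = WittVector.frobenius (WittVector.mk p (cut i q)) := by
    ext1 j
    rw [WittVector.coeff_frobenius_charP, map_mk, WittVector.coeff_mk, WittVector.coeff_mk,
      ← hcr j, ← map_pow]
    rfl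
  set w := WittVector.map r C - WittVector.map r C' with hw
  have hwc : ∀ j, w.coeff j = wpSeq p (cut i q) j := fun j => by rw [hw, hrC, hrC']; rfl
  have hry : ∀ j, (WittVector.map r y).coeff j = if j < i then wpSeq p q j else 0 := by
    intro j
    rw [map_mk, WittVector.coeff_mk]
    change redMap hres ⟨cut i a j, (hca j).2⟩ = _
    split_ifs with hj
    · rw [← hred j hj]
      congr 2
      exact cut_apply_lt a hj
    · rw [← map_zero (redMap hres)]
      congr 1
      exact Subtype.ext (cut_apply_ge a (not_lt.1 hj))
  have hagree : ∀ j < i, (WittVector.map r y).coeff j = w.coeff j := by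
    intro j hj
    rw [hry, if_pos hj, hwc]
    exact wpSeq_congr fun k hk => (cut_apply_lt q (by omega)).symm
  have hrρ' : WittVector.map r ρ = WittVector.map r y - w := by rw [map_sub, map_sub]
  refine ⟨c, ι ρ, fun j => ⟨hc j, hc0 j⟩, ?_, ?_, hρ, ?_, ?_⟩
  · have h1 : ι ρ = WittVector.mk p (cut i a) + -(WittVector.mk p c +
        -WittVector.mk p (fun j => c j ^ p)) := by
      rw [← hy, ← hC, ← hC', ← sub_eq_add_neg, ← sub_eq_add_neg, ← map_sub, ← map_sub]
    rw [h1]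
    refine constantCoeff_add_coeff (fun j => ?_) (constantCoeff_neg_coeff
      (constantCoeff_add_coeff (fun j => ?_) (constantCoeff_neg_coeff fun j => ?_)))
    · rw [WittVector.coeff_mk]; exact constantCoeff_cut ha0 j
    · rw [WittVector.coeff_mk]; exact hc0 j
    · rw [WittVector.coeff_mk, map_pow, hc0, zero_pow hp.out.ne_zero]
  · rw [← hy, ← hC, ← hC', ← map_add, ← map_add]
    exact congrArg ι (add_eq_sub_sub_add y C C')
  · intro j hj
    rw [hrρ, hrρ', sub_coeff_eq_zero hagree hj]
  -- Position i is the first where the two reductions may differ: the cut vector has 0 there, which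
  -- produces the term -℘_i.
  · rw [hrρ, hrρ', sub_coeff_of_agree hagree, hry, if_neg (lt_irrefl _), hwc, zero_sub]

end ArtinSchreierStep

/-! ### Inductive construction of E_i, Y'_i and b_i. -/

section ArtinSchreierExistence

variable {p s : ℕ} [hp : Fact p.Prime] {K : Type*} [Field K] [NumberField K] {ζ : K}
  {res : levelRing p s ζ s →+* ZMod p}
  (hres : ∀ x : levelRing p s ζ s, res x = 0 ↔ ∃ r ∈ levelRing p s ζ s, (x : K) = (ζ - 1) * r)

theorem exp_lam_subst_mem (hs : 1 ≤ s) {n m : ℕ} (hn : 1 ≤ n) (hns : n ≤ s)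
    (hζ : IsPrimitiveRoot ζ (p ^ s)) {t : MvPowerSeries (Fin s) K}
    (ht : t ∈ coeffSub (levelRing p s ζ n) s m) (h0 : MvPowerSeries.constantCoeff t = 0) :
    artinHasse p s ζ 1 t ∈ mvOneAddMul (levelRing p s ζ n) s (lam p s ζ) m := by
  rw [artinHasse_eq_subst hζ hs h0]
  obtain ⟨g, hg, h⟩ := expQuot_mem_oneAddMul (p := p) (R := K) (locSub_le_levelRing (s := s) (ζ := ζ) 1)
    (zeta_mem_levelRing 1)
  exact subst_mem_mvOneAddMul ⟨g, mem_seriesOver.2 fun k =>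
    levelRing_mono hn hns (mem_seriesOver.1 hg k), h⟩ ht h0

/-- `EWitt` of the vector cut at `i` is a restricted power series up to a factor congruent to `1`
modulo `λ`, which is the exponential of `λ` times the last remainder. -/
theorem exists_EWitt_cut_eq (hζ : IsPrimitiveRoot ζ (p ^ s)) {i : ℕ} (hi : i + 1 ≤ s)
    {a : ℕ → MvPowerSeries (Fin s) K}
    (ha : ∀ j < i, a j ∈ goodSub p s ζ (i + 1) i)
    (ha0 : ∀ j < i, MvPowerSeries.constantCoeff (a j) = 0)
    {q : ℕ → MvPolynomial (Fin s) (ZMod p)} (hq : ∀ j < i, q j ∈ varSub p s i)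
    (hq0 : ∀ j < i, MvPolynomial.constantCoeff (q j) = 0)
    (hred : ∀ j, ∀ hj : j < i, redMap hres ⟨a j, (ha j hj).2⟩ = wpSeq p q j) :
    ∃ Q r, EWitt p s ζ (i + 1) (cut i a) = Q * artinHasse p s ζ 1 r ∧
      Q ∈ goodSub p s ζ (i + 1) i ∧
      Q ∈ mvOneAddMul (levelRing p s ζ (i + 1)) s (zetaLevel p s ζ (i + 1) - 1) i ∧
      MvPowerSeries.constantCoeff Q = 1 ∧ MvPowerSeries.constantCoeff r = 0 ∧
      ∃ hr : r ∈ goodSub p s ζ (i + 1) i, redMap hres ⟨r, hr.2⟩ = -wpSeq p (cut i q) i := by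
  have hs : 1 ≤ s := by omega
  obtain ⟨c, ρ, hc, hρ0, hadd, hρ, hρr, hρi⟩ := exists_witt_remainder hres hi ha ha0 hq hq0 hred
  have hc0 := fun j => (hc j).2
  have hcp0 : ∀ j, MvPowerSeries.constantCoeff (c j ^ p) = 0 := fun j => by
    rw [map_pow, hc0, zero_pow hp.out.ne_zero]
  set Q₁ := ∏ j ∈ Finset.range (i + 1), (expQuotFrob p (zetaLevel p s ζ (i + 1 - j))).subst (c j)
    with hQ₁
  set Q₂ := EWitt p s ζ (i + 1) (cut i ρ.coeff) with hQ₂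
  have hcut0 : ∀ j, MvPowerSeries.constantCoeff (cut i ρ.coeff j) = 0 :=
    constantCoeff_cut fun j _ => hρ0 j
  have hcut : ∀ j, cut i ρ.coeff j ∈ goodSub p s ζ (i + 1) i := cut_mem_goodSub fun j _ => hρ j
  have hcutr : ∀ j, redMap hres ⟨cut i ρ.coeff j, (hcut j).2⟩ = 0 := fun j => by
    by_cases hj : j < i
    · rw [← hρr j hj]; congr 2; exact cut_apply_lt _ hj
    · rw [← map_zero (redMap hres)]; congr 1; exact Subtype.ext (cut_apply_ge _ (not_lt.1 hj))
  -- Apply E to cut(a) + c^{(p)} = ρ + c and cancel E(c^{(p)}): the quotient E(c)/E(c^{(p)}) is Q₁.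
  -- The component ρ_i has nonzero reduction in general, so its factor is kept apart from Q₂.
  have h1 : EWitt p s ζ (i + 1) (cut i a) = Q₁ * Q₂ * artinHasse p s ζ 1 (ρ.coeff i) := by
    have e1 := EWitt_add (p := p) (s := s) (ζ := ζ) (i + 1) (x := WittVector.mk p (cut i a))
      (y := WittVector.mk p fun j => c j ^ p)
      (fun j => by rw [WittVector.coeff_mk]; exact constantCoeff_cut ha0 j)
      (fun j => by rw [WittVector.coeff_mk]; exact hcp0 j)
    have e2 := EWitt_add (p := p) (s := s) (ζ := ζ) (i + 1) (x := ρ) (y := WittVector.mk p c)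
      hρ0 (fun j => by rw [WittVector.coeff_mk]; exact hc0 j)
    rw [hadd, e2, WittVector.coeff_mk, WittVector.coeff_mk, WittVector.coeff_mk,
      EWitt_eq_prod_mul hζ hi hc0, EWitt_succ_cut i ρ.coeff] at e1
    have h0 : EWitt p s ζ (i + 1) (fun j => c j ^ p) ≠ 0 := fun h => by
      have := constantCoeff_EWitt (p := p) (s := s) (ζ := ζ) (i + 1) hcp0
      rw [h, map_zero] at this
      exact zero_ne_one this
    refine mul_right_cancel₀ h0 ?_
    rw [← e1]; ring
  have hF := fun j => expQuotFrob_subst_mem hs hζ (n := i + 1 - j) (n' := i + 1) (Nat.sub_le _ _) hi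
    (hc j).1 (hc0 j)
  have hE : Q₂ = ∏ j ∈ Finset.range (i + 1),
      (expQuot p (zetaLevel p s ζ (i + 1 - j))).subst (cut i ρ.coeff j) := by
    rw [hQ₂, EWitt]
    exact Finset.prod_congr rfl fun j _ => artinHasse_eq_subst hζ (by omega) (hcut0 j)
  refine ⟨Q₁ * Q₂, ρ.coeff i, h1, mul_mem (prod_mem fun j _ => (hF j).1) ?_,
    mul_mem_mvOneAddMul (pi_mem _) (prod_mem_mvOneAddMul (pi_mem _) _ fun j _ => (hF j).2) ?_, ?_,
    hρ0 i, hρ i, hρi⟩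
  · rw [hE]
    -- All components of the cut of ρ reduce to zero, so the unrestricted series `expQuot` may be
    -- evaluated there.
    exact prod_mem fun j _ => subst_mem_goodSub_of_red hres hζ (by omega) hi
      (mem_seriesOver_of_oneAddMul (pi_mem _) (oneAddMul_level (ζ := ζ) (Nat.sub_le (i + 1) j) hi
        (expQuot_mem_oneAddMul (p := p) (R := K) (locSub_le_levelRing _) (zeta_mem_levelRing _))))
      (hcut j) (hcut0 j) (hcutr j)
  · rw [hE]
    exact prod_mem_mvOneAddMul (pi_mem _) _ fun j _ =>
      expQuot_subst_mem (Nat.sub_le _ _) hi (hcut j).1 (hcut0 j)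
  · rw [map_mul, constantCoeff_EWitt _ hcut0, mul_one, hQ₁, map_prod]
    exact Finset.prod_eq_one fun j _ => by
      rw [constantCoeff_subst_of_zero _ (hc0 j), constantCoeff_expQuotFrob]

/-- The equation `exp(λ y) exp(λ r) Q = Q + λ (X - D)` has a solution `y` that is a restricted power
series, with a known reduction. -/
theorem exists_exp_lam_mul_eq (hζ : IsPrimitiveRoot ζ (p ^ s)) (i : Fin s)
    {Q r D : MvPowerSeries (Fin s) K} (hQ : Q ∈ goodSub p s ζ (i + 1) i)
    (hQ1 : Q ∈ mvOneAddMul (levelRing p s ζ (i + 1)) s (zetaLevel p s ζ (i + 1) - 1) i)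
    (hQ0 : MvPowerSeries.constantCoeff Q = 1)
    (hr : r ∈ goodSub p s ζ (i + 1) i) (hr0 : MvPowerSeries.constantCoeff r = 0)
    (hD : D ∈ goodSub p s ζ (i + 1) i) (hD0 : MvPowerSeries.constantCoeff D = 0) :
    ∃ y, ∃ hy : y ∈ goodSub p s ζ (i + 1) (i + 1), MvPowerSeries.constantCoeff y = 0 ∧
      Q * artinHasse p s ζ 1 r * artinHasse p s ζ 1 y =
        Q + MvPowerSeries.C (lam p s ζ) * (MvPowerSeries.X i - D) ∧
      redMap hres ⟨y, hy.2⟩ = (MvPolynomial.X i - redMap hres ⟨D, hD.2⟩) -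
        (MvPolynomial.X i - redMap hres ⟨D, hD.2⟩) ^ p - redMap hres ⟨r, hr.2⟩ := by
  have hi : (i : ℕ) + 1 ≤ s := i.2
  have hs : 1 ≤ s := by omega
  obtain ⟨Q', hQ', hQQ'⟩ := exists_inv_mem_goodSub hζ (by omega) hi hQ hQ1 hQ0
  have hup : ∀ {x : MvPowerSeries (Fin s) K}, x ∈ goodSub p s ζ (i + 1) i →
      x ∈ goodSub p s ζ (i + 1) (i + 1) := fun hx => goodSub_mono le_rfl hi (Nat.le_succ _) hx
  -- Dividing by Q, the equation becomes exp(λ(y + r)) = 1 + λt with t = (X_i - D)/Q, so y + r is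
  -- `ellS` at λ evaluated at t. As Q ≡ 1, it reduces to (X_i - D) - (X_i - D)^p.
  obtain ⟨t, htdef⟩ : ∃ t, t = (MvPowerSeries.X i - D) * Q' := ⟨_, rfl⟩
  have ht : t ∈ goodSub p s ζ (i + 1) (i + 1) := by
    rw [htdef]
    exact mul_mem (sub_mem (X_mem_goodSub _ (Nat.lt_succ_self _)) (hup hD)) (hup hQ')
  have htQ : t * Q = MvPowerSeries.X i - D := by
    rw [htdef, mul_assoc, mul_comm Q', hQQ', mul_one]
  have ht0 : MvPowerSeries.constantCoeff t = 0 := by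
    rw [htdef, map_mul, map_sub, hD0, MvPowerSeries.constantCoeff_X, sub_zero, zero_mul]
  have hst := PowerSeries.HasSubst.of_constantCoeff_zero ht0
  have hell : ellS (lam p s ζ) ∈ seriesOver (levelRing p s ζ (i + 1)) := mem_seriesOver.2 fun k => by
    obtain ⟨D', hD', h1⟩ := ellS_lam_eq hs hζ
    have hX : (PowerSeries.X : PowerSeries K) ∈ seriesOver (levelRing p s ζ 1) :=
      mem_seriesOver.2 fun n => by rw [PowerSeries.coeff_X]; split_ifs <;> simp
    have h2 : ellS (lam p s ζ) ∈ seriesOver (levelRing p s ζ 1) := by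
      rw [h1]
      exact add_mem (sub_mem hX (pow_mem hX p)) (mul_mem (C_mem_seriesOver (lam_mem le_rfl hs)) hD')
    exact levelRing_mono (i := 1) (Nat.le_add_left 1 i) hi (mem_seriesOver.1 h2 k)
  have hy1 := subst_mem_goodSub hs hζ hi hell (ellS_lam_tendsZero hs hζ) ht ht0
  have hy10 : MvPowerSeries.constantCoeff ((ellS (lam p s ζ)).subst t) = 0 := by
    rw [constantCoeff_subst_of_zero _ ht0, constantCoeff_ellS]
  have hexpt := exp_subst_ellS (lam p s ζ) hst
  have h3 := redMap_ellS hres hs hζ ⟨t, ht.2⟩ ht0 hy1.2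
  generalize (ellS (lam p s ζ)).subst t = w at hy1 hy10 hexpt h3
  have hy0 : MvPowerSeries.constantCoeff (w - r) = 0 := by rw [map_sub, hy10, hr0, sub_zero]
  refine ⟨w - r, sub_mem hy1 (hup hr), hy0, ?_, ?_⟩
  · have h1 : artinHasse p s ζ 1 (w - r) * artinHasse p s ζ 1 r =
        1 + MvPowerSeries.C (lam p s ζ) * t := by
      rw [artinHasse_one, artinHasse_one, ← exp_subst_add, ← mul_add, sub_add_cancel, hexpt]
      · exact PowerSeries.HasSubst.of_constantCoeff_zero (by rw [map_mul, hy0, mul_zero])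
      · exact PowerSeries.HasSubst.of_constantCoeff_zero (by rw [map_mul, hr0, mul_zero])
    rw [mul_assoc, mul_comm (artinHasse p s ζ 1 r), h1, ← htQ]
    ring
  · have hrt : redMap hres ⟨t, ht.2⟩ = MvPolynomial.X i - redMap hres ⟨D, hD.2⟩ := by
      have h1 : redMap hres ⟨Q, hQ.2⟩ = 1 := by
        rw [← map_one (redMap hres), redMap_eq_iff]
        obtain ⟨g, hg, h2⟩ := hQ1
        intro n
        change MvPowerSeries.coeff n (Q - 1) ∈ _
        rw [h2, add_sub_cancel_left, MvPowerSeries.coeff_C_mul]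
        exact mul_mem_mulSub (pi_mem_mulSub hi) (levelRing_mono hi le_rfl (hg n).1)
      have h2 : (⟨t, ht.2⟩ : resSub (levelRing p s ζ s) (ζ - 1) s) * ⟨Q, hQ.2⟩ =
          ⟨MvPowerSeries.X i, X_mem_resSub _ _ i⟩ - ⟨D, hD.2⟩ := Subtype.ext htQ
      have h4 := congrArg (redMap hres) h2
      rwa [map_mul, h1, mul_one, map_sub, redMap_X] at h4
    rw [← hrt, ← h3, ← map_sub]
    rfl

open scoped Classical in
/-- The truncation `e` of the series `Q A`, with `A` congruent to `1` modulo `λ`. -/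
theorem exists_lam_truncation (hζ : IsPrimitiveRoot ζ (p ^ s)) {i : ℕ} (hi : i + 1 ≤ s)
    {f Q A : MvPowerSeries (Fin s) K} (hf : f = Q * A) (hf0 : MvPowerSeries.constantCoeff f = 1)
    (hA : A ∈ mvOneAddMul (levelRing p s ζ (i + 1)) s (lam p s ζ) i)
    (hQ : Q ∈ goodSub p s ζ (i + 1) i)
    (hQ0 : MvPowerSeries.constantCoeff Q = 1) :
    ∃ e : MvPolynomial (Fin s) K,
      (∀ n, e.coeff n = if MvPowerSeries.coeff n f ∈ mulSub (levelRing p s ζ s) (lam p s ζ)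
        then 0 else MvPowerSeries.coeff n f) ∧
      (∀ n, e.coeff n ∈ levelRing p s ζ (i + 1)) ∧
      (∀ j ∈ e.vars, (j : ℕ) < i) ∧ MvPolynomial.constantCoeff e = 1 ∧
      ∃ D ∈ goodSub p s ζ (i + 1) i, MvPowerSeries.constantCoeff D = 0 ∧
        Q = (e : MvPowerSeries (Fin s) K) + MvPowerSeries.C (lam p s ζ) * D := by
  have hs : 1 ≤ s := by omega
  have hl0 : lam p s ζ ≠ 0 := pi_ne_zero hζ le_rfl hs
  have hlm : lam p s ζ ∈ levelRing p s ζ (i + 1) := lam_mem (by omega) hi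
  obtain ⟨g, hg, hAg⟩ := hA
  have hfm : f ∈ coeffSub (levelRing p s ζ (i + 1)) s i := by
    rw [hf, hAg]
    exact mul_mem hQ.1 (add_mem (one_mem _) (mul_mem (C_mem_coeffSub hlm _) hg))
  obtain ⟨e, hec, hem, hev, D, hD, hQD, -⟩ := exists_truncation hζ (by omega) hi hl0 hlm
    (mulSub (levelRing p s ζ s) (lam p s ζ)) (fun x hx => hx) (M := p ^ s) (fun x hx => by
      obtain ⟨r, hr, rfl⟩ := mem_mulSub.1 hx
      exact mul_mem_mulSub (pi_pow_mem_mulSub_lam hs hζ) hr) (f := f) (Q := Q) hfm hQ (fun k => by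
      -- The factor A = 1 + λg changes nothing modulo λ, so f has the same large coefficients as the
      -- restricted Q.
      have : Q - f = MvPowerSeries.C (lam p s ζ) * (-(Q * g)) := by rw [hf, hAg]; ring
      rw [this, MvPowerSeries.coeff_C_mul]
      exact mem_mulSub.2 ⟨_, levelRing_mono hi le_rfl (neg_mem (mul_mem hQ.1 hg) k).1, rfl⟩)
  have he0 : MvPolynomial.constantCoeff e = 1 := by
    rw [MvPolynomial.constantCoeff_eq, hec, coeff_zero_eq, hf0, if_neg]
    intro h1
    obtain ⟨r, hr, h1⟩ := mem_mulSub.1 h1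
    exact one_notMem_mulSub hs hζ (Set.mem_of_eq_of_mem h1
      (mul_mem_mulSub (pi_mem_mulSub (i := 1) hs) hr))
  refine ⟨e, fun n => (hec n).trans (by congr), hem, hev, he0, D, hD, ?_, hQD⟩
  have h := congrArg MvPowerSeries.constantCoeff hQD
  rw [map_add, constantCoeff_coe_mvPolynomial, he0, hQ0, left_eq_add, map_mul,
    MvPowerSeries.constantCoeff_C] at h
  exact (mul_eq_zero.1 h).resolve_left hl0

/-- With Q = E_i + λD the new component reduces to (X_i - D̄) - (X_i - D̄)^p plus the part of ℘_i
coming from the earlier variables. By `wpSeq_eq_cut` this is ℘_i at the shifted variables with b_i =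
-D̄. -/
theorem exists_aswStep (hζ : IsPrimitiveRoot ζ (p ^ s)) (i : Fin s)
    {a : ℕ → MvPowerSeries (Fin s) K} {b : ℕ → MvPolynomial (Fin s) (ZMod p)}
    {E : ℕ → MvPolynomial (Fin s) K} (h : ∀ j : Fin s, j < i → ASWStep hres a b (E j) j) :
    ∃ y c e, ASWStep hres (Function.update a i y) (Function.update b i c) e i := by
  classical
  have hi : (i : ℕ) + 1 ≤ s := i.2
  have hs : 1 ≤ s := by omega
  have hj : ∀ j, ∀ hji : j < (i : ℕ), ASWStep hres a b (E j) ⟨j, hji.trans i.2⟩ :=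
    fun j hji => h ⟨j, hji.trans i.2⟩ hji
  have ha : ∀ j < (i : ℕ), a j ∈ goodSub p s ζ (i + 1) i := fun j hji =>
    goodSub_mono (Nat.succ_le_succ hji.le) hi hji (hj j hji).mem
  have ha0 : ∀ j < (i : ℕ), MvPowerSeries.constantCoeff (a j) = 0 := fun j hji =>
    (hj j hji).constantCoeff_eq
  have hq : ∀ j < (i : ℕ), shiftVar p s b j ∈ varSub p s i := fun j hji => by
    rw [shiftVar_of_lt b ⟨j, hji.trans i.2⟩]
    exact add_mem (X_mem_varSub hji) (varSub_mono hji.le (hj j hji).b_mem)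
  have hq0 : ∀ j < (i : ℕ), MvPolynomial.constantCoeff (shiftVar p s b j) = 0 := fun j hji => by
    rw [shiftVar_of_lt b ⟨j, hji.trans i.2⟩, map_add, MvPolynomial.constantCoeff_X, zero_add]
    exact (hj j hji).b_constantCoeff
  obtain ⟨Q, r, hf, hQ, hQ1, hQ0, hr0, hr, hrr⟩ :=
    exists_EWitt_cut_eq hres hζ hi ha ha0 hq hq0 fun j hji => (hj j hji).red_eq
  obtain ⟨e, hec, hem, hev, he0, D, hD, hD0, hQD⟩ := exists_lam_truncation hζ hi hf
    (constantCoeff_EWitt _ (constantCoeff_cut ha0))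
    (exp_lam_subst_mem hs (by omega) hi hζ hr.1 hr0) hQ hQ0
  obtain ⟨y, hy, hy0, hyE, hyr⟩ := exists_exp_lam_mul_eq hres hζ i hQ hQ1 hQ0 hr hr0 hD hD0
  have hu : Function.update a i y i = y := Function.update_self ..
  have hub : Function.update b i (-redMap hres ⟨D, hD.2⟩) i = -redMap hres ⟨D, hD.2⟩ :=
    Function.update_self ..
  refine ⟨y, -redMap hres ⟨D, hD.2⟩, e, by rwa [hu], by rwa [hu],
    hem, hev, he0, fun n => ?_, ?_, ?_, ?_, ?_, ?_⟩
  · obtain ⟨g, hg, h2⟩ := hQ1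
    obtain ⟨r', hr', h3⟩ := pi_dvd_pi (p := p) (ζ := ζ) (i := i + 1) (j := 1) (by omega) hi
    have h4 : (e : MvPowerSeries (Fin s) K) - 1 = MvPowerSeries.C (zetaLevel p s ζ (i + 1) - 1) *
        (g - MvPowerSeries.C r' * D) := by
      have h5 : MvPowerSeries.C (lam p s ζ) = MvPowerSeries.C (σ := Fin s)
          (zetaLevel p s ζ (i + 1) - 1) * MvPowerSeries.C r' := by rw [lam, h3, map_mul]
      linear_combination h2 - hQD - D * h5
    rw [h4, MvPowerSeries.coeff_C_mul]
    exact mem_mulSub.2 ⟨_, (sub_mem hg (mul_mem (C_mem_coeffSub hr' _) hD.1) n).1, rfl⟩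
  · rw [EWitt_succ_cut, cut_update a le_rfl, hu, hf, hyE, hQD]
    ring
  · intro n
    rw [cut_update a le_rfl, hec]
  · rw [hub]; exact neg_mem (redMap_mem_varSub hres ⟨D, hD.2⟩ hD.1)
  · rw [hub, map_neg, constantCoeff_redMap hres ⟨D, hD.2⟩ hD0, neg_zero]
  · have h1 : ∀ hm, redMap hres ⟨Function.update a (↑i) y i, hm⟩ = redMap hres ⟨y, hy.2⟩ := by
      rw [hu]; exact fun _ => rfl
    have h4 : cut i (shiftVar p s (Function.update b i (-redMap hres ⟨D, hD.2⟩))) =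
        cut i (shiftVar p s b) := cut_congr fun j hji => by
      unfold shiftVar
      rw [Function.update_of_ne hji.ne]
    refine (h1 _).trans ?_
    rw [hyr, hrr, wpSeq_eq_cut (shiftVar p s (Function.update b _ _)), h4, shiftVar_of_lt, hub]
    ring

theorem exists_aswSteps (hζ : IsPrimitiveRoot ζ (p ^ s)) (m : ℕ) (hm : m ≤ s) :
    ∃ (a : ℕ → MvPowerSeries (Fin s) K) (b : ℕ → MvPolynomial (Fin s) (ZMod p))
      (E : ℕ → MvPolynomial (Fin s) K),
      ∀ i : Fin s, (i : ℕ) < m → ASWStep hres a b (E i) i := by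
  induction m with
  | zero => exact ⟨0, 0, 0, fun i hi => absurd hi (Nat.not_lt_zero _)⟩
  | succ m ih =>
    obtain ⟨a, b, E, h⟩ := ih (by omega)
    obtain ⟨y, c, e, hy⟩ := exists_aswStep hres hζ ⟨m, hm⟩ (a := a) (b := b) (E := E)
      (fun j hj => h j hj)
    refine ⟨Function.update a m y, Function.update b m c, Function.update E m e, fun i hi => ?_⟩
    rcases Nat.lt_succ_iff_lt_or_eq.1 hi with h1 | h1
    · rw [Function.update_of_ne h1.ne]
      exact (h i h1).update hres h1 y c
    · obtain rfl : i = ⟨m, hm⟩ := Fin.ext h1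
      rw [Function.update_self]
      exact hy

end ArtinSchreierExistence

/-! ### The resulting data E, Y', F, b and the shape of Y'. -/

section ArtinSchreierDatum

variable {p s : ℕ} [hp : Fact p.Prime] {K : Type*} [Field K] [NumberField K] {ζ : K}

/-- The data attached to the change of variables `Z_i = E_i + λ Y_i`. -/
structure ASWDatum (p s : ℕ) [Fact p.Prime] (ζ : K) (E : Fin s → MvPolynomial (Fin s) K)
    (Y' F : Fin s → MvPowerSeries (Fin s) K) (P : Fin s → MvPolynomial (Fin s) ℤ)
    (b : Fin s → MvPolynomial (Fin s) (ZMod p)) : Prop where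
  coeff_mem : ∀ (i : Fin s) (n : Fin s →₀ ℕ), (E i).coeff n ∈ levelRing p s ζ (i + 1)
  vars_lt : ∀ i, ∀ j ∈ (E i).vars, j < i
  constantCoeff_E : ∀ i, MvPolynomial.constantCoeff (E i) = 1
  sub_one_mem : ∀ (i : Fin s) (n : Fin s →₀ ℕ), (E i - 1).coeff n ∈
    mulSub (levelRing p s ζ (i + 1)) (zetaLevel p s ζ (i + 1) - 1)
  assoc : IsAssociatedWitt p s ζ E Y'
  trunc : ∀ i : Fin s, IsTruncation p s (E i) (EWitt p s ζ (i + 1) (cut i (extendZero Y')))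
  shape : ∀ i : Fin s, Y' i =
    MvPowerSeries.C ((-1) ^ (p - 1) * (lam p s ζ ^ (p - 1) / (p : K))) *
      MvPowerSeries.X i ^ p + MvPowerSeries.X i + F i
  F_mem : ∀ i : Fin s, F i ∈ coeffSub (levelRing p s ζ (i + 1)) s (i + 1)
  P_vars : ∀ i, ∀ j ∈ (P i).vars, j < i
  F_sub_P : ∀ (i : Fin s) (n : Fin s →₀ ℕ),
    MvPowerSeries.coeff n (F i) - (((P i).coeff n : ℤ) : K) ∈
      mulSub (levelRing p s ζ (i + 1)) (zetaLevel p s ζ (i + 1) - 1)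
  b_zero : ∀ i : Fin s, (i : ℕ) = 0 → b i = 0
  b_vars : ∀ i, ∀ j ∈ (b i).vars, j < i
  map_P : ∀ i : Fin s, MvPolynomial.map (Int.castRingHom (ZMod p)) (P i) =
    MvPolynomial.aeval (fun j => MvPolynomial.X j + b j) (aswPoly p s i) + (b i - b i ^ p)

theorem extendZero_shift (b : ℕ → MvPolynomial (Fin s) (ZMod p)) :
    extendZero (fun j : Fin s => (MvPolynomial.X j : MvPolynomial (Fin s) (ZMod p)) + b j) =
      shiftVar p s b := rfl

theorem aeval_aswPoly (b : ℕ → MvPolynomial (Fin s) (ZMod p)) (i : Fin s) :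
    MvPolynomial.aeval (fun j : Fin s => MvPolynomial.X j + b j) (aswPoly p s i) + (b i - b i ^ p) =
      wpSeq p (shiftVar p s b) i - MvPolynomial.X i + MvPolynomial.X i ^ p := by
  have h := map_wp (MvPolynomial.aeval (R := ZMod p)
    (fun j : Fin s => (MvPolynomial.X j : MvPolynomial (Fin s) (ZMod p)) + b j)).toRingHom
    (fun j : Fin s => (MvPolynomial.X j : MvPolynomial (Fin s) (ZMod p))) i
  have h1 : ∀ q : MvPolynomial (Fin s) (ZMod p), (MvPolynomial.aeval (R := ZMod p)
    (fun j : Fin s => (MvPolynomial.X j : MvPolynomial (Fin s) (ZMod p)) + b j)).toRingHom q =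
    MvPolynomial.aeval (fun j : Fin s => MvPolynomial.X j + b j) q := fun _ => rfl
  simp only [h1, MvPolynomial.aeval_X] at h
  rw [aswPoly, map_sub, h, wp_eq_wpSeq, extendZero_shift, map_sub, map_pow, MvPolynomial.aeval_X,
    add_pow_char]
  ring

theorem wpSeq_shift_mem {b : ℕ → MvPolynomial (Fin s) (ZMod p)} {i : Fin s}
    (hb : ∀ j : Fin s, j ≤ i → b j ∈ varSub p s j) :
    wpSeq p (shiftVar p s b) i - MvPolynomial.X i + MvPolynomial.X i ^ p ∈ varSub p s i := by
  have h1 : wpSeq p (shiftVar p s b) i - MvPolynomial.X i + MvPolynomial.X i ^ p =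
      wpSeq p (cut i (shiftVar p s b)) i + (b i - b i ^ p) := by
    rw [wpSeq_eq_cut, shiftVar_of_lt, add_pow_char]; ring
  rw [h1]
  refine add_mem (wpSeq_mem fun j _ => ?_) (sub_mem (hb i le_rfl) (pow_mem (hb i le_rfl) p))
  by_cases hj : j < i
  · rw [cut_apply_lt _ hj, shiftVar_of_lt b ⟨j, hj.trans i.2⟩]
    exact add_mem (X_mem_varSub hj) (varSub_mono (m := j) hj.le (hb ⟨j, hj.trans i.2⟩ hj.le))
  · rw [cut_apply_ge _ (not_lt.1 hj)]; exact zero_mem _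

theorem neg_one_pow_mul_lam_pow (hs : 1 ≤ s) (hζ : IsPrimitiveRoot ζ (p ^ s)) :
    ∃ r ∈ levelRing p s ζ 1, (-1) ^ (p - 1) * (lam p s ζ ^ (p - 1) / (p : K)) =
      -1 + lam p s ζ * r := by
  obtain ⟨r, hr, h⟩ := lam_pow hζ hs
  rcases hp.out.eq_two_or_odd' with h2 | h2
  · obtain ⟨t, ht, h3⟩ := p_dvd_pi hζ le_rfl hs
    refine ⟨t - r, sub_mem ht hr, ?_⟩
    have h4 : ((-1 : K)) ^ (p - 1) = -1 := by subst h2; norm_num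
    have h5 : (2 : K) = lam p s ζ * t := by rw [lam, ← h3, h2]; norm_num
    rw [h, h4]
    linear_combination h5
  · have : Even (p - 1) := Nat.Odd.sub_odd h2 odd_one
    exact ⟨r, hr, by rw [this.neg_one_pow, one_mul, h]⟩

variable {res : levelRing p s ζ s →+* ZMod p}
  (hres : ∀ x : levelRing p s ζ s, res x = 0 ↔ ∃ r ∈ levelRing p s ζ s, (x : K) = (ζ - 1) * r)

/-- F is what remains of Y'_i after the two displayed terms. The coefficient of X_i^p is ≡ -1, so F
reduces to ℘_i - X_i + X_i^p, which is free of X_i. The congruence is obtained at level s and then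
descended to level i + 1. -/
theorem ASWStep.exists_remainder (hs : 1 ≤ s) (hζ : IsPrimitiveRoot ζ (p ^ s))
    {a : ℕ → MvPowerSeries (Fin s) K} {b : ℕ → MvPolynomial (Fin s) (ZMod p)}
    {E : ℕ → MvPolynomial (Fin s) K} {i : Fin s}
    (h : ∀ j : Fin s, j ≤ i → ASWStep hres a b (E j) j) :
    ∃ (F : MvPowerSeries (Fin s) K) (P : MvPolynomial (Fin s) ℤ),
      a i = MvPowerSeries.C ((-1) ^ (p - 1) * (lam p s ζ ^ (p - 1) / (p : K))) *
        MvPowerSeries.X i ^ p + MvPowerSeries.X i + F ∧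
      F ∈ coeffSub (levelRing p s ζ (i + 1)) s (i + 1) ∧ (∀ j ∈ P.vars, j < i) ∧
      (∀ n, MvPowerSeries.coeff n F - ((P.coeff n : ℤ) : K) ∈
        mulSub (levelRing p s ζ (i + 1)) (zetaLevel p s ζ (i + 1) - 1)) ∧
      MvPolynomial.map (Int.castRingHom (ZMod p)) P =
        MvPolynomial.aeval (fun j : Fin s => MvPolynomial.X j + b j) (aswPoly p s i) +
          (b i - b i ^ p) := by
  have hi : (i : ℕ) + 1 ≤ s := i.2
  obtain ⟨r, hr, hc⟩ := neg_one_pow_mul_lam_pow hs hζ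
  set c := (-1) ^ (p - 1) * (lam p s ζ ^ (p - 1) / (p : K)) with hcdef
  have hri := levelRing_mono (i := 1) (j := i + 1) (by omega) hi hr
  have hlm : lam p s ζ ∈ levelRing p s ζ (i + 1) := lam_mem (by omega) hi
  have hcm : c ∈ levelRing p s ζ (i + 1) := by
    rw [hc]; exact add_mem (neg_mem (one_mem _)) (mul_mem hlm hri)
  rw [aeval_aswPoly]
  set q := wpSeq p (shiftVar p s b) i - MvPolynomial.X i + MvPolynomial.X i ^ p with hq
  have hqv : q ∈ varSub p s i := wpSeq_shift_mem fun j hj => (h j hj).b_mem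
  obtain ⟨P, hP, hP0⟩ := exists_int_lift q
  have hPv : ∀ j ∈ P.vars, j < i := fun j hj => by
    obtain ⟨n, hn, hjn⟩ := (MvPolynomial.mem_vars_iff_mem_support j).1 hj
    refine mem_varSub.1 hqv j ((MvPolynomial.mem_vars_iff_mem_support j).2 ⟨n, ?_, hjn⟩)
    rw [MvPolynomial.mem_support_iff] at hn ⊢
    exact fun h0 => hn (hP0 n h0)
  have hX : (MvPowerSeries.X i : MvPowerSeries (Fin s) K) ∈ goodSub p s ζ (i + 1) (i + 1) :=
    X_mem_goodSub _ (Nat.lt_succ_self _)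
  have ha := (h i le_rfl).mem
  have hPm : ((MvPolynomial.map (Int.castRingHom K) P : MvPolynomial (Fin s) K) :
      MvPowerSeries (Fin s) K) ∈ goodSub p s ζ (i + 1) (i + 1) :=
    mvPolynomial_mem_goodSub hi (fun k => by
      rw [MvPolynomial.coeff_map]; exact intCast_mem _ _) fun j hj =>
        Nat.lt_succ_of_lt (hPv j (MvPolynomial.vars_map _ _ hj))
  have hF : a i - MvPowerSeries.C c * MvPowerSeries.X i ^ p - MvPowerSeries.X i ∈
      coeffSub (levelRing p s ζ (i + 1)) s (i + 1) :=
    sub_mem (sub_mem ha.1 (mul_mem (C_mem_coeffSub hcm _) (pow_mem hX.1 p))) hX.1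
  refine ⟨_, P, (by ring), hF, hPv, fun n => ?_, ?_⟩
  · have hred : redMap hres (⟨a i, ha.2⟩ - ⟨MvPowerSeries.X i, hX.2⟩ +
        ⟨MvPowerSeries.X i, hX.2⟩ ^ p) = redMap hres ⟨_, hPm.2⟩ := by
      rw [redMap_int hres P hP, map_add, map_sub, map_pow, redMap_X, (h i le_rfl).red_eq]
    have h1 := (redMap_eq_iff hres _ _).1 hred n
    change MvPowerSeries.coeff n (a i - MvPowerSeries.X i + MvPowerSeries.X i ^ p - _) ∈ _ at h1
    have hcoe : MvPowerSeries.coeff n ((MvPolynomial.map (Int.castRingHom K) P :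
        MvPolynomial (Fin s) K) : MvPowerSeries (Fin s) K) = ((P.coeff n : ℤ) : K) := by
      rw [MvPolynomial.coeff_coe, MvPolynomial.coeff_map]; rfl
    have h2 : MvPowerSeries.coeff n (a i - MvPowerSeries.C c * MvPowerSeries.X i ^ p -
        MvPowerSeries.X i) - ((P.coeff n : ℤ) : K) ∈ mulSub (levelRing p s ζ s) (ζ - 1) := by
      have h3 : a i - MvPowerSeries.C c * MvPowerSeries.X i ^ p - MvPowerSeries.X i -
          ((MvPolynomial.map (Int.castRingHom K) P : MvPolynomial (Fin s) K) :
            MvPowerSeries (Fin s) K) = (a i - MvPowerSeries.X i + MvPowerSeries.X i ^ p -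
          ((MvPolynomial.map (Int.castRingHom K) P : MvPolynomial (Fin s) K) :
            MvPowerSeries (Fin s) K)) - MvPowerSeries.C (lam p s ζ) *
              (MvPowerSeries.C r * MvPowerSeries.X i ^ p) := by
        have h4 : MvPowerSeries.C (σ := Fin s) c = -1 + MvPowerSeries.C (lam p s ζ) *
            MvPowerSeries.C r := by rw [hc, map_add, map_neg, map_one, map_mul]
        rw [h4]; ring
      rw [← hcoe, ← map_sub, h3, map_sub]
      refine sub_mem h1 ?_
      rw [MvPowerSeries.coeff_C_mul]
      refine mul_mem_mulSub (pi_mem_mulSub (i := 1) hs) ?_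
      exact levelRing_mono hi le_rfl
        ((mul_mem (C_mem_coeffSub hri _) (pow_mem hX.1 p) : _ ∈ coeffSub _ s _) n).1
    obtain ⟨t, ht, h5⟩ := mem_mulSub.1 h2
    rw [← zetaLevel_self (p := p) (s := s) (ζ := ζ)] at h5
    exact mem_mulSub.2 (pi_dvd_descend hζ (Nat.le_add_left 1 i) hi le_rfl
      (sub_mem (hF n).1 (intCast_mem _ _)) ht h5)
  · ext n
    rw [MvPolynomial.coeff_map]
    exact hP n

theorem exists_aswDatum [IsCyclotomicExtension {p ^ s} ℚ K] (hs : 1 ≤ s)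
    (hζ : IsPrimitiveRoot ζ (p ^ s)) :
    ∃ E Y' F P b, ASWDatum p s ζ E Y' F P b := by
  obtain ⟨res, hres⟩ := exists_residue (K := K) hζ hs
  obtain ⟨a, b, E, h⟩ := exists_aswSteps hres hζ s le_rfl
  have h' : ∀ i : Fin s, ASWStep hres a b (E i) i := fun i => h i i.2
  choose F P hshape hF hPv hFP hmap using fun i : Fin s =>
    ASWStep.exists_remainder hres hs hζ (i := i) fun j _ => h' j
  have hcut : ∀ i : Fin s, cut i (extendZero (fun j : Fin s => a j)) = cut i a := fun i =>
    cut_extendZero a i.2.le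
  refine ⟨fun i => E i, fun i => a i, F, P, fun i => b i, fun i => (h' i).coeff_mem,
    fun i => (h' i).vars_lt, fun i => (h' i).constantCoeff_E, fun i n => ?_,
    ⟨fun i => (h' i).constantCoeff_eq, fun i => ?_⟩, fun i n => ?_, hshape, hF, hPv, hFP,
    fun i hi => ?_, fun i => mem_varSub.1 (h' i).b_mem, hmap⟩
  · have h1 := (h' i).sub_one_mem n
    rwa [map_sub, MvPolynomial.coeff_coe, ← MvPolynomial.coe_one, MvPolynomial.coeff_coe,
      ← MvPolynomial.coeff_sub] at h1
  · rw [(h' i).witt_eq]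
    exact EWitt_congr fun j hj => (extendZero_apply a (by omega)).symm
  · rw [hcut, (h' i).trunc n]
    have hl0 : lam p s ζ ≠ 0 := pi_ne_zero hζ le_rfl hs
    have h1 : ∀ x : K, x ∈ mulSub (levelRing p s ζ s) (lam p s ζ) ↔
        x / lam p s ζ ∈ levelRing p s ζ s := fun x => by
      refine mem_mulSub.trans ⟨fun ⟨r, hr, h⟩ => ?_, fun h => ⟨_, h, ?_⟩⟩
      · rwa [h, mul_div_cancel_left₀ _ hl0]
      · rw [mul_div_cancel₀ _ hl0]
    have h4 := fun x : K => nu_lt_iff hζ hs x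
    split_ifs with h2 h3 h3
    · exact absurd ((h1 _).1 h2) ((h4 _).1 h3)
    · rfl
    · rfl
    · exact absurd ((h1 _).2 (not_not.1 (mt (h4 _).2 h3))) h2
  -- b_0 is a polynomial in no variables with zero constant term.
  · ext n
    rw [MvPolynomial.coeff_zero]
    by_contra hn
    have hn0 : n ≠ 0 := by
      rintro rfl
      exact hn (h' i).b_constantCoeff
    obtain ⟨j, hj⟩ := Finsupp.support_nonempty_iff.2 hn0
    have := mem_varSub.1 (h' i).b_mem j ((MvPolynomial.mem_vars_iff_mem_support j).2
      ⟨n, MvPolynomial.mem_support_iff.2 hn, hj⟩)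
    omega

end ArtinSchreierDatum

/-! ### Integrality of the Witt vector X' of an arbitrary admissible datum. -/

section KummerIntegrality

variable {p s : ℕ} [hp : Fact p.Prime] {K : Type*} [Field K] [NumberField K] {ζ : K}

theorem coeffSub_level_mono {n n' m m' : ℕ} (hn : n ≤ n') (hn' : n' ≤ s) (hm : m ≤ m')
    {f : MvPowerSeries (Fin s) K} (hf : f ∈ coeffSub (levelRing p s ζ n) s m) :
    f ∈ coeffSub (levelRing p s ζ n') s m' :=
  mem_coeffSub.2 fun k => ⟨levelRing_mono hn hn' (hf k).1, fun h j hj =>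
    ((hf k).2 h j hj).trans_le hm⟩

theorem coe_mem_coeffSub {n m : ℕ} {f : MvPolynomial (Fin s) K}
    (hf : ∀ k, f.coeff k ∈ levelRing p s ζ n) (hv : ∀ j ∈ f.vars, (j : ℕ) < m) :
    (f : MvPowerSeries (Fin s) K) ∈ coeffSub (levelRing p s ζ n) s m :=
  mem_coeffSub.2 fun k => by
    rw [MvPolynomial.coeff_coe]
    exact ⟨hf k, fun h j hj => hv j ((MvPolynomial.mem_vars_iff_mem_support j).2
      ⟨k, MvPolynomial.mem_support_iff.2 h, hj⟩)⟩

theorem exists_inv_mem_coeffSub {n m : ℕ} {c : K} (hc0 : c ≠ 0) (hc : c ∈ levelRing p s ζ n) {f : MvPowerSeries (Fin s) K}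
    (hf1 : f ∈ mvOneAddMul (levelRing p s ζ n) s c m)
    (h0 : MvPowerSeries.constantCoeff f = 1) :
    ∃ g ∈ coeffSub (levelRing p s ζ n) s m, f * g = 1 := by
  obtain ⟨q, hq, rfl⟩ := hf1
  have hq0 : MvPowerSeries.constantCoeff q = 0 := by
    rw [map_add, map_one, map_mul, MvPowerSeries.constantCoeff_C, add_eq_left] at h0
    exact (mul_eq_zero.1 h0).resolve_left hc0
  refine ⟨_, subst_mem_coeffSub (fun k => ?_) hq hq0,
    geom_subst c (PowerSeries.HasSubst.of_constantCoeff_zero hq0)⟩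
  rw [PowerSeries.coeff_mk]
  exact pow_mem (neg_mem hc) k

theorem mvOneAddMul_mem_coeffSub {n m : ℕ} {c : K} (hc : c ∈ levelRing p s ζ n)
    {f : MvPowerSeries (Fin s) K} (hf : f ∈ mvOneAddMul (levelRing p s ζ n) s c m) :
    f ∈ coeffSub (levelRing p s ζ n) s m := by
  obtain ⟨q, hq, rfl⟩ := hf
  exact add_mem (one_mem _) (mul_mem (C_mem_coeffSub hc _) hq)

theorem GWitt_cut_mem_mvOneAddMul (hζ : IsPrimitiveRoot ζ (p ^ s)) {i : ℕ} (hi : i + 1 ≤ s)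
    {a : ℕ → MvPowerSeries (Fin s) K}
    (ha : ∀ j < i, a j ∈ coeffSub (levelRing p s ζ (j + 1)) s (j + 1))
    (ha0 : ∀ j < i, MvPowerSeries.constantCoeff (a j) = 0) :
    GWitt p s ζ (i + 1) (cut i a) ∈
      mvOneAddMul (levelRing p s ζ (i + 1)) s (zetaLevel p s ζ (i + 1) - 1) i := by
  rw [GWitt_eq_prod hζ hi (constantCoeff_cut ha0)]
  refine prod_mem_mvOneAddMul (pi_mem _) _ fun j _ => subst_mem_mvOneAddMul
    (oneAddMul_level (ζ := ζ) (Nat.sub_le _ _) hi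
      (expQuotPow_mem_oneAddMul (p := p) (R := K) (locSub_le_levelRing _) (zeta_mem_levelRing _)))
    ?_ (constantCoeff_cut ha0 j)
  by_cases hj : j < i
  · rw [cut_apply_lt _ hj]; exact coeffSub_level_mono (by omega) hi hj (ha j hj)
  · rw [cut_apply_ge _ (not_lt.1 hj)]; exact zero_mem _

theorem constantCoeff_GWitt (hζ : IsPrimitiveRoot ζ (p ^ s)) {n : ℕ} (hn : n ≤ s)
    {a : ℕ → MvPowerSeries (Fin s) K} (ha : ∀ j, MvPowerSeries.constantCoeff (a j) = 0) :
    MvPowerSeries.constantCoeff (GWitt p s ζ n a) = 1 := by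
  rw [GWitt_eq_prod hζ hn ha, map_prod]
  exact Finset.prod_eq_one fun j _ => by
    rw [constantCoeff_subst_of_zero _ (ha j), constantCoeff_expQuotPow]

variable [IsCyclotomicExtension {p ^ s} ℚ K]
  {G : Fin s → MvPolynomial (Fin s) K} {X' : Fin s → MvPowerSeries (Fin s) K}

/-- The remainder in the approximation of `GWitt` by an admissible polynomial. -/
theorem IsKummerDatum.exists_remainder (hG : IsKummerDatum p s ζ G X') (hs : 1 ≤ s)
    (hζ : IsPrimitiveRoot ζ (p ^ s)) (i : Fin s)
    (h : ∀ j : Fin s, j < i → X' j ∈ coeffSub (levelRing p s ζ (j + 1)) s (j + 1)) :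
    ∃ R ∈ coeffSub (levelRing p s ζ (i + 1)) s i, MvPowerSeries.constantCoeff R = 0 ∧
      (G i : MvPowerSeries (Fin s) K) = GWitt p s ζ (i + 1) (cut i (extendZero X')) +
        MvPowerSeries.C ((p : K) * lam p s ζ) *
          (MvPowerSeries.C (zetaLevel p s ζ (i + 1) - 1) * R) := by
  have hi : (i : ℕ) + 1 ≤ s := i.2
  have hX0 := constantCoeff_extendZero hG.witt_constantCoeff
  have hc0 : ∀ j, MvPowerSeries.constantCoeff (cut i (extendZero X') j) = 0 :=
    constantCoeff_cut fun j _ => hX0 j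
  have hg1 : GWitt p s ζ (i + 1) (cut i (extendZero X')) ∈
      mvOneAddMul (levelRing p s ζ (i + 1)) s (zetaLevel p s ζ (i + 1) - 1) i :=
    GWitt_cut_mem_mvOneAddMul hζ hi (fun j hj => by
      have h1 := h ⟨j, hj.trans i.2⟩ hj
      rwa [show extendZero X' j = X' ⟨j, hj.trans i.2⟩ from dif_pos _]) fun j _ => hX0 j
  have hg0 := constantCoeff_GWitt hζ hi hc0
  have hg := mvOneAddMul_mem_coeffSub (pi_mem _) hg1
  have hGm : (G i : MvPowerSeries (Fin s) K) ∈ coeffSub (levelRing p s ζ (i + 1)) s i :=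
    coe_mem_coeffSub (hG.coeff_mem i) (hG.vars_lt i)
  have happ := hG.approx i
  generalize GWitt p s ζ (i + 1) (cut i (extendZero X')) = g at *
  have hπ0 := pi_ne_zero (p := p) (s := s) hζ (Nat.le_add_left 1 i) hi
  have hc := p_mul_lam_ne_zero hs hζ
  obtain ⟨R, hR, h2⟩ := coeffSub_div (R' := levelRing p s ζ (i + 1)) (mul_ne_zero hc hπ0)
    (sub_mem hGm hg) fun n => by
      obtain ⟨r, hr, h1⟩ := (lt_nu_iff hζ hs _).1 (happ n)
      have h3 : MvPowerSeries.coeff n ((G i : MvPowerSeries (Fin s) K) - g) =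
          ((p : K) * lam p s ζ) * ((ζ - 1) * -r) := by
        rw [map_sub] at h1 ⊢; linear_combination -h1
      have h4 := levelRing_of_mul hζ (Nat.le_add_left 1 i) hi ((sub_mem hGm hg : _ ∈ coeffSub _ s _) n).1
        (p_mul_lam_mem (Nat.le_add_left 1 i) hi) hc (mul_mem (pi_self_mem) (neg_mem hr)) h3
      have h5 : (ζ - 1) * -r = (zetaLevel p s ζ s - 1) * -r := by rw [zetaLevel_self]
      obtain ⟨t, ht, h6⟩ := pi_dvd_descend hζ (Nat.le_add_left 1 i) hi le_rfl h4 (neg_mem hr) h5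
      exact mem_mulSub.2 ⟨t, ht, by rw [h3, h6]; ring⟩
  refine ⟨R, hR, ?_, ?_⟩
  · have h1 := congrArg MvPowerSeries.constantCoeff h2
    rw [map_sub, constantCoeff_coe_mvPolynomial, hG.constantCoeff_eq, hg0, sub_self, map_mul,
      MvPowerSeries.constantCoeff_C] at h1
    exact (mul_eq_zero.1 h1.symm).resolve_left (mul_ne_zero hc hπ0)
  · rw [map_mul] at h2
    linear_combination h2

/-- The datum is arbitrary, so integrality has to be deduced. Admissibility and the equation for u_i
force exp(pλX'_i) = 1 + pλt with t integral; injectivity of exp then identifies X'_i with `ellS` at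
t. -/
theorem IsKummerDatum.witt_mem (hG : IsKummerDatum p s ζ G X') (hs : 1 ≤ s)
    (hζ : IsPrimitiveRoot ζ (p ^ s)) (i : Fin s) :
    X' i ∈ coeffSub (levelRing p s ζ (i + 1)) s (i + 1) := by
  induction i using WellFoundedLT.induction with
  | ind i ih =>
  have hi : (i : ℕ) + 1 ≤ s := i.2
  have hc := p_mul_lam_ne_zero (K := K) hs hζ
  have hX0 := constantCoeff_extendZero hG.witt_constantCoeff
  have hc0 : ∀ j, MvPowerSeries.constantCoeff (cut i (extendZero X') j) = 0 :=
    constantCoeff_cut fun j _ => hX0 j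
  have hg1 : GWitt p s ζ (i + 1) (cut i (extendZero X')) ∈
      mvOneAddMul (levelRing p s ζ (i + 1)) s (zetaLevel p s ζ (i + 1) - 1) i :=
    GWitt_cut_mem_mvOneAddMul hζ hi (fun j hj => by
      have h1 := ih ⟨j, hj.trans i.2⟩ hj
      rwa [show extendZero X' j = X' ⟨j, hj.trans i.2⟩ from dif_pos _]) fun j _ => hX0 j
  obtain ⟨R, hR, hR0, hGR⟩ := hG.exists_remainder hs hζ i ih
  have hw := hG.witt_eq i
  rw [GWitt_succ_cut hζ hi hX0, show extendZero X' i = X' i from dif_pos i.2, hGR] at hw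
  obtain ⟨g', hg', hgg⟩ := exists_inv_mem_coeffSub
    (pi_ne_zero (p := p) (s := s) hζ (Nat.le_add_left 1 i) hi) (pi_mem _) hg1
    (constantCoeff_GWitt hζ hi hc0)
  generalize GWitt p s ζ (i + 1) (cut i (extendZero X')) = g at *
  set t := (MvPowerSeries.X i + MvPowerSeries.C (zetaLevel p s ζ (i + 1) - 1) * R) * g' with ht
  have htm : t ∈ coeffSub (levelRing p s ζ (i + 1)) s (i + 1) :=
    mul_mem (add_mem (X_mem_goodSub (p := p) (ζ := ζ) _ (Nat.lt_succ_self _)).1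
      (mul_mem (C_mem_coeffSub (pi_mem _) _) (coeffSub_level_mono le_rfl hi (Nat.le_succ _) hR)))
      (coeffSub_level_mono le_rfl hi (Nat.le_succ _) hg')
  have ht0 : MvPowerSeries.constantCoeff t = 0 := by
    rw [ht, map_mul, map_add, MvPowerSeries.constantCoeff_X, map_mul, hR0, mul_zero, add_zero,
      zero_mul]
  have hexp : (PowerSeries.exp K).subst (MvPowerSeries.C ((p : K) * lam p s ζ) * X' i) =
      1 + MvPowerSeries.C ((p : K) * lam p s ζ) * t := by
    rw [ht]
    linear_combination g' * hw + (1 - (PowerSeries.exp K).subst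
      (MvPowerSeries.C ((p : K) * lam p s ζ) * X' i)) * hgg
  have hst := PowerSeries.HasSubst.of_constantCoeff_zero ht0
  rw [← exp_subst_ellS _ hst] at hexp
  have h0 : MvPowerSeries.constantCoeff ((ellS ((p : K) * lam p s ζ)).subst t) = 0 := by
    rw [constantCoeff_subst_of_zero _ ht0, constantCoeff_ellS]
  have h1 := exp_subst_injective
    (PowerSeries.HasSubst.of_constantCoeff_zero (by rw [map_mul, hG.witt_constantCoeff, mul_zero]))
    (PowerSeries.HasSubst.of_constantCoeff_zero (by rw [map_mul, h0, mul_zero])) hexp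
  have hC0 : MvPowerSeries.C (σ := Fin s) ((p : K) * lam p s ζ) ≠ 0 := fun h => hc
    (by have := congrArg MvPowerSeries.constantCoeff h
        rwa [MvPowerSeries.constantCoeff_C, map_zero] at this)
  rw [mul_left_cancel₀ hC0 h1]
  refine subst_mem_coeffSub (fun k => ?_) htm ht0
  obtain ⟨D, hD, h2⟩ := ellS_p_lam_eq (p := p) (ζ := ζ) hs
  have h3 : ellS ((p : K) * lam p s ζ) ∈ seriesOver (levelRing p s ζ 1) := by
    rw [h2]
    exact add_mem (mem_seriesOver.2 fun n => by rw [PowerSeries.coeff_X]; split_ifs <;> simp)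
      (mul_mem (C_mem_seriesOver (lam_mem le_rfl hs)) hD)
  exact levelRing_mono (i := 1) (Nat.le_add_left 1 i) hi (mem_seriesOver.1 h3 k)

end KummerIntegrality

/-- A triangular recursion over `Fin s` has a solution. -/
theorem exists_triangular_solution {s : ℕ} {A : Type*} [Zero A] (Φ : Fin s → (Fin s → A) → A)
    (hΦ : ∀ i ξ ξ', (∀ j < i, ξ j = ξ' j) → Φ i ξ = Φ i ξ') :
    ∃ ξ : Fin s → A, ∀ i, ξ i = Φ i ξ := by
  classical
  let f : ∀ i : Fin s, (∀ j : Fin s, j < i → A) → A :=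
    fun i ih => Φ i fun j => if h : j < i then ih j h else 0
  refine ⟨fun i => (wellFounded_lt (α := Fin s)).fix f i, fun i => ?_⟩
  refine (WellFounded.fix_eq _ f i).trans ?_
  refine hΦ i _ _ fun j hj => ?_
  rw [dif_pos hj]

theorem aeval_congr_vars {σ R A : Type*} [CommRing R] [CommRing A] [Algebra R A]
    {q : MvPolynomial σ R} {f g : σ → A} (h : ∀ j ∈ q.vars, f j = g j) :
    MvPolynomial.aeval f q = MvPolynomial.aeval g q :=
  MvPolynomial.eval₂Hom_congr' rfl (fun j hj _ => h j hj) rfl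

/-! ### Substitution in multivariate series with integral coefficients. -/

section SubstMv

variable {s : ℕ} {K : Type*} [Field K]

theorem mvSubst_mem_coeffSub {R : Subring K} {i m : ℕ} {f : MvPowerSeries (Fin s) K}
    (hf : f ∈ coeffSub R s i) {ξ : Fin s → MvPowerSeries (Fin s) K}
    (hξ : MvPowerSeries.HasSubst ξ) (h : ∀ j : Fin s, (j : ℕ) < i → ξ j ∈ coeffSub R s m) :
    f.subst ξ ∈ coeffSub R s m := by
  have hterm : ∀ d, MvPowerSeries.coeff d f ≠ 0 →
      d.prod (fun j e => ξ j ^ e) ∈ coeffSub R s m := fun d hd =>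
    prod_mem fun j hj => pow_mem (h j ((hf d).2 hd j hj)) _
  refine mem_coeffSub.2 fun n => ?_
  rw [MvPowerSeries.coeff_subst hξ]
  constructor
  · refine finsum_induction (· ∈ R) (zero_mem R) (fun x y hx hy => add_mem hx hy) fun d => ?_
    by_cases hd : MvPowerSeries.coeff d f = 0
    · rw [hd, zero_smul]; exact zero_mem R
    · rw [smul_eq_mul]
      exact mul_mem (hf d).1 (hterm d hd n).1
  · intro hne j hj
    by_contra hjm
    refine hne (finsum_eq_zero_of_forall_eq_zero fun d => ?_)
    by_cases hd : MvPowerSeries.coeff d f = 0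
    · rw [hd, zero_smul]
    · by_contra h0
      exact hjm ((hterm d hd n).2 (fun h1 => h0 (by rw [h1, smul_zero])) j hj)

theorem mvSubst_subst {ξ : Fin s → MvPowerSeries (Fin s) K} (hξ : MvPowerSeries.HasSubst ξ)
    {t : MvPowerSeries (Fin s) K} (ht : MvPowerSeries.constantCoeff t = 0) (f : PowerSeries K) :
    (f.subst t).subst ξ = f.subst (t.subst ξ) :=
  MvPowerSeries.subst_comp_subst_apply (R := K)
    (PowerSeries.HasSubst.of_constantCoeff_zero ht).const hξ f

theorem mvSubst_prod {ξ : Fin s → MvPowerSeries (Fin s) K} (hξ : MvPowerSeries.HasSubst ξ)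
    {ι : Type*} (I : Finset ι) (f : ι → MvPowerSeries (Fin s) K) :
    (∏ j ∈ I, f j).subst ξ = ∏ j ∈ I, (f j).subst ξ := by
  simp only [← MvPowerSeries.substAlgHom_apply hξ, map_prod]

theorem mvSubst_C {ξ : Fin s → MvPowerSeries (Fin s) K} (c : K) :
    (MvPowerSeries.C (σ := Fin s) c).subst ξ = MvPowerSeries.C c := MvPowerSeries.subst_C c

end SubstMv

/-! ### The X_i as power series in the Y_j, and X'(ξ) = Y'. -/

section KummerSubstitution

variable {p s : ℕ} [hp : Fact p.Prime] {K : Type*} [Field K] [NumberField K] {ζ : K}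

theorem mvSubst_GWitt (hζ : IsPrimitiveRoot ζ (p ^ s)) {n : ℕ} (hn : n ≤ s)
    {ξ : Fin s → MvPowerSeries (Fin s) K} (hξ0 : ∀ j, MvPowerSeries.constantCoeff (ξ j) = 0)
    {a : ℕ → MvPowerSeries (Fin s) K} (ha : ∀ j, MvPowerSeries.constantCoeff (a j) = 0) :
    (GWitt p s ζ n a).subst ξ = GWitt p s ζ n fun j => (a j).subst ξ := by
  have hξ := MvPowerSeries.hasSubst_of_constantCoeff_zero hξ0
  rw [GWitt_eq_prod hζ hn ha, GWitt_eq_prod hζ hn fun j =>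
    MvPowerSeries.constantCoeff_subst_eq_zero hξ hξ0 (ha j), mvSubst_prod hξ]
  exact Finset.prod_congr rfl fun j _ => mvSubst_subst hξ (ha j) _

/-- The polynomials `Z_i = E_i + λ X_i`, with indices shifted by one and `Z_0 = 1`. -/
def zPoly (p s : ℕ) (ζ : K) (E : Fin s → MvPolynomial (Fin s) K) (i : ℕ) :
    MvPolynomial (Fin s) K :=
  match i with
  | 0 => 1
  | i + 1 => if h : i < s then E ⟨i, h⟩ + MvPolynomial.C (lam p s ζ) * MvPolynomial.X ⟨i, h⟩ else 1

theorem zPoly_succ (E : Fin s → MvPolynomial (Fin s) K) (i : Fin s) :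
    zPoly p s ζ E (i + 1) = E i + MvPolynomial.C (lam p s ζ) * MvPolynomial.X i := dif_pos i.2

theorem coe_zPoly_succ (E : Fin s → MvPolynomial (Fin s) K) (i : Fin s) :
    (zPoly p s ζ E (i + 1) : MvPowerSeries (Fin s) K) = (E i : MvPowerSeries (Fin s) K) +
      MvPowerSeries.C (lam p s ζ) * MvPowerSeries.X i := by
  rw [zPoly_succ, MvPolynomial.coe_add, MvPolynomial.coe_mul, MvPolynomial.coe_C,
    MvPolynomial.coe_X]

variable {E : Fin s → MvPolynomial (Fin s) K} {Y' F : Fin s → MvPowerSeries (Fin s) K}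
  {P : Fin s → MvPolynomial (Fin s) ℤ} {b : Fin s → MvPolynomial (Fin s) (ZMod p)}

theorem ASWDatum.zPoly_eq (D : ASWDatum p s ζ E Y' F P b) {i : ℕ} (hi : i ≤ s) :
    (zPoly p s ζ E i : MvPowerSeries (Fin s) K) = EWitt p s ζ i (extendZero Y') := by
  cases i with
  | zero => rw [zPoly, MvPolynomial.coe_one]; rfl
  | succ i => exact (coe_zPoly_succ E ⟨i, hi⟩).trans (D.assoc.witt_eq ⟨i, hi⟩)

theorem ASWDatum.constantCoeff_zPoly (D : ASWDatum p s ζ E Y' F P b) {i : ℕ} (hi : i ≤ s) :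
    MvPowerSeries.constantCoeff (zPoly p s ζ E i : MvPowerSeries (Fin s) K) = 1 := by
  rw [D.zPoly_eq hi, constantCoeff_EWitt _ (constantCoeff_extendZero D.assoc.witt_constantCoeff)]

/-- The expansion of `X_i` as a power series in the `Y_j`. -/
theorem ASWDatum.exists_xi (D : ASWDatum p s ζ E Y' F P b) (hs : 1 ≤ s)
    (hζ : IsPrimitiveRoot ζ (p ^ s)) {G : Fin s → MvPolynomial (Fin s) K}
    {X' : Fin s → MvPowerSeries (Fin s) K} (hG : IsKummerDatum p s ζ G X') :
    ∃ ξ : Fin s → MvPowerSeries (Fin s) K, (∀ i, MvPowerSeries.constantCoeff (ξ i) = 0) ∧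
      ∀ i : Fin s, (zPoly p s ζ E (i + 1) : MvPowerSeries (Fin s) K) ^ p =
        (zPoly p s ζ E i : MvPowerSeries (Fin s) K) * (MvPolynomial.aeval ξ (G i) +
          MvPowerSeries.C ((p : K) * lam p s ζ) * ξ i) := by
  have hc := p_mul_lam_ne_zero (K := K) hs hζ
  -- The Kummer equation is solved for X_i; the recursion is triangular because G_i involves only
  -- earlier variables.
  obtain ⟨ξ, hξ⟩ := exists_triangular_solution (s := s) (A := MvPowerSeries (Fin s) K)
    (fun i ξ => MvPowerSeries.C ((p : K) * lam p s ζ)⁻¹ *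
      ((zPoly p s ζ E (i + 1) : MvPowerSeries (Fin s) K) ^ p *
        (zPoly p s ζ E i : MvPowerSeries (Fin s) K)⁻¹ - MvPolynomial.aeval ξ (G i)))
    fun i ξ ξ' h => by
      have h1 : MvPolynomial.aeval ξ (G i) = MvPolynomial.aeval ξ' (G i) :=
        aeval_congr_vars fun j hj => h j (hG.vars_lt i j hj)
      simp only [h1]
  have hcc : ∀ x : MvPowerSeries (Fin s) K, MvPowerSeries.C ((p : K) * lam p s ζ) *
      (MvPowerSeries.C ((p : K) * lam p s ζ)⁻¹ * x) = x := fun x => by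
    rw [← mul_assoc, ← map_mul, mul_inv_cancel₀ hc, map_one, one_mul]
  refine ⟨ξ, fun i => ?_, fun i => ?_⟩
  · induction i using WellFoundedLT.induction with
    | ind i ih =>
    have h1 : MvPowerSeries.constantCoeff (MvPolynomial.aeval ξ (G i)) = 1 := by
      rw [← hG.constantCoeff_eq i, MvPolynomial.aeval_def, MvPolynomial.hom_eval₂]
      have h2 : ((MvPowerSeries.constantCoeff (σ := Fin s) (R := K)).comp
          (algebraMap K (MvPowerSeries (Fin s) K))) = RingHom.id K := by
        ext x
        rw [RingHom.comp_apply, MvPowerSeries.algebraMap_apply, MvPowerSeries.constantCoeff_C]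
        rfl
      rw [h2]
      refine (MvPolynomial.eval₂Hom_congr' rfl (g₂ := fun _ => (0 : K)) (fun j hj _ =>
        ih j (hG.vars_lt i j hj)) rfl).trans ?_
      exact MvPolynomial.eval₂_zero_apply (RingHom.id K) (G i)
    rw [hξ, map_mul, map_sub, map_mul, map_pow, D.constantCoeff_zPoly i.2,
      MvPowerSeries.constantCoeff_inv, D.constantCoeff_zPoly i.2.le, h1]
    simp
  · have h1 : (zPoly p s ζ E i : MvPowerSeries (Fin s) K) *
        (zPoly p s ζ E i : MvPowerSeries (Fin s) K)⁻¹ = 1 :=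
      MvPowerSeries.mul_inv_cancel _ (by rw [D.constantCoeff_zPoly i.2.le]; exact one_ne_zero)
    have h2 := hξ i
    conv_rhs => rw [h2, hcc]
    linear_combination (-(zPoly p s ζ E (i + 1) : MvPowerSeries (Fin s) K) ^ p) * h1

/-- Both G_{i+1,p}(X'(ξ)) and G_{i+1,p}(Y') are equal to Z_i^p/Z_{i-1}. By induction the earlier
components agree, and then the factor exp(pλ ·) determines the last one. -/
theorem ASWDatum.subst_xi_eq (D : ASWDatum p s ζ E Y' F P b) (hs : 1 ≤ s)
    (hζ : IsPrimitiveRoot ζ (p ^ s)) {G : Fin s → MvPolynomial (Fin s) K}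
    {X' : Fin s → MvPowerSeries (Fin s) K} (hG : IsKummerDatum p s ζ G X')
    {ξ : Fin s → MvPowerSeries (Fin s) K} (hξ0 : ∀ i, MvPowerSeries.constantCoeff (ξ i) = 0)
    (hξ : ∀ i : Fin s, (zPoly p s ζ E (i + 1) : MvPowerSeries (Fin s) K) ^ p =
        (zPoly p s ζ E i : MvPowerSeries (Fin s) K) * (MvPolynomial.aeval ξ (G i) +
          MvPowerSeries.C ((p : K) * lam p s ζ) * ξ i)) (i : Fin s) :
    (X' i).subst ξ = Y' i := by
  induction i using WellFoundedLT.induction with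
  | ind i ih =>
  have hi : (i : ℕ) + 1 ≤ s := i.2
  have hc := p_mul_lam_ne_zero (K := K) hs hζ
  have hsub := MvPowerSeries.hasSubst_of_constantCoeff_zero hξ0
  have hX0 := constantCoeff_extendZero hG.witt_constantCoeff
  have hY0 := constantCoeff_extendZero D.assoc.witt_constantCoeff
  set a : ℕ → MvPowerSeries (Fin s) K := fun j => (extendZero X' j).subst ξ with ha
  have ha0 : ∀ j, MvPowerSeries.constantCoeff (a j) = 0 := fun j =>
    MvPowerSeries.constantCoeff_subst_eq_zero hsub hξ0 (hX0 j)
  have hw := congrArg (MvPowerSeries.subst ξ) (hG.witt_eq i)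
  rw [mvSubst_GWitt hζ hi hξ0 hX0, MvPowerSeries.subst_add hsub, MvPowerSeries.subst_coe,
    MvPowerSeries.subst_mul hsub, mvSubst_C, MvPowerSeries.subst_X hsub] at hw
  have h1 := GWitt_mul_EWitt (p := p) (s := s) (ζ := ζ) (i + 1) hY0
  rw [Nat.add_sub_cancel, ← D.zPoly_eq hi, ← D.zPoly_eq i.2.le, hξ i, ← hw, mul_comm] at h1
  have hz0 : (zPoly p s ζ E i : MvPowerSeries (Fin s) K) ≠ 0 := fun h => by
    have := D.constantCoeff_zPoly i.2.le
    rw [h, map_zero] at this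
    exact zero_ne_one this
  have h2 := mul_left_cancel₀ hz0 h1
  have hcut : cut i a = cut i (extendZero Y') := cut_congr fun j hj => by
    have h3 := ih ⟨j, hj.trans i.2⟩ hj
    rw [ha]
    simp only [show extendZero X' j = X' ⟨j, hj.trans i.2⟩ from dif_pos _,
      show extendZero Y' j = Y' ⟨j, hj.trans i.2⟩ from dif_pos _, h3]
  rw [GWitt_succ_cut hζ hi hY0, GWitt_succ_cut hζ hi ha0, hcut] at h2
  have hg0 : GWitt p s ζ (i + 1) (cut i (extendZero Y')) ≠ 0 := fun h => by
    have := constantCoeff_GWitt hζ hi (constantCoeff_cut (i := i) fun j _ => hY0 j)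
    rw [h, map_zero] at this
    exact zero_ne_one this
  have h4 := exp_subst_injective
    (PowerSeries.HasSubst.of_constantCoeff_zero (by rw [map_mul, hY0, mul_zero]))
    (PowerSeries.HasSubst.of_constantCoeff_zero (by rw [map_mul, ha0, mul_zero]))
    (mul_left_cancel₀ hg0 h2)
  have hC0 : MvPowerSeries.C (σ := Fin s) ((p : K) * lam p s ζ) ≠ 0 := fun h => hc
    (by have := congrArg MvPowerSeries.constantCoeff h
        rwa [MvPowerSeries.constantCoeff_C, map_zero] at this)
  have h5 := mul_left_cancel₀ hC0 h4
  rw [ha] at h5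
  simp only [show extendZero X' i = X' i from dif_pos i.2,
    show extendZero Y' i = Y' i from dif_pos i.2] at h5
  exact h5.symm

end KummerSubstitution

/-- The binomial formula up to second order, divided by `p`. -/
theorem exists_add_pow_eq {A : Type*} [CommRing A] (S : Subring A) {p : ℕ} (hp : p.Prime) {x y : A}
    (hx : x ∈ S) (hy : y ∈ S) :
    ∃ w ∈ S, (x + y) ^ p = x ^ p + p * (x ^ (p - 1) * y) + p * (y ^ 2 * w) + y ^ p := by
  obtain ⟨n, rfl⟩ : ∃ n, p = n + 2 := ⟨p - 2, by have := hp.two_le; omega⟩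
  have hd : ∀ m < n, ∃ k : ℕ, (n + 2).choose (m + 1) = (n + 2) * k := fun m hm =>
    hp.dvd_choose_self (Nat.succ_ne_zero m) (by omega)
  choose! k hk using hd
  refine ⟨∑ m ∈ Finset.range n, x ^ (m + 1) * y ^ (n - 1 - m) * k m, sum_mem fun m _ =>
    mul_mem (mul_mem (pow_mem hx _) (pow_mem hy _)) (natCast_mem _ _), ?_⟩
  rw [add_pow, Finset.sum_range_succ, Finset.sum_range_succ, Finset.sum_range_succ']
  have h1 : ∑ m ∈ Finset.range n, x ^ (m + 1) * y ^ (n + 2 - (m + 1)) *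
      (((n + 2).choose (m + 1) : ℕ) : A) =
      ((n + 2 : ℕ) : A) * (y ^ 2 * ∑ m ∈ Finset.range n, x ^ (m + 1) * y ^ (n - 1 - m) * k m) := by
    rw [Finset.mul_sum, Finset.mul_sum]
    refine Finset.sum_congr rfl fun m hm => ?_
    have hm := Finset.mem_range.1 hm
    rw [hk m hm, show n + 2 - (m + 1) = 2 + (n - 1 - m) by omega, pow_add, Nat.cast_mul]
    ring
  rw [h1]
  have h2 : (n + 2).choose (n + 1) = n + 2 := Nat.choose_succ_self_right (n + 1)
  simp only [h2, Nat.choose_self, Nat.choose_zero_right, pow_zero, Nat.sub_self, Nat.sub_zero,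
    Nat.cast_one, mul_one, one_mul, show n + 2 - (n + 1) = 1 by omega, pow_one,
    show n + 2 - 1 = n + 1 from rfl]
  ring

/-- The computation behind the constant term. Here e = E_i^p, z = Z_i^p, z' = Z_i^{p-1}, v =
(-λX_i)^p, u is the p-th power of E at the cut vector, t = Z_{i-1}G_i, y = Y'_i, q the lift of the
reduction of F_i, m = p, L = λ, c = pλ, and ϖ is the uniformizer. In e - t the terms X_i and X_i^p
cancel against those of Y'_i, leaving F_i. -/
theorem kummer_identity {A : Type*} [CommRing A]
    {e z z' L X Xp m w g c ϖ l a b d y f f' q r t u v : A}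
    (h1 : e = z + m * (z' * -(L * X)) + m * ((-(L * X)) ^ 2 * w) + v) (h2 : v = -(g * c * Xp))
    (h3 : t = u + c * (ϖ * r)) (h4 : u = z * (1 + c * (-y + L * d)))
    (h5 : z = 1 + ϖ * a) (h6 : z' = 1 + ϖ * b) (h7 : y = g * Xp + X + f) (h8 : f - q = ϖ * f')
    (h9 : c = m * L) (h10 : L = ϖ * l) :
    e - t = c * (q + ϖ * (f' - X * b + y * a + l * (X ^ 2 * w) - l * (d * z) - r)) := by
  linear_combination h1 + h2 - h3 - h4 + (z' * X - L * X ^ 2 * w) * h9 - c * X * h6 + c * y * h5 +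
    c * (X ^ 2 * w - d * z) * h10 + c * h7 + c * h8

/-- The same relation solved for x = ξ_i, with i = Z_{i-1}, i' its inverse and k = G_i(ξ). It
exhibits ξ_i as integral, which the induction on i needs. -/
theorem kummer_identity' {A : Type*} [CommRing A]
    {e z z' L X Xp m w g c ϖ q t v i i' x k W : A}
    (h1 : e = z + m * (z' * -(L * X)) + m * ((-(L * X)) ^ 2 * w) + v) (h2 : v = -(g * c * Xp))
    (h3 : e - t = c * (q + ϖ * W)) (h4 : z = i * (k + c * x)) (ht : t = i * k) (h5 : i * i' = 1)
    (h9 : c = m * L) :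
    c * x = c * (i' * (z' * X - L * X ^ 2 * w + g * Xp + (q + ϖ * W))) := by
  have h : c * (i * x) = c * (z' * X - L * X ^ 2 * w + g * Xp + (q + ϖ * W)) := by
    linear_combination -h1 - h2 + h3 - h4 + ht - (z' * X - L * X ^ 2 * w) * h9
  linear_combination i' * h - c * x * h5

/-! ### The constant term of the equation of Y_i, as a power series identity. -/

section KummerExpansion

variable {p s : ℕ} [hp : Fact p.Prime] {K : Type*} [Field K] [NumberField K] {ζ : K}
  {E : Fin s → MvPolynomial (Fin s) K} {Y' F : Fin s → MvPowerSeries (Fin s) K}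
  {P : Fin s → MvPolynomial (Fin s) ℤ} {b : Fin s → MvPolynomial (Fin s) (ZMod p)}

theorem mvOneAddMul_level_mono {n n' m m' : ℕ} (hn : n ≤ n') (hn' : n' ≤ s) (hm : m ≤ m')
    {f : MvPowerSeries (Fin s) K}
    (hf : f ∈ mvOneAddMul (levelRing p s ζ n) s (zetaLevel p s ζ n - 1) m) :
    f ∈ mvOneAddMul (levelRing p s ζ n') s (zetaLevel p s ζ n' - 1) m' := by
  obtain ⟨g, hg, rfl⟩ := hf
  obtain ⟨r, hr, h⟩ := pi_dvd_pi (p := p) (ζ := ζ) hn hn'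
  refine ⟨MvPowerSeries.C r * g, mul_mem (C_mem_coeffSub hr _) (coeffSub_level_mono hn hn' hm hg), ?_⟩
  rw [h, map_mul, mul_assoc]

theorem ASWDatum.E_mem (D : ASWDatum p s ζ E Y' F P b) (hζ : IsPrimitiveRoot ζ (p ^ s))
    (i : Fin s) : (E i : MvPowerSeries (Fin s) K) ∈
      mvOneAddMul (levelRing p s ζ (i + 1)) s (zetaLevel p s ζ (i + 1) - 1) i := by
  have hi : (i : ℕ) + 1 ≤ s := i.2
  obtain ⟨g, hg, h⟩ := coeffSub_div (R' := levelRing p s ζ (i + 1))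
    (pi_ne_zero (p := p) (s := s) hζ (Nat.le_add_left 1 i) hi)
    (sub_mem (coe_mem_coeffSub (D.coeff_mem i) (D.vars_lt i)) (one_mem _) :
      (E i : MvPowerSeries (Fin s) K) - 1 ∈ coeffSub _ s i) fun n => by
    have := D.sub_one_mem i n
    rwa [MvPolynomial.coeff_sub, ← MvPolynomial.coeff_coe, ← MvPolynomial.coeff_coe,
      MvPolynomial.coe_one, ← map_sub] at this
  exact ⟨g, hg, by rw [← h]; ring⟩

theorem ASWDatum.zPoly_mem (D : ASWDatum p s ζ E Y' F P b) (hζ : IsPrimitiveRoot ζ (p ^ s))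
    {i n : ℕ} (hin : i ≤ n) (hn : n ≤ s) : (zPoly p s ζ E i : MvPowerSeries (Fin s) K) ∈
      mvOneAddMul (levelRing p s ζ n) s (zetaLevel p s ζ n - 1) i := by
  cases i with
  | zero => rw [zPoly, MvPolynomial.coe_one]; exact one_mem_mvOneAddMul _ _ _
  | succ i =>
    refine mvOneAddMul_level_mono hin hn le_rfl ?_
    obtain ⟨g, hg, h⟩ := D.E_mem hζ ⟨i, by omega⟩
    obtain ⟨r, hr, h1⟩ := pi_dvd_pi (p := p) (s := s) (ζ := ζ) (i := i + 1) (j := 1) (by omega)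
      (by omega)
    refine ⟨g + MvPowerSeries.C r * MvPowerSeries.X ⟨i, by omega⟩,
      add_mem (coeffSub_level_mono le_rfl (by omega) (Nat.le_succ _) hg)
        (mul_mem (C_mem_coeffSub hr _) (X_mem_goodSub (p := p) (ζ := ζ) _ (Nat.lt_succ_self _)).1), ?_⟩
    rw [show (zPoly p s ζ E (i + 1) : MvPowerSeries (Fin s) K) = _ from
      coe_zPoly_succ E ⟨i, by omega⟩, h, lam, h1, map_mul]
    ring

theorem pow_eq_one_add_mul {A : Type*} [CommRing A] {S : Subring A} {c x z : A} (hz : z ∈ S)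
    (hc : c ∈ S) (h : x = 1 + c * z) (k : ℕ) : ∃ w ∈ S, x ^ k = 1 + c * w := by
  have hx : x ∈ S := by rw [h]; exact add_mem (one_mem _) (mul_mem hc hz)
  refine ⟨(∑ j ∈ Finset.range k, x ^ j) * z, mul_mem (sum_mem fun j _ => pow_mem hx j) hz, ?_⟩
  have h1 := geom_sum_mul x k
  have h2 : x - 1 = c * z := by rw [h]; ring
  rw [h2] at h1
  linear_combination -h1

theorem ASWDatum.Y'_mem (D : ASWDatum p s ζ E Y' F P b)
    (hζ : IsPrimitiveRoot ζ (p ^ s)) (i : Fin s) :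
    Y' i ∈ coeffSub (levelRing p s ζ (i + 1)) s (i + 1) := by
  have hi : (i : ℕ) + 1 ≤ s := i.2
  have hX : (MvPowerSeries.X i : MvPowerSeries (Fin s) K) ∈
    coeffSub (levelRing p s ζ (i + 1)) s (i + 1) :=
      (X_mem_goodSub (p := p) (ζ := ζ) _ (Nat.lt_succ_self _)).1
  rw [D.shape i]
  exact add_mem (add_mem (mul_mem (C_mem_coeffSub (mul_mem (pow_mem (neg_mem (one_mem _)) _)
    (lam_pow_unit hζ (Nat.le_add_left 1 i) hi).1) _) (pow_mem hX p)) hX) (D.F_mem i)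

/-- The `p`-th power of `EWitt` of the vector cut at `i`. -/
theorem ASWDatum.EWitt_cut_pow (D : ASWDatum p s ζ E Y' F P b) (hs : 1 ≤ s)
    (hζ : IsPrimitiveRoot ζ (p ^ s)) (i : Fin s) :
    ∃ d ∈ coeffSub (levelRing p s ζ (i + 1)) s (i + 1),
      EWitt p s ζ (i + 1) (cut i (extendZero Y')) ^ p =
        (zPoly p s ζ E (i + 1) : MvPowerSeries (Fin s) K) ^ p *
          (1 + MvPowerSeries.C ((p : K) * lam p s ζ) *
            (-Y' i + MvPowerSeries.C (lam p s ζ) * d)) := by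
  have hi : (i : ℕ) + 1 ≤ s := i.2
  have h0 := D.assoc.witt_constantCoeff i
  have hn0 : MvPowerSeries.constantCoeff (-Y' i) = 0 := by rw [map_neg, h0, neg_zero]
  obtain ⟨d, hd, h1⟩ := expSubOneDiv_p_lam_eq (p := p) (ζ := ζ) hs
  have hst := PowerSeries.HasSubst.of_constantCoeff_zero hn0
  refine ⟨d.subst (-Y' i), subst_mem_coeffSub (fun k =>
    levelRing_mono (i := 1) (Nat.le_add_left 1 i) hi (mem_seriesOver.1 hd k))
    (neg_mem (D.Y'_mem hζ i)) hn0, ?_⟩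
  have h2 : (PowerSeries.X + PowerSeries.C (lam p s ζ) * d).subst (-Y' i) =
      -Y' i + MvPowerSeries.C (lam p s ζ) * d.subst (-Y' i) := by
    rw [PowerSeries.subst_add hst, PowerSeries.subst_X hst, PowerSeries.subst_mul hst,
      PowerSeries.subst_C]
  -- Cutting off Y'_i removes the factor exp(λY'_i) from Z_i; the p-th power is therefore divided by
  -- exp(pλY'_i).
  rw [← h2, ← h1, ← exp_subst_C_mul _ hst, D.zPoly_eq hi,
    EWitt_succ_cut _ (extendZero Y'), artinHasse_one, mul_pow,
    show extendZero Y' i = Y' i from dif_pos i.2]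
  have hl : PowerSeries.HasSubst (MvPowerSeries.C (lam p s ζ) * Y' i) :=
    PowerSeries.HasSubst.of_constantCoeff_zero (by rw [map_mul, h0, mul_zero])
  have hc : PowerSeries.HasSubst (MvPowerSeries.C ((p : K) * lam p s ζ) * Y' i) :=
    PowerSeries.HasSubst.of_constantCoeff_zero (by rw [map_mul, h0, mul_zero])
  rw [← exp_subst_nsmul hl, nsmul_eq_mul, ← mul_assoc, show ((p : ℕ) : MvPowerSeries (Fin s) K) =
    MvPowerSeries.C (p : K) from (map_natCast _ p).symm, ← map_mul, mul_neg, mul_assoc,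
    exp_subst_neg hc, mul_one]

/-- The constant term of the polynomial equation of `Y_i`. -/
theorem ASWDatum.exists_constant_term [IsCyclotomicExtension {p ^ s} ℚ K]
    (D : ASWDatum p s ζ E Y' F P b) (hs : 1 ≤ s)
    (hζ : IsPrimitiveRoot ζ (p ^ s)) {G : Fin s → MvPolynomial (Fin s) K}
    {X' : Fin s → MvPowerSeries (Fin s) K} (hG : IsKummerDatum p s ζ G X')
    {ξ : Fin s → MvPowerSeries (Fin s) K} (hξ0 : ∀ i, MvPowerSeries.constantCoeff (ξ i) = 0)
    (hξ : ∀ i : Fin s, (zPoly p s ζ E (i + 1) : MvPowerSeries (Fin s) K) ^ p =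
        (zPoly p s ζ E i : MvPowerSeries (Fin s) K) * (MvPolynomial.aeval ξ (G i) +
          MvPowerSeries.C ((p : K) * lam p s ζ) * ξ i)) (i : Fin s)
    (hm : ∀ j : Fin s, j < i → ξ j ∈ coeffSub (levelRing p s ζ (j + 1)) s (j + 1)) :
    ∃ W ∈ coeffSub (levelRing p s ζ (i + 1)) s i,
      (E i : MvPowerSeries (Fin s) K) ^ p -
        (zPoly p s ζ E i : MvPowerSeries (Fin s) K) * MvPolynomial.aeval ξ (G i) =
        MvPowerSeries.C ((p : K) * lam p s ζ) *
          ((((P i).map (Int.castRingHom K) : MvPolynomial (Fin s) K) : MvPowerSeries (Fin s) K) +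
            MvPowerSeries.C (zetaLevel p s ζ (i + 1) - 1) * W) ∧
      ξ i ∈ coeffSub (levelRing p s ζ (i + 1)) s (i + 1) := by
  have hi : (i : ℕ) + 1 ≤ s := i.2
  have h1i : 1 ≤ (i : ℕ) + 1 := Nat.le_add_left 1 i
  have hsub := MvPowerSeries.hasSubst_of_constantCoeff_zero hξ0
  have hX0 := constantCoeff_extendZero hG.witt_constantCoeff
  have hY0 := constantCoeff_extendZero D.assoc.witt_constantCoeff
  have hc0 := p_mul_lam_ne_zero (K := K) hs hζ
  have hπ0 := pi_ne_zero (p := p) (s := s) hζ h1i hi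
  set S := coeffSub (levelRing p s ζ (i + 1)) s (i + 1) with hS
  have hup : ∀ {x : MvPowerSeries (Fin s) K}, x ∈ coeffSub (levelRing p s ζ (i + 1)) s i → x ∈ S :=
    fun hx => coeffSub_level_mono le_rfl hi (Nat.le_succ _) hx
  have hC : ∀ {x : K}, x ∈ levelRing p s ζ (i + 1) → MvPowerSeries.C x ∈ S :=
    fun hx => C_mem_coeffSub hx _
  have hX : (MvPowerSeries.X i : MvPowerSeries (Fin s) K) ∈ S :=
    (X_mem_goodSub (p := p) (ζ := ζ) _ (Nat.lt_succ_self _)).1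
  obtain ⟨R, hR, hR0, hGR⟩ := hG.exists_remainder hs hζ i fun j _ => hG.witt_mem hs hζ j
  have hRξ : R.subst ξ ∈ coeffSub (levelRing p s ζ (i + 1)) s i :=
    mvSubst_mem_coeffSub hR hsub fun j hj => coeffSub_level_mono (by omega) hi hj (hm j hj)
  have hGξ : MvPolynomial.aeval ξ (G i) ∈ coeffSub (levelRing p s ζ (i + 1)) s i := by
    rw [← MvPowerSeries.subst_coe]
    exact mvSubst_mem_coeffSub (coe_mem_coeffSub (hG.coeff_mem i) (hG.vars_lt i)) hsub
      fun j hj => coeffSub_level_mono (by omega) hi hj (hm j hj)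
  have hcut : ∀ j, (cut i (extendZero X') j).subst ξ = cut i (extendZero Y') j := fun j => by
    by_cases hj : j < i
    · rw [cut_apply_lt _ hj, cut_apply_lt _ hj,
        show extendZero X' j = X' ⟨j, hj.trans i.2⟩ from dif_pos _,
        show extendZero Y' j = Y' ⟨j, hj.trans i.2⟩ from dif_pos _, D.subst_xi_eq hs hζ hG hξ0 hξ]
    · rw [cut_apply_ge _ (not_lt.1 hj), cut_apply_ge _ (not_lt.1 hj),
        ← MvPowerSeries.substAlgHom_apply hsub, map_zero]
  -- Substituting ξ in the approximation of G turns X' into Y', and Z_{i-1} G_{i+1,p} at the cut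
  -- vector is a p-th power. Admissibility bounds the error by pλ times the uniformizer.
  have e3 : (zPoly p s ζ E i : MvPowerSeries (Fin s) K) * MvPolynomial.aeval ξ (G i) =
      EWitt p s ζ (i + 1) (cut i (extendZero Y')) ^ p + MvPowerSeries.C ((p : K) * lam p s ζ) *
        (MvPowerSeries.C (zetaLevel p s ζ (i + 1) - 1) *
          ((zPoly p s ζ E i : MvPowerSeries (Fin s) K) * R.subst ξ)) := by
    have h1 := congrArg (MvPowerSeries.subst ξ) hGR
    rw [MvPowerSeries.subst_coe, MvPowerSeries.subst_add hsub, MvPowerSeries.subst_mul hsub,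
      MvPowerSeries.subst_mul hsub, mvSubst_C, mvSubst_C, mvSubst_GWitt hζ hi hξ0
      (constantCoeff_cut fun j _ => hX0 j)] at h1
    simp only [hcut] at h1
    have h2 := GWitt_mul_EWitt (p := p) (s := s) (ζ := ζ) (i + 1)
      (constantCoeff_cut (i := i) fun j _ => hY0 j)
    rw [Nat.add_sub_cancel, EWitt_congr (n := i) (a' := extendZero Y')
      (fun j hj => cut_apply_lt _ hj), ← D.zPoly_eq i.2.le] at h2
    rw [← h2, h1]
    ring
  obtain ⟨d, hd, e4⟩ := D.EWitt_cut_pow hs hζ i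
  obtain ⟨z, hz, hZ⟩ := D.zPoly_mem hζ (i := i + 1) le_rfl hi
  obtain ⟨zi, hzi, hZi⟩ := D.zPoly_mem hζ (i := i) (Nat.le_succ _) hi
  obtain ⟨Zi', hZi', hZZ⟩ := exists_inv_mem_coeffSub hπ0 (pi_mem _)
    (D.zPoly_mem hζ (i := i) (Nat.le_succ _) hi) (D.constantCoeff_zPoly i.2.le)
  have hEs := coe_zPoly_succ (p := p) (ζ := ζ) E i
  have hZim : (zPoly p s ζ E i : MvPowerSeries (Fin s) K) ∈ S :=
    hup (mvOneAddMul_mem_coeffSub (pi_mem _) (D.zPoly_mem hζ (Nat.le_succ _) hi))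
  have hZm : (zPoly p s ζ E (i + 1) : MvPowerSeries (Fin s) K) ∈ S :=
    mvOneAddMul_mem_coeffSub (pi_mem _) (D.zPoly_mem hζ le_rfl hi)
  obtain ⟨l, hl, hlam⟩ := pi_dvd_pi (p := p) (s := s) (ζ := ζ) (i := i + 1) (j := 1) h1i hi
  obtain ⟨a₁, ha₁, e5⟩ := pow_eq_one_add_mul hz (hC (pi_mem _)) hZ p
  obtain ⟨b₁, hb₁, e5'⟩ := pow_eq_one_add_mul hz (hC (pi_mem _)) hZ (p - 1)
  have hPm : (((P i).map (Int.castRingHom K) : MvPolynomial (Fin s) K) : MvPowerSeries (Fin s) K) ∈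
      coeffSub (levelRing p s ζ (i + 1)) s i :=
    coe_mem_coeffSub (fun k => by rw [MvPolynomial.coeff_map]; exact intCast_mem _ _)
      fun j hj => D.P_vars i j (MvPolynomial.vars_map _ _ hj)
  obtain ⟨F₁, hF₁, e7⟩ := coeffSub_div (R' := levelRing p s ζ (i + 1)) hπ0
    (sub_mem (D.F_mem i) (hup hPm)) fun n => by
      have h1 := D.F_sub_P i n
      rw [map_sub, MvPolynomial.coeff_coe, MvPolynomial.coeff_map]
      exact h1
  have hYm := D.Y'_mem hζ i
  have e6 := D.shape i
  have hκ := (lam_pow_unit hζ h1i hi).1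
  have hEpow : (E i : MvPowerSeries (Fin s) K) = (zPoly p s ζ E (i + 1) : MvPowerSeries (Fin s) K) +
      -(MvPowerSeries.C (lam p s ζ) * MvPowerSeries.X i) := by rw [hEs]; ring
  have hLX : -(MvPowerSeries.C (lam p s ζ) * MvPowerSeries.X i) ∈ S :=
    neg_mem (mul_mem (hC (lam_mem h1i hi)) hX)
  obtain ⟨w, hw, e1⟩ := exists_add_pow_eq S hp.out hZm hLX
  rw [← hEpow] at e1
  have e2 : (-(MvPowerSeries.C (lam p s ζ) * MvPowerSeries.X i : MvPowerSeries (Fin s) K)) ^ p =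
      -(MvPowerSeries.C ((-1) ^ (p - 1) * (lam p s ζ ^ (p - 1) / (p : K))) *
        MvPowerSeries.C ((p : K) * lam p s ζ) * MvPowerSeries.X i ^ p) := by
    rw [← neg_mul, mul_pow, ← map_neg, ← map_pow, ← map_mul, ← neg_mul, ← map_neg]
    congr 2
    obtain ⟨n, hn⟩ : ∃ n, p = n + 1 := ⟨p - 1, by have := hp.out.pos; omega⟩
    have hp0 : (p : K) ≠ 0 := Nat.cast_ne_zero.2 hp.out.ne_zero
    field_simp
    rw [hn, Nat.add_sub_cancel, neg_pow, pow_succ, pow_succ]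
    ring
  have e8 : MvPowerSeries.C (σ := Fin s) ((p : K) * lam p s ζ) =
      (p : MvPowerSeries (Fin s) K) * MvPowerSeries.C (lam p s ζ) := by
    rw [map_mul, map_natCast]
  have e9 : MvPowerSeries.C (σ := Fin s) (lam p s ζ) =
      MvPowerSeries.C (zetaLevel p s ζ (i + 1) - 1) * MvPowerSeries.C l := by
    rw [← map_mul, ← hlam, lam]
  set W := F₁ - MvPowerSeries.X i * b₁ + Y' i * a₁ + MvPowerSeries.C l * (MvPowerSeries.X i ^ 2 * w) -
    MvPowerSeries.C l * (d * (zPoly p s ζ E (i + 1) : MvPowerSeries (Fin s) K) ^ p) -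
    (zPoly p s ζ E i : MvPowerSeries (Fin s) K) * R.subst ξ with hW
  have key := kummer_identity e1 e2 e3 e4 e5 e5' e6 e7 e8 e9
  have hWm : W ∈ S := sub_mem (sub_mem (add_mem (add_mem (sub_mem hF₁ (mul_mem hX hb₁))
    (mul_mem hYm ha₁)) (mul_mem (hC hl) (mul_mem (pow_mem hX 2) hw)))
      (mul_mem (hC hl) (mul_mem hd (pow_mem hZm p)))) (mul_mem hZim (hup hRξ))
  rw [← hW] at key
  have hξi := kummer_identity' e1 e2 key (hξ i) rfl hZZ e8
  have hC0 : MvPowerSeries.C (σ := Fin s) ((p : K) * lam p s ζ) ≠ 0 := fun h => hc0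
    (by have := congrArg MvPowerSeries.constantCoeff h
        rwa [MvPowerSeries.constantCoeff_C, map_zero] at this)
  have hPS : ((((P i).map (Int.castRingHom K) : MvPolynomial (Fin s) K) :
      MvPowerSeries (Fin s) K) + MvPowerSeries.C (zetaLevel p s ζ (i + 1) - 1) * W) ∈ S :=
    add_mem (hup hPm) (mul_mem (hC (pi_mem _)) hWm)
  have hξm : ξ i ∈ S := by
    rw [mul_left_cancel₀ hC0 hξi]
    exact mul_mem (hup hZi') (add_mem (add_mem (sub_mem (mul_mem (pow_mem hZm _) hX)
      (mul_mem (mul_mem (hC (lam_mem h1i hi)) (pow_mem hX 2)) hw))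
      (mul_mem (hC (mul_mem (pow_mem (neg_mem (one_mem _)) _) hκ)) (pow_mem hX p))) hPS)
  -- W was assembled from terms involving X_i, but the left side does not involve X_i. Dividing it
  -- afresh gives the remainder in the earlier variables only.
  obtain ⟨W', hW', h1⟩ := coeffSub_div (R' := levelRing p s ζ (i + 1)) (mul_ne_zero hc0 hπ0)
    (sub_mem (sub_mem (pow_mem (mvOneAddMul_mem_coeffSub (pi_mem _) (D.E_mem hζ i)) p)
      (mul_mem (mvOneAddMul_mem_coeffSub (pi_mem _) (D.zPoly_mem hζ (i := i) (Nat.le_succ _) hi)) hGξ))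
      (mul_mem (C_mem_coeffSub (p_mul_lam_mem h1i hi) _) hPm)) fun n => by
        rw [key, mul_add, add_sub_cancel_left, ← mul_assoc, ← map_mul, MvPowerSeries.coeff_C_mul]
        exact mem_mulSub.2 ⟨_, (hWm n).1, rfl⟩
  refine ⟨W', hW', ?_, hξm⟩
  rw [map_mul _ ((p : K) * lam p s ζ)] at h1
  linear_combination h1

/-- The power series expansions of the `X_i` in the `Y_j` and of the constant terms of the
polynomial equations of the `Y_i`. -/
theorem ASWDatum.exists_expansion [IsCyclotomicExtension {p ^ s} ℚ K]
    (D : ASWDatum p s ζ E Y' F P b) (hs : 1 ≤ s)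
    (hζ : IsPrimitiveRoot ζ (p ^ s)) {G : Fin s → MvPolynomial (Fin s) K}
    {X' : Fin s → MvPowerSeries (Fin s) K} (hG : IsKummerDatum p s ζ G X') :
    ∃ ξ : Fin s → MvPowerSeries (Fin s) K,
      (∀ i : Fin s, (zPoly p s ζ E (i + 1) : MvPowerSeries (Fin s) K) ^ p =
        (zPoly p s ζ E i : MvPowerSeries (Fin s) K) * (MvPolynomial.aeval ξ (G i) +
          MvPowerSeries.C ((p : K) * lam p s ζ) * ξ i)) ∧
      ∀ i : Fin s, ∃ W ∈ coeffSub (levelRing p s ζ (i + 1)) s i,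
        (E i : MvPowerSeries (Fin s) K) ^ p -
          (zPoly p s ζ E i : MvPowerSeries (Fin s) K) * MvPolynomial.aeval ξ (G i) =
          MvPowerSeries.C ((p : K) * lam p s ζ) *
            ((((P i).map (Int.castRingHom K) : MvPolynomial (Fin s) K) : MvPowerSeries (Fin s) K) +
              MvPowerSeries.C (zetaLevel p s ζ (i + 1) - 1) * W) := by
  obtain ⟨ξ, hξ0, hξ⟩ := D.exists_xi hs hζ hG
  have hm : ∀ i : Fin s, ξ i ∈ coeffSub (levelRing p s ζ (i + 1)) s (i + 1) := fun i => by
    induction i using WellFoundedLT.induction with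
    | ind i ih =>
    obtain ⟨-, -, -, h⟩ := D.exists_constant_term hs hζ hG hξ0 hξ i ih
    exact h
  refine ⟨ξ, hξ, fun i => ?_⟩
  obtain ⟨W, hW, h, -⟩ := D.exists_constant_term hs hζ hG hξ0 hξ i fun j _ => hm j
  exact ⟨W, hW, h⟩

end KummerExpansion

theorem aeval_mem_subring {σ R A : Type*} [CommRing R] [CommRing A] [Algebra R A] {T : Subring A}
    {q : MvPolynomial σ R} {f : σ → A} (hc : ∀ d, algebraMap R A (q.coeff d) ∈ T)
    (hf : ∀ j ∈ q.vars, f j ∈ T) : MvPolynomial.aeval f q ∈ T := by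
  rw [MvPolynomial.aeval_def, MvPolynomial.eval₂_eq]
  refine sum_mem fun d hd => mul_mem (hc d) (prod_mem fun j hj => pow_mem (hf j ?_) _)
  exact (MvPolynomial.mem_vars_iff_mem_support j).2 ⟨d, hd, hj⟩

/-! ### Elements of L and power series represented by the same fraction. -/

section FracPair

variable {s : ℕ} {K : Type*} [Field K] {L : Type*} [Field L] [Algebra K L]

/-- The pairs of an element of `L` and a power series that are given by the same fraction, with a
numerator in the variables of index smaller than `m` and a power of `Q` as denominator. -/
def fracPair (Y : Fin s → L) (Q : MvPolynomial (Fin s) K) (m : ℕ)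
    (hQ : Q ∈ MvPolynomial.supported K {j : Fin s | (j : ℕ) < m}) :
    Subring (L × MvPowerSeries (Fin s) K) where
  carrier := {t | ∃ N ∈ MvPolynomial.supported K {j : Fin s | (j : ℕ) < m}, ∃ e : ℕ,
    t.1 * MvPolynomial.aeval Y Q ^ e = MvPolynomial.aeval Y N ∧
      t.2 * (Q : MvPowerSeries (Fin s) K) ^ e = (N : MvPowerSeries (Fin s) K)}
  mul_mem' := by
    rintro t t' ⟨N, hN, e, h1, h2⟩ ⟨N', hN', e', h1', h2'⟩
    refine ⟨N * N', mul_mem hN hN', e + e', ?_, ?_⟩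
    · rw [map_mul, ← h1, ← h1', Prod.fst_mul]; ring
    · rw [MvPolynomial.coe_mul, ← h2, ← h2', Prod.snd_mul]; ring
  one_mem' := ⟨1, one_mem _, 0, by simp, by simp⟩
  add_mem' := by
    rintro t t' ⟨N, hN, e, h1, h2⟩ ⟨N', hN', e', h1', h2'⟩
    refine ⟨N * Q ^ e' + N' * Q ^ e, add_mem (mul_mem hN (pow_mem hQ _))
      (mul_mem hN' (pow_mem hQ _)), e + e', ?_, ?_⟩
    · rw [map_add, map_mul, map_mul, map_pow, map_pow, ← h1, ← h1', Prod.fst_add]; ring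
    · rw [MvPolynomial.coe_add, MvPolynomial.coe_mul, MvPolynomial.coe_mul, MvPolynomial.coe_pow,
        MvPolynomial.coe_pow, ← h2, ← h2', Prod.snd_add]; ring
  zero_mem' := ⟨0, zero_mem _, 0, by simp, by simp⟩
  neg_mem' := by
    rintro t ⟨N, hN, e, h1, h2⟩
    refine ⟨-N, neg_mem hN, e, ?_, ?_⟩
    · rw [map_neg, ← h1, Prod.fst_neg]; ring
    · have h3 : ((-N : MvPolynomial (Fin s) K) : MvPowerSeries (Fin s) K) = -N :=
        map_neg (MvPolynomial.coeToMvPowerSeries.ringHom (σ := Fin s) (R := K)) N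
      rw [h3, ← h2, Prod.snd_neg]; ring

variable {Y : Fin s → L} {Q : MvPolynomial (Fin s) K} {m : ℕ}
  {hQ : Q ∈ MvPolynomial.supported K {j : Fin s | (j : ℕ) < m}}

theorem poly_mem_fracPair {N : MvPolynomial (Fin s) K}
    (hN : N ∈ MvPolynomial.supported K {j : Fin s | (j : ℕ) < m}) :
    ((MvPolynomial.aeval Y N : L), (N : MvPowerSeries (Fin s) K)) ∈ fracPair Y Q m hQ :=
  ⟨N, hN, 0, by simp, by simp⟩

theorem const_mem_fracPair (c : K) :
    (algebraMap K L c, MvPowerSeries.C c) ∈ fracPair Y Q m hQ := by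
  have h := poly_mem_fracPair (Y := Y) (hQ := hQ) (N := MvPolynomial.C c)
    (Subalgebra.algebraMap_mem _ c)
  rwa [MvPolynomial.aeval_C, MvPolynomial.coe_C] at h

theorem inv_mem_fracPair {q q' : MvPolynomial (Fin s) K} (h : Q = q * q')
    (hq' : q' ∈ MvPolynomial.supported K {j : Fin s | (j : ℕ) < m})
    (h0 : MvPolynomial.aeval Y q ≠ 0) {g : MvPowerSeries (Fin s) K}
    (hg : (q : MvPowerSeries (Fin s) K) * g = 1) :
    ((MvPolynomial.aeval Y q)⁻¹, g) ∈ fracPair Y Q m hQ := by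
  refine ⟨q', hq', 1, ?_, ?_⟩
  · change (MvPolynomial.aeval Y q)⁻¹ * _ = _
    rw [h, pow_one, map_mul, inv_mul_cancel_left₀ h0]
  · change g * _ = _
    rw [h, pow_one, MvPolynomial.coe_mul, ← mul_assoc, mul_comm g, hg, one_mul]

/-- The numerator is N = fQ^e, so it has coefficients in R as soon as f and Q do. Integrality of a
power series thus passes to L without using that the Y_j are independent. -/
theorem fst_mem_of_mem_fracPair {R : Subring K} {T : Subring L}
    (hT : ∀ c ∈ R, algebraMap K L c ∈ T) (hYT : ∀ j : Fin s, (j : ℕ) < m → Y j ∈ T)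
    (hQR : ∀ d, Q.coeff d ∈ R) (hQT : (MvPolynomial.aeval Y Q)⁻¹ ∈ T)
    (hQ0 : MvPolynomial.aeval Y Q ≠ 0) {l : L} {f : MvPowerSeries (Fin s) K}
    (h : (l, f) ∈ fracPair Y Q m hQ) (hf : ∀ n, MvPowerSeries.coeff n f ∈ R) : l ∈ T := by
  obtain ⟨N, hN, e, h1, h2⟩ := h
  change l * _ = _ at h1
  change f * _ = _ at h2
  have hNR : ∀ d, N.coeff d ∈ R := fun d => by
    have h3 : f * (Q : MvPowerSeries (Fin s) K) ^ e ∈ coeffSub R s s :=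
      mul_mem (mem_coeffSub.2 fun n => ⟨hf n, fun _ j _ => j.2⟩)
        (pow_mem (mem_coeffSub.2 fun n => ⟨by rw [MvPolynomial.coeff_coe]; exact hQR n,
          fun _ j _ => j.2⟩) e)
    rw [← MvPolynomial.coeff_coe, ← h2]
    exact (h3 d).1
  have h3 : l = MvPolynomial.aeval Y N * (MvPolynomial.aeval Y Q)⁻¹ ^ e := by
    rw [← h1, inv_pow, mul_assoc, mul_inv_cancel₀ (pow_ne_zero e hQ0), mul_one]
  rw [h3]
  refine mul_mem (aeval_mem_subring (fun d => hT _ (hNR d)) fun j hj => hYT j ?_) (pow_mem hQT e)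
  exact MvPolynomial.mem_supported.1 hN hj

end FracPair

/-! ### Nonvanishing in the Kummer tower, and the rings generated by Y_j and 1/Z_j. -/

section TowerBasics

variable {p s : ℕ} [hp : Fact p.Prime] {K : Type*} [Field K] [NumberField K] {ζ : K}
  {L : Type*} [Field L] [Algebra K L]
  {G E : Fin s → MvPolynomial (Fin s) K} {x Y : Fin s → L} {Z : Fin (s + 1) → L}

theorem IsKummerTower.unitElt_ne_zero (hT : IsKummerTower p s ζ G x Z) (hs : 1 ≤ s)
    (hζ : IsPrimitiveRoot ζ (p ^ s)) (hG : ∀ i, ∀ j ∈ (G i).vars, j < i) (i : Fin s) :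
    unitElt p s ζ G x i ≠ 0 := by
  have h1 : unitElt p s ζ G x i = MvPolynomial.aeval x
      (G i + MvPolynomial.C ((p : K) * lam p s ζ) * MvPolynomial.X i) := by
    rw [unitElt, map_add (MvPolynomial.aeval x), map_mul (MvPolynomial.aeval x),
      MvPolynomial.aeval_C, MvPolynomial.aeval_X]
  rw [h1]
  refine fun h => p_mul_lam_ne_zero (K := K) hs hζ ?_
  have h2 := congrArg (MvPolynomial.coeff (Finsupp.single i 1))
    ((map_eq_zero_iff _ hT.algebraicIndependent).1 h)
  have h3 : MvPolynomial.coeff (Finsupp.single i 1) (G i) = 0 := by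
    by_contra h3
    exact lt_irrefl _ (hG i i ((MvPolynomial.mem_vars_iff_mem_support i).2
      ⟨_, MvPolynomial.mem_support_iff.2 h3, by simp⟩))
  rw [MvPolynomial.coeff_add, h3, zero_add, MvPolynomial.coeff_C_mul, MvPolynomial.coeff_X,
    MvPolynomial.coeff_zero] at h2
  simpa using h2

theorem IsKummerTower.Z_ne_zero (hT : IsKummerTower p s ζ G x Z) (hs : 1 ≤ s)
    (hζ : IsPrimitiveRoot ζ (p ^ s)) (hG : ∀ i, ∀ j ∈ (G i).vars, j < i) (i : Fin (s + 1)) :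
    Z i ≠ 0 := by
  induction i using Fin.induction with
  | zero => rw [hT.zero_eq]; exact one_ne_zero
  | succ i ih =>
    intro h
    have h1 := hT.pow_eq i
    rw [h, zero_pow hp.out.ne_zero] at h1
    exact mul_ne_zero ih (hT.unitElt_ne_zero hs hζ hG i) h1.symm

theorem aeval_zPoly (hT : IsKummerTower p s ζ G x Z)
    (hY : ∀ i : Fin s, Z i.succ =
      MvPolynomial.aeval Y (E i) + algebraMap K L (lam p s ζ) * Y i) (i : Fin (s + 1)) :
    MvPolynomial.aeval Y (zPoly p s ζ E i) = Z i := by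
  cases i using Fin.cases with
  | zero => rw [hT.zero_eq]; exact map_one _
  | succ i =>
    rw [Fin.val_succ, zPoly_succ, hY, map_add, map_mul, MvPolynomial.aeval_C, MvPolynomial.aeval_X]

theorem zPoly_mem_supported (hE : ∀ i, ∀ j ∈ (E i).vars, j < i) {k i : ℕ} (hki : k ≤ i) :
    zPoly p s ζ E k ∈ MvPolynomial.supported K {j : Fin s | (j : ℕ) < i} := by
  cases k with
  | zero => exact one_mem _
  | succ k =>
    rw [zPoly]
    split_ifs with h
    · refine add_mem (MvPolynomial.mem_supported.2 fun j hj => ?_)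
        (mul_mem (Subalgebra.algebraMap_mem _ _) (MvPolynomial.X_mem_supported.2 ?_))
      · have h1 : (j : ℕ) < k := hE ⟨k, h⟩ j hj
        exact h1.trans hki
      · exact hki
    · exact one_mem _

theorem algebraMap_mem_fracRing {i m : ℕ} {c : K} (hc : c ∈ levelRing p s ζ (i + 1)) :
    algebraMap K L c ∈ fracRing p s ζ Y Z i m :=
  Subring.subset_closure (Or.inl (Or.inl ⟨c, hc, rfl⟩))

theorem Y_mem_fracRing {i m : ℕ} {j : Fin s} (hj : (j : ℕ) < m) :
    Y j ∈ fracRing p s ζ Y Z i m :=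
  Subring.subset_closure (Or.inl (Or.inr ⟨j, hj, rfl⟩))

theorem Z_inv_mem_fracRing (h0 : Z 0 = 1) {i m : ℕ} {j : Fin (s + 1)} (hj : (j : ℕ) ≤ i) :
    (Z j)⁻¹ ∈ fracRing p s ζ Y Z i m := by
  cases j using Fin.cases with
  | zero => rw [h0, inv_one]; exact one_mem _
  | succ j => exact Subring.subset_closure (Or.inr ⟨j, hj, rfl⟩)

theorem fracRing_mono {i i' m m' : ℕ} (hi : i ≤ i') (hi' : i' + 1 ≤ s) (hm : m ≤ m') :
    fracRing p s ζ Y Z i m ≤ fracRing p s ζ Y Z i' m' := by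
  refine Subring.closure_mono ?_
  rintro t ((⟨c, hc, rfl⟩ | ⟨j, hj, rfl⟩) | ⟨j, hj, rfl⟩)
  · exact Or.inl (Or.inl ⟨c, levelRing_mono (by omega) hi' hc, rfl⟩)
  · exact Or.inl (Or.inr ⟨j, by omega, rfl⟩)
  · exact Or.inr ⟨j, by omega, rfl⟩

end TowerBasics

/-! ### The constant term in L. -/

section Transfer

variable {p s : ℕ} [hp : Fact p.Prime] {K : Type*} [Field K] [NumberField K] {ζ : K}
  [IsCyclotomicExtension {p ^ s} ℚ K]
  {E : Fin s → MvPolynomial (Fin s) K} {Y' F : Fin s → MvPowerSeries (Fin s) K}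
  {P : Fin s → MvPolynomial (Fin s) ℤ} {b : Fin s → MvPolynomial (Fin s) (ZMod p)}
  {L : Type*} [Field L] [Algebra K L]
  {G : Fin s → MvPolynomial (Fin s) K} {X' : Fin s → MvPowerSeries (Fin s) K}
  {x Y : Fin s → L} {Z : Fin (s + 1) → L}

/-- The x_j in L and the series ξ_j solve the same triangular equations, so they form pairs in
`fracPair`. The integral series W of the expansion is then paired with the wanted element w. -/
theorem ASWDatum.constant_term_eq (D : ASWDatum p s ζ E Y' F P b) (hs : 1 ≤ s)
    (hζ : IsPrimitiveRoot ζ (p ^ s)) (hG : IsKummerDatum p s ζ G X')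
    (hT : IsKummerTower p s ζ G x Z) (hY : ∀ i : Fin s, Z i.succ =
      MvPolynomial.aeval Y (E i) + algebraMap K L (lam p s ζ) * Y i) (i : Fin s) :
    ∃ w ∈ fracRing p s ζ Y Z i i,
      MvPolynomial.aeval Y (E i) ^ p - Z i.castSucc * MvPolynomial.aeval x (G i) =
        algebraMap K L ((p : K) * lam p s ζ) * (MvPolynomial.aeval Y (P i) +
          algebraMap K L (zetaLevel p s ζ (i + 1) - 1) * w) := by
  have hi : (i : ℕ) + 1 ≤ s := i.2
  have hc0 := p_mul_lam_ne_zero (K := K) hs hζ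
  have hπ0 := pi_ne_zero (p := p) (s := s) hζ (Nat.le_add_left 1 (i : ℕ)) hi
  obtain ⟨ξ, hξ, hW⟩ := D.exists_expansion hs hζ hG
  obtain ⟨W, hWm, hW⟩ := hW i
  have hsup : ∀ k ∈ Finset.range ((i : ℕ) + 1),
      zPoly p s ζ E k ∈ MvPolynomial.supported K {j : Fin s | (j : ℕ) < i} := fun k hk =>
    zPoly_mem_supported D.vars_lt (Nat.lt_succ_iff.1 (Finset.mem_range.1 hk))
  -- One common denominator for all fractions that occur.
  set Q := ∏ k ∈ Finset.range ((i : ℕ) + 1), zPoly p s ζ E k with hQdef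
  have hQ : Q ∈ MvPolynomial.supported K {j : Fin s | (j : ℕ) < i} := prod_mem hsup
  have hZk : ∀ k, ∀ hk : k ≤ (i : ℕ), MvPolynomial.aeval Y (zPoly p s ζ E k) = Z ⟨k, by omega⟩ :=
    fun k hk => aeval_zPoly hT hY ⟨k, by omega⟩
  have hZ0 := hT.Z_ne_zero hs hζ hG.vars_lt
  set T := fracPair Y Q i hQ with hTdef
  have hz : ∀ k, ∀ hk : k ≤ (i : ℕ), ((Z ⟨k, by omega⟩ : L),
      (zPoly p s ζ E k : MvPowerSeries (Fin s) K)) ∈ T := fun k hk => by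
    rw [← hZk k hk]; exact poly_mem_fracPair (hsup k (Finset.mem_range.2 (by omega)))
  have hzinv : ∀ k, ∀ hk : k ≤ (i : ℕ), ∃ g, (zPoly p s ζ E k : MvPowerSeries (Fin s) K) * g = 1 ∧
      (((Z ⟨k, by omega⟩)⁻¹ : L), g) ∈ T := fun k hk => by
    have h1 : (zPoly p s ζ E k : MvPowerSeries (Fin s) K) *
        (zPoly p s ζ E k : MvPowerSeries (Fin s) K)⁻¹ = 1 :=
      MvPowerSeries.mul_inv_cancel _ (by
        rw [D.constantCoeff_zPoly (hk.trans i.2.le)]; exact one_ne_zero)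
    refine ⟨_, h1, ?_⟩
    rw [← hZk k hk]
    refine inv_mem_fracPair (q' := ∏ k ∈ (Finset.range ((i : ℕ) + 1)).erase k, zPoly p s ζ E k)
      (Finset.mul_prod_erase _ _ (Finset.mem_range.2 (by omega))).symm
      (prod_mem fun j hj => hsup j (Finset.mem_of_mem_erase hj)) ?_ h1
    rw [hZk k hk]; exact hZ0 _
  have haev : ∀ j : Fin s, (∀ k : Fin s, k < j → (x k, ξ k) ∈ T) →
      (MvPolynomial.aeval x (G j), MvPolynomial.aeval ξ (G j)) ∈ T := fun j hj => by
    have h1 : MvPolynomial.aeval (fun k => (x k, ξ k)) (G j) ∈ T :=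
      aeval_mem_subring (fun d => const_mem_fracPair _) fun k hk => hj k (hG.vars_lt j k hk)
    have h2 : MvPolynomial.aeval (fun k => (x k, ξ k)) (G j) =
        (MvPolynomial.aeval x (G j), MvPolynomial.aeval ξ (G j)) :=
      Prod.ext
        (congrArg (fun φ => φ (G j)) (MvPolynomial.algHom_ext (f := (AlgHom.fst K L
          (MvPowerSeries (Fin s) K)).comp (MvPolynomial.aeval fun k => (x k, ξ k)))
          (g := MvPolynomial.aeval x) fun k => by simp))
        (congrArg (fun φ => φ (G j)) (MvPolynomial.algHom_ext (f := (AlgHom.snd K L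
          (MvPowerSeries (Fin s) K)).comp (MvPolynomial.aeval fun k => (x k, ξ k)))
          (g := MvPolynomial.aeval ξ) fun k => by simp))
    rwa [h2] at h1
  have hx : ∀ j : Fin s, j < i → (x j, ξ j) ∈ T := fun j => by
    induction j using WellFoundedLT.induction with
    | ind j ih =>
    intro hji
    have hji' : (j : ℕ) < i := hji
    obtain ⟨g, hg, hgT⟩ := hzinv j hji'.le
    have h1 := mul_mem (const_mem_fracPair (Y := Y) (hQ := hQ) ((p : K) * lam p s ζ)⁻¹)
      (sub_mem (mul_mem (pow_mem (hz (j + 1) hji') p) hgT)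
        (haev j fun k hk => ih k hk (hk.trans hji)))
    have h2 : Z j.succ ^ p = Z j.castSucc * (MvPolynomial.aeval x (G j) +
      algebraMap K L ((p : K) * lam p s ζ) * x j) := hT.pow_eq j
    have h3 := hξ j
    have hzj : Z j.castSucc * (Z j.castSucc)⁻¹ = 1 := mul_inv_cancel₀ (hZ0 _)
    have hcL : algebraMap K L ((p : K) * lam p s ζ)⁻¹ * algebraMap K L ((p : K) * lam p s ζ) = 1 := by
      rw [← map_mul, inv_mul_cancel₀ hc0, map_one]
    have hcS : MvPowerSeries.C (σ := Fin s) ((p : K) * lam p s ζ)⁻¹ *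
        MvPowerSeries.C ((p : K) * lam p s ζ) = 1 := by
      rw [← map_mul, inv_mul_cancel₀ hc0, map_one]
    have h4 : x j = algebraMap K L ((p : K) * lam p s ζ)⁻¹ *
        (Z j.succ ^ p * (Z j.castSucc)⁻¹ - MvPolynomial.aeval x (G j)) := by
      rw [h2]
      linear_combination (-x j) * hcL - algebraMap K L ((p : K) * lam p s ζ)⁻¹ *
        (MvPolynomial.aeval x (G j) + algebraMap K L ((p : K) * lam p s ζ) * x j) * hzj
    have h5 : ξ j = MvPowerSeries.C ((p : K) * lam p s ζ)⁻¹ *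
        ((zPoly p s ζ E (j + 1) : MvPowerSeries (Fin s) K) ^ p * g - MvPolynomial.aeval ξ (G j)) := by
      rw [h3]
      linear_combination (-ξ j) * hcS - MvPowerSeries.C ((p : K) * lam p s ζ)⁻¹ *
        (MvPolynomial.aeval ξ (G j) + MvPowerSeries.C ((p : K) * lam p s ζ) * ξ j) * hg
    rw [h4, h5]
    exact h1
  have hcπ : algebraMap K L ((p : K) * lam p s ζ) * algebraMap K L (zetaLevel p s ζ (i + 1) - 1) *
      algebraMap K L (((p : K) * lam p s ζ) * (zetaLevel p s ζ (i + 1) - 1))⁻¹ = 1 := by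
    rw [← map_mul, ← map_mul, mul_inv_cancel₀ (mul_ne_zero hc0 hπ0), map_one]
  have hcπ' : MvPowerSeries.C (σ := Fin s) (((p : K) * lam p s ζ) * (zetaLevel p s ζ (i + 1) - 1))⁻¹ *
      (MvPowerSeries.C ((p : K) * lam p s ζ) * MvPowerSeries.C (zetaLevel p s ζ (i + 1) - 1)) = 1 := by
    rw [← map_mul, ← map_mul, inv_mul_cancel₀ (mul_ne_zero hc0 hπ0), map_one]
  have hP : MvPolynomial.aeval Y ((P i).map (Int.castRingHom K)) = MvPolynomial.aeval Y (P i) :=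
    MvPolynomial.aeval_map_algebraMap K Y (P i)
  have hPs : (P i).map (Int.castRingHom K) ∈ MvPolynomial.supported K {j : Fin s | (j : ℕ) < i} :=
    MvPolynomial.mem_supported.2 fun j hj => D.P_vars i j (MvPolynomial.vars_map _ _ hj)
  have hEs : E i ∈ MvPolynomial.supported K {j : Fin s | (j : ℕ) < i} :=
    MvPolynomial.mem_supported.2 fun j hj => D.vars_lt i j hj
  have hfin := mul_mem (const_mem_fracPair (Y := Y) (hQ := hQ)
      (((p : K) * lam p s ζ) * (zetaLevel p s ζ (i + 1) - 1))⁻¹)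
    (sub_mem (sub_mem (pow_mem (poly_mem_fracPair (hQ := hQ) hEs) p)
      (mul_mem (hz i le_rfl) (haev i fun k hk => hx k hk)))
      (mul_mem (const_mem_fracPair ((p : K) * lam p s ζ)) (poly_mem_fracPair hPs)))
  have hsnd : MvPowerSeries.C (((p : K) * lam p s ζ) * (zetaLevel p s ζ (i + 1) - 1))⁻¹ *
      ((E i : MvPowerSeries (Fin s) K) ^ p -
          (zPoly p s ζ E i : MvPowerSeries (Fin s) K) * MvPolynomial.aeval ξ (G i) -
        MvPowerSeries.C ((p : K) * lam p s ζ) *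
          (((P i).map (Int.castRingHom K) : MvPolynomial (Fin s) K) : MvPowerSeries (Fin s) K)) = W := by
    rw [hW]
    linear_combination W * hcπ'
  refine ⟨algebraMap K L (((p : K) * lam p s ζ) * (zetaLevel p s ζ (i + 1) - 1))⁻¹ *
    (MvPolynomial.aeval Y (E i) ^ p - Z i.castSucc * MvPolynomial.aeval x (G i) -
      algebraMap K L ((p : K) * lam p s ζ) *
        MvPolynomial.aeval Y ((P i).map (Int.castRingHom K))), ?_, ?_⟩
  · have hQY : MvPolynomial.aeval Y Q = ∏ k ∈ Finset.range ((i : ℕ) + 1),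
        MvPolynomial.aeval Y (zPoly p s ζ E k) := map_prod _ _ _
    refine fst_mem_of_mem_fracPair (R := levelRing p s ζ (i + 1)) (hQ := hQ)
      (fun c hc => algebraMap_mem_fracRing hc) (fun j hj => Y_mem_fracRing hj) (fun d => ?_) ?_ ?_
      hfin fun n => ?_
    · have h1 : (Q : MvPowerSeries (Fin s) K) ∈ coeffSub (levelRing p s ζ (i + 1)) s i := by
        rw [← MvPolynomial.coeToMvPowerSeries.ringHom_apply, hQdef, map_prod]
        refine prod_mem fun k hk => ?_
        have hk := Finset.mem_range.1 hk
        exact coeffSub_level_mono le_rfl hi (by omega)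
          (mvOneAddMul_mem_coeffSub (pi_mem _) (D.zPoly_mem hζ hk.le hi))
      rw [← MvPolynomial.coeff_coe]
      exact (h1 d).1
    · rw [hQY, ← Finset.prod_inv_distrib]
      refine prod_mem fun k hk => ?_
      have hk' : k ≤ (i : ℕ) := Nat.lt_succ_iff.1 (Finset.mem_range.1 hk)
      rw [hZk k hk']
      exact Z_inv_mem_fracRing hT.zero_eq hk'
    · rw [hQY]
      refine Finset.prod_ne_zero_iff.2 fun k hk => ?_
      rw [hZk k (Nat.lt_succ_iff.1 (Finset.mem_range.1 hk))]
      exact hZ0 _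
    · exact hsnd ▸ (hWm n).1
  · rw [hP]
    linear_combination (-(MvPolynomial.aeval Y (E i) ^ p - Z i.castSucc * MvPolynomial.aeval x (G i) -
      algebraMap K L ((p : K) * lam p s ζ) * MvPolynomial.aeval Y (P i))) * hcπ

end Transfer

/-! ### The polynomial equation satisfied by Y_i. -/

section KummerPolynomial

open Polynomial

theorem coeff_add_C_mul_X_pow {A : Type*} [CommRing A] (e l : A) (m n : ℕ) :
    ((C e + C l * X) ^ m : A[X]).coeff n = e ^ (m - n) * (m.choose n : A) * l ^ n := by
  have h : (C e + C l * X : A[X]) ^ m = ((X + C e) ^ m).comp (C l * X) := by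
    rw [pow_comp, add_comp, X_comp, C_comp, add_comm]
  rw [h, comp_C_mul_X_coeff, coeff_X_add_C_pow]

theorem eval_mem_subring {A : Type*} [CommRing A] {T : Subring A} {q : A[X]} {y : A}
    (hq : ∀ n, q.coeff n ∈ T) (hy : y ∈ T) : q.eval y ∈ T := by
  rw [eval_eq_sum]
  exact sum_mem fun n _ => mul_mem (hq n) (pow_mem hy n)

theorem aeval_mem_mul {σ K L : Type*} [Field K] [Field L] [Algebra K L] {R : Subring K}
    {T : Subring L} (hT : ∀ c ∈ R, algebraMap K L c ∈ T) {π : K} (hπ : π ≠ 0)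
    {q : MvPolynomial σ K} {f : σ → L} (hc : ∀ d, q.coeff d ∈ mulSub R π)
    (hf : ∀ j ∈ q.vars, f j ∈ T) :
    ∃ r ∈ T, MvPolynomial.aeval f q = algebraMap K L π * r := by
  have h1 : q = MvPolynomial.C π * (MvPolynomial.C π⁻¹ * q) := by
    rw [← mul_assoc, ← map_mul, mul_inv_cancel₀ hπ, map_one, one_mul]
  refine ⟨MvPolynomial.aeval f (MvPolynomial.C π⁻¹ * q),
    aeval_mem_subring (fun d => ?_) fun j hj => hf j ?_, ?_⟩
  · rw [MvPolynomial.coeff_C_mul]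
    obtain ⟨r, hr, h⟩ := mem_mulSub.1 (hc d)
    rw [h, inv_mul_cancel_left₀ hπ]
    exact hT r hr
  · obtain ⟨d, hd, hjd⟩ := (MvPolynomial.mem_vars_iff_mem_support j).1 hj
    refine (MvPolynomial.mem_vars_iff_mem_support j).2 ⟨d, ?_, hjd⟩
    rw [MvPolynomial.mem_support_iff, MvPolynomial.coeff_C_mul] at hd
    exact MvPolynomial.mem_support_iff.2 (right_ne_zero_of_mul hd)
  · conv_lhs => rw [h1, map_mul, MvPolynomial.aeval_C]

variable {p s : ℕ} [hp : Fact p.Prime] {K : Type*} [Field K] [NumberField K] {ζ : K}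
  [IsCyclotomicExtension {p ^ s} ℚ K]
  {E : Fin s → MvPolynomial (Fin s) K} {Y' F : Fin s → MvPowerSeries (Fin s) K}
  {P : Fin s → MvPolynomial (Fin s) ℤ} {b : Fin s → MvPolynomial (Fin s) (ZMod p)}
  {L : Type*} [Field L] [Algebra K L]
  {G : Fin s → MvPolynomial (Fin s) K} {X' : Fin s → MvPowerSeries (Fin s) K}
  {x Y : Fin s → L} {Z : Fin (s + 1) → L}

theorem ASWDatum.P_mem (D : ASWDatum p s ζ E Y' F P b) {i : Fin s} {T : Subring L}
    (h : ∀ j : Fin s, j < i → Y j ∈ T) : MvPolynomial.aeval Y (P i) ∈ T :=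
  aeval_mem_subring (fun d => by rw [eq_intCast]; exact intCast_mem _ _)
    fun j hj => h j (D.P_vars i j hj)

/-- The polynomial equation of `Y_i`. -/
theorem ASWDatum.exists_polynomial (D : ASWDatum p s ζ E Y' F P b) (hs : 1 ≤ s)
    (hζ : IsPrimitiveRoot ζ (p ^ s)) (hG : IsKummerDatum p s ζ G X')
    (hT : IsKummerTower p s ζ G x Z) (hY : ∀ i : Fin s, Z i.succ =
      MvPolynomial.aeval Y (E i) + algebraMap K L (lam p s ζ) * Y i) (i : Fin s) :
    ∃ H : L[X], H.degree < (p : WithBot ℕ) ∧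
      (∀ n, H.coeff n ∈ fracRing p s ζ Y Z i i) ∧
      (∀ n, ∃ r ∈ fracRing p s ζ Y Z i i, (H - C (MvPolynomial.aeval Y (P i))).coeff n =
        algebraMap K L (zetaLevel p s ζ (i + 1) - 1) * r) ∧
      C (algebraMap K L ((p : K) * lam p s ζ)) *
          (C (algebraMap K L (lam p s ζ ^ (p - 1) / (p : K))) * X ^ p + X + H -
            C (Z i.castSucc * x i)) =
        (C (MvPolynomial.aeval Y (E i)) + C (algebraMap K L (lam p s ζ)) * X) ^ p -
          C (Z i.castSucc * unitElt p s ζ G x i) := by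
  have hi : (i : ℕ) + 1 ≤ s := i.2
  have h1i : 1 ≤ (i : ℕ) + 1 := Nat.le_add_left 1 _
  have hc0 := p_mul_lam_ne_zero (K := K) hs hζ
  have hp2 := hp.out.two_le
  have hπ0 := pi_ne_zero (p := p) (s := s) hζ h1i hi
  set T := fracRing p s ζ Y Z i i with hTdef
  have hTK : ∀ c ∈ levelRing p s ζ (i + 1), algebraMap K L c ∈ T := fun c hc =>
    algebraMap_mem_fracRing hc
  have hπT : algebraMap K L (zetaLevel p s ζ (i + 1) - 1) ∈ T := hTK _ (pi_mem _)
  have hYT : ∀ j : Fin s, j < i → Y j ∈ T := fun j hj => Y_mem_fracRing hj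
  have hPT : MvPolynomial.aeval Y (P i) ∈ T := D.P_mem hYT
  obtain ⟨w, hw, hcst⟩ := D.constant_term_eq hs hζ hG hT hY i
  obtain ⟨l, hl, hlam⟩ := pi_dvd_pi (p := p) (s := s) (ζ := ζ) (i := i + 1) (j := 1) h1i hi
  set c := algebraMap K L ((p : K) * lam p s ζ) with hc
  set Λ := algebraMap K L (lam p s ζ) with hΛ
  set κ := algebraMap K L (lam p s ζ ^ (p - 1) / (p : K)) with hκ
  set π := algebraMap K L (zetaLevel p s ζ (i + 1) - 1) with hπ
  set e := MvPolynomial.aeval Y (E i) with he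
  have hcL0 : c ≠ 0 := (_root_.map_ne_zero _).2 hc0
  have hcp : c = (p : L) * Λ := by rw [hc, map_mul, map_natCast]
  have hΛπ : Λ = π * algebraMap K L l := by rw [hΛ, hπ, ← map_mul, ← hlam, lam]
  have hκc : c * κ = Λ ^ p := by
    rw [hc, hκ, ← map_mul, hΛ, ← map_pow]
    congr 1
    have hp0 : (p : K) ≠ 0 := Nat.cast_ne_zero.2 hp.out.ne_zero
    rw [mul_div_assoc', div_eq_iff hp0, mul_assoc, ← pow_succ', Nat.sub_add_cancel hp.out.one_le,
      mul_comm]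
  obtain ⟨e', he', hee⟩ : ∃ r ∈ T, e = 1 + π * r := by
    obtain ⟨r, hr, h⟩ := aeval_mem_mul (T := T) hTK hπ0 (D.sub_one_mem i) (f := Y) fun j hj => by
      refine hYT j ?_
      have h1 := MvPolynomial.vars_sub_subset (E i) hj
      rw [Finset.mem_union, MvPolynomial.vars_one] at h1
      exact D.vars_lt i j (h1.resolve_right (Finset.notMem_empty j))
    exact ⟨r, hr, by rw [← h, map_sub, map_one, he]; ring⟩
  have heT : e ∈ T := by rw [hee]; exact add_mem (one_mem _) (mul_mem hπT he')
  -- H is what is left of (e + λT)^p - Z_{i-1}u_i, divided by pλ, after removing κT^p, T and the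
  -- term in x_i. The leading terms cancel because pλκ = λ^p.
  set H : L[X] := C c⁻¹ * ((C e + C Λ * X) ^ p - C (Z i.castSucc * MvPolynomial.aeval x (G i))) -
    C κ * X ^ p - X with hH
  have hcoeff : ∀ n, H.coeff n = c⁻¹ * (e ^ (p - n) * (p.choose n : L) * Λ ^ n -
      if n = 0 then Z i.castSucc * MvPolynomial.aeval x (G i) else 0) -
      κ * (if n = p then 1 else 0) - (if 1 = n then 1 else 0) := fun n => by
    rw [hH, coeff_sub, coeff_sub, coeff_C_mul, coeff_sub, coeff_add_C_mul_X_pow, coeff_C,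
      coeff_C_mul, coeff_X_pow, coeff_X]
  have hbig : ∀ n, p ≤ n → H.coeff n = 0 := fun n hn => by
    rw [hcoeff, if_neg (by omega : n ≠ 0), if_neg (by omega : 1 ≠ n)]
    rcases hn.eq_or_lt with rfl | hn
    · rw [if_pos rfl, Nat.sub_self, pow_zero, Nat.choose_self, Nat.cast_one, ← hκc]
      field_simp
      ring
    · rw [if_neg (by omega : n ≠ p), Nat.choose_eq_zero_of_lt hn]
      simp
  -- Degree 0 is `ASWDatum.constant_term_eq`; degree 1 is e^{p-1} - 1, where e ≡ 1. For 1 < n < p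
  -- the binomial coefficient absorbs p and λ^n leaves λ^{n-1}, which is divisible by π.
  have hmod : ∀ n, ∃ r ∈ T, (H - C (MvPolynomial.aeval Y (P i))).coeff n = π * r := fun n => by
    rw [coeff_sub, coeff_C]
    rcases Nat.lt_or_ge n p with hn | hn
    · rcases Nat.lt_trichotomy n 1 with h1 | rfl | h1
      · obtain rfl : n = 0 := by omega
        refine ⟨w, hw, ?_⟩
        rw [hcoeff, if_pos rfl, if_neg (by omega : 0 ≠ p), if_neg one_ne_zero, if_pos rfl,
          Nat.sub_zero, Nat.choose_zero_right, Nat.cast_one, mul_one, pow_zero, mul_one, hcst]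
        field_simp
        ring
      · obtain ⟨r, hr, h2⟩ := pow_eq_one_add_mul he' hπT hee (p - 1)
        refine ⟨r, hr, ?_⟩
        rw [hcoeff, if_neg one_ne_zero, if_neg (by omega : 1 ≠ p), if_pos rfl, if_neg one_ne_zero,
          h2, Nat.choose_one_right, pow_one, mul_assoc, ← hcp]
        field_simp
        ring
      · obtain ⟨k, hk⟩ := hp.out.dvd_choose_self (by omega : n ≠ 0) hn
        refine ⟨e ^ (p - n) * (k : L) * Λ ^ (n - 2) * algebraMap K L l, mul_mem (mul_mem (mul_mem
          (pow_mem heT _) (natCast_mem _ _)) (pow_mem (hTK _ (lam_mem h1i hi)) _)) (hTK _ hl), ?_⟩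
        obtain ⟨m, rfl⟩ : ∃ m, n = m + 2 := ⟨n - 2, by omega⟩
        rw [hcoeff, if_neg (by omega : m + 2 ≠ 0), if_neg hn.ne, if_neg (by omega : 1 ≠ m + 2),
          if_neg (by omega : m + 2 ≠ 0), hk, Nat.cast_mul, Nat.add_sub_cancel]
        have h3 : e ^ (p - (m + 2)) * ((p : L) * (k : L)) * Λ ^ (m + 2) - 0 =
            c * (π * (e ^ (p - (m + 2)) * (k : L) * Λ ^ m * algebraMap K L l)) := by
          rw [hcp]
          linear_combination (e ^ (p - (m + 2)) * (p : L) * (k : L) * Λ ^ (m + 1)) * hΛπ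
        rw [h3, inv_mul_cancel_left₀ hcL0]
        ring
    · exact ⟨0, zero_mem _, by rw [hbig n hn, if_neg (by omega : n ≠ 0)]; ring⟩
  refine ⟨H, (degree_lt_iff_coeff_zero H p).2 hbig, fun n => ?_, hmod, ?_⟩
  · obtain ⟨r, hr, h⟩ := hmod n
    rw [coeff_sub, coeff_C, sub_eq_iff_eq_add] at h
    rw [h]
    refine add_mem (mul_mem hπT hr) ?_
    split_ifs
    · exact hPT
    · exact zero_mem _
  · have h1 : C c * C c⁻¹ = (1 : L[X]) := by rw [← C_mul, mul_inv_cancel₀ hcL0, C_1]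
    have h2 : unitElt p s ζ G x i = MvPolynomial.aeval x (G i) + c * x i := rfl
    rw [hH, h2, mul_add (Z i.castSucc), C_add, C_mul, C_mul, C_mul, C_mul]
    linear_combination ((C e + C Λ * X) ^ p - C (Z i.castSucc) * C (MvPolynomial.aeval x (G i))) * h1

theorem root_identity {c κ : L} (hc : c ≠ 0) {q : L[X]} {e l y a z u : L}
    (h : C c * (C κ * X ^ p + X + q - C a) = (C e + C l * X) ^ p - C u) (hy : z = e + l * y)
    (hz : z ^ p = u) : κ * y ^ p + y + q.eval y - a = 0 := by
  have h1 := congrArg (eval y) h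
  simp only [eval_mul, eval_sub, eval_add, eval_pow, eval_C, eval_X] at h1
  rw [← hy, hz, sub_self] at h1
  exact (mul_eq_zero.1 h1).resolve_left hc

end KummerPolynomial

/-! ### Irreducibility and the minimal polynomial of Y_i. -/

section Transcendence

open Polynomial IntermediateField

/-- If αx + β = (r/t)^n, then n deg r = 1 + n deg t, impossible for n ≥ 2. -/
theorem pow_ne_of_transcendental {B L : Type*} [Field B] [Field L] [Algebra B L] {x : L}
    (hx : Transcendental B x) {α β : B} (hα : α ≠ 0) {n : ℕ} (hn : 2 ≤ n) {y : L} (hy : y ∈ B⟮x⟯) :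
    y ^ n ≠ algebraMap B L α * x + algebraMap B L β := by
  intro h
  have hlin : aeval x (C α * X + C β) = algebraMap B L α * x + algebraMap B L β := by simp
  have hl0 : (C α * X + C β : B[X]) ≠ 0 := fun h0 => by
    have := congrArg natDegree h0
    rw [natDegree_linear hα, natDegree_zero] at this
    exact one_ne_zero this
  have hinj := transcendental_iff.1 hx
  obtain ⟨r, t, hrt⟩ := (mem_adjoin_simple_iff B y).1 hy
  by_cases ht : aeval x t = 0
  · rw [hrt, ht, div_zero, zero_pow (by omega), ← hlin] at h
    exact hl0 (hinj _ h.symm)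
  · have ht0 : t ≠ 0 := fun h0 => ht (by rw [h0, map_zero])
    have h1 : r ^ n = (C α * X + C β) * t ^ n := by
      refine sub_eq_zero.1 (hinj _ ?_)
      rw [map_sub, map_mul, map_pow, map_pow, hlin, ← h, hrt, div_pow,
        div_mul_cancel₀ _ (pow_ne_zero n ht), sub_self]
    have h2 := congrArg natDegree h1
    rw [natDegree_pow, natDegree_mul hl0 (pow_ne_zero n ht0), natDegree_linear hα,
      natDegree_pow] at h2
    have h3 : n ∣ 1 := (Nat.dvd_add_left (Dvd.intro _ rfl)).1 (Dvd.intro _ h2)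
    have := Nat.le_of_dvd one_pos h3
    omega

variable {p s : ℕ} [hp : Fact p.Prime] {K : Type*} [Field K] [NumberField K] {ζ : K}
  {L : Type*} [Field L] [Algebra K L]
  {G E : Fin s → MvPolynomial (Fin s) K} {x Y : Fin s → L} {Z : Fin (s + 1) → L}

/-- `Z_{i-1} u_i` is not a `p`-th power in `K(Y_0, …, Y_{i-1}, X_i)`. -/
theorem IsKummerTower.pow_ne (hT : IsKummerTower p s ζ G x Z) (hs : 1 ≤ s)
    (hζ : IsPrimitiveRoot ζ (p ^ s)) (hG : ∀ i, ∀ j ∈ (G i).vars, j < i)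
    (hE : ∀ i, ∀ j ∈ (E i).vars, j < i) (hY : ∀ i : Fin s, Z i.succ =
      MvPolynomial.aeval Y (E i) + algebraMap K L (lam p s ζ) * Y i) (i : Fin s) {y : L}
    (hy : y ∈ adjoin K ({t | ∃ j < i, t = Y j} ∪ {x i})) :
    y ^ p ≠ Z i.castSucc * unitElt p s ζ G x i := by
  set A := adjoin K (x '' {j | j < i})
  -- All Z_j and Y_j with smaller index are algebraic over K(x_j : j < i), while x_i stays
  -- transcendental over this closure. Over it Z_{i-1}u_i is linear in x_i.
  set B := algebraicClosure A L
  have hxA : Transcendental A (x i) := IntermediateField.transcendental_adjoin_iff.2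
    (hT.algebraicIndependent.transcendental_adjoin (lt_irrefl i))
  have hxB : Transcendental B (x i) := hxA.extendScalars _
  have hK : ∀ c : K, algebraMap K L c ∈ B := fun c =>
    B.algebraMap_mem ⟨algebraMap K L c, A.algebraMap_mem c⟩
  have hxm : ∀ j < i, x j ∈ B := fun j hj =>
    B.algebraMap_mem ⟨x j, subset_adjoin K _ ⟨j, hj, rfl⟩⟩
  have hGm : ∀ j ≤ i, MvPolynomial.aeval x (G j) ∈ B := fun j hj =>
    aeval_mem_subring (T := B.toSubring) (fun d => hK _) fun k hk => hxm k ((hG j k hk).trans_le hj)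
  have hl0 : algebraMap K L (lam p s ζ) ≠ 0 :=
    (_root_.map_ne_zero _).2 (pi_ne_zero hζ le_rfl hs)
  have hmem : ∀ k : Fin (s + 1), (k : ℕ) ≤ i → Z k ∈ B ∧ ∀ j : Fin s, (j : ℕ) < k → Y j ∈ B := by
    intro k
    induction k using Fin.induction with
    | zero =>
      rw [hT.zero_eq]
      exact fun _ => ⟨one_mem _, fun j hj => absurd hj (Nat.not_lt_zero _)⟩
    | succ k ih =>
      intro hk
      have hki : k < i := hk
      obtain ⟨h1, h2⟩ := ih hki.le
      have h3 : Z k.succ ∈ B := by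
        refine mem_algebraicClosure_iff.2 (IsAlgebraic.of_pow hp.out.pos
          (mem_algebraicClosure_iff.1 ?_))
        rw [hT.pow_eq]
        exact mul_mem h1 (add_mem (hGm k hki.le) (mul_mem (hK _) (hxm k hki)))
      refine ⟨h3, fun j hj => ?_⟩
      rcases Nat.lt_succ_iff_lt_or_eq.1 hj with hj | hj
      · exact h2 j hj
      · obtain rfl : j = k := Fin.ext hj
        have h4 : Y j = (Z j.succ - MvPolynomial.aeval Y (E j)) * (algebraMap K L (lam p s ζ))⁻¹ := by
          rw [hY, add_sub_cancel_left, mul_comm, inv_mul_cancel_left₀ hl0]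
        rw [h4]
        exact mul_mem (sub_mem h3 (aeval_mem_subring (T := B.toSubring) (fun d => hK _)
          fun k hk => h2 k (hE j k hk))) (inv_mem (hK _))
  obtain ⟨hZ, hYm⟩ := hmem i.castSucc le_rfl
  have hyB : y ∈ B⟮x i⟯ := by
    have h1 : adjoin K ({t | ∃ j < i, t = Y j} ∪ {x i}) ≤
        (B⟮x i⟯).toSubfield.toIntermediateField
          fun c => (B⟮x i⟯).algebraMap_mem ⟨algebraMap K L c, hK c⟩ := by
      rw [adjoin_le_iff]
      rintro t (⟨j, hj, rfl⟩ | rfl)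
      · exact (B⟮x i⟯).algebraMap_mem ⟨Y j, hYm j hj⟩
      · exact mem_adjoin_simple_self B (x i)
    exact h1 hy
  have hc0 := p_mul_lam_ne_zero (K := K) hs hζ
  have hne := pow_ne_of_transcendental hxB
    (α := ⟨Z i.castSucc * algebraMap K L ((p : K) * lam p s ζ), mul_mem hZ (hK _)⟩)
    (β := ⟨Z i.castSucc * MvPolynomial.aeval x (G i), mul_mem hZ (hGm i le_rfl)⟩)
    (fun h => mul_ne_zero (hT.Z_ne_zero hs hζ hG _) ((_root_.map_ne_zero _).2 hc0)
      (congrArg Subtype.val h)) hp.out.two_le hyB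
  intro h
  refine hne (h.trans ?_)
  change _ = Z i.castSucc * algebraMap K L ((p : K) * lam p s ζ) * x i +
    Z i.castSucc * MvPolynomial.aeval x (G i)
  rw [unitElt]
  ring

theorem fracRing_le {M : IntermediateField K L} {i : Fin s} (hE : ∀ i, ∀ j ∈ (E i).vars, j < i)
    (hY : ∀ i : Fin s, Z i.succ =
      MvPolynomial.aeval Y (E i) + algebraMap K L (lam p s ζ) * Y i)
    (hM : ∀ j < i, Y j ∈ M) : fracRing p s ζ Y Z i i ≤ M.toSubring := by
  refine Subring.closure_le.2 ?_
  rintro t ((⟨c, -, rfl⟩ | ⟨j, hj, rfl⟩) | ⟨j, hj, rfl⟩)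
  · exact M.algebraMap_mem c
  · exact hM j hj
  · refine inv_mem (S := IntermediateField K L) ?_
    rw [hY]
    exact add_mem (aeval_mem_subring (T := M.toSubring) (fun d => M.algebraMap_mem _)
      fun k hk => hM k ((hE j k hk).trans hj)) (mul_mem (M.algebraMap_mem _) (hM j hj))

theorem Z_mem_adjoin (h0 : Z 0 = 1) {M : IntermediateField K L} {i : Fin s}
    (hE : ∀ i, ∀ j ∈ (E i).vars, j < i) (hY : ∀ i : Fin s, Z i.succ =
      MvPolynomial.aeval Y (E i) + algebraMap K L (lam p s ζ) * Y i)
    (hM : ∀ j < i, Y j ∈ M) : Z i.castSucc ∈ M := by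
  have h := fracRing_le (p := p) hE hY hM (Z_inv_mem_fracRing h0 (j := i.castSucc) (le_refl _))
  rw [← inv_inv (Z i.castSucc)]
  exact inv_mem (S := IntermediateField K L) h

/-- The minimal polynomial of `Y_i`. -/
theorem IsKummerTower.minpoly_eq (hT : IsKummerTower p s ζ G x Z) (hs : 1 ≤ s)
    (hζ : IsPrimitiveRoot ζ (p ^ s)) (hG : ∀ i, ∀ j ∈ (G i).vars, j < i)
    (hE : ∀ i, ∀ j ∈ (E i).vars, j < i) (hY : ∀ i : Fin s, Z i.succ =
      MvPolynomial.aeval Y (E i) + algebraMap K L (lam p s ζ) * Y i) (i : Fin s)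
    {H : L[X]} (hdeg : H.degree < (p : WithBot ℕ)) (hH : ∀ n, H.coeff n ∈ fracRing p s ζ Y Z i i)
    (heq : C (algebraMap K L ((p : K) * lam p s ζ)) *
        (C (algebraMap K L (lam p s ζ ^ (p - 1) / (p : K))) * X ^ p + X + H -
            C (Z i.castSucc * x i)) =
        (C (MvPolynomial.aeval Y (E i)) + C (algebraMap K L (lam p s ζ)) * X) ^ p -
          C (Z i.castSucc * unitElt p s ζ G x i)) :
    C (algebraMap K L (lam p s ζ ^ (p - 1) / (p : K))) *
      (minpoly (adjoin K ({t | ∃ j < i, t = Y j} ∪ {x i})) (Y i)).map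
        (algebraMap (adjoin K ({t | ∃ j < i, t = Y j} ∪ {x i})) L) =
      C (algebraMap K L (lam p s ζ ^ (p - 1) / (p : K))) * X ^ p + X + H -
        C (Z i.castSucc * x i) := by
  have hpow := fun y hy => hT.pow_ne hs hζ hG hE hY i (y := y) hy
  set M := adjoin K ({t | ∃ j < i, t = Y j} ∪ {x i}) with hM
  have hYM : ∀ j < i, Y j ∈ M := fun j hj => subset_adjoin K _ (Or.inl ⟨j, hj, rfl⟩)
  have hxM : x i ∈ M := subset_adjoin K _ (Or.inr rfl)
  have hHM : ∀ n, H.coeff n ∈ M := fun n => fracRing_le (p := p) hE hY hYM (hH n)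
  have hZM : Z i.castSucc ∈ M := Z_mem_adjoin (p := p) hT.zero_eq hE hY hYM
  have heM : MvPolynomial.aeval Y (E i) ∈ M := aeval_mem_subring (T := M.toSubring)
    (fun d => M.algebraMap_mem _) fun k hk => hYM k (hE i k hk)
  have hl0 : lam p s ζ ≠ 0 := pi_ne_zero hζ le_rfl hs
  have hp0 : (p : K) ≠ 0 := Nat.cast_ne_zero.2 hp.out.ne_zero
  have hκ0 : algebraMap K L (lam p s ζ ^ (p - 1) / (p : K)) ≠ 0 :=
    (_root_.map_ne_zero _).2 (div_ne_zero (pow_ne_zero _ hl0) hp0)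
  have hcL0 : algebraMap K L ((p : K) * lam p s ζ) ≠ 0 :=
    (_root_.map_ne_zero _).2 (p_mul_lam_ne_zero hs hζ)
  set κ := algebraMap K L (lam p s ζ ^ (p - 1) / (p : K)) with hκ
  have hκM : κ ∈ M := M.algebraMap_mem _
  set g : L[X] := C κ⁻¹ * (X + H - C (Z i.castSucc * x i)) with hg
  have hgdeg : g.degree < (p : WithBot ℕ) := by
    rw [hg, degree_C_mul (inv_ne_zero hκ0)]
    have h1p : (1 : WithBot ℕ) < (p : WithBot ℕ) := by exact_mod_cast hp.out.one_lt
    refine (degree_sub_le _ _).trans_lt (max_lt ((degree_add_le _ _).trans_lt (max_lt ?_ hdeg)) ?_)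
    · rwa [degree_X]
    · exact degree_C_le.trans_lt (lt_of_le_of_lt zero_le_one h1p)
  have hgM : ∀ n, g.coeff n ∈ M := fun n => by
    rw [hg, coeff_C_mul, coeff_sub, coeff_add, coeff_X, coeff_C]
    refine mul_mem (inv_mem hκM) (sub_mem (add_mem ?_ (hHM n)) ?_)
    · split_ifs
      exacts [one_mem _, zero_mem _]
    · split_ifs
      exacts [mul_mem hZM hxM, zero_mem _]
  have hfact : C κ * (X ^ p + g) = C κ * X ^ p + X + H - C (Z i.castSucc * x i) := by
    have h1 : C κ * C κ⁻¹ = (1 : L[X]) := by rw [← C_mul, mul_inv_cancel₀ hκ0, C_1]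
    rw [hg]
    linear_combination (X + H - C (Z i.castSucc * x i)) * h1
  obtain ⟨g', hg'⟩ : ∃ g' : M[X], g'.map (algebraMap M L) = g :=
    (mem_lifts g).1 ((lifts_iff_coeff_lifts g).2 fun n => ⟨⟨_, hgM n⟩, rfl⟩)
  have hg'deg : g'.degree < (p : WithBot ℕ) := by
    rwa [← hg', degree_map_eq_of_injective (algebraMap M L).injective] at hgdeg
  have hmonic : (X ^ p + g').Monic := monic_X_pow_add hg'deg
  have hnat : (X ^ p + g').natDegree = p := by
    have : (X ^ p + g').degree = (p : WithBot ℕ) := by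
      rw [degree_add_eq_left_of_degree_lt (by rwa [degree_X_pow]), degree_X_pow]
    exact natDegree_eq_of_degree_eq_some this
  have hroot : aeval (Y i) (X ^ p + g') = 0 := by
    have h1 := root_identity hcL0 heq (hY i) (hT.pow_eq i)
    have h2 := congrArg (eval (Y i)) hfact
    simp only [eval_mul, eval_sub, eval_add, eval_pow, eval_C, eval_X] at h2
    rw [h1] at h2
    have h3 := (mul_eq_zero.1 h2).resolve_left hκ0
    rwa [map_add, map_pow, aeval_X, ← eval_map_algebraMap, hg']
  have ha : Z i.castSucc * unitElt p s ζ G x i ∈ M := by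
    have h1 := congrArg (eval 0) heq
    simp only [eval_mul, eval_sub, eval_add, eval_pow, eval_C, eval_X, zero_pow hp.out.ne_zero,
      mul_zero, zero_add, add_zero, ← coeff_zero_eq_eval_zero] at h1
    have h2 : Z i.castSucc * unitElt p s ζ G x i = MvPolynomial.aeval Y (E i) ^ p -
        algebraMap K L ((p : K) * lam p s ζ) * (H.coeff 0 - Z i.castSucc * x i) := by
      rw [h1]; ring
    rw [h2]
    exact sub_mem (pow_mem heM p) (mul_mem (M.algebraMap_mem _)
      (sub_mem (hHM 0) (mul_mem hZM hxM)))
  -- A non-p-th-power gives an irreducible binomial, so Z_i has degree p over M. The affine change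
  -- Z_i = E_i + λY_i carries this degree over to Y_i.
  have hirr : Irreducible (X ^ p - C (⟨_, ha⟩ : M)) :=
    X_pow_sub_C_irreducible_of_prime hp.out fun y hy => hpow y y.2 (congrArg Subtype.val hy)
  have hminZ : X ^ p - C (⟨_, ha⟩ : M) = minpoly M (Z i.succ) :=
    minpoly.eq_of_irreducible_of_monic hirr (by
      rw [map_sub, map_pow, aeval_X, aeval_C, hT.pow_eq]; exact sub_self _)
      (monic_X_pow_sub_C _ hp.out.ne_zero)
  have hint : IsIntegral M (Y i) := ⟨_, hmonic, hroot⟩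
  have hle : p ≤ (minpoly M (Y i)).natDegree := by
    set l : M := ⟨algebraMap K L (lam p s ζ), M.algebraMap_mem _⟩
    set e : M := ⟨_, heM⟩
    have hlM : l ≠ 0 := fun h => (_root_.map_ne_zero (algebraMap K L)).2 hl0 (congrArg Subtype.val h)
    have h1 : (C l⁻¹ * X + C (-(l⁻¹ * e)) : M[X]).natDegree = 1 := natDegree_linear (inv_ne_zero hlM)
    have h2 : aeval (Z i.succ) ((minpoly M (Y i)).comp (C l⁻¹ * X + C (-(l⁻¹ * e)))) = 0 := by
      have h3 : aeval (Z i.succ) (C l⁻¹ * X + C (-(l⁻¹ * e)) : M[X]) = Y i := by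
        have h4 : algebraMap M L l = algebraMap K L (lam p s ζ) := rfl
        have h5 : algebraMap M L e = MvPolynomial.aeval Y (E i) := rfl
        simp only [map_add, map_mul, aeval_C, aeval_X, map_neg, map_inv₀, h4, h5]
        rw [hY]
        have := (_root_.map_ne_zero (algebraMap K L)).2 hl0
        field_simp
        ring
      rw [aeval_comp, h3, minpoly.aeval]
    have h6 : (minpoly M (Y i)).comp (C l⁻¹ * X + C (-(l⁻¹ * e))) ≠ 0 := fun h => by
      have h7 := congrArg natDegree h
      rw [natDegree_comp, h1, mul_one, natDegree_zero] at h7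
      exact (minpoly.natDegree_pos hint).ne' h7
    have h8 := natDegree_le_of_dvd (minpoly.dvd M _ h2) h6
    rwa [← hminZ, natDegree_X_pow_sub_C, natDegree_comp, h1, mul_one] at h8
  have hmin := eq_of_monic_of_dvd_of_natDegree_le (minpoly.monic hint) hmonic
    (minpoly.dvd M _ hroot) (hnat.trans_le hle)
  rw [← hmin, Polynomial.map_add, Polynomial.map_pow, map_X, hg', hfact]

end Transcendence

/-! ### The Y_i are independent generators of L. -/

section Generation

open Polynomial

theorem eval_mem_mul {A : Type*} [CommRing A] {T : Subring A} {q : A[X]} {c y : A}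
    (hq : ∀ n, ∃ r ∈ T, q.coeff n = c * r) (hy : y ∈ T) : ∃ r ∈ T, q.eval y = c * r := by
  choose r hr h using hq
  refine ⟨∑ n ∈ q.support, r n * y ^ n, sum_mem fun n _ => mul_mem (hr n) (pow_mem hy n), ?_⟩
  rw [eval_eq_sum, Polynomial.sum, Finset.mul_sum]
  exact Finset.sum_congr rfl fun n _ => by rw [h, mul_assoc]

variable {p s : ℕ} [hp : Fact p.Prime] {K : Type*} [Field K] [NumberField K] {ζ : K}
  {L : Type*} [Field L] [Algebra K L]
  {G E : Fin s → MvPolynomial (Fin s) K} {x Y : Fin s → L} {Z : Fin (s + 1) → L}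

theorem IsKummerTower.x_mem (hT : IsKummerTower p s ζ G x Z) (hs : 1 ≤ s)
    (hζ : IsPrimitiveRoot ζ (p ^ s)) (hG : ∀ i, ∀ j ∈ (G i).vars, j < i) {i : Fin s} {q : L[X]}
    (hq : ∀ n, q.coeff n ∈ fracRing p s ζ Y Z i i)
    (h : algebraMap K L (lam p s ζ ^ (p - 1) / (p : K)) * Y i ^ p + Y i + q.eval (Y i) -
      Z i.castSucc * x i = 0) : x i ∈ fracRing p s ζ Y Z i (i + 1) := by
  have h1 : x i = (Z i.castSucc)⁻¹ *
      (algebraMap K L (lam p s ζ ^ (p - 1) / (p : K)) * Y i ^ p + Y i + q.eval (Y i)) := by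
    rw [sub_eq_zero.1 h, inv_mul_cancel_left₀ (hT.Z_ne_zero hs hζ hG _)]
  have hYi : Y i ∈ fracRing p s ζ Y Z i (i + 1) := Y_mem_fracRing (Nat.lt_succ_self _)
  rw [h1]
  refine mul_mem (Z_inv_mem_fracRing hT.zero_eq le_rfl) (add_mem (add_mem (mul_mem
    (algebraMap_mem_fracRing (lam_pow_unit hζ (Nat.le_add_left 1 _) i.2).1) (pow_mem hYi p)) hYi) ?_)
  exact eval_mem_subring
    (fun n => fracRing_mono le_rfl i.2 (Nat.le_succ _) (hq n)) hYi

/-- `L` is generated over `K` by the `Y_i`. -/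
theorem IsKummerTower.adjoin_range_eq_top (hT : IsKummerTower p s ζ G x Z) (hs : 1 ≤ s)
    (hE : ∀ i, ∀ j ∈ (E i).vars, j < i) (hY : ∀ i : Fin s, Z i.succ =
      MvPolynomial.aeval Y (E i) + algebraMap K L (lam p s ζ) * Y i)
    (hx : ∀ i : Fin s, x i ∈ fracRing p s ζ Y Z i (i + 1)) :
    IntermediateField.adjoin K (Set.range Y) = ⊤ := by
  set M := IntermediateField.adjoin K (Set.range Y)
  have hYM : ∀ j, Y j ∈ M := fun j => IntermediateField.subset_adjoin K _ ⟨j, rfl⟩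
  have hZM : ∀ j : Fin s, Z j.succ ∈ M := fun j => by
    rw [hY]
    exact add_mem (aeval_mem_subring (T := M.toSubring) (fun d => M.algebraMap_mem _)
      fun k _ => hYM k) (mul_mem (M.algebraMap_mem _) (hYM j))
  rw [eq_top_iff, ← hT.adjoin_eq_top, IntermediateField.adjoin_le_iff]
  rintro t (⟨i, rfl⟩ | rfl)
  · have h1 : fracRing p s ζ Y Z i (i + 1) ≤ M.toSubring := by
      refine Subring.closure_le.2 ?_
      rintro t ((⟨c, -, rfl⟩ | ⟨j, -, rfl⟩) | ⟨j, -, rfl⟩)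
      · exact M.algebraMap_mem c
      · exact hYM j
      · exact inv_mem (S := IntermediateField K L) (hZM j)
    exact h1 (hx i)
  · obtain ⟨k, rfl⟩ : ∃ k, s = k + 1 := ⟨s - 1, by omega⟩
    rw [← Fin.succ_last]
    exact hZM _

/-- The independent family x bounds the transcendence degree below by the size of ι. A generating
family of that size is then a transcendence basis. -/
theorem algebraicIndependent_of_adjoin_eq_top {ι : Type*} [Finite ι] {x Y : ι → L}
    (hx : AlgebraicIndependent K x) (hY : IntermediateField.adjoin K (Set.range Y) = ⊤) :
    AlgebraicIndependent K Y := by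
  have h1 : Algebra.IsAlgebraic (IntermediateField.adjoin K (Set.range Y)) L := by
    refine ⟨fun t => ?_⟩
    have ht : t ∈ IntermediateField.adjoin K (Set.range Y) := hY ▸ IntermediateField.mem_top
    exact isAlgebraic_algebraMap (⟨t, ht⟩ : IntermediateField.adjoin K (Set.range Y))
  have h2 := IntermediateField.isAlgebraic_adjoin_iff_top.1 h1
  exact (Algebra.IsAlgebraic.isTranscendenceBasis_of_lift_le_trdeg_of_finite K Y
    hx.lift_cardinalMk_le_trdeg).1

end Generation

/-! ### Rings R[y, 1/t]: special fibre and integral closedness. -/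

section LocalizedPolynomials

open MvPolynomial

variable {K : Type*} [Field K] {L : Type*} [Field L] [Algebra K L] {σ ι : Type*}

/-- Evaluation at `y` of the polynomials with coefficients in a subring `R` of `K`. -/
def polyHom (R : Subring K) (y : σ → L) : MvPolynomial σ R →+* L :=
  eval₂Hom ((algebraMap K L).comp R.subtype) y

/-- The ring `R[y, 1/t]`, as a subring of `L`. -/
def locRing (R : Subring K) (y : σ → L) (t : ι → L) : Subring L :=
  Subring.closure (algebraMap K L '' R ∪ Set.range y ∪ Set.range fun i => (t i)⁻¹)

variable {R : Subring K} {y : σ → L} {t : ι → L}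

theorem polyHom_eq (N : MvPolynomial σ R) :
    polyHom R y N = aeval y (map R.subtype N) := by
  rw [aeval_def, eval₂_map]; rfl

theorem polyHom_C (c : R) : polyHom R y (C c) = algebraMap K L c := eval₂_C _ _ _

theorem polyHom_X (i : σ) : polyHom R y (X i) = y i := eval₂_X _ _ _

theorem polyHom_injective (hy : AlgebraicIndependent K y) :
    Function.Injective (polyHom R y) := by
  intro M N h
  rw [polyHom_eq, polyHom_eq] at h
  exact map_injective _ R.subtype_injective (hy h)

theorem exists_map_subtype_eq {f : MvPolynomial σ K} (hf : ∀ d, f.coeff d ∈ R) :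
    ∃ N : MvPolynomial σ R, map R.subtype N = f := by
  refine mem_range_map_iff_coeffs_subset.2 fun c hc => ?_
  obtain ⟨d, -, rfl⟩ := mem_coeffs_iff.1 hc
  exact ⟨⟨_, hf d⟩, rfl⟩

theorem algebraMap_mem_locRing {c : K} (hc : c ∈ R) : algebraMap K L c ∈ locRing R y t :=
  Subring.subset_closure (Or.inl (Or.inl ⟨c, hc, rfl⟩))

theorem mem_locRing (i : σ) : y i ∈ locRing R y t :=
  Subring.subset_closure (Or.inl (Or.inr ⟨i, rfl⟩))

theorem inv_mem_locRing (i : ι) : (t i)⁻¹ ∈ locRing R y t :=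
  Subring.subset_closure (Or.inr ⟨i, rfl⟩)

theorem polyHom_mem_locRing (N : MvPolynomial σ R) : polyHom R y N ∈ locRing R y t := by
  rw [polyHom_eq]
  refine aeval_mem_subring (fun d => ?_) fun j _ => mem_locRing j
  rw [coeff_map]
  exact algebraMap_mem_locRing (N.coeff d).2

/-- The elements of `R[y, 1/t]` are fractions. -/
theorem exists_frac_of_mem_locRing {q : ι → MvPolynomial σ R} (hq : ∀ i, polyHom R y (q i) = t i)
    (ht : ∀ i, t i ≠ 0) {w : L} (hw : w ∈ locRing R y t) :
    ∃ (N : MvPolynomial σ R) (D : Submonoid.closure (Set.range q)),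
      w * polyHom R y D = polyHom R y N := by
  unfold locRing at hw
  induction hw using Subring.closure_induction with
  | mem w hw =>
    obtain (⟨c, hc, rfl⟩ | ⟨i, rfl⟩) | ⟨i, rfl⟩ := hw
    · exact ⟨C ⟨c, hc⟩, 1, by
        rw [polyHom_C, OneMemClass.coe_one, map_one, mul_one]⟩
    · exact ⟨X i, 1, by rw [polyHom_X, OneMemClass.coe_one, map_one, mul_one]⟩
    · exact ⟨1, ⟨q i, Submonoid.subset_closure ⟨i, rfl⟩⟩, by
        rw [map_one]
        change (t i)⁻¹ * polyHom R y (q i) = 1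
        rw [hq, inv_mul_cancel₀ (ht i)]⟩
  | zero => exact ⟨0, 1, by rw [zero_mul, map_zero]⟩
  | one => exact ⟨1, 1, by rw [one_mul]; rfl⟩
  | add a b _ _ ha hb =>
    obtain ⟨N, D, h⟩ := ha
    obtain ⟨N', D', h'⟩ := hb
    refine ⟨N * D' + N' * D, D * D', ?_⟩
    rw [Submonoid.coe_mul, map_mul, map_add, map_mul, map_mul, ← h, ← h']
    ring
  | neg a _ ha =>
    obtain ⟨N, D, h⟩ := ha
    exact ⟨-N, D, by rw [map_neg, ← h, neg_mul]⟩
  | mul a b _ _ ha hb =>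
    obtain ⟨N, D, h⟩ := ha
    obtain ⟨N', D', h'⟩ := hb
    refine ⟨N * N', D * D', ?_⟩
    rw [Submonoid.coe_mul, map_mul, map_mul, ← h, ← h']
    ring

theorem mem_idealOf {S : Subring L} {c : L} (hc : c ∈ S) {w : S} :
    w ∈ idealOf S c ↔ ∃ r ∈ S, (w : L) = c * r := by
  have h : {w : S | (w : L) = c} = {⟨c, hc⟩} :=
    Set.ext fun w => ⟨fun h => Subtype.ext h, fun h => congrArg Subtype.val h⟩
  rw [idealOf, h, Ideal.mem_span_singleton']
  constructor
  · rintro ⟨a, rfl⟩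
    exact ⟨a, a.2, mul_comm _ _⟩
  · rintro ⟨r, hr, h⟩
    exact ⟨⟨r, hr⟩, Subtype.ext ((mul_comm _ _).trans h.symm)⟩

variable {k : Type*} [CommRing k] {π : K} {res : R →+* k}

theorem map_res_eq_zero_iff (hπ : π ∈ R)
    (hres : ∀ x : R, res x = 0 ↔ ∃ r ∈ R, (x : K) = π * r) {N : MvPolynomial σ R} :
    map res N = 0 ↔ ∃ M, N = C ⟨π, hπ⟩ * M := by
  constructor
  · intro h
    have h1 : N ∈ RingHom.ker (map (σ := σ) res) := h
    have h2 : RingHom.ker res = Ideal.span {⟨π, hπ⟩} := by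
      ext x
      rw [RingHom.mem_ker, hres, Ideal.mem_span_singleton']
      constructor
      · rintro ⟨r, hr, h⟩
        exact ⟨⟨r, hr⟩, Subtype.ext ((mul_comm _ _).trans h.symm)⟩
      · rintro ⟨a, rfl⟩
        exact ⟨a, a.2, mul_comm _ _⟩
    rw [ker_map, h2, Ideal.map_span, Set.image_singleton, Ideal.mem_span_singleton'] at h1
    obtain ⟨M, h1⟩ := h1
    exact ⟨M, by rw [← h1, mul_comm]⟩
  · rintro ⟨M, rfl⟩
    rw [map_mul, map_C, (hres ⟨π, hπ⟩).2 ⟨1, one_mem R, (mul_one _).symm⟩, C_0, zero_mul]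

theorem map_res_eq_one (hres : ∀ x : R, res x = 0 ↔ ∃ r ∈ R, (x : K) = π * r)
    {N : MvPolynomial σ R} (h : ∀ d, (map R.subtype N - 1).coeff d ∈ mulSub R π) :
    map res N = 1 := by
  rw [← sub_eq_zero, ← map_one (map (σ := σ) res), ← map_sub]
  ext d
  rw [coeff_map, coeff_zero, hres]
  obtain ⟨r, hr, h1⟩ := mem_mulSub.1 (h d)
  refine ⟨r, hr, ?_⟩
  rw [← h1, ← map_one (map (σ := σ) R.subtype), ← map_sub, coeff_map]
  rfl

/-- The special fibre of a localization `R[y, 1/q]` of a polynomial ring, where the reductions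
of the polynomials `q` are `1`. -/
theorem exists_specialFiber_equiv (hy : AlgebraicIndependent K y) {q : ι → MvPolynomial σ R}
    (hq : ∀ i, polyHom R y (q i) = t i) (ht : ∀ i, t i ≠ 0) (hπ : π ∈ R) (hπ0 : π ≠ 0)
    (hres : ∀ x : R, res x = 0 ↔ ∃ r ∈ R, (x : K) = π * r) (hsurj : Function.Surjective res)
    (hq1 : ∀ i, map res (q i) = 1) :
    ∃ e : (locRing R y t ⧸ idealOf (locRing R y t) (algebraMap K L π)) ≃+* MvPolynomial σ k,
      ∀ N, e (Ideal.Quotient.mk _ ⟨polyHom R y N, polyHom_mem_locRing N⟩) = map res N := by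
  set B := locRing R y t
  have hπB : algebraMap K L π ∈ B := algebraMap_mem_locRing hπ
  have hπL : algebraMap K L π ≠ 0 := (_root_.map_ne_zero _).2 hπ0
  let Φ : MvPolynomial σ R →+* B := (polyHom R y).codRestrict B polyHom_mem_locRing
  let g := (Ideal.Quotient.mk (idealOf B (algebraMap K L π))).comp Φ
  have hD : ∀ D : Submonoid.closure (Set.range q), map res (D : MvPolynomial σ R) = 1 := by
    intro D
    have h1 : Submonoid.closure (Set.range q) ≤
        MonoidHom.mker (map (σ := σ) res : MvPolynomial σ R →* MvPolynomial σ k) :=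
      Submonoid.closure_le.2 (by rintro _ ⟨i, rfl⟩; exact hq1 i)
    exact h1 D.2
  have hfrac : ∀ w ∈ B, ∃ N D : MvPolynomial σ R, map res D = 1 ∧
      w * polyHom R y D = polyHom R y N := fun w hw => by
    obtain ⟨N, D, h⟩ := exists_frac_of_mem_locRing hq ht hw
    exact ⟨N, D, hD D, h⟩
  -- Denominators are ≡ 1 modulo π, so modulo π each fraction equals its numerator.
  have hg : Function.Surjective g := by
    intro w
    obtain ⟨w, rfl⟩ := Ideal.Quotient.mk_surjective w
    obtain ⟨N, D, hD1, h⟩ := hfrac w w.2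
    obtain ⟨M, hM⟩ := (map_res_eq_zero_iff hπ hres (N := 1 - D)).1 (by
      rw [map_sub, map_one, hD1, sub_self])
    refine ⟨N, ?_⟩
    refine Ideal.Quotient.eq.2 ((mem_idealOf hπB).2 ⟨-(w * polyHom R y M),
      neg_mem (mul_mem w.2 (polyHom_mem_locRing M)), ?_⟩)
    change polyHom R y N - w = _
    have h2 := congrArg (polyHom R y) hM
    rw [map_sub, map_one, map_mul, polyHom_C] at h2
    rw [← h]
    linear_combination -(w : L) * h2
  have hker : RingHom.ker g = RingHom.ker (map (σ := σ) res) := by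
    ext N
    rw [RingHom.mem_ker, RingHom.mem_ker, RingHom.comp_apply, Ideal.Quotient.eq_zero_iff_mem,
      mem_idealOf hπB, map_res_eq_zero_iff hπ hres]
    constructor
    · rintro ⟨r, hr, h⟩
      -- Clearing denominators gives ND = πN' as polynomials, by independence; the reduction of D is
      -- 1, so N reduces to 0.
      obtain ⟨N', D, hD1, h1⟩ := hfrac r hr
      have h2 : N * D = C ⟨π, hπ⟩ * N' := by
        refine polyHom_injective hy ?_
        rw [map_mul, map_mul, polyHom_C, ← h1]
        change polyHom R y N = _ at h
        rw [h, mul_assoc]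
      refine (map_res_eq_zero_iff hπ hres).1 ?_
      rw [← mul_one (map res N), ← hD1, ← map_mul]
      exact (map_res_eq_zero_iff hπ hres).2 ⟨N', h2⟩
    · rintro ⟨M, rfl⟩
      refine ⟨polyHom R y M, polyHom_mem_locRing M, ?_⟩
      change polyHom R y _ = _
      rw [map_mul, polyHom_C]
  refine ⟨(RingHom.quotientKerEquivOfSurjective hg).symm.trans
    ((Ideal.quotEquivOfEq hker).trans
      (RingHom.quotientKerEquivOfSurjective (map_surjective res hsurj))), fun N => ?_⟩
  have h1 : (RingHom.quotientKerEquivOfSurjective hg).symm (g N) = Ideal.Quotient.mk _ N := by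
    rw [RingEquiv.symm_apply_eq]; rfl
  change RingHom.quotientKerEquivOfSurjective (map_surjective res hsurj)
    (Ideal.quotEquivOfEq hker ((RingHom.quotientKerEquivOfSurjective hg).symm (g N))) = _
  rw [h1]
  rfl

/-- The ring `R[y, 1/t]` is integrally closed if `R` is factorial. -/
theorem mem_locRing_of_isIntegral [UniqueFactorizationMonoid R] (hy : AlgebraicIndependent K y)
    (htop : IntermediateField.adjoin K (Set.range y) = ⊤)
    (hR : ∀ c : K, ∃ a ∈ R, ∃ b ∈ R, c = a / b) {q : ι → MvPolynomial σ R}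
    (hq : ∀ i, polyHom R y (q i) = t i) (ht : ∀ i, t i ≠ 0) {w : L}
    (hw : IsIntegral (locRing R y t) w) : w ∈ locRing R y t := by
  set B := locRing R y t
  let Φ : MvPolynomial σ R →+* B := (polyHom R y).codRestrict B polyHom_mem_locRing
  let _ : Algebra (MvPolynomial σ R) B := Φ.toAlgebra
  have hΦ : ∀ N, ((algebraMap (MvPolynomial σ R) B N : B) : L) = polyHom R y N := fun _ => rfl
  have hM0 : ∀ D : Submonoid.closure (Set.range q),
      polyHom R y D ≠ 0 ∧ (polyHom R y D)⁻¹ ∈ B := by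
    rintro ⟨D, hD⟩
    induction hD using Submonoid.closure_induction with
    | mem D hD =>
      obtain ⟨i, rfl⟩ := hD
      change polyHom R y (q i) ≠ 0 ∧ (polyHom R y (q i))⁻¹ ∈ B
      rw [hq]
      exact ⟨ht i, inv_mem_locRing i⟩
    | one =>
      change polyHom R y 1 ≠ 0 ∧ (polyHom R y 1)⁻¹ ∈ B
      rw [map_one, inv_one]
      exact ⟨one_ne_zero, one_mem B⟩
    | mul a b _ _ ha hb =>
      change polyHom R y (a * b) ≠ 0 ∧ (polyHom R y (a * b))⁻¹ ∈ B
      rw [map_mul, mul_inv]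
      exact ⟨mul_ne_zero ha.1 hb.1, mul_mem ha.2 hb.2⟩
  have hloc : IsLocalization (Submonoid.closure (Set.range q)) B := by
    refine (isLocalization_iff _ _).2 ⟨fun D => ?_, fun z => ?_, fun {a b} h => ⟨1, ?_⟩⟩
    · refine IsUnit.of_mul_eq_one ⟨_, (hM0 D).2⟩ (Subtype.ext ?_)
      exact mul_inv_cancel₀ (hM0 D).1
    · obtain ⟨N, D, h⟩ := exists_frac_of_mem_locRing hq ht z.2
      exact ⟨(N, D), Subtype.ext h⟩
    · rw [polyHom_injective hy (congrArg Subtype.val h)]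
  -- A polynomial ring over a factorial ring is factorial, hence integrally closed, and localization
  -- preserves this.
  have hB : IsIntegrallyClosed B := by
    refine isIntegrallyClosed_of_isLocalization B (Submonoid.closure (Set.range q))
      fun D hD => mem_nonZeroDivisors_of_ne_zero fun h => (hM0 ⟨D, hD⟩).1 ?_
    change polyHom R y D = 0
    rw [h, map_zero]
  have hfrac : IsFractionRing B L := by
    refine IsFractionRing.of_field B L fun z => ?_
    suffices h : ∃ a ∈ B, ∃ b ∈ B, z = a / b by
      obtain ⟨a, ha, b, hb, h⟩ := h
      exact ⟨⟨a, ha⟩, ⟨b, hb⟩, h⟩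
    have hz : z ∈ IntermediateField.adjoin K (Set.range y) := htop ▸ IntermediateField.mem_top
    induction hz using IntermediateField.adjoin_induction with
    | mem z hz =>
      obtain ⟨i, rfl⟩ := hz
      exact ⟨_, mem_locRing i, 1, one_mem B, (div_one _).symm⟩
    | algebraMap c =>
      obtain ⟨a, ha, b, hb, rfl⟩ := hR c
      exact ⟨_, algebraMap_mem_locRing ha, _, algebraMap_mem_locRing hb, map_div₀ _ _ _⟩
    | inv z _ h =>
      obtain ⟨a, ha, b, hb, rfl⟩ := h
      exact ⟨b, hb, a, ha, inv_div _ _⟩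
    | mul z z' _ _ h h' =>
      obtain ⟨a, ha, b, hb, rfl⟩ := h
      obtain ⟨a', ha', b', hb', rfl⟩ := h'
      exact ⟨_, mul_mem ha ha', _, mul_mem hb hb', div_mul_div_comm _ _ _ _⟩
    | add z z' _ _ h h' =>
      obtain ⟨a, ha, b, hb, rfl⟩ := h
      obtain ⟨a', ha', b', hb', rfl⟩ := h'
      by_cases hb0 : b = 0
      · exact ⟨a', ha', b', hb', by rw [hb0, div_zero, zero_add]⟩
      by_cases hb0' : b' = 0
      · exact ⟨a, ha, b, hb, by rw [hb0', div_zero, add_zero]⟩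
      exact ⟨_, add_mem (mul_mem ha hb') (mul_mem hb ha'), _, mul_mem hb hb',
        div_add_div _ _ hb0 hb0'⟩
  obtain ⟨z, rfl⟩ := (isIntegrallyClosed_iff L).1 hB hw
  exact z.2

end LocalizedPolynomials

/-! ### Integrality of Y_i and Z_i over the coordinate ring of 𝒱_s. -/

section IntegralClosure

open Polynomial

/-- κ is invertible over T, so the equation can be made monic of degree p. -/
theorem isIntegral_of_artinSchreier {L : Type*} [Field L] {T : Subring L} {p : ℕ} (hp : 1 < p)
    {κ : L} (hκ0 : κ ≠ 0) (hκ : κ⁻¹ ∈ T) {q : L[X]} (hdeg : q.degree < (p : WithBot ℕ))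
    (hq : ∀ n, q.coeff n ∈ T) {a y : L} (ha : a ∈ T)
    (h : κ * y ^ p + y + q.eval y - a = 0) : IsIntegral T y := by
  set g : L[X] := C κ⁻¹ * (X + q - C a) with hg
  have hgdeg : g.degree < (p : WithBot ℕ) := by
    rw [hg, degree_C_mul (inv_ne_zero hκ0)]
    have h1p : (1 : WithBot ℕ) < (p : WithBot ℕ) := by exact_mod_cast hp
    refine (degree_sub_le _ _).trans_lt (max_lt ((degree_add_le _ _).trans_lt (max_lt ?_ hdeg)) ?_)
    · rwa [degree_X]
    · exact degree_C_le.trans_lt (lt_of_le_of_lt zero_le_one h1p)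
  have hgT : ∀ n, g.coeff n ∈ T := fun n => by
    rw [hg, coeff_C_mul, coeff_sub, coeff_add, coeff_X, coeff_C]
    refine mul_mem hκ (sub_mem (add_mem ?_ (hq n)) ?_)
    · split_ifs
      exacts [one_mem _, zero_mem _]
    · split_ifs
      exacts [ha, zero_mem _]
  obtain ⟨g', hg'⟩ : ∃ g' : T[X], g'.map (algebraMap T L) = g :=
    (mem_lifts g).1 ((lifts_iff_coeff_lifts g).2 fun n => ⟨⟨_, hgT n⟩, rfl⟩)
  have hg'deg : g'.degree < (p : WithBot ℕ) := by
    rwa [← hg', degree_map_eq_of_injective (FaithfulSMul.algebraMap_injective T L)] at hgdeg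
  refine ⟨X ^ p + g', monic_X_pow_add hg'deg, ?_⟩
  rw [← eval_map, Polynomial.map_add, Polynomial.map_pow, map_X, hg', hg]
  simp only [eval_mul, eval_sub, eval_add, eval_pow, eval_C, eval_X]
  have h1 := mul_inv_cancel₀ hκ0
  linear_combination κ⁻¹ * h - y ^ p * h1

variable {p s : ℕ} [hp : Fact p.Prime] {K : Type*} [Field K] [NumberField K] {ζ : K}

theorem levelRing_uniqueFactorizationMonoid (hζ : IsPrimitiveRoot ζ (p ^ s)) (hs : 1 ≤ s) :
    UniqueFactorizationMonoid (levelRing p s ζ s) := by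
  set R := levelRing p s ζ s
  let ϖ : R := ⟨zetaLevel p s ζ s - 1, pi_mem s⟩
  have hfac : ∀ x : R, x ≠ 0 → ∃ (k : ℕ) (u : Rˣ), x = u * ϖ ^ k := fun x hx => by
    obtain ⟨k, u, hu, hu', hu0, h⟩ := levelRing_factor hζ hs le_rfl x.2
      fun h => hx (Subtype.ext h)
    exact ⟨k, ⟨⟨u, hu⟩, ⟨u⁻¹, hu'⟩, Subtype.ext (mul_inv_cancel₀ hu0),
      Subtype.ext (inv_mul_cancel₀ hu0)⟩, Subtype.ext h⟩
  have hunit : ¬ IsUnit ϖ := fun h => by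
    obtain ⟨r, hr⟩ := h.exists_right_inv
    exact not_pi_dvd_one hζ hs le_rfl r.2 (congrArg Subtype.val hr).symm
  have hϖ0 : ϖ ≠ 0 := fun h => pi_ne_zero hζ hs le_rfl (congrArg Subtype.val h)
  refine IsDiscreteValuationRing.HasUnitMulPowIrreducibleFactorization.toUniqueFactorizationMonoid
    ⟨ϖ, ⟨hunit, fun a b h => ?_⟩, fun {x} hx => ?_⟩
  · have ha0 : a ≠ 0 := by rintro rfl; exact hϖ0 (h.trans (zero_mul b))
    have hb0 : b ≠ 0 := by rintro rfl; exact hϖ0 (h.trans (mul_zero a))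
    obtain ⟨k, u, rfl⟩ := hfac a ha0
    obtain ⟨l, v, rfl⟩ := hfac b hb0
    rcases k with _ | k
    · left
      rw [pow_zero, mul_one]
      exact u.isUnit
    rcases l with _ | l
    · right
      rw [pow_zero, mul_one]
      exact v.isUnit
    refine absurd (IsUnit.of_mul_eq_one (u * ϖ ^ k * (v * ϖ ^ l)) (mul_left_cancel₀ hϖ0 ?_)) hunit
    rw [mul_one]
    refine Eq.trans ?_ h.symm
    ring
  · obtain ⟨k, u, rfl⟩ := hfac x hx
    exact ⟨k, u, mul_comm _ _⟩

theorem exists_levelRing_div [IsCyclotomicExtension {p ^ s} ℚ K] (hζ : IsPrimitiveRoot ζ (p ^ s))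
    (c : K) : ∃ a ∈ levelRing p s ζ s, ∃ b ∈ levelRing p s ζ s, c = a / b := by
  obtain ⟨m, hm, h⟩ := exists_int_mul_mem p s hζ c
  have hm' : (m : K) ≠ 0 := Int.cast_ne_zero.2 hm
  exact ⟨_, h, m, intCast_mem _ m, by rw [mul_div_cancel_left₀ _ hm']⟩

variable {L : Type*} [Field L] [Algebra K L]
  {G E : Fin s → MvPolynomial (Fin s) K} {x Y : Fin s → L} {Z : Fin (s + 1) → L}

theorem fracRing_le_locRing {i m : ℕ} (hi : i + 1 ≤ s) :
    fracRing p s ζ Y Z i m ≤ locRing (levelRing p s ζ s) Y fun i : Fin s => Z i.succ := by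
  refine Subring.closure_le.2 ?_
  rintro t ((⟨c, hc, rfl⟩ | ⟨j, -, rfl⟩) | ⟨j, -, rfl⟩)
  · exact algebraMap_mem_locRing (levelRing_mono hi le_rfl hc)
  · exact mem_locRing j
  · exact inv_mem_locRing (t := fun i : Fin s => Z i.succ) j

theorem ringV_le_ringW : ringV p s ζ G x ≤ ringW p s ζ G x := fun t ht =>
  (integralClosure (ringV p s ζ G x) L).algebraMap_mem ⟨t, ht⟩

theorem mem_ringW_of_isIntegral {t : L} (ht : IsIntegral (ringW p s ζ G x) t) :
    t ∈ ringW p s ζ G x :=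
  isIntegral_trans (R := ringV p s ζ G x) (A := integralClosure (ringV p s ζ G x) L) t ht

theorem mem_ringW_of_pow_mem {t : L} (ht : t ^ p ∈ ringW p s ζ G x) : t ∈ ringW p s ζ G x :=
  IsIntegral.of_pow (R := ringV p s ζ G x) hp.out.pos ht

/-- The p-th powers of Z_i and of its inverse are, inductively, products of integral elements,
because the u_i are inverted on 𝒱_s. -/
theorem IsKummerTower.Z_mem_ringW (hT : IsKummerTower p s ζ G x Z)
    (hG : ∀ (i : Fin s) (n : Fin s →₀ ℕ), (G i).coeff n ∈ levelRing p s ζ (i + 1)) (hs : 1 ≤ s)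
    (i : Fin (s + 1)) : Z i ∈ ringW p s ζ G x ∧ (Z i)⁻¹ ∈ ringW p s ζ G x := by
  have hc : ∀ c ∈ levelRing p s ζ s, algebraMap K L c ∈ ringW p s ζ G x := fun c hc =>
    ringV_le_ringW (algebraMap_mem_locRing (t := unitElt p s ζ G x) hc)
  have hx : ∀ j, x j ∈ ringW p s ζ G x := fun j =>
    ringV_le_ringW (mem_locRing (t := unitElt p s ζ G x) j)
  induction i using Fin.induction with
  | zero => rw [hT.zero_eq, inv_one]; exact ⟨one_mem _, one_mem _⟩
  | succ i ih =>
    refine ⟨mem_ringW_of_pow_mem ?_, mem_ringW_of_pow_mem ?_⟩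
    · rw [hT.pow_eq]
      refine mul_mem ih.1 (add_mem (aeval_mem_subring (fun d => hc _
        (levelRing_mono i.2 le_rfl (hG i d))) fun j _ => hx j) (mul_mem (hc _ ?_) (hx i)))
      exact mul_mem (natCast_mem _ p) (lam_mem hs le_rfl)
    · rw [inv_pow, hT.pow_eq, mul_inv]
      exact mul_mem ih.2 (ringV_le_ringW (inv_mem_locRing (t := unitElt p s ζ G x) i))

theorem IsKummerTower.Y_mem_ringW (hT : IsKummerTower p s ζ G x Z) (hs : 1 ≤ s)
    (hζ : IsPrimitiveRoot ζ (p ^ s))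
    (hG : ∀ (i : Fin s) (n : Fin s →₀ ℕ), (G i).coeff n ∈ levelRing p s ζ (i + 1))
    {H : Fin s → L[X]} (hdeg : ∀ i, (H i).degree < (p : WithBot ℕ))
    (hH : ∀ (i : Fin s) n, (H i).coeff n ∈ fracRing p s ζ Y Z i i)
    (h : ∀ i, algebraMap K L (lam p s ζ ^ (p - 1) / (p : K)) * Y i ^ p + Y i + (H i).eval (Y i) -
      Z i.castSucc * x i = 0) (i : Fin s) : Y i ∈ ringW p s ζ G x := by
  have hc : ∀ c ∈ levelRing p s ζ s, algebraMap K L c ∈ ringW p s ζ G x := fun c hc =>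
    ringV_le_ringW (algebraMap_mem_locRing (t := unitElt p s ζ G x) hc)
  have hl0 : lam p s ζ ≠ 0 := pi_ne_zero hζ le_rfl hs
  have hp0 : (p : K) ≠ 0 := Nat.cast_ne_zero.2 hp.out.ne_zero
  suffices hk : ∀ k : ℕ, ∀ i : Fin s, (i : ℕ) < k → Y i ∈ ringW p s ζ G x from
    hk _ i (Nat.lt_succ_self _)
  intro k
  induction k with
  | zero => exact fun i hi => absurd hi (Nat.not_lt_zero _)
  | succ k ih =>
    intro i hi
    have hle : fracRing p s ζ Y Z i i ≤ ringW p s ζ G x := by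
      refine Subring.closure_le.2 ?_
      rintro t ((⟨c, hc', rfl⟩ | ⟨j, hj, rfl⟩) | ⟨j, -, rfl⟩)
      · exact hc c (levelRing_mono i.2 le_rfl hc')
      · exact ih j (by omega)
      · exact (hT.Z_mem_ringW hG hs _).2
    refine mem_ringW_of_isIntegral (isIntegral_of_artinSchreier hp.out.one_lt
      ((_root_.map_ne_zero _).2 (div_ne_zero (pow_ne_zero _ hl0) hp0)) ?_ (hdeg i)
      (fun n => hle (hH i n)) (mul_mem (hT.Z_mem_ringW hG hs _).1
        (ringV_le_ringW (mem_locRing (t := unitElt p s ζ G x) i))) (h i))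
    rw [← map_inv₀]
    exact hc _ (lam_pow_unit hζ hs le_rfl).2

end IntegralClosure

/-! ### The Artin-Schreier-Witt cover as an affine space in the y_i. -/

section ArtinSchreierWittRing

open MvPolynomial

variable {p s : ℕ} [hp : Fact p.Prime]

theorem aeval_aswPoly_eq_wp (b : Fin s → MvPolynomial (Fin s) (ZMod p)) (i : Fin s) :
    X i - X i ^ p + (aeval (fun j => X j + b j) (aswPoly p s i) + (b i - b i ^ p)) =
      wp p s (fun j => X j + b j) i := by
  have h := aeval_aswPoly (extendZero b) i
  have hb : ∀ j : Fin s, extendZero b j = b j := fun j => dif_pos j.2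
  simp only [hb] at h
  rw [h, wp_eq_wpSeq]
  have h1 : extendZero (fun j : Fin s => (X j : MvPolynomial (Fin s) (ZMod p)) + b j) =
      shiftVar p s (extendZero b) := by
    rw [← extendZero_shift]
    simp only [hb]
  rw [h1]
  ring

/-- The coordinate ring of the Artin-Schreier-Witt cover is a polynomial ring in the `y_i`. -/
theorem exists_aswCover_equiv (b : Fin s → MvPolynomial (Fin s) (ZMod p)) :
    ∃ e : MvPolynomial (Fin s) (ZMod p) ≃+* aswCover p s b,
      (∀ i, e (X i) = Ideal.Quotient.mk _ (X (Sum.inr i))) ∧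
      ∀ i, e (wp p s (fun j => X j + b j) i) = Ideal.Quotient.mk _ (X (Sum.inl i)) := by
  set I : Ideal (MvPolynomial (Fin s ⊕ Fin s) (ZMod p)) := Ideal.span (Set.range fun i : Fin s =>
    wp p s (fun j => X (Sum.inr j) + rename Sum.inr (b j)) i - X (Sum.inl i)) with hI
  have hwp : ∀ i, rename Sum.inr (wp p s (fun j => X j + b j) i) =
      wp p s (fun j => X (Sum.inr j) + rename Sum.inr (b j)) i := fun i => by
    have h := map_wp (rename (R := ZMod p) (Sum.inr : Fin s → Fin s ⊕ Fin s)).toRingHom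
      (fun j : Fin s => X j + b j) i
    simpa using h
  let f : MvPolynomial (Fin s) (ZMod p) →+* MvPolynomial (Fin s ⊕ Fin s) (ZMod p) ⧸ I :=
    (Ideal.Quotient.mk I).comp (rename Sum.inr).toRingHom
  -- The defining equations express each x_i through the y_j, so the x_i can be eliminated.
  let g₀ : MvPolynomial (Fin s ⊕ Fin s) (ZMod p) →ₐ[ZMod p] MvPolynomial (Fin s) (ZMod p) :=
    aeval (Sum.elim (wp p s fun j => X j + b j) X)
  have hg₀ : ∀ q : MvPolynomial (Fin s) (ZMod p), g₀ (rename Sum.inr q) = q := fun q => by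
    rw [aeval_rename, Sum.elim_comp_inr, aeval_X_left_apply]
  have hg : ∀ q ∈ I, g₀.toRingHom q = 0 := by
    suffices h : I ≤ RingHom.ker g₀.toRingHom from fun q hq => h hq
    refine Ideal.span_le.2 ?_
    rintro _ ⟨i, rfl⟩
    change g₀ _ = 0
    rw [map_sub, ← hwp, hg₀, aeval_X, Sum.elim_inl, sub_self]
  let g : MvPolynomial (Fin s ⊕ Fin s) (ZMod p) ⧸ I →+* MvPolynomial (Fin s) (ZMod p) :=
    Ideal.Quotient.lift I g₀.toRingHom hg
  have hgf : ∀ q, g (f q) = q := fun q => hg₀ q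
  have hx : ∀ i, f (wp p s (fun j => X j + b j) i) = Ideal.Quotient.mk I (X (Sum.inl i)) :=
    fun i => by
    change Ideal.Quotient.mk I (rename Sum.inr _) = _
    rw [hwp, Ideal.Quotient.eq]
    exact Ideal.subset_span ⟨i, rfl⟩
  have hfy : ∀ i, f (X i) = Ideal.Quotient.mk I (X (Sum.inr i)) := fun i => by
    change Ideal.Quotient.mk I (rename Sum.inr (X i)) = _
    rw [rename_X]
  have hfg : f.comp g = RingHom.id _ := by
    refine Ideal.Quotient.ringHom_ext (MvPolynomial.ringHom_ext' (Subsingleton.elim _ _) ?_)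
    rintro (i | i)
    · change f (g₀ (X (Sum.inl i))) = _
      rw [aeval_X, Sum.elim_inl, hx]
      rfl
    · change f (g₀ (X (Sum.inr i))) = _
      rw [aeval_X, Sum.elim_inr, hfy]
      rfl
  exact ⟨RingEquiv.ofRingHom f g hfg (RingHom.ext hgf), hfy, hx⟩

end ArtinSchreierWittRing

/-! ### Congruence of the inverted elements to 1. -/

section SpecialFiber

open MvPolynomial

variable {p s : ℕ} [hp : Fact p.Prime] {K : Type*} [Field K] [NumberField K]
  [IsCyclotomicExtension {p ^ s} ℚ K] {ζ : K}
  {G : Fin s → MvPolynomial (Fin s) K} {X' : Fin s → MvPowerSeries (Fin s) K}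

/-- G_{i,p} ≡ 1 at integral Witt vectors, and the approximation error is far smaller. So inverting
u_i does not change the special fibre of affine space. -/
theorem IsKummerDatum.sub_one_mem (hG : IsKummerDatum p s ζ G X') (hs : 1 ≤ s)
    (hζ : IsPrimitiveRoot ζ (p ^ s)) (i : Fin s) (n : Fin s →₀ ℕ) :
    (G i - 1).coeff n ∈ mulSub (levelRing p s ζ s) (ζ - 1) := by
  have hi : (i : ℕ) + 1 ≤ s := i.2
  obtain ⟨R, hR, -, hGR⟩ := hG.exists_remainder hs hζ i fun j _ => hG.witt_mem hs hζ j
  obtain ⟨g, hg, h⟩ := GWitt_cut_mem_mvOneAddMul hζ hi (a := extendZero X') (fun j hj => by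
      rw [show extendZero X' j = X' ⟨j, hj.trans i.2⟩ from dif_pos _]
      exact hG.witt_mem hs hζ ⟨j, hj.trans i.2⟩)
    fun j _ => constantCoeff_extendZero hG.witt_constantCoeff j
  have h1 : ((G i - 1 : MvPolynomial (Fin s) K) : MvPowerSeries (Fin s) K) =
      MvPowerSeries.C (zetaLevel p s ζ (i + 1) - 1) *
        (g + MvPowerSeries.C ((p : K) * lam p s ζ) * R) := by
    have h2 : ((G i - 1 : MvPolynomial (Fin s) K) : MvPowerSeries (Fin s) K) =
        (G i : MvPowerSeries (Fin s) K) - 1 :=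
      (map_sub (MvPolynomial.coeToMvPowerSeries.ringHom (σ := Fin s) (R := K)) _ _).trans
        (congrArg _ MvPolynomial.coe_one)
    rw [h2, hGR, h]
    ring
  rw [← MvPolynomial.coeff_coe, h1, MvPowerSeries.coeff_C_mul]
  have h3 : g + MvPowerSeries.C ((p : K) * lam p s ζ) * R ∈
      coeffSub (levelRing p s ζ (i + 1)) s i :=
    add_mem hg (mul_mem (C_mem_coeffSub (p_mul_lam_mem (Nat.le_add_left 1 _) hi) _) hR)
  exact mul_mem_mulSub (pi_mem_mulSub hi) (levelRing_mono hi le_rfl (h3 n).1)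

theorem coeff_add_C_mul_X_sub_one_mem {f : MvPolynomial (Fin s) K} {S : Subring K} {π c : K}
    (hf : ∀ n, (f - 1).coeff n ∈ mulSub S π) (hc : c ∈ mulSub S π) (i : Fin s) (n : Fin s →₀ ℕ) :
    (f + C c * X i - 1).coeff n ∈ mulSub S π := by
  rw [add_sub_right_comm, coeff_add, coeff_C_mul]
  refine add_mem (hf n) ?_
  classical
  rw [coeff_X]
  split_ifs
  · rwa [mul_one]
  · rw [mul_zero]
    exact zero_mem _

theorem coeff_mem_of_sub_one_mem {f : MvPolynomial (Fin s) K} {S : Subring K} {π : K} (hπ : π ∈ S)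
    (hf : ∀ n, (f - 1).coeff n ∈ mulSub S π) (n : Fin s →₀ ℕ) : f.coeff n ∈ S := by
  have h : f = (f - 1) + 1 := by ring
  rw [h, coeff_add]
  refine add_mem (mulSub_le hπ (hf n)) ?_
  classical
  rw [coeff_one]
  split_ifs
  exacts [one_mem S, zero_mem S]

variable {L : Type*} [Field L] [Algebra K L] {ι : Type*}

/-- The special fibre of `R[y, 1/q(y)]` for polynomials `q` congruent to `1`. -/
theorem exists_specialFiber_levelRing (hs : 1 ≤ s) (hζ : IsPrimitiveRoot ζ (p ^ s))
    {y : Fin s → L} (hy : AlgebraicIndependent K y) {q : ι → MvPolynomial (Fin s) K} {t : ι → L}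
    (hq : ∀ i n, (q i - 1).coeff n ∈ mulSub (levelRing p s ζ s) (ζ - 1))
    (hqt : ∀ i, aeval y (q i) = t i) (ht : ∀ i, t i ≠ 0) {res : levelRing p s ζ s →+* ZMod p}
    (hres : ∀ x, res x = 0 ↔ ∃ r ∈ levelRing p s ζ s, (x : K) = (ζ - 1) * r) :
    ∃ e : (locRing (levelRing p s ζ s) y t ⧸
        idealOf (locRing (levelRing p s ζ s) y t) (algebraMap K L (ζ - 1))) ≃+*
        MvPolynomial (Fin s) (ZMod p),
      ∀ N, e (Ideal.Quotient.mk _ ⟨polyHom _ y N, polyHom_mem_locRing N⟩) = map res N := by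
  have hπ : ζ - 1 ∈ levelRing p s ζ s := pi_self_mem
  choose N hN using fun i => exists_map_subtype_eq (coeff_mem_of_sub_one_mem hπ (hq i))
  refine exists_specialFiber_equiv hy (q := N) (fun i => ?_) ht hπ (pi_ne_zero_self hs hζ) hres
    (ZMod.ringHom_surjective res) fun i => map_res_eq_one hres fun d => ?_
  · rw [polyHom_eq, hN, hqt]
  · rw [hN]
    exact hq i d

end SpecialFiber

/-! ### The coordinate rings of 𝒱_s and 𝒲_s and their special fibres. -/

section Cover

open Polynomial

variable {p s : ℕ} [hp : Fact p.Prime] {K : Type*} [Field K] [NumberField K]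
  [IsCyclotomicExtension {p ^ s} ℚ K] {ζ : K}
  {L : Type*} [Field L] [Algebra K L]
  {G E : Fin s → MvPolynomial (Fin s) K} {X' Y' F : Fin s → MvPowerSeries (Fin s) K}
  {P : Fin s → MvPolynomial (Fin s) ℤ} {b : Fin s → MvPolynomial (Fin s) (ZMod p)}
  {x Y : Fin s → L} {Z : Fin (s + 1) → L}

theorem ASWDatum.zPoly_sub_one_mem (D : ASWDatum p s ζ E Y' F P b) (hs : 1 ≤ s)
    (i : Fin (s + 1)) (n : Fin s →₀ ℕ) :
    (zPoly p s ζ E i - 1).coeff n ∈ mulSub (levelRing p s ζ s) (ζ - 1) := by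
  cases i using Fin.cases with
  | zero =>
    have h : zPoly p s ζ E (0 : Fin (s + 1)) - 1 = 0 := sub_self 1
    rw [h, MvPolynomial.coeff_zero]
    exact zero_mem _
  | succ i =>
    rw [Fin.val_succ, zPoly_succ]
    refine coeff_add_C_mul_X_sub_one_mem (fun n => ?_) (pi_mem_mulSub hs) i n
    obtain ⟨r, hr, h⟩ := mem_mulSub.1 (D.sub_one_mem i n)
    rw [h]
    exact mul_mem_mulSub (pi_mem_mulSub i.2) (levelRing_mono i.2 le_rfl hr)

/-- Read the equation of Y_i modulo ζ - 1: κ ≡ -1, Z_{i-1} ≡ 1, and H is congruent to its constant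
P_i(Y). -/
theorem ASWDatum.exists_x_eq (D : ASWDatum p s ζ E Y' F P b) (hs : 1 ≤ s)
    (hζ : IsPrimitiveRoot ζ (p ^ s)) (hG : ∀ i, ∀ j ∈ (G i).vars, j < i)
    (hT : IsKummerTower p s ζ G x Z) (hY : ∀ i : Fin s, Z i.succ =
      MvPolynomial.aeval Y (E i) + algebraMap K L (lam p s ζ) * Y i) {i : Fin s} {H : L[X]}
    (hH : ∀ n, ∃ r ∈ fracRing p s ζ Y Z i i, (H - C (MvPolynomial.aeval Y (P i))).coeff n =
      algebraMap K L (zetaLevel p s ζ (i + 1) - 1) * r)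
    (h : algebraMap K L (lam p s ζ ^ (p - 1) / (p : K)) * Y i ^ p + Y i + H.eval (Y i) -
      Z i.castSucc * x i = 0) :
    ∃ r ∈ locRing (levelRing p s ζ s) Y fun j : Fin s => Z j.succ,
      x i = Y i - Y i ^ p + MvPolynomial.aeval Y (P i) + algebraMap K L (ζ - 1) * r := by
  set W := locRing (levelRing p s ζ s) Y fun j : Fin s => Z j.succ
  have hi : (i : ℕ) + 1 ≤ s := i.2
  have hYW : ∀ j, Y j ∈ W := mem_locRing
  have hcW : ∀ c ∈ levelRing p s ζ s, algebraMap K L c ∈ W := fun c => algebraMap_mem_locRing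
  have hPW : MvPolynomial.aeval Y (P i) ∈ W := aeval_mem_subring
    (fun d => by rw [eq_intCast]; exact intCast_mem W _) fun j _ => hYW j
  have hZ0 := hT.Z_ne_zero hs hζ hG i.castSucc
  have hZW : (Z i.castSucc)⁻¹ ∈ W := fracRing_le_locRing (m := 0) hi
    (Z_inv_mem_fracRing hT.zero_eq (le_refl _))
  obtain ⟨z, hz, hZ⟩ := aeval_mem_mul hcW (pi_ne_zero_self hs hζ)
    (D.zPoly_sub_one_mem hs i.castSucc) fun j _ => hYW j
  rw [map_sub, map_one, aeval_zPoly hT hY] at hZ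
  obtain ⟨a, ha, hκ⟩ := lam_pow hζ hs
  obtain ⟨a', ha', hl⟩ := mem_mulSub.1 (pi_mem_mulSub (p := p) (ζ := ζ) hs)
  obtain ⟨c', hc', hc⟩ := mem_mulSub.1 (pi_mem_mulSub (p := p) (ζ := ζ) hi)
  obtain ⟨g, hg, hHY⟩ := eval_mem_mul
    (fun n => (hH n).imp fun r hr => ⟨fracRing_le_locRing hi hr.1, hr.2⟩) (hYW i)
  rw [eval_sub, eval_C, hc, map_mul] at hHY
  change lam p s ζ = _ at hl
  rw [hκ, hl, map_add, map_neg, map_one, map_mul, map_mul] at h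
  have haW := mul_mem (hcW a' ha') (hcW a (levelRing_mono hs le_rfl ha))
  set π := algebraMap K L (ζ - 1)
  set α := algebraMap K L a' * algebraMap K L a
  have hπW : π ∈ W := hcW _ pi_self_mem
  have hgW := mul_mem (hcW c' hc') hg
  set γ := algebraMap K L c' * g
  have hx : x i = (Z i.castSucc)⁻¹ *
      (Y i - Y i ^ p + MvPolynomial.aeval Y (P i) + π * (α * Y i ^ p + γ)) := by
    rw [eq_inv_mul_iff_mul_eq₀ hZ0]
    linear_combination -h + hHY
  have hinv : (Z i.castSucc)⁻¹ = 1 - π * (z * (Z i.castSucc)⁻¹) := by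
    rw [← mul_assoc, ← hZ, sub_mul, mul_inv_cancel₀ hZ0]
    ring
  have hαγ : α * Y i ^ p + γ ∈ W := add_mem (mul_mem haW (pow_mem (hYW i) p)) hgW
  refine ⟨(Z i.castSucc)⁻¹ * (α * Y i ^ p + γ) - z * (Z i.castSucc)⁻¹ *
    (Y i - Y i ^ p + MvPolynomial.aeval Y (P i)), sub_mem (mul_mem hZW hαγ)
      (mul_mem (mul_mem hz hZW) (add_mem (sub_mem (hYW i) (pow_mem (hYW i) p)) hPW)), ?_⟩
  rw [hx]
  linear_combination (Y i - Y i ^ p + MvPolynomial.aeval Y (P i)) * hinv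

theorem IsKummerDatum.exists_specialFiber_ringV (hG : IsKummerDatum p s ζ G X') (hs : 1 ≤ s)
    (hζ : IsPrimitiveRoot ζ (p ^ s)) (hT : IsKummerTower p s ζ G x Z) :
    ∃ e : (ringV p s ζ G x ⧸ idealOf (ringV p s ζ G x) (algebraMap K L (ζ - 1))) ≃+*
        MvPolynomial (Fin s) (ZMod p),
      ∀ i, ∃ hx : x i ∈ ringV p s ζ G x,
        e (Ideal.Quotient.mk _ ⟨x i, hx⟩) = MvPolynomial.X i := by
  obtain ⟨res, hres⟩ := exists_residue hζ hs
  have hc : (p : K) * lam p s ζ ∈ mulSub (levelRing p s ζ s) (ζ - 1) :=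
    mul_mem_mulSub' (natCast_mem _ p) (pi_mem_mulSub hs)
  obtain ⟨e, he⟩ := exists_specialFiber_levelRing hs hζ hT.algebraicIndependent
    (q := fun i => G i + MvPolynomial.C ((p : K) * lam p s ζ) * MvPolynomial.X i)
    (t := unitElt p s ζ G x)
    (fun i => coeff_add_C_mul_X_sub_one_mem (hG.sub_one_mem hs hζ i) hc i)
    (fun i => by
      rw [unitElt, map_add (MvPolynomial.aeval x), map_mul (MvPolynomial.aeval x),
        MvPolynomial.aeval_C, MvPolynomial.aeval_X])
    (hT.unitElt_ne_zero hs hζ hG.vars_lt) hres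
  refine ⟨e, fun i => ⟨mem_locRing (t := unitElt p s ζ G x) i, ?_⟩⟩
  have h := he (MvPolynomial.X i)
  rw [MvPolynomial.map_X] at h
  rw [← h]
  congr 2
  exact Subtype.ext (polyHom_X i).symm

/-- R[Y, 1/Z] contains the ring of 𝒱_s, since 1/u_j = Z_{j-1}/Z_j^p, and is integrally closed in L,
so it contains the integral closure. Conversely its generators are integral. -/
theorem ringW_eq_locRing (hs : 1 ≤ s) (hζ : IsPrimitiveRoot ζ (p ^ s))
    (hG : IsKummerDatum p s ζ G X') (hT : IsKummerTower p s ζ G x Z)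
    (hE : ∀ (i : Fin s) (n : Fin s →₀ ℕ), (zPoly p s ζ E (i + 1) - 1).coeff n ∈
      mulSub (levelRing p s ζ s) (ζ - 1)) (hY : ∀ i : Fin s, Z i.succ =
      MvPolynomial.aeval Y (E i) + algebraMap K L (lam p s ζ) * Y i)
    (hind : AlgebraicIndependent K Y) (htop : IntermediateField.adjoin K (Set.range Y) = ⊤)
    (hx : ∀ i : Fin s, x i ∈ fracRing p s ζ Y Z i (i + 1))
    (hYW : ∀ i, Y i ∈ ringW p s ζ G x) :
    ringW p s ζ G x = locRing (levelRing p s ζ s) Y fun j : Fin s => Z j.succ := by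
  have hGs : ∀ i n, (G i).coeff n ∈ levelRing p s ζ s := fun i n =>
    levelRing_mono i.2 le_rfl (hG.coeff_mem i n)
  refine le_antisymm (fun w hw => ?_) (Subring.closure_le.2 ?_)
  · have hxW : ∀ i, x i ∈ locRing (levelRing p s ζ s) Y fun j : Fin s => Z j.succ :=
      fun i => fracRing_le_locRing i.2 (hx i)
    choose N hN using fun i => exists_map_subtype_eq
      (coeff_mem_of_sub_one_mem pi_self_mem (hE i))
    have hNZ : ∀ i, polyHom (levelRing p s ζ s) Y (N i) = Z i.succ := fun i => by
      rw [polyHom_eq, hN, ← Fin.val_succ, aeval_zPoly hT hY]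
    have hle : ringV p s ζ G x ≤
        locRing (levelRing p s ζ s) Y fun j : Fin s => Z j.succ := by
      refine Subring.closure_le.2 ?_
      rintro t ((⟨c, hc, rfl⟩ | ⟨j, rfl⟩) | ⟨j, rfl⟩)
      · exact algebraMap_mem_locRing hc
      · exact hxW j
      · have h1 : (unitElt p s ζ G x j)⁻¹ = Z j.castSucc * (Z j.succ)⁻¹ ^ p := by
          rw [inv_pow, hT.pow_eq, mul_inv,
            mul_inv_cancel_left₀ (hT.Z_ne_zero hs hζ hG.vars_lt _)]
        change (unitElt p s ζ G x j)⁻¹ ∈ locRing (levelRing p s ζ s) Y fun j : Fin s => Z j.succ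
        rw [h1]
        refine mul_mem ?_ (pow_mem (inv_mem_locRing (t := fun j : Fin s => Z j.succ) j) p)
        cases j.castSucc using Fin.cases with
        | zero => rw [hT.zero_eq]; exact one_mem _
        | succ k =>
          rw [← hNZ]
          exact polyHom_mem_locRing _
    have := levelRing_uniqueFactorizationMonoid hζ hs
    refine mem_locRing_of_isIntegral hind htop (exists_levelRing_div hζ) hNZ
      (fun i => hT.Z_ne_zero hs hζ hG.vars_lt _) ?_
    have hw' : IsIntegral (ringV p s ζ G x) w := hw
    obtain ⟨f, hf, hfw⟩ := hw'
    refine ⟨f.map (Subring.inclusion hle), hf.map _, ?_⟩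
    rw [eval₂_map]
    exact hfw
  · rintro t ((⟨c, hc, rfl⟩ | ⟨j, rfl⟩) | ⟨j, rfl⟩)
    · exact ringV_le_ringW (algebraMap_mem_locRing (t := unitElt p s ζ G x) hc)
    · exact hYW j
    · exact (hT.Z_mem_ringW hG.coeff_mem hs _).2

/-- Since Z_i ≡ 1, reducing R[Y, 1/Z] gives 𝔽_p[y]. There x_i becomes ℘_i(y + b), so 𝔽_p[y] is the
ring of the Artin-Schreier-Witt cover with x eliminated. -/
theorem ASWDatum.exists_specialFiber_equiv (D : ASWDatum p s ζ E Y' F P b) (hs : 1 ≤ s)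
    (hζ : IsPrimitiveRoot ζ (p ^ s)) (hG : ∀ i, ∀ j ∈ (G i).vars, j < i)
    (hT : IsKummerTower p s ζ G x Z) (hY : ∀ i : Fin s, Z i.succ =
      MvPolynomial.aeval Y (E i) + algebraMap K L (lam p s ζ) * Y i)
    (hind : AlgebraicIndependent K Y)
    (hx : ∀ i, ∃ r ∈ locRing (levelRing p s ζ s) Y fun j : Fin s => Z j.succ,
      x i = Y i - Y i ^ p + MvPolynomial.aeval Y (P i) + algebraMap K L (ζ - 1) * r)
    {W : Subring L} (hW : W = locRing (levelRing p s ζ s) Y fun j : Fin s => Z j.succ) :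
    ∃ e : (W ⧸ idealOf W (algebraMap K L (ζ - 1))) ≃+* aswCover p s b,
      ∀ i, (∃ hx : x i ∈ W, e (Ideal.Quotient.mk _ ⟨x i, hx⟩) =
          Ideal.Quotient.mk _ (MvPolynomial.X (Sum.inl i))) ∧
        (∃ hy : Y i ∈ W, e (Ideal.Quotient.mk _ ⟨Y i, hy⟩) =
          Ideal.Quotient.mk _ (MvPolynomial.X (Sum.inr i))) := by
  subst hW
  obtain ⟨res, hres⟩ := exists_residue hζ hs
  obtain ⟨e, he⟩ := exists_specialFiber_levelRing hs hζ hind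
    (q := fun i : Fin s => zPoly p s ζ E (i + 1)) (t := fun i : Fin s => Z i.succ)
    (fun i => D.zPoly_sub_one_mem hs i.succ) (fun i => aeval_zPoly hT hY i.succ)
    (fun i => hT.Z_ne_zero hs hζ hG _) hres
  obtain ⟨e', hy', hx'⟩ := exists_aswCover_equiv b
  have hπ : algebraMap K L (ζ - 1) ∈ locRing (levelRing p s ζ s) Y fun j : Fin s => Z j.succ :=
    algebraMap_mem_locRing pi_self_mem
  refine ⟨e.trans e', fun i => ⟨?_, mem_locRing i, ?_⟩⟩
  · let N : MvPolynomial (Fin s) (levelRing p s ζ s) := MvPolynomial.X i - MvPolynomial.X i ^ p +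
      MvPolynomial.map (Int.castRingHom _) (P i)
    have hN : polyHom (levelRing p s ζ s) Y N =
        Y i - Y i ^ p + MvPolynomial.aeval Y (P i) := by
      rw [map_add, map_sub, map_pow, polyHom_X, polyHom, MvPolynomial.coe_eval₂Hom,
        MvPolynomial.eval₂_map, MvPolynomial.aeval_def]
      congr 2
      exact Subsingleton.elim _ _
    have hres' : MvPolynomial.map res N = wp p s (fun j => MvPolynomial.X j + b j) i := by
      rw [map_add, map_sub, map_pow, MvPolynomial.map_X, MvPolynomial.map_map,
        Subsingleton.elim (res.comp (Int.castRingHom _)) (Int.castRingHom (ZMod p)),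
        ← aeval_aswPoly_eq_wp, ← D.map_P]
    obtain ⟨r, hr, hxr⟩ := hx i
    rw [← hN] at hxr
    have hxW : x i ∈ locRing (levelRing p s ζ s) Y fun j : Fin s => Z j.succ := by
      rw [hxr]
      exact add_mem (polyHom_mem_locRing N) (mul_mem hπ hr)
    refine ⟨hxW, ?_⟩
    rw [RingEquiv.trans_apply, ← hx', ← hres', ← he]
    congr 2
    refine Ideal.Quotient.eq.2 ((mem_idealOf hπ).2 ⟨r, hr, ?_⟩)
    change x i - polyHom _ Y N = _
    rw [hxr, add_sub_cancel_left]
  · have h := he (MvPolynomial.X i)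
    rw [MvPolynomial.map_X] at h
    rw [RingEquiv.trans_apply, ← hy', ← h]
    congr 3
    exact Subtype.ext (polyHom_X i).symm

end Cover

end KASW

end

theorem mainTheorem4 (p s : ℕ) [Fact p.Prime] (hs : 0 < s)
    {K : Type u} [Field K] [NumberField K] [IsCyclotomicExtension {p ^ s} ℚ K]
    (ζ : K) (hζ : IsPrimitiveRoot ζ (p ^ s)) :
    -- the Kummer data `G_1, …, G_s` exist
    (∃ (G : Fin s → MvPolynomial (Fin s) K) (X' : Fin s → MvPowerSeries (Fin s) K),
      KASW.IsKummerDatum p s ζ G X') ∧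
    ∃ (E : Fin s → MvPolynomial (Fin s) K)
      (Y' F : Fin s → MvPowerSeries (Fin s) K)
      (P : Fin s → MvPolynomial (Fin s) ℤ)
      (b : Fin s → MvPolynomial (Fin s) (ZMod p)),
      -- the polynomials `E_i`
      (∀ (i : Fin s) (n : Fin s →₀ ℕ), (E i).coeff n ∈ KASW.levelRing p s ζ (i + 1)) ∧
      (∀ i, ∀ j ∈ (E i).vars, j < i) ∧
      KASW.IsAssociatedWitt p s ζ E Y' ∧
      (∀ i : Fin s, KASW.IsTruncation p s (E i)
        (KASW.EWitt p s ζ (i + 1) (KASW.cut i (KASW.extendZero Y')))) ∧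
      -- the shape of the associated Witt vector
      (∀ i : Fin s, Y' i =
        MvPowerSeries.C ((-1) ^ (p - 1) * (KASW.lam p s ζ ^ (p - 1) / (p : K))) *
          MvPowerSeries.X i ^ p + MvPowerSeries.X i + F i) ∧
      (∀ (i : Fin s) (n : Fin s →₀ ℕ),
        MvPowerSeries.coeff n (F i) ∈ KASW.levelRing p s ζ (i + 1) ∧
        (MvPowerSeries.coeff n (F i) ≠ 0 → ∀ j ∈ n.support, j ≤ i)) ∧
      -- `P i` is an integral lift of the common reduction of `F_{i+1}` and `H_{i+1}`
      (∀ i, ∀ j ∈ (P i).vars, j < i) ∧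
      (∀ (i : Fin s) (n : Fin s →₀ ℕ), ∃ r ∈ KASW.levelRing p s ζ (i + 1),
        MvPowerSeries.coeff n (F i) - (((P i).coeff n : ℤ) : K) =
          (KASW.zetaLevel p s ζ (i + 1) - 1) * r) ∧
      b ⟨0, hs⟩ = 0 ∧
      (∀ i, ∀ j ∈ (b i).vars, j < i) ∧
      (∀ i : Fin s, MvPolynomial.map (Int.castRingHom (ZMod p)) (P i) =
        MvPolynomial.aeval (fun j => MvPolynomial.X j + b j) (KASW.aswPoly p s i) +
          (b i - b i ^ p)) ∧
      -- the function field level, for every choice of the Kummer data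
      ∀ (G : Fin s → MvPolynomial (Fin s) K) (X' : Fin s → MvPowerSeries (Fin s) K),
        KASW.IsKummerDatum p s ζ G X' →
      ∀ (L : Type v) [Field L] [Algebra K L] (x : Fin s → L) (Z : Fin (s + 1) → L),
        KASW.IsKummerTower p s ζ G x Z →
      ∀ Y : Fin s → L,
        (∀ i : Fin s, Z i.succ =
          MvPolynomial.aeval Y (E i) + algebraMap K L (KASW.lam p s ζ) * Y i) →
        -- the minimal polynomial of `Y_i` over `K(Y_0, …, Y_{i-1}, X_i)`
        (∀ i : Fin s, ∃ H : Polynomial L,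
          H.degree < (p : WithBot ℕ) ∧
          (∀ n, H.coeff n ∈ KASW.fracRing p s ζ Y Z i i) ∧
          (∀ n, ∃ r ∈ KASW.fracRing p s ζ Y Z i i,
            (H - Polynomial.C (MvPolynomial.aeval Y (P i))).coeff n =
              algebraMap K L (KASW.zetaLevel p s ζ (i + 1) - 1) * r) ∧
          Polynomial.C (algebraMap K L (KASW.lam p s ζ ^ (p - 1) / (p : K))) *
              (minpoly (IntermediateField.adjoin K ({t | ∃ j < i, t = Y j} ∪ {x i})) (Y i)).map
                (algebraMap (IntermediateField.adjoin K ({t | ∃ j < i, t = Y j} ∪ {x i})) L) =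
            Polynomial.C (algebraMap K L (KASW.lam p s ζ ^ (p - 1) / (p : K))) *
                Polynomial.X ^ p + Polynomial.X + H - Polynomial.C (Z i.castSucc * x i)) ∧
        (∀ i : Fin s, x i ∈ KASW.fracRing p s ζ Y Z i (i + 1)) ∧
        -- the special fibre of `𝒲_s → 𝒱_s`
        (∃ e : (KASW.ringV p s ζ G x ⧸
              KASW.idealOf (KASW.ringV p s ζ G x) (algebraMap K L (ζ - 1))) ≃+*
            MvPolynomial (Fin s) (ZMod p),
          ∀ i, ∃ hx : x i ∈ KASW.ringV p s ζ G x,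
            e (Ideal.Quotient.mk _ ⟨x i, hx⟩) = MvPolynomial.X i) ∧
        (∃ e : (KASW.ringW p s ζ G x ⧸
              KASW.idealOf (KASW.ringW p s ζ G x) (algebraMap K L (ζ - 1))) ≃+*
            KASW.aswCover p s b,
          ∀ i,
            (∃ hx : x i ∈ KASW.ringW p s ζ G x,
              e (Ideal.Quotient.mk _ ⟨x i, hx⟩) =
                Ideal.Quotient.mk _ (MvPolynomial.X (Sum.inl i))) ∧
            (∃ hy : Y i ∈ KASW.ringW p s ζ G x,
              e (Ideal.Quotient.mk _ ⟨Y i, hy⟩) =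
                Ideal.Quotient.mk _ (MvPolynomial.X (Sum.inr i)))) := by
  refine ⟨KASW.exists_isKummerDatum hs hζ, ?_⟩
  obtain ⟨E, Y', F, P, b, D⟩ := KASW.exists_aswDatum (K := K) hs hζ
  refine ⟨E, Y', F, P, b, D.coeff_mem, D.vars_lt, D.assoc, D.trunc, D.shape, fun i n => ?_,
    D.P_vars, fun i n => KASW.mem_mulSub.1 (D.F_sub_P i n), D.b_zero _ rfl, D.b_vars, D.map_P, ?_⟩
  · exact ⟨(D.F_mem i n).1, fun h j hj => Nat.lt_succ_iff.1 ((D.F_mem i n).2 h j hj)⟩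
  intro G X' hG L _ _ x Z hT Y hY
  choose H hdeg hH hHP heq using fun i => D.exists_polynomial hs hζ hG hT hY i
  -- The equation at Y_i is used twice: solved for x_i it shows that the Y_i generate L, and made
  -- monic it shows that they are integral over 𝒱_s.
  have hroot := fun i : Fin s => KASW.root_identity
    ((map_ne_zero (algebraMap K L)).2 (KASW.p_mul_lam_ne_zero hs hζ)) (heq i) (hY i) (hT.pow_eq i)
  have hx : ∀ i : Fin s, x i ∈ KASW.fracRing p s ζ Y Z i (i + 1) := fun i =>
    hT.x_mem hs hζ hG.vars_lt (hH i) (hroot i)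
  have htop := hT.adjoin_range_eq_top hs D.vars_lt hY hx
  have hind := KASW.algebraicIndependent_of_adjoin_eq_top hT.algebraicIndependent htop
  refine ⟨fun i => ⟨H i, hdeg i, hH i, hHP i, ?_⟩, hx, hG.exists_specialFiber_ringV hs hζ hT, ?_⟩
  · exact hT.minpoly_eq hs hζ hG.vars_lt D.vars_lt hY i (hdeg i) (hH i) (heq i)
  · exact D.exists_specialFiber_equiv hs hζ hG.vars_lt hT hY hind
      (fun i => D.exists_x_eq hs hζ hG.vars_lt hT hY (hHP i) (hroot i))
      (KASW.ringW_eq_locRing hs hζ hG hT (fun i => D.zPoly_sub_one_mem hs i.succ) hY hind htop hx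
        (hT.Y_mem_ringW hs hζ hG.coeff_mem hdeg hH hroot))
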